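/- Let $\Gamma$ be a finite group and let $\Gamma^*=\{\gamma_0,\dots,\gamma_r\}$ be its set of complex irreducible characters. For $n\ge 0$ let $\widetilde S_n$ be the group generated by $z,t_1,\dots,t_{n-1}$ subject to $z^2=1$, $t_i^2=(t_it_{i+1})^3=z$, $t_it_j=zt_jt_i$ for $i>j+1$, and $zt_i=t_iz$. Let $\widetilde\Gamma_n=\Gamma^n\rtimes\widetilde S_n$, where $\widetilde S_n$ permutes the factors through $\widetilde S_n\to S_n$, $t_i\mapsto(i,i+1)$, $z\mapsto 1$; it is $\mathbb Z_2$-graded with the $t_i$ odd, and $z$ and $\Gamma^n$ even. Let $R^-(\widetilde\Gamma_n)$ be the complex vector space of class functions $f$ on $\widetilde\Gamma_n$ with $f(zx)=-f(x)$ that vanish on odd elements, and let $R^-_\Gamma=\bigoplus_{n\ge0}R^-(\widetilde\Gamma_n)$, with the bilinear form that is the orthogonal sum of the forms $\langle f,g\rangle=|\widetilde\Gamma_n|^{-1}\sum_{x\in\widetilde\Gamma_n}f(x)g(x^{-1})$. The product of $R^-_\Gamma$ sends $f\in R^-(\widetilde\Gamma_a)$ and $g\in R^-(\widetilde\Gamma_b)$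 to the class function induced to $\widetilde\Gamma_{a+b}$ from the function $xy\mapsto f(x)g(y)$ on the subgroup $\widetilde\Gamma_a\hat\times\widetilde\Gamma_b=\{xy\}$, where $x$ runs over the copy of $\widetilde\Gamma_a$ on the first $a$ letters and $y$ over the copy of $\widetilde\Gamma_b$ on the last $b$ letters; the unit $1$ is the function on $\widetilde\Gamma_0=\{1,z\}$ with values $1$ at $1$ and $-1$ at $z$. For $\gamma\in\Gamma^*$ afforded by the module $V$, let $\chi_n(\gamma)\in R^-(\widetilde\Gamma_n)$ be the character of the spin supermodule $V^{\otimes n}\otimes U_n$, where $U_n=(\mathbb C^{1|1})^{\otimes\lfloor n/2\rfloor}$ is the basic spin supermodule of $\widetilde S_n$, on which $t_j$ acts as $\sqrt{\tfrac{j+1}{2j}}\,e_j-\sqrt{\tfrac{j-1}{2j}}\,e_{j-1}$ (with $e_0=0$) and $z$ as $-1$; here $e_1,\dots,e_{n-1}$ are the Clifford generators ($e_ie_j+e_je_i=-2\delta_{ij}$) acting by $e_{2j-1}=\sqrt{-1}\,\sigma_3^{\otimes(j-1)}\otimes\sigma_1\otimes1\otimes\cdots\otimes1$ and $e_{2j}=\sqrt{-1}\,\sigma_3^{\otimes(j-1)}\otimes\sigma_2\otimes1\otimes\cdots\otimes1$,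 with $\sigma_1,\sigma_2,\sigma_3$ the Pauli matrices. Put $q_n(\gamma)=2^{\bar n/2}\chi_n(\gamma)$, where $\bar n\in\{0,1\}$ is the parity of $n$. For $n\ge0$ let $H_{-n}(\gamma)$ be multiplication by $q_n(\gamma)$ on $R^-_\Gamma$, and let $H_n(\gamma):R^-(\widetilde\Gamma_m)\to R^-(\widetilde\Gamma_{m-n})$ (zero if $n>m$) be restriction to $\widetilde\Gamma_n\hat\times\widetilde\Gamma_{m-n}$ followed by the pairing of the first factor with $q_n(\gamma)$. The operators $X_n(\gamma)$, $n\in\mathbb Z$, on $R^-_\Gamma$ are defined by $$\sum_{n\in\mathbb Z}X_n(\gamma)w^{-n}=\Big(\sum_{a\ge0}H_{-a}(\gamma)w^a\Big)\Big(\sum_{b\ge0}H_b(\gamma)(-w)^{-b}\Big).$$ For $\phi\in\mathbb Z^m$ put $X_\phi(\gamma)=X_{-\phi_1}(\gamma)\cdots X_{-\phi_m}(\gamma).1$ and $x_\phi(\gamma)=(X_{-\phi_1}(\gamma).1)\cdots(X_{-\phi_m}(\gamma).1)$; note that $X_{-n}(\gamma).1$ is $q_n(\gamma)$ for $n\ge0$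 and $0$ for $n<0$. Let $\mathcal{SP}(\Gamma^*)$ be the set of families $\lambda=(\lambda(\gamma))_{\gamma\in\Gamma^*}$ of partitions with distinct parts, let $l(\lambda)$ be the total number of parts of $\lambda$, and put $X_\lambda=\prod_{\gamma}X_{\lambda(\gamma)}(\gamma)$ and $x_\lambda=\prod_\gamma x_{\lambda(\gamma)}(\gamma)$. Write $\mu\gg\lambda$ if $\mu\ne\lambda$ and, for every $\gamma$, the partition $\mu(\gamma)$ has the same size as $\lambda(\gamma)$ and dominates it ($\mu(\gamma)_1+\dots+\mu(\gamma)_k\ge\lambda(\gamma)_1+\dots+\lambda(\gamma)_k$ for all $k$). Theorem. The vectors $X_\lambda$, $\lambda\in\mathcal{SP}(\Gamma^*)$, form an orthogonal basis of $R^-_\Gamma$, with $\langle X_\lambda,X_\mu\rangle=2^{l(\lambda)}\delta_{\lambda,\mu}$. Moreover, for every $\lambda\in\mathcal{SP}(\Gamma^*)$, $$X_\lambda=\prod_{\gamma\in\Gamma^*}\prod_{i<j}\frac{1-R_{ij}}{1+R_{ij}}\,x_\lambda(\gamma)=x_\lambda+\sum_{\mu\in\mathcal{SP}(\Gamma^*),\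 \mu\gg\lambda}c_{\lambda,\mu}\,x_\mu$$ with $c_{\lambda,\mu}\in\mathbb Z$ and only finitely many of them nonzero for each $\lambda$. Here, in the factor of $\gamma$, $x_\lambda(\gamma)$ stands for $x_{\lambda(\gamma)}(\gamma)$, the fraction is expanded as a power series in the raising operators $R_{ij}$, and $R_{ij}$ acts on $x_\phi(\gamma)$ by adding $1$ to $\phi_i$ and subtracting $1$ from $\phi_j$; only finitely many terms of the expansion are nonzero. -/

import Mathlib

open scoped Kronecker

namespace SpinWreath

/-! ### The spin group -/

/-- Generators of the spin group on `n` letters: the central element `z` and `t i`, which stands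
for `t_{i+1}` when the generators are numbered from `1` to `n - 1`. -/
inductive SpinGen (n : ℕ) : Type
  | z : SpinGen n
  | t : Fin (n - 1) → SpinGen n

/-- The relators of the spin group: `z ^ 2 = 1`, `t_i ^ 2 = z`, `(t_i t_{i+1}) ^ 3 = z`,
`t_i t_j = z t_j t_i` for `i > j + 1`, and `z t_i = t_i z`. -/
inductive SpinRel (n : ℕ) : FreeGroup (SpinGen n) → Prop
  | z_sq : SpinRel n (FreeGroup.of SpinGen.z ^ 2)
  | t_sq (i : Fin (n - 1)) :
      SpinRel n (FreeGroup.of (SpinGen.t i) ^ 2 * (FreeGroup.of SpinGen.z)⁻¹)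
  | braid (i j : Fin (n - 1)) (h : (j : ℕ) = i + 1) :
      SpinRel n ((FreeGroup.of (SpinGen.t i) * FreeGroup.of (SpinGen.t j)) ^ 3 *
        (FreeGroup.of SpinGen.z)⁻¹)
  | far (i j : Fin (n - 1)) (h : (j : ℕ) + 1 < i) :
      SpinRel n (FreeGroup.of (SpinGen.t i) * FreeGroup.of (SpinGen.t j) *
        (FreeGroup.of SpinGen.z * FreeGroup.of (SpinGen.t j) * FreeGroup.of (SpinGen.t i))⁻¹)
  | central (i : Fin (n - 1)) :
      SpinRel n (FreeGroup.of SpinGen.z * FreeGroup.of (SpinGen.t i) *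
        (FreeGroup.of (SpinGen.t i) * FreeGroup.of SpinGen.z)⁻¹)

/-- The spin group `S̃_n`, a double cover of the symmetric group `S_n`. -/
abbrev SpinGroup (n : ℕ) : Type := PresentedGroup {w | SpinRel n w}

/-- The central involution `z` of `S̃_n`. -/
def spinZ (n : ℕ) : SpinGroup n := PresentedGroup.of SpinGen.z

/-- The generator `t i` of `S̃_n`. -/
def spinT {n : ℕ} (i : Fin (n - 1)) : SpinGroup n := PresentedGroup.of (SpinGen.t i)

/-- The universal property of `S̃_n`. -/
def SpinGroup.lift {n : ℕ} {G : Type*} [Group G] (ζ : G) (τ : Fin (n - 1) → G)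
    (hz : ζ ^ 2 = 1) (ht : ∀ i, τ i ^ 2 = ζ)
    (hb : ∀ i j : Fin (n - 1), (j : ℕ) = i + 1 → (τ i * τ j) ^ 3 = ζ)
    (hf : ∀ i j : Fin (n - 1), (j : ℕ) + 1 < i → τ i * τ j = ζ * τ j * τ i)
    (hc : ∀ i, ζ * τ i = τ i * ζ) : SpinGroup n →* G :=
  PresentedGroup.toGroup (f := fun s => SpinGen.casesOn s ζ τ) (by
    rintro _ (_ | i | ⟨i, j, h⟩ | ⟨i, j, h⟩ | i)
    · simpa using hz
    · simpa [mul_inv_eq_one] using ht i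
    · simpa [mul_inv_eq_one] using hb i j h
    · simpa only [map_mul, map_inv, FreeGroup.lift_apply_of, mul_inv_eq_one] using hf i j h
    · simpa only [map_mul, map_inv, FreeGroup.lift_apply_of, mul_inv_eq_one] using hc i)

/-- The parity `d`, written multiplicatively: `t_i ↦ -1`, `z ↦ 1`. -/
def spinParity (n : ℕ) : SpinGroup n →* ℤˣ :=
  SpinGroup.lift 1 (fun _ => -1) (by decide) (fun _ => by decide) (fun _ _ _ => by decide)
    (fun _ _ _ => by decide) (fun _ => by decide)

theorem swap_braid {n : ℕ} (a b c : Fin n) (hab : a ≠ b) (hbc : b ≠ c) (hac : a ≠ c) :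
    (Equiv.swap a b * Equiv.swap b c) ^ 3 = 1 := by
  have h : (Equiv.swap b a * Equiv.swap b c).IsThreeCycle :=
    Equiv.Perm.isThreeCycle_swap_mul_swap_same hab.symm hbc hac
  rw [Equiv.swap_comm a b, ← h.orderOf, pow_orderOf_eq_one]

/-- The projection `θ : S̃_n → S_n`, sending `t_i` to the transposition `(i, i+1)` and `z`
to `1`. -/
def spinPerm (n : ℕ) : SpinGroup n →* Equiv.Perm (Fin n) :=
  SpinGroup.lift 1
    (fun i => Equiv.swap ⟨i, by omega⟩ ⟨i + 1, by omega⟩) (one_pow 2)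
    (fun i => by rw [pow_two, Equiv.swap_mul_self])
    (fun i j h => by
      have e : (⟨(i : ℕ) + 1, by omega⟩ : Fin n) = ⟨j, by omega⟩ := by simp [h]
      simp only [e]
      apply swap_braid <;> simp only [ne_eq, Fin.mk.injEq] <;> omega)
    (fun i j h => by
      rw [one_mul]
      refine (Equiv.Perm.Disjoint.commute ?_).eq
      rw [Equiv.Perm.disjoint_iff_disjoint_support,
        Equiv.Perm.support_swap (by simp), Equiv.Perm.support_swap (by simp)]
      simp only [Finset.disjoint_insert_left, Finset.disjoint_singleton_left, Finset.mem_insert,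
        Finset.mem_singleton, Fin.mk.injEq]
      omega)
    (fun i => by rw [one_mul, mul_one])

theorem spinZ_sq (n : ℕ) : spinZ n ^ 2 = 1 := by
  have := PresentedGroup.one_of_mem (rels := {w | SpinRel n w}) SpinRel.z_sq
  simpa [spinZ, PresentedGroup.of] using this

theorem spinT_sq {n : ℕ} (i : Fin (n - 1)) : spinT i ^ 2 = spinZ n := by
  have := PresentedGroup.one_of_mem (rels := {w | SpinRel n w}) (SpinRel.t_sq i)
  simpa [spinZ, spinT, PresentedGroup.of, mul_inv_eq_one] using this

theorem spinT_braid {n : ℕ} (i j : Fin (n - 1)) (h : (j : ℕ) = i + 1) :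
    (spinT i * spinT j) ^ 3 = spinZ n := by
  have := PresentedGroup.one_of_mem (rels := {w | SpinRel n w}) (SpinRel.braid i j h)
  simpa [spinZ, spinT, PresentedGroup.of, mul_inv_eq_one] using this

theorem spinT_far {n : ℕ} (i j : Fin (n - 1)) (h : (j : ℕ) + 1 < i) :
    spinT i * spinT j = spinZ n * spinT j * spinT i := by
  have := PresentedGroup.one_of_mem (rels := {w | SpinRel n w}) (SpinRel.far i j h)
  simpa only [spinZ, spinT, PresentedGroup.of, map_mul, map_inv, mul_inv_eq_one] using this

theorem spinZ_central {n : ℕ} (i : Fin (n - 1)) :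
    spinZ n * spinT i = spinT i * spinZ n := by
  have := PresentedGroup.one_of_mem (rels := {w | SpinRel n w}) (SpinRel.central i)
  simpa only [spinZ, spinT, PresentedGroup.of, map_mul, map_inv, mul_inv_eq_one] using this

/-- The homomorphism `S̃_a → S̃_m` with `t_i ↦ t_{k+i}` and `z ↦ z`; it covers the inclusion of
the symmetric group of the letters `k + 1, …, k + a` in `S_m`. -/
def spinShift (k a m : ℕ) (h : k + a ≤ m) : SpinGroup a →* SpinGroup m :=
  SpinGroup.lift (spinZ m) (fun i => spinT ⟨k + i, by omega⟩) (spinZ_sq m)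
    (fun _ => spinT_sq _)
    (fun i j hij => spinT_braid _ _ (by simp only [hij]; omega))
    (fun i j hij => spinT_far _ _ (by simp only; omega))
    (fun _ => spinZ_central _)

/-! ### The spin wreath product -/

/-- The spin wreath product `Γ̃_n = Γ^n ⋊ S̃_n`, where `S̃_n` acts through `S_n` by
`(σ g) i = g (σ⁻¹ i)`. -/
abbrev Wreath (Γ : Type*) [Group Γ] (n : ℕ) : Type _ :=
  (Fin n → Γ) ⋊[(mulAutArrow (G := Equiv.Perm (Fin n)) (A := Fin n) (M := Γ)).comp (spinPerm n)]
    SpinGroup n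

section Groups

variable {Γ : Type*} [Group Γ]

/-- The central involution `z` of `Γ̃_n`. -/
def wreathZ (Γ : Type*) [Group Γ] (n : ℕ) : Wreath Γ n := ⟨1, spinZ n⟩

/-- The copy in `Γ̃_m` of an element of `Γ̃_a`, placed on the letters `k + 1, …, k + a`. -/
def place (k : ℕ) {a m : ℕ} (h : k + a ≤ m) (x : Wreath Γ a) : Wreath Γ m :=
  ⟨fun i => if hi : k ≤ (i : ℕ) ∧ (i : ℕ) < k + a then x.left ⟨i - k, by omega⟩ else 1,
    spinShift k a m h x.right⟩

/-- The map `Γ̃_a × Γ̃_b → Γ̃_m`, `m = a + b`, which puts the first element on the first `a` letters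
and the second on the last `b` letters, and multiplies. It is two-to-one: it identifies `(x, y)`
with `(z x, z y)`, and its image is the spin product of `Γ̃_a` and `Γ̃_b`. -/
def spinMul {a b m : ℕ} (h : a + b = m) (p : Wreath Γ a × Wreath Γ b) : Wreath Γ m :=
  place 0 (by omega) p.1 * place a (by omega) p.2

end Groups

/-! ### Super spin class functions -/

/-- Sequences of functions on the groups `Γ̃_n`, `n ≥ 0`; the ambient space of `R^-_Γ`. -/
abbrev GradedFun (Γ : Type*) [Group Γ] : Type _ := (n : ℕ) → Wreath Γ n → ℂ

/-- `R^-(Γ̃_n)`: the class functions `f` on `Γ̃_n` with `f (z x) = - f x` that vanish on the odd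
elements. -/
def superSpin (Γ : Type*) [Group Γ] (n : ℕ) : Submodule ℂ (Wreath Γ n → ℂ) where
  carrier := {f | (∀ x y, f (y * x * y⁻¹) = f x) ∧ (∀ x, f (wreathZ Γ n * x) = -f x) ∧
    ∀ x, spinParity n x.right = -1 → f x = 0}
  add_mem' := by
    rintro f g ⟨h1, h2, h3⟩ ⟨k1, k2, k3⟩
    refine ⟨fun x y => by simp [h1, k1], fun x => ?_, fun x hx => by simp [h3 x hx, k3 x hx]⟩
    simp [h2, k2, add_comm]
  zero_mem' := by simp
  smul_mem' := by
    rintro c f ⟨h1, h2, h3⟩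
    exact ⟨fun x y => by simp [h1], fun x => by simp [h2], fun x hx => by simp [h3 x hx]⟩

/-- `R^-_Γ = ⨁ R^-(Γ̃_n)`, as the space of finitely supported sequences. -/
def RMinus (Γ : Type*) [Group Γ] : Submodule ℂ (GradedFun Γ) where
  carrier := {F | (∀ n, F n ∈ superSpin Γ n) ∧ {n | F n ≠ 0}.Finite}
  add_mem' := by
    rintro F G ⟨h1, h2⟩ ⟨k1, k2⟩
    refine ⟨fun n => (superSpin Γ n).add_mem (h1 n) (k1 n), (h2.union k2).subset ?_⟩
    intro n hn
    by_contra hc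
    simp only [Set.mem_union, Set.mem_ofPred_eq, not_or, not_not] at hc
    exact hn (by simp [hc.1, hc.2])
  zero_mem' := ⟨fun n => (superSpin Γ n).zero_mem, by simp⟩
  smul_mem' := by
    rintro c F ⟨h1, h2⟩
    refine ⟨fun n => (superSpin Γ n).smul_mem c (h1 n), h2.subset ?_⟩
    intro n hn hc
    exact hn (by simp [hc])

section Operations

variable {Γ : Type*} [Group Γ]

/-- The standard bilinear form on functions on `Γ̃_n`. -/
noncomputable def form {n : ℕ} (f g : Wreath Γ n → ℂ) : ℂ :=
  (Nat.card (Wreath Γ n) : ℂ)⁻¹ * ∑ᶠ x, f x * g x⁻¹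

/-- The standard bilinear form on `R^-_Γ`. -/
noncomputable def gradedForm (F G : GradedFun Γ) : ℂ := ∑ᶠ n, form (F n) (G n)

/-- The function `x y ↦ f x * g y` on the spin product of `Γ̃_a` and `Γ̃_b`, extended by zero to
`Γ̃_{a+b}`. Each element of the spin product comes from two pairs `(x, y)`, whose contributions
agree for spin functions `f`, `g`, whence the factor `1 / 2`. For characters of supermodules it
is the character of their super tensor product. -/
noncomputable def outer {a b m : ℕ} (h : a + b = m) (f : Wreath Γ a → ℂ) (g : Wreath Γ b → ℂ) :
    Wreath Γ m → ℂ :=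
  fun w => (2 : ℂ)⁻¹ * ∑ᶠ p : {p : Wreath Γ a × Wreath Γ b // spinMul h p = w},
    f p.1.1 * g p.1.2

/-- The induction product `R^-(Γ̃_a) ⊗ R^-(Γ̃_b) → R^-(Γ̃_{a+b})`: the function above, induced from
the spin product to `Γ̃_{a+b}`. -/
noncomputable def indProd {a b m : ℕ} (h : a + b = m) (f : Wreath Γ a → ℂ) (g : Wreath Γ b → ℂ) :
    Wreath Γ m → ℂ :=
  fun w => (Nat.card (Set.range (spinMul (Γ := Γ) h)) : ℂ)⁻¹ *
    ∑ᶠ y : Wreath Γ m, outer h f g (y⁻¹ * w * y)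

/-- Restriction of `f` from `Γ̃_{a+b}` to the spin product of `Γ̃_a` and `Γ̃_b`, followed by the
pairing with `u` in the first factor. -/
noncomputable def skew {a b m : ℕ} (h : a + b = m) (u : Wreath Γ a → ℂ) (f : Wreath Γ m → ℂ) :
    Wreath Γ b → ℂ :=
  fun y => form u (fun x => f (spinMul h (x, y)))

/-- The product of `R^-_Γ`. -/
noncomputable def gradedMul (F G : GradedFun Γ) : GradedFun Γ :=
  fun m => ∑ p : {p // p ∈ Finset.HasAntidiagonal.antidiagonal m},
    indProd (Finset.HasAntidiagonal.mem_antidiagonal.1 p.2) (F p.1.1) (G p.1.2)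

/-- The unit of `R^-_Γ`: the spin function on `Γ̃_0 = {1, z}` with value `1` at `1` and `-1`
at `z`. -/
noncomputable def gradedOne (Γ : Type*) [Group Γ] : GradedFun Γ := by
  classical
  exact fun n x => if n = 0 then (if x = 1 then 1 else -1) else 0

/-- Product of a list of elements of `R^-_Γ`. -/
noncomputable def gradedProd (L : List (GradedFun Γ)) : GradedFun Γ :=
  L.foldr gradedMul (gradedOne Γ)

end Operations

/-! ### The basic spin supermodule -/

/-- The matrix, in the standard basis of `(ℂ²)^{⊗ K}`, of the tensor product of a family of
endomorphisms of `ℂ²`. -/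
def tensorMat {K : ℕ} (A : Fin K → Matrix (Fin 2) (Fin 2) ℂ) :
    Matrix (Fin K → Fin 2) (Fin K → Fin 2) ℂ :=
  fun v w => ∏ k, A k (v k) (w k)

/-- The Pauli matrices. -/
def pauli1 : Matrix (Fin 2) (Fin 2) ℂ := !![0, 1; 1, 0]

/-- The Pauli matrices. -/
def pauli2 : Matrix (Fin 2) (Fin 2) ℂ := !![0, -Complex.I; Complex.I, 0]

/-- The Pauli matrices. -/
def pauli3 : Matrix (Fin 2) (Fin 2) ℂ := !![1, 0; 0, -1]

/-- The tensor factors of a Clifford generator. -/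
def cliffordFactor (K m : ℕ) (k : Fin K) : Matrix (Fin 2) (Fin 2) ℂ :=
  if (k : ℕ) < m / 2 then pauli3
  else if (k : ℕ) = m / 2 then (if m % 2 = 0 then pauli1 else pauli2) else 1

/-- The action of the Clifford generator `e_{m+1}` on `(ℂ^{1|1})^{⊗ K}`:
`e_{2j-1} = √-1 σ₃^{⊗(j-1)} ⊗ σ₁ ⊗ 1^{⊗(K-j)}` and
`e_{2j} = √-1 σ₃^{⊗(j-1)} ⊗ σ₂ ⊗ 1^{⊗(K-j)}`. -/
noncomputable def clifford (K m : ℕ) : Matrix (Fin K → Fin 2) (Fin K → Fin 2) ℂ :=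
  Complex.I • tensorMat (cliffordFactor K m)

theorem tensorMat_mul {K : ℕ} (A B : Fin K → Matrix (Fin 2) (Fin 2) ℂ) :
    tensorMat A * tensorMat B = tensorMat (fun k => A k * B k) := by
  ext v w
  simp only [Matrix.mul_apply, tensorMat, ← Finset.prod_mul_distrib]
  rw [Finset.prod_univ_sum]
  simp

theorem tensorMat_one {K : ℕ} :
    tensorMat (fun _ : Fin K => (1 : Matrix (Fin 2) (Fin 2) ℂ)) = 1 := by
  ext v w
  simp only [tensorMat, Matrix.one_apply, Finset.prod_ite_zero, Finset.prod_const_one]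
  simp [funext_iff]

theorem pauli1_sq : pauli1 * pauli1 = 1 := by
  ext i j; fin_cases i <;> fin_cases j <;> simp [pauli1]

theorem pauli2_sq : pauli2 * pauli2 = 1 := by
  ext i j; fin_cases i <;> fin_cases j <;> simp [pauli2]

theorem pauli3_sq : pauli3 * pauli3 = 1 := by
  ext i j; fin_cases i <;> fin_cases j <;> simp [pauli3]

theorem pauli12 : pauli1 * pauli2 = -(pauli2 * pauli1) := by
  ext i j; fin_cases i <;> fin_cases j <;> simp [pauli1, pauli2]

theorem pauli13 : pauli1 * pauli3 = -(pauli3 * pauli1) := by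
  ext i j; fin_cases i <;> fin_cases j <;> simp [pauli1, pauli3]

theorem pauli23 : pauli2 * pauli3 = -(pauli3 * pauli2) := by
  ext i j; fin_cases i <;> fin_cases j <;> simp [pauli2, pauli3]

theorem clifford_sq (K m : ℕ) : clifford K m * clifford K m = -1 := by
  have : (fun k => cliffordFactor K m k * cliffordFactor K m k) = fun _ => 1 := by
    funext k
    unfold cliffordFactor
    split_ifs <;> simp [pauli1_sq, pauli2_sq, pauli3_sq]
  rw [clifford, smul_mul_smul_comm, tensorMat_mul, this, tensorMat_one, Complex.I_mul_I]
  simp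

theorem clifford_anticomm (K m p : ℕ) (hmp : m < p) (hm : m / 2 < K) :
    clifford K m * clifford K p = -(clifford K p * clifford K m) := by
  rw [clifford, clifford, smul_mul_smul_comm, smul_mul_smul_comm, tensorMat_mul, tensorMat_mul,
    ← smul_neg]
  congr 1
  ext v w
  have key : ∀ k : Fin K, cliffordFactor K m k * cliffordFactor K p k =
      (if k = ⟨m / 2, hm⟩ then (-1 : ℂ) else 1) •
        (cliffordFactor K p k * cliffordFactor K m k) := by
    intro k
    unfold cliffordFactor
    have hk : k = ⟨m / 2, hm⟩ ↔ (k : ℕ) = m / 2 := by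
      constructor
      · rintro rfl; rfl
      · intro h; ext; exact h
    have hmp2 : m / 2 ≤ p / 2 := Nat.div_le_div_right hmp.le
    simp only [hk]
    split_ifs <;> first
      | (exfalso; omega)
      | simp [pauli12, pauli13, pauli23]
  simp only [tensorMat, key, Matrix.smul_apply, Matrix.neg_apply, smul_eq_mul,
    Finset.prod_mul_distrib]
  simp

/-- The action of the generator `t_{j+1}` of `S̃_n` on `(ℂ^{1|1})^{⊗ K}`:
`t_i ↦ √((i+1)/(2i)) e_i - √((i-1)/(2i)) e_{i-1}` for `i = j + 1`. -/
noncomputable def spinMatT (K j : ℕ) : Matrix (Fin K → Fin 2) (Fin K → Fin 2) ℂ :=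
  (Real.sqrt (((j : ℝ) + 2) / (2 * ((j : ℝ) + 1))) : ℂ) • clifford K j -
    (Real.sqrt ((j : ℝ) / (2 * ((j : ℝ) + 1))) : ℂ) • clifford K (j - 1)


theorem spinMatT_sq (K j : ℕ) (hj : j / 2 < K) : spinMatT K j * spinMatT K j = -1 := by
  have hpos : (0 : ℝ) < 2 * ((j : ℝ) + 1) := by positivity
  have ha : (Real.sqrt (((j : ℝ) + 2) / (2 * ((j : ℝ) + 1))) : ℂ) *
      (Real.sqrt (((j : ℝ) + 2) / (2 * ((j : ℝ) + 1))) : ℂ) =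
      (((((j : ℝ) + 2) / (2 * ((j : ℝ) + 1)) : ℝ)) : ℂ) := by
    rw [← Complex.ofReal_mul, Real.mul_self_sqrt (by positivity)]
  have hb : (Real.sqrt ((j : ℝ) / (2 * ((j : ℝ) + 1))) : ℂ) *
      (Real.sqrt ((j : ℝ) / (2 * ((j : ℝ) + 1))) : ℂ) =
      ((((j : ℝ) / (2 * ((j : ℝ) + 1)) : ℝ)) : ℂ) := by
    rw [← Complex.ofReal_mul, Real.mul_self_sqrt (by positivity)]
  have hab : (((((j : ℝ) + 2) / (2 * ((j : ℝ) + 1)) : ℝ)) : ℂ) +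
      ((((j : ℝ) / (2 * ((j : ℝ) + 1)) : ℝ)) : ℂ) = 1 := by
    rw [← Complex.ofReal_add]
    norm_cast
    push_cast
    field_simp
    ring
  rcases Nat.eq_zero_or_pos j with rfl | h0
  · simp [spinMatT, clifford_sq]
  · have hanti := clifford_anticomm K (j - 1) j (by omega) (by omega)
    unfold spinMatT
    generalize (Real.sqrt (((j : ℝ) + 2) / (2 * ((j : ℝ) + 1))) : ℂ) = a at *
    generalize (Real.sqrt ((j : ℝ) / (2 * ((j : ℝ) + 1))) : ℂ) = b at *
    have h1 := clifford_sq K j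
    have h2 := clifford_sq K (j - 1)
    simp only [sub_mul, mul_sub, smul_mul_smul_comm, h1, h2, hanti, ha, hb, mul_comm b a]
    refine Eq.trans ?_ (show (-(((((j : ℝ) + 2) / (2 * ((j : ℝ) + 1)) : ℝ)) : ℂ) -
      ((((j : ℝ) / (2 * ((j : ℝ) + 1)) : ℝ)) : ℂ)) •
        (1 : Matrix (Fin K → Fin 2) (Fin K → Fin 2) ℂ) = -1 by
      rw [← neg_add', hab, neg_smul, one_smul])
    module

theorem spinMatT_braid (K j : ℕ) (hj : (j + 1) / 2 < K) :
    (spinMatT K j * spinMatT K (j + 1)) ^ 3 = -1 := by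
  have hsum : spinMatT K j * spinMatT K (j + 1) + spinMatT K (j + 1) * spinMatT K j = 1 := by
    have hc : (Real.sqrt (((j : ℝ) + 2) / (2 * ((j : ℝ) + 1))) : ℂ) *
        (Real.sqrt ((((j + 1 : ℕ) : ℝ)) / (2 * (((j + 1 : ℕ) : ℝ) + 1))) : ℂ) = 1 / 2 := by
      rw [← Complex.ofReal_mul, ← Real.sqrt_mul (by positivity)]
      have : ((j : ℝ) + 2) / (2 * ((j : ℝ) + 1)) *
          ((((j + 1 : ℕ) : ℝ)) / (2 * (((j + 1 : ℕ) : ℝ) + 1))) = (1 / 2) ^ 2 := by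
        push_cast
        field_simp
        ring
      rw [this, Real.sqrt_sq (by norm_num)]
      norm_num
    have h1 := clifford_sq K j
    have h2 := clifford_anticomm K j (j + 1) (by omega) (by omega)
    rcases Nat.eq_zero_or_pos j with rfl | h0
    · unfold spinMatT
      simp only [Nat.add_sub_cancel] at *
      generalize (Real.sqrt ((((0 : ℕ) : ℝ) + 2) / (2 * (((0 : ℕ) : ℝ) + 1))) : ℂ) = a at *
      generalize (Real.sqrt ((((0 + 1 : ℕ) : ℝ)) / (2 * (((0 + 1 : ℕ) : ℝ) + 1))) : ℂ) = b at *
      simp only [Nat.cast_zero, zero_div, Real.sqrt_zero, Complex.ofReal_zero, zero_smul, sub_zero]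
      simp only [mul_sub, sub_mul, smul_mul_smul_comm, h1, h2, mul_comm b a, hc,
        mul_comm _ a]
      module
    · have h3 := clifford_anticomm K (j - 1) j (by omega) (by omega)
      have h4 := clifford_anticomm K (j - 1) (j + 1) (by omega) (by omega)
      unfold spinMatT
      simp only [Nat.add_sub_cancel] at *
      generalize (Real.sqrt (((j : ℝ) + 2) / (2 * ((j : ℝ) + 1))) : ℂ) = a at *
      generalize (Real.sqrt ((((j + 1 : ℕ) : ℝ)) / (2 * (((j + 1 : ℕ) : ℝ) + 1))) : ℂ) = b at *
      generalize (Real.sqrt ((j : ℝ) / (2 * ((j : ℝ) + 1))) : ℂ) = c at *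
      generalize (Real.sqrt ((((j + 1 : ℕ) : ℝ) + 2) / (2 * (((j + 1 : ℕ) : ℝ) + 1))) : ℂ) = d
        at *
      simp only [mul_sub, sub_mul, smul_mul_smul_comm, h1, h2, h3, h4, mul_comm b a, hc,
        mul_comm b c, mul_comm d a, mul_comm d c]
      module
  have hA := spinMatT_sq K j (by omega)
  have hB := spinMatT_sq K (j + 1) hj
  generalize spinMatT K j = A at *
  generalize spinMatT K (j + 1) = B at *
  have hBA : B * A = 1 - A * B := by rw [← hsum]; abel
  have h2 : (A * B) * (A * B) = A * B - 1 := by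
    calc (A * B) * (A * B) = A * (B * A) * B := by noncomm_ring
      _ = A * B - (A * A) * (B * B) := by rw [hBA]; noncomm_ring
      _ = A * B - 1 := by rw [hA, hB]; simp
  rw [pow_succ, pow_two, h2, sub_mul, h2, one_mul]
  abel

theorem spinMatT_far (K i j : ℕ) (h : j + 1 < i) (hi : i / 2 < K) :
    spinMatT K i * spinMatT K j = -(spinMatT K j * spinMatT K i) := by
  have h1 := clifford_anticomm K j i (by omega) (by omega)
  have h2 := clifford_anticomm K j (i - 1) (by omega) (by omega)
  have h3 := clifford_anticomm K (j - 1) i (by omega) (by omega)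
  have h4 := clifford_anticomm K (j - 1) (i - 1) (by omega) (by omega)
  unfold spinMatT
  simp only [mul_sub, sub_mul, smul_mul_smul_comm, h1, h2, h3, h4]
  simp only [mul_comm (Complex.ofReal (Real.sqrt (((i : ℝ) + 2) / (2 * ((i : ℝ) + 1))))),
    mul_comm (Complex.ofReal (Real.sqrt ((i : ℝ) / (2 * ((i : ℝ) + 1)))))]
  module

/-- `spinMatT` as a unit, for the generators of `S̃_n`. -/
noncomputable def spinUnitT (n : ℕ) (j : Fin (n - 1)) :
    (Matrix (Fin (n / 2) → Fin 2) (Fin (n / 2) → Fin 2) ℂ)ˣ where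
  val := spinMatT (n / 2) j
  inv := -spinMatT (n / 2) j
  val_inv := by rw [mul_neg, spinMatT_sq _ _ (by omega), neg_neg]
  inv_val := by rw [neg_mul, spinMatT_sq _ _ (by omega), neg_neg]

/-- The basic spin supermodule of `S̃_n`, on the space `(ℂ^{1|1})^{⊗ ⌊n/2⌋}`. -/
noncomputable def basicSpin (n : ℕ) :
    SpinGroup n →* (Matrix (Fin (n / 2) → Fin 2) (Fin (n / 2) → Fin 2) ℂ)ˣ :=
  SpinGroup.lift (-1) (spinUnitT n) (by simp)
    (fun i => Units.ext (by
      simpa [pow_two, spinUnitT] using spinMatT_sq (n / 2) i (by omega)))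
    (fun i j h => Units.ext (by
      simpa [spinUnitT, h] using spinMatT_braid (n / 2) i (by omega)))
    (fun i j h => Units.ext (by
      simpa [spinUnitT] using spinMatT_far (n / 2) i j h (by omega)))
    (fun i => by simp)

/-! ### The characters `χ_n(γ)` -/

section Characters

variable {Γ : Type*} [Group Γ]

/-- `Γ^*`: the complex irreducible characters of `Γ`. -/
def IrrChar (Γ : Type*) [Group Γ] : Type _ :=
  {χ : Γ → ℂ // ∃ (d : ℕ) (ρ : Representation ℂ Γ (Fin d → ℂ)),
    ρ.IsIrreducible ∧ ρ.character = χ}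

/-- The degree of an irreducible character. -/
noncomputable def IrrChar.deg (γ : IrrChar Γ) : ℕ := γ.2.choose

/-- A representation affording an irreducible character. -/
noncomputable def IrrChar.rep (γ : IrrChar Γ) : Representation ℂ Γ (Fin γ.deg → ℂ) :=
  γ.2.choose_spec.choose

/-- The matrix of `(g, t) ∈ Γ̃_n` on `V^{⊗ n}`, in the standard basis: the element
`v_1 ⊗ ⋯ ⊗ v_n` goes to `g_1 v_{s⁻¹(1)} ⊗ ⋯ ⊗ g_n v_{s⁻¹(n)}`, with `s` the image of `t`
in `S_n`. -/
noncomputable def tensorPowMat {d : ℕ} (ρ : Representation ℂ Γ (Fin d → ℂ)) {n : ℕ}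
    (x : Wreath Γ n) : Matrix (Fin n → Fin d) (Fin n → Fin d) ℂ :=
  fun i j => ∏ k, LinearMap.toMatrix' (ρ (x.left k)) (i k) (j ((spinPerm n x.right)⁻¹ k))

/-- `χ_n(γ)`: the character of the spin supermodule `V^{⊗ n} ⊗ U` of `Γ̃_n`, where `V` affords `γ`
and `U` is the basic spin supermodule of `S̃_n`. -/
noncomputable def basicChar (γ : IrrChar Γ) (n : ℕ) (x : Wreath Γ n) : ℂ :=
  (tensorPowMat γ.rep x ⊗ₖ (basicSpin n x.right).val).trace

/-- `2^{n̄/2} χ_n(γ)`, where `n̄ ∈ {0, 1}` is the parity of `n`. -/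
noncomputable def normChar (γ : IrrChar Γ) (n : ℕ) : Wreath Γ n → ℂ :=
  (Real.sqrt 2 : ℂ) ^ (n % 2) • basicChar γ n

/-! ### Twisted vertex operators -/

/-- `H_{-a}(γ)`, `a ≥ 0`: induction product with `2^{ā/2} χ_a(γ)`. It raises the degree by `a`. -/
noncomputable def creation (γ : IrrChar Γ) (a : ℕ) (F : GradedFun Γ) : GradedFun Γ :=
  fun p => if h : a ≤ p then indProd (Nat.add_sub_of_le h) (normChar γ a) (F (p - a)) else 0

/-- `H_b(γ)`, `b ≥ 0`: restriction followed by pairing with `2^{b̄/2} χ_b(γ)`. It lowers the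
degree by `b`. -/
noncomputable def annihilation (γ : IrrChar Γ) (b : ℕ) (F : GradedFun Γ) : GradedFun Γ :=
  fun c => skew rfl (normChar γ b) (F (b + c))

/-- The component `X_n(γ)`, `n ∈ ℤ`, of the twisted vertex operator
`X(γ, w) = ∑_n X_n(γ) w^{-n} = (∑_{a ≥ 0} H_{-a}(γ) w^a) (∑_{b ≥ 0} H_b(γ) (-w)^{-b})`, that is,
`X_n(γ) = ∑_{b - a = n} (-1)^b H_{-a}(γ) H_b(γ)`. In degree `p` only the terms with `a ≤ p`
contribute. -/
noncomputable def vertexOp (γ : IrrChar Γ) (n : ℤ) (F : GradedFun Γ) : GradedFun Γ :=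
  fun p => ∑ a ∈ Finset.range (p + 1),
    if 0 ≤ (a : ℤ) + n then
      (-1 : ℂ) ^ ((a : ℤ) + n).toNat • creation γ a (annihilation γ ((a : ℤ) + n).toNat F) p
    else 0

/-! ### Strict partitions and the vectors `X_λ`, `x_λ` -/

/-- Strict partitions: strictly decreasing lists of positive integers. -/
def StrictPartition : Type := {l : List ℕ // l.Pairwise (· > ·) ∧ ∀ x ∈ l, 0 < x}

/-- `SP(Γ^*)`: strict-partition-valued functions on `Γ^*`. -/
abbrev SP (Γ : Type*) [Group Γ] : Type _ := IrrChar Γ → StrictPartition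

/-- Dominance order on partitions of the same integer: `Dominates l m` says that the partial sums
of `l` are at least those of `m`. -/
def Dominates (l m : List ℕ) : Prop :=
  l.sum = m.sum ∧ ∀ k, (m.take k).sum ≤ (l.take k).sum

/-- Strict dominance of partition-valued functions. -/
def SP.StrictlyDominates (μ lam : SP Γ) : Prop :=
  (∀ γ, Dominates (μ γ).1 (lam γ).1) ∧ μ ≠ lam

/-- `X_φ(γ) = X_{-φ_1}(γ) ⋯ X_{-φ_m}(γ) 1`. -/
noncomputable def XVec (γ : IrrChar Γ) (φ : List ℤ) : GradedFun Γ :=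
  φ.foldr (fun k F => vertexOp γ (-k) F) (gradedOne Γ)

/-- `x_φ(γ) = (X_{-φ_1}(γ) 1) ⋯ (X_{-φ_m}(γ) 1)`. -/
noncomputable def xVec (γ : IrrChar Γ) (φ : List ℤ) : GradedFun Γ :=
  gradedProd (φ.map fun k => vertexOp γ (-k) (gradedOne Γ))

/-- The parts of a strict partition, as integers. -/
def StrictPartition.parts (l : StrictPartition) : List ℤ := l.1.map (fun k : ℕ => (k : ℤ))

/-- The length of a strict partition. -/
def StrictPartition.length (l : StrictPartition) : ℕ := l.1.length

variable {r : ℕ}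

/-- `X_λ = ∏_γ X_{λ(γ)}(γ)`, for an enumeration `γ_0, …, γ_r` of `Γ^*`. -/
noncomputable def XLam (e : Fin (r + 1) ≃ IrrChar Γ) (lam : SP Γ) : GradedFun Γ :=
  gradedProd (List.ofFn fun p => XVec (e p) (lam (e p)).parts)

/-- `x_λ = ∏_γ x_{λ(γ)}(γ)`, for an enumeration `γ_0, …, γ_r` of `Γ^*`. -/
noncomputable def xLam (e : Fin (r + 1) ≃ IrrChar Γ) (lam : SP Γ) : GradedFun Γ :=
  gradedProd (List.ofFn fun p => xVec (e p) (lam (e p)).parts)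

/-- The length `l(λ) = ∑_γ l(λ(γ))`. -/
def SP.length (e : Fin (r + 1) ≃ IrrChar Γ) (lam : SP Γ) : ℕ := ∑ p, (lam (e p)).length

/-! ### Raising operators -/

/-- Exponents `(k_{ij})_{i < j}` of a monomial `∏_{i<j} R_{ij}^{k_{ij}}` in the raising operators on
`m`-tuples. -/
abbrev RaisingExp (m : ℕ) : Type := {ij : Fin m × Fin m // ij.1 < ij.2} → ℕ

/-- The coefficient of `∏_{i<j} R_{ij}^{k_{ij}}` in `∏_{i<j} (1 - R_{ij}) / (1 + R_{ij})`. -/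
noncomputable def raisingCoeff {m : ℕ} (k : RaisingExp m) : ℂ :=
  ∏ ij, PowerSeries.coeff (k ij)
    ((1 - PowerSeries.X) * (1 + PowerSeries.X)⁻¹ : PowerSeries ℂ)

/-- The action of `∏_{i<j} R_{ij}^{k_{ij}}` on `m`-tuples of integers, where `R_{ij}` adds `1` to the
entry `i` and subtracts `1` from the entry `j`. -/
def raiseMonomial {m : ℕ} (k : RaisingExp m) (φ : Fin m → ℤ) : Fin m → ℤ :=
  φ + ∑ ij, (k ij : ℤ) • (Pi.single ij.1.1 1 - Pi.single ij.1.2 1)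

/-- Exponents of the raising operators acting in all the components `γ_0, …, γ_r`. -/
abbrev MultiRaisingExp (e : Fin (r + 1) ≃ IrrChar Γ) (lam : SP Γ) : Type :=
  (p : Fin (r + 1)) → RaisingExp (lam (e p)).parts.length

/-- The term `∏_γ (c_γ · x_{R^k λ(γ)}(γ))` of the expansion of
`∏_γ ∏_{i<j} (1 - R_{ij}) / (1 + R_{ij}) x_λ`. -/
noncomputable def raisingTerm (e : Fin (r + 1) ≃ IrrChar Γ) (lam : SP Γ)
    (k : MultiRaisingExp e lam) : GradedFun Γ :=
  (∏ p, raisingCoeff (k p)) •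
    gradedProd (List.ofFn fun p =>
      xVec (e p) (List.ofFn (raiseMonomial (k p) (lam (e p)).parts.get)))

end Characters

end SpinWreath

/-! Everything is measured against one family of spin functions. For a weight `X` on cycle types (a
cycle length together with the class of the cycle product), `spinExp X n` is the normalized basic
spin character times the product over the cycles of their weights. The factor `2^{n̄/2}` makes the
basic spin character multiplicative on blocks of letters (`spinChar_spinShift`), so by Frobenius
reciprocity the pairing with `spinExp X` turns induction products into products of numbers
(`form_indProd_spinExp`). These pairings separate spin functions (`eq_zero_of_form_spinExp`): cycle
types determine conjugacy up to `z`, functions of `superSpin` vanish on elements with an even cycle,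
and the basic spin character vanishes on no other element. Hence `R^-_Γ` embeds in a product of
polynomial rings, and the ring axioms come from there.

The vector `q_n(γ)` is `spinExp` for the weight that evaluates `γ` at the cycle product
(`normChar_eq_spinExp`). In terms of generating series, the family turns sums of weights into
products (`expElt_add`). Applied to `X` and the sign-twisted weight `(-1)^d X`, this gives `q(w)
q(-w) = 1`, because the sum of the two weights is zero on odd cycles. Evaluation at `tX + Y`,
compared as a polynomial in `t`, shows that the adjoints of multiplication by the `q_n` obey a
Leibniz rule (`lower_mul`). The norms `⟨q_n(γ), q_n(γ')⟩ = 2 δ` for `n > 0` (`form_normChar`) then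
give `H_b q_n = 2 q_{n-b}` for `b > 0`. These facts are collected in the structure `TwistedFock`;
what follows them is formal, apart from the generation of `R^-_Γ`.

In a twisted Fock space, moving a vertex operator past a generator produces the coefficients of `(1
- x) / (1 + x)` (`vertex_q_mul`). Iterating this gives the raising operator formula
(`word_eq_raising`). Combined with `q(w) q(-w) = 1` it gives the Clifford relations `X_{-k} X_{-l} +
X_{-l} X_{-k} = 2 (-1)^k δ_{k,-l}` (`vertex_anticomm`). As the adjoint of `X_{-k}` is `(-1)^k X_k`
(`form_vertex`), orthogonality and the norms `2^{l(λ)}` follow as in a fermionic Fock space.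

For triangularity, raising operators move a decreasing tuple up in dominance order and strictly
increase its sum of squares (`majorizes_raiseMonomial`). Repeated parts are removed with `q_m² = 2 ∑
± q_{m+i} q_{m-i}` (`straighten`), which again spreads the parts. So words and products of
generators differ by a unitriangular integral matrix, and the words span once the `q_n(γ)` are known
to generate `R^-_Γ` (`qAlgebra_eq_top`). Generation rests on the completeness of the irreducible
characters (`span_onClasses`), on `expElt_add`, and on Vandermonde matrices, which isolate cycle
lengths and rescale weights. -/

open scoped Kronecker

namespace SpinWreath

/-! ### Words of a Coxeter system of type `A` -/

section CoxeterWords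

variable {G : Type*} [Group G]

/-- `s j * s (j + 1) * ⋯ * s (j + d - 1)`. -/
def ascProd (s : ℕ → G) : ℕ → ℕ → G
  | _, 0 => 1
  | j, d + 1 => s j * ascProd s (j + 1) d

theorem ascProd_comm (s : ℕ → G) (i : ℕ) : ∀ (d j : ℕ), i + 1 < j →
    (∀ k, i + 1 < k → k < j + d → s i * s k = s k * s i) →
    s i * ascProd s j d = ascProd s j d * s i
  | 0, j, _, _ => by simp [ascProd]
  | d + 1, j, h, hc => by
    rw [ascProd, ← mul_assoc, hc j h (by omega), mul_assoc,
      ascProd_comm s i d (j + 1) (by omega) (fun k h1 h2 => hc k h1 (by omega)), mul_assoc]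

/-- In a group generated by elements satisfying the Coxeter relations of type `A_n`, the products
`s j ⋯ s (n - 1)` meet every coset of the subgroup generated by the first `n - 1` generators. -/
theorem exists_ascProd_mul (s : ℕ → G) (n : ℕ) (hsq : ∀ i < n, s i * s i = 1)
    (hb : ∀ i, i + 1 < n → s (i + 1) * s i * s (i + 1) = s i * s (i + 1) * s i)
    (hf : ∀ i j, i + 1 < j → j < n → s i * s j = s j * s i) (x : G)
    (hx : x ∈ Subgroup.closure {g | ∃ i < n, g = s i}) :
    ∃ j ≤ n, ∃ y ∈ Subgroup.closure {g | ∃ i, i + 1 < n ∧ g = s i},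
      x = ascProd s j (n - j) * y := by
  -- It is enough that the union of these cosets is stable under left multiplication by each `s i`.
  -- Against the word `s j ⋯ s (n - 1)` the generator is absorbed on the right if `i + 1 < j`,
  -- lengthens the word if `i + 1 = j`, cancels its first letter if `i = j`, and passes through as
  -- `s (i - 1)` if `i > j`.
  have step : ∀ i < n, ∀ x, (∃ j ≤ n, ∃ y ∈ Subgroup.closure {g | ∃ i, i + 1 < n ∧ g = s i},
      x = ascProd s j (n - j) * y) → ∃ j ≤ n,
      ∃ y ∈ Subgroup.closure {g | ∃ i, i + 1 < n ∧ g = s i}, s i * x = ascProd s j (n - j) * y := by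
    rintro i hi _ ⟨j, hj, y, hy, rfl⟩
    have hgen : ∀ k, k + 1 < n → s k ∈ Subgroup.closure {g | ∃ i, i + 1 < n ∧ g = s i} :=
      fun k hk => Subgroup.subset_closure ⟨k, hk, rfl⟩
    rcases lt_trichotomy (i + 1) j with h | h | h
    · refine ⟨j, hj, s i * y, mul_mem (hgen i (by omega)) hy, ?_⟩
      rw [← mul_assoc, ascProd_comm s i _ j h (fun k h1 h2 => hf i k h1 (by omega)), mul_assoc]
    · refine ⟨i, by omega, y, hy, ?_⟩
      obtain ⟨d, hd⟩ : ∃ d, n - j = d := ⟨_, rfl⟩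
      rw [show n - i = (n - j) + 1 by omega, ascProd, h, mul_assoc]
    · rcases Nat.lt_or_ge j i with h' | h'
      · obtain ⟨d, rfl⟩ : ∃ d, i = j + d + 1 := ⟨i - j - 1, by omega⟩
        refine ⟨j, hj, s (j + d) * y, mul_mem (hgen _ hi) hy, ?_⟩
        rw [← mul_assoc, ← mul_assoc]
        congr 1
        clear hy
        -- The generator commutes with the first `d` letters, and one braid relation then lowers its
        -- index by one; after that it commutes with the rest of the word.
        have key : ∀ (d j e : ℕ), j + d + 1 + e + 1 = n →
            s (j + d + 1) * ascProd s j (d + 2 + e) = ascProd s j (d + 2 + e) * s (j + d) := by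
          intro d
          induction d with
          | zero =>
            intro j e he
            rw [show 0 + 2 + e = (e + 1) + 1 by omega, ascProd, ascProd]
            simp only [Nat.add_zero]
            have h1 := ascProd_comm s j e (j + 1 + 1) (by omega)
              (fun k h1 h2 => hf j k h1 (by omega))
            rw [mul_assoc, mul_assoc, ← h1]
            simp only [← mul_assoc]
            rw [hb j (by omega)]
          | succ d ih =>
            intro j e he
            rw [show d + 1 + 2 + e = (d + 2 + e) + 1 by omega, ascProd, ← mul_assoc,
              ← hf j (j + (d + 1) + 1) (by omega) (by omega), mul_assoc, mul_assoc]
            congr 1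
            have := ih (j + 1) e (by omega)
            rw [show j + (d + 1) + 1 = j + 1 + d + 1 by omega, this]
            congr 2
            omega
        have := key d j (n - (j + d + 1) - 1) (by omega)
        rwa [show d + 2 + (n - (j + d + 1) - 1) = n - j by omega] at this
      · obtain rfl : i = j := by omega
        refine ⟨i + 1, by omega, y, hy, ?_⟩
        rw [show n - i = (n - (i + 1)) + 1 by omega, ascProd, ← mul_assoc, ← mul_assoc, hsq i hi,
          one_mul]
  induction hx using Subgroup.closure_induction_left with
  | one => exact ⟨n, le_rfl, 1, one_mem _, by simp [ascProd]⟩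
  | mul_left x hx y _ ih =>
    obtain ⟨i, hi, rfl⟩ := hx
    exact step i hi y ih
  | inv_mul_cancel x hx y _ ih =>
    obtain ⟨i, hi, rfl⟩ := hx
    rw [inv_eq_of_mul_eq_one_left (hsq i hi)]
    exact step i hi y ih

theorem ascProd_map {H : Type*} [Group H] (f : G →* H) (s : ℕ → G) :
    ∀ d j, f (ascProd s j d) = ascProd (fun i => f (s i)) j d
  | 0, j => by simp [ascProd]
  | d + 1, j => by simp [ascProd, ascProd_map f s d (j + 1)]

/-- The image of the last letter recovers the starting index, so the permutation identifies the
coset representative. -/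
theorem ascProd_swap_apply : ∀ d j,
    ascProd (fun i => Equiv.swap i (i + 1)) j d (j + d) = j
  | 0, j => by simp [ascProd]
  | d + 1, j => by
    rw [ascProd, Equiv.Perm.mul_apply, show j + (d + 1) = j + 1 + d by omega,
      ascProd_swap_apply d (j + 1), Equiv.swap_apply_right]

/-- The Coxeter relations of type `A_{n-1}` present the symmetric group. -/
theorem coxeter_faithful (s : ℕ → G) : ∀ (n : ℕ) (_ : ∀ i, i + 1 < n → s i * s i = 1)
    (_ : ∀ i, i + 2 < n → s (i + 1) * s i * s (i + 1) = s i * s (i + 1) * s i)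
    (_ : ∀ i j, i + 1 < j → j + 1 < n → s i * s j = s j * s i) (x : G × Equiv.Perm ℕ)
    (_ : x ∈ Subgroup.closure {g | ∃ i, i + 1 < n ∧ g = (s i, Equiv.swap i (i + 1))}),
    x.2 = 1 → x = 1
  | 0, _, _, _, x, hx, _ => by simpa using hx
  | n + 1, hsq, hb, hf, x, hx, h1 => by
    -- Writing the element as `ascProd` times `y`, with `y` in the smaller subgroup, its permutation
    -- sends `n` to `j`, because `y` fixes `n`. A trivial permutation thus forces `j = n`; the
    -- element is then `y` itself and induction applies.
    have hfix : ∀ y ∈ Subgroup.closure {g | ∃ i, i + 1 < n ∧ g = (s i, Equiv.swap i (i + 1))},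
        y.2 n = n := by
      intro y hy
      induction hy using Subgroup.closure_induction with
      | mem x hx =>
        obtain ⟨i, hi, rfl⟩ := hx
        exact Equiv.swap_apply_of_ne_of_ne (by omega) (by omega)
      | one => rfl
      | mul x y _ _ hx hy => simp [hx, hy]
      | inv x _ hx => simpa using (Equiv.Perm.inv_eq_iff_eq.2 hx.symm)
    obtain ⟨j, hj, y, hy, rfl⟩ := exists_ascProd_mul
      (fun i => ((s i, Equiv.swap i (i + 1)) : G × Equiv.Perm ℕ)) n
      (fun i hi => by simp [hsq i (by omega), Prod.ext_iff])
      (fun i hi => by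
        ext1
        · exact hb i (by omega)
        · have e1 := Equiv.swap_mul_swap_mul_swap (x := i) (y := i + 1) (z := i + 1 + 1)
            (by omega) (by omega)
          have e2 := Equiv.swap_mul_swap_mul_swap (x := i + 1 + 1) (y := i + 1) (z := i)
            (by omega) (by omega)
          rw [Equiv.swap_comm (i + 1) i, Equiv.swap_comm (i + 1 + 1) (i + 1)] at e2
          exact e1.trans ((Equiv.swap_comm _ _).trans e2.symm))
      (fun i j hij hj => by
        ext1
        · exact hf i j hij (by omega)
        · refine (Equiv.Perm.disjoint_swap_swap ?_).commute.eq
          simp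
          omega)
      x (by simpa using hx)
    have h2 := congrArg (fun f => f n) h1
    have h3 : (ascProd (fun i => ((s i, Equiv.swap i (i + 1)) : G × Equiv.Perm ℕ)) j (n - j)).2
        = ascProd (fun i => Equiv.swap i (i + 1)) j (n - j) :=
      ascProd_map (MonoidHom.snd G (Equiv.Perm ℕ)) _ _ _
    have h4 := ascProd_swap_apply (n - j) j
    rw [Nat.add_sub_of_le hj] at h4
    simp only [Prod.snd_mul, Equiv.Perm.mul_apply, hfix y hy, h3, h4, Equiv.Perm.one_apply] at h2
    subst h2
    rw [Nat.sub_self, ascProd, one_mul] at h1 ⊢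
    exact coxeter_faithful s j (fun i hi => hsq i (by omega)) (fun i hi => hb i (by omega))
      (fun i k h h' => hf i k h (by omega)) y hy h1

end CoxeterWords

/-! ### The double cover `S̃_n → S_n` -/

section SpinCover

variable {n : ℕ}

theorem spinZ_mul_self (n : ℕ) : spinZ n * spinZ n = 1 := by rw [← pow_two, spinZ_sq]

theorem spinZ_inv (n : ℕ) : (spinZ n)⁻¹ = spinZ n := inv_eq_of_mul_eq_one_left (spinZ_mul_self n)

theorem spinZ_comm (x : SpinGroup n) : spinZ n * x = x * spinZ n := by
  have h : ∀ s : SpinGen n, Commute (spinZ n) (PresentedGroup.of s) := by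
    rintro (_ | i)
    · exact Commute.refl _
    · exact spinZ_central i
  have : x ∈ Subgroup.closure (Set.range (PresentedGroup.of (rels := {w | SpinRel n w}))) := by
    rw [PresentedGroup.closure_range_of]; trivial
  induction this using Subgroup.closure_induction with
  | mem x hx => obtain ⟨s, rfl⟩ := hx; exact h s
  | one => simp
  | mul x y _ _ hx hy => exact (Commute.mul_right hx hy : Commute _ _)
  | inv x _ hx => exact (Commute.inv_right hx : Commute _ _)

theorem spinT_inv (i : Fin (n - 1)) : (spinT i)⁻¹ = spinZ n * spinT i := by
  apply inv_eq_of_mul_eq_one_left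
  rw [mul_assoc, ← pow_two, spinT_sq, spinZ_mul_self]

theorem SpinGroup.induction {p : SpinGroup n → Prop} (one : p 1)
    (z : ∀ x, p x → p (spinZ n * x)) (t : ∀ i x, p x → p (spinT i * x)) (x : SpinGroup n) :
    p x := by
  have hx : x ∈ Subgroup.closure (Set.range (PresentedGroup.of (rels := {w | SpinRel n w}))) := by
    rw [PresentedGroup.closure_range_of]; trivial
  induction hx using Subgroup.closure_induction_left with
  | one => exact one
  | mul_left x hx y _ ih =>
    obtain ⟨_ | i, rfl⟩ := hx
    · exact z y ih
    · exact t i y ih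
  | inv_mul_cancel x hx y _ ih =>
    obtain ⟨_ | i, rfl⟩ := hx
    · rw [show PresentedGroup.of SpinGen.z = spinZ n from rfl, spinZ_inv]
      exact z y ih
    · rw [show PresentedGroup.of (SpinGen.t i) = spinT i from rfl, spinT_inv, mul_assoc]
      exact z _ (t i y ih)

theorem SpinGroup.lift_spinZ {G : Type*} [Group G] (ζ : G) (τ : Fin (n - 1) → G) (hz ht hb hf hc) :
    SpinGroup.lift ζ τ hz ht hb hf hc (spinZ n) = ζ := by
  unfold SpinGroup.lift
  exact PresentedGroup.toGroup.of ..

theorem SpinGroup.lift_spinT {G : Type*} [Group G] (ζ : G) (τ : Fin (n - 1) → G) (hz ht hb hf hc)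
    (i : Fin (n - 1)) : SpinGroup.lift ζ τ hz ht hb hf hc (spinT i) = τ i := by
  unfold SpinGroup.lift
  exact PresentedGroup.toGroup.of ..

@[simp] theorem spinPerm_spinZ : spinPerm n (spinZ n) = 1 := SpinGroup.lift_spinZ ..

@[simp] theorem spinPerm_spinT (i : Fin (n - 1)) :
    spinPerm n (spinT i) = Equiv.swap ⟨i, by omega⟩ ⟨i + 1, by omega⟩ :=
  SpinGroup.lift_spinT ..

@[simp] theorem spinParity_spinZ : spinParity n (spinZ n) = 1 := SpinGroup.lift_spinZ ..

@[simp] theorem spinParity_spinT (i : Fin (n - 1)) : spinParity n (spinT i) = -1 :=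
  SpinGroup.lift_spinT ..

@[simp] theorem spinShift_spinZ (k a m : ℕ) (h : k + a ≤ m) :
    spinShift k a m h (spinZ a) = spinZ m := SpinGroup.lift_spinZ ..

@[simp] theorem spinShift_spinT (k a m : ℕ) (h : k + a ≤ m) (i : Fin (a - 1)) :
    spinShift k a m h (spinT i) = spinT ⟨k + i, by omega⟩ := SpinGroup.lift_spinT ..

@[simp] theorem basicSpin_spinZ : basicSpin n (spinZ n) = -1 := SpinGroup.lift_spinZ ..

@[simp] theorem basicSpin_spinT (i : Fin (n - 1)) : basicSpin n (spinT i) = spinUnitT n i :=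
  SpinGroup.lift_spinT ..

/-- The basic spin supermodule is nonzero and `z` acts on it by `-1`. -/
theorem spinZ_ne_one (n : ℕ) : spinZ n ≠ 1 := by
  intro h
  have h1 := congrArg (fun x => ((basicSpin n x).val : Matrix _ _ ℂ) (fun _ => 0) (fun _ => 0)) h
  simp only [basicSpin_spinZ, map_one, Units.val_neg, Units.val_one, Matrix.neg_apply,
    Matrix.one_apply_eq] at h1
  norm_num at h1

theorem spinParity_eq_sign (x : SpinGroup n) : spinParity n x = (spinPerm n x).sign := by
  induction x using SpinGroup.induction with
  | one => simp
  | z x ih => simp [ih]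
  | t i x ih => simp [ih]

instance zpowers_spinZ_normal : (Subgroup.zpowers (spinZ n)).Normal := by
  constructor
  intro x hx g
  obtain ⟨k, rfl⟩ := hx
  have : Commute g (spinZ n ^ k) := (show Commute g (spinZ n) from (spinZ_comm g).symm).zpow_right k
  rw [this.eq, mul_inv_cancel_right]
  exact ⟨k, rfl⟩

theorem mem_zpowers_spinZ {x : SpinGroup n} (hx : x ∈ Subgroup.zpowers (spinZ n)) :
    x = 1 ∨ x = spinZ n := by
  obtain ⟨k, rfl⟩ := hx
  have h2 : spinZ n ^ (2 : ℤ) = 1 := by exact_mod_cast spinZ_sq n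
  rcases Int.even_or_odd' k with ⟨m, rfl | rfl⟩
  · left; simp only [zpow_mul, h2, one_zpow]
  · right; simp only [zpow_add, zpow_mul, h2, one_zpow, one_mul, zpow_one]

/-- Modulo `z` the generators satisfy the Coxeter relations of type `A`, and `coxeter_faithful` says
that these present the symmetric group. The kernel of the projection is therefore generated by `z`.
-/
theorem spinPerm_eq_one {x : SpinGroup n} (hx : spinPerm n x = 1) : x = 1 ∨ x = spinZ n := by
  apply mem_zpowers_spinZ
  rw [← QuotientGroup.eq_one_iff]
  let π : SpinGroup n →* SpinGroup n ⧸ Subgroup.zpowers (spinZ n) := QuotientGroup.mk' _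
  let s : ℕ → SpinGroup n ⧸ Subgroup.zpowers (spinZ n) :=
    fun i => if h : i < n - 1 then π (spinT ⟨i, h⟩) else 1
  have hs : ∀ i (h : i + 1 < n), s i = π (spinT ⟨i, by omega⟩) := fun i h => dif_pos (by omega)
  have hz : π (spinZ n) = 1 :=
    (QuotientGroup.eq_one_iff _).2 (Subgroup.mem_zpowers _)
  have hsq : ∀ i, i + 1 < n → s i * s i = 1 := by
    intro i hi
    rw [hs i hi, ← map_mul, ← pow_two, spinT_sq, hz]
  let e : Fin n ≃ {i // i < n} := Fin.equivSubtype
  let ψ : SpinGroup n →* Equiv.Perm ℕ := (Equiv.Perm.extendDomainHom e).comp (spinPerm n)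
  have hψ : ∀ i : Fin (n - 1), ψ (spinT i) = Equiv.swap (i : ℕ) (i + 1) := by
    intro i
    simp only [ψ, MonoidHom.comp_apply, spinPerm_spinT, Equiv.Perm.extendDomainHom_apply]
    ext k
    by_cases hk : k < n
    · have := Equiv.Perm.extendDomain_apply_image
        (Equiv.swap (⟨i, by omega⟩ : Fin n) ⟨i + 1, by omega⟩) e ⟨k, hk⟩
      rw [show ((e ⟨k, hk⟩ : {i // i < n}) : ℕ) = k from rfl] at this
      rw [this]
      simp only [Equiv.swap_apply_def, Fin.mk.injEq]
      split_ifs <;> rfl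
    · rw [Equiv.Perm.extendDomain_apply_not_subtype (p := fun i => i < n) _ _ hk,
        Equiv.swap_apply_of_ne_of_ne (by omega) (by omega)]
  have hmem : ∀ y : SpinGroup n, ((π y, ψ y) : _ × Equiv.Perm ℕ) ∈
      Subgroup.closure {g | ∃ i, i + 1 < n ∧ g = (s i, Equiv.swap i (i + 1))} := by
    intro y
    induction y using SpinGroup.induction with
    | one => rw [map_one, map_one]; exact one_mem _
    | z y ih =>
      have : ψ (spinZ n) = 1 := by simp [ψ]
      simpa [hz, this] using ih
    | t i y ih =>
      have := mul_mem (Subgroup.subset_closure (show (s i, Equiv.swap (i : ℕ) (i + 1)) ∈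
        {g | ∃ i, i + 1 < n ∧ g = (s i, Equiv.swap i (i + 1))} from ⟨(i : ℕ), by omega, rfl⟩)) ih
      rw [hs _ (by omega), ← hψ i] at this
      simpa using this
  have := coxeter_faithful s n hsq
    (fun i hi => by
      rw [hs i (by omega), hs (i + 1) (by omega)]
      have hb := congrArg π (spinT_braid (n := n) ⟨i, by omega⟩ ⟨i + 1, by omega⟩ rfl)
      have h1 := hsq i (by omega)
      have h2 := hsq (i + 1) (by omega)
      rw [hs i (by omega)] at h1
      rw [hs (i + 1) (by omega)] at h2
      rw [hz, map_pow, map_mul] at hb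
      generalize π (spinT ⟨i, _⟩) = a at *
      generalize π (spinT ⟨i + 1, _⟩) = b at *
      -- For involutions, `(ab)³ = 1` is the braid relation: `aba` and `bab` are both inverse to
      -- `bab`.
      have h3 : (a * b * a) * (b * a * b) = 1 := by
        rw [← hb]; simp only [pow_succ, pow_zero, one_mul, mul_assoc]
      have h4 : (b * a * b) * (b * a * b) = 1 := by
        calc (b * a * b) * (b * a * b) = b * a * (b * b) * a * b := by simp only [mul_assoc]
          _ = 1 := by rw [h2, mul_one, mul_assoc b, h1, mul_one, h2]
      exact (mul_right_cancel (h3.trans h4.symm)).symm)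
    (fun i j hij hj => by
      rw [hs i (by omega), hs j (by omega)]
      have := congrArg π (spinT_far (n := n) ⟨j, by omega⟩ ⟨i, by omega⟩ hij)
      simpa [hz] using this.symm)
    (π x, ψ x) (hmem x) (by simp [ψ, hx])
  exact (Prod.ext_iff.1 this).1

theorem spinPerm_eq_iff {x y : SpinGroup n} :
    spinPerm n x = spinPerm n y ↔ x = y ∨ x = spinZ n * y := by
  constructor
  · intro h
    have : spinPerm n (x * y⁻¹) = 1 := by rw [map_mul, map_inv, h, mul_inv_cancel]
    rcases spinPerm_eq_one this with h | h
    · left; exact mul_inv_eq_one.1 h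
    · right; exact mul_inv_eq_iff_eq_mul.1 h
  · rintro (rfl | rfl) <;> simp

theorem spinPerm_surjective (n : ℕ) : Function.Surjective (spinPerm n) := by
  rcases n with _ | n
  · intro x; exact ⟨1, Subsingleton.elim _ _⟩
  intro x
  have hx : x ∈ Submonoid.closure (Set.range fun i : Fin n ↦ Equiv.swap i.castSucc i.succ) := by
    rw [Equiv.Perm.mclosure_swap_castSucc_succ]; trivial
  induction hx using Submonoid.closure_induction with
  | mem x hx => obtain ⟨i, rfl⟩ := hx; exact ⟨spinT i, spinPerm_spinT (n := n + 1) i⟩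
  | one => exact ⟨1, map_one _⟩
  | mul x y _ _ hx hy =>
    obtain ⟨u, rfl⟩ := hx
    obtain ⟨v, rfl⟩ := hy
    exact ⟨u * v, map_mul _ _ _⟩

theorem spinZ_mul_ne (x : SpinGroup n) : spinZ n * x ≠ x := by
  intro h
  exact spinZ_ne_one n (mul_eq_right.1 h)

end SpinCover

/-! ### Blocks of letters -/

section Shift

theorem spinParity_spinShift (k a m : ℕ) (h : k + a ≤ m) (x : SpinGroup a) :
    spinParity m (spinShift k a m h x) = spinParity a x := by
  induction x using SpinGroup.induction with
  | one => simp
  | z x ih => simp [ih]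
  | t i x ih => simp [ih]

theorem spinPerm_spinShift (k a m : ℕ) (h : k + a ≤ m) (x : SpinGroup a) (i : Fin a) :
    spinPerm m (spinShift k a m h x) ⟨k + i, by omega⟩ = ⟨k + spinPerm a x i, by omega⟩ := by
  induction x using SpinGroup.induction with
  | one => simp
  | z x ih => simpa using ih
  | t j x ih =>
    apply Fin.ext
    rw [map_mul, map_mul, Equiv.Perm.mul_apply, ih]
    simp only [map_mul, Equiv.Perm.mul_apply]
    have : ∀ l : Fin a, (spinPerm m (spinShift k a m h (spinT j)) ⟨k + l, by omega⟩ : ℕ) =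
        k + spinPerm a (spinT j) l := by
      intro l
      simp only [spinShift_spinT, spinPerm_spinT, Equiv.swap_apply_def, Fin.ext_iff]
      split_ifs <;> simp only [] <;> omega
    exact this _

theorem spinPerm_spinShift_of_notMem (k a m : ℕ) (h : k + a ≤ m) (x : SpinGroup a) (i : Fin m)
    (hi : (i : ℕ) < k ∨ k + a ≤ i) : spinPerm m (spinShift k a m h x) i = i := by
  induction x using SpinGroup.induction with
  | one => simp
  | z x ih => simpa using ih
  | t j x ih =>
    rw [map_mul, map_mul, Equiv.Perm.mul_apply, ih, spinShift_spinT, spinPerm_spinT]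
    apply Equiv.swap_apply_of_ne_of_ne <;> simp only [ne_eq, Fin.ext_iff] <;> omega

/-- `z` if both parities are odd, and `1` otherwise. -/
def spinSign (m : ℕ) (u v : ℤˣ) : SpinGroup m := if u = -1 ∧ v = -1 then spinZ m else 1

/-- Generators of different blocks have indices at least two apart, so each interchange costs one
factor `z`. The number of interchanges is the product of the word lengths, hence odd exactly when
both elements are odd. -/
theorem spinShift_comm (a b m : ℕ) (h : 0 + a ≤ m) (h' : a + b ≤ m) (x : SpinGroup a)
    (y : SpinGroup b) :
    spinShift 0 a m h x * spinShift a b m h' y =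
      spinSign m (spinParity a x) (spinParity b y) *
        (spinShift a b m h' y * spinShift 0 a m h x) := by
  have hz := spinZ_mul_self m
  have hc := spinZ_comm (n := m)
  have hgen : ∀ i : Fin (a - 1), spinT (⟨0 + i, by omega⟩ : Fin (m - 1)) * spinShift a b m h' y =
      spinSign m (-1) (spinParity b y) *
        (spinShift a b m h' y * spinT ⟨0 + i, by omega⟩) := by
    intro i
    induction y using SpinGroup.induction with
    | one => simp [spinSign]
    | z y ih =>
      simp only [map_mul, spinShift_spinZ, spinParity_spinZ, one_mul]
      rw [← mul_assoc, ← hc, mul_assoc, ih, ← mul_assoc, hc, mul_assoc, mul_assoc]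
    | t j y ih =>
      have far := spinT_far (n := m) ⟨a + j, by omega⟩ ⟨0 + i, by omega⟩ (by simp only; omega)
      simp only [map_mul, spinShift_spinT, spinParity_spinT]
      have far' : spinT (⟨0 + i, by omega⟩ : Fin (m - 1)) * spinT ⟨a + j, by omega⟩ =
          spinZ m * (spinT ⟨a + j, by omega⟩ * spinT ⟨0 + i, by omega⟩) := by
        rw [far, ← mul_assoc, ← mul_assoc, hz, one_mul]
      rw [← mul_assoc, far', mul_assoc, mul_assoc, ih]
      rcases Int.units_eq_one_or (spinParity b y) with hy | hy <;>
        simp [hy, spinSign, mul_assoc]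
      rw [← mul_assoc (spinT _) (spinZ m), ← hc, mul_assoc, ← mul_assoc, hz, one_mul]
  induction x using SpinGroup.induction with
  | one => simp [spinSign]
  | z x ih =>
    simp only [map_mul, spinShift_spinZ, spinParity_spinZ, one_mul]
    rw [mul_assoc, ih, ← mul_assoc, hc, mul_assoc, ← mul_assoc (spinZ m), hc, mul_assoc]
  | t i x ih =>
    simp only [map_mul, spinShift_spinT, spinParity_spinT]
    rw [mul_assoc, ih, ← mul_assoc]
    have : spinT (⟨0 + i, by omega⟩ : Fin (m - 1)) * spinSign m (spinParity a x) (spinParity b y) =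
      spinSign m (spinParity a x) (spinParity b y) * spinT ⟨0 + i, by omega⟩ := by
      unfold spinSign; split_ifs
      · exact (hc _).symm
      · simp
    rw [this, mul_assoc, ← mul_assoc (spinT _), hgen i]
    rcases Int.units_eq_one_or (spinParity b y) with hy | hy <;>
      rcases Int.units_eq_one_or (spinParity a x) with hx | hx <;>
        simp [hy, hx, spinSign, mul_assoc]
    rw [← mul_assoc, hz, one_mul]

end Shift

/-! ### Elements of the wreath product supported on blocks of letters. -/

section Blocks

variable {Γ : Type*} [Group Γ] {n : ℕ}

/-- The underlying permutation of an element of `Γ̃_n`. -/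
def wreathPerm : Wreath Γ n →* Equiv.Perm (Fin n) :=
  (spinPerm n).comp SemidirectProduct.rightHom

/-- The parity of an element of `Γ̃_n`. -/
def wreathParity : Wreath Γ n →* ℤˣ := (spinParity n).comp SemidirectProduct.rightHom

theorem wreathPerm_apply (x : Wreath Γ n) : wreathPerm x = spinPerm n x.right := rfl

theorem wreathParity_apply (x : Wreath Γ n) : wreathParity x = spinParity n x.right := rfl

theorem wreathParity_eq_sign (x : Wreath Γ n) : wreathParity x = (wreathPerm x).sign :=
  spinParity_eq_sign _

theorem Wreath.mul_left_apply (x y : Wreath Γ n) (i : Fin n) :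
    (x * y).left i = x.left i * y.left ((wreathPerm x)⁻¹ i) := rfl

theorem Wreath.ext {x y : Wreath Γ n} (h1 : ∀ i, x.left i = y.left i) (h2 : x.right = y.right) :
    x = y := SemidirectProduct.ext (funext h1) h2

theorem Wreath.one_left_apply (i : Fin n) : (1 : Wreath Γ n).left i = 1 := rfl

@[simp] theorem wreathPerm_wreathZ : wreathPerm (wreathZ Γ n) = 1 := spinPerm_spinZ

theorem wreathZ_mul_left (x : Wreath Γ n) (i : Fin n) : (wreathZ Γ n * x).left i = x.left i := by
  rw [Wreath.mul_left_apply, wreathPerm_wreathZ]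
  exact one_mul _

theorem wreathZ_mul_self : wreathZ Γ n * wreathZ Γ n = 1 :=
  Wreath.ext (fun i => by rw [wreathZ_mul_left]; rfl) (spinZ_mul_self n)

theorem wreathZ_mul_wreathZ_mul (x : Wreath Γ n) : wreathZ Γ n * (wreathZ Γ n * x) = x := by
  rw [← mul_assoc, wreathZ_mul_self, one_mul]

theorem wreathZ_comm (x : Wreath Γ n) : wreathZ Γ n * x = x * wreathZ Γ n := by
  refine Wreath.ext (fun i => ?_) (spinZ_comm _)
  rw [wreathZ_mul_left, Wreath.mul_left_apply]
  exact (mul_one _).symm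

theorem wreathZ_inv : (wreathZ Γ n)⁻¹ = wreathZ Γ n :=
  inv_eq_of_mul_eq_one_left wreathZ_mul_self

theorem wreathZ_mul_ne (x : Wreath Γ n) : wreathZ Γ n * x ≠ x := fun h =>
  spinZ_mul_ne x.right (congrArg SemidirectProduct.right h)

theorem eq_or_eq_wreathZ_mul {x y : Wreath Γ n} (h1 : ∀ i, x.left i = y.left i)
    (h2 : wreathPerm x = wreathPerm y) : x = y ∨ x = wreathZ Γ n * y := by
  rcases spinPerm_eq_iff.1 h2 with h | h
  · exact Or.inl (Wreath.ext h1 h)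
  · exact Or.inr (Wreath.ext (fun i => by rw [h1, wreathZ_mul_left]) h)

theorem exists_wreath (g : Fin n → Γ) (σ : Equiv.Perm (Fin n)) :
    ∃ x : Wreath Γ n, x.left = g ∧ wreathPerm x = σ := by
  obtain ⟨s, rfl⟩ := spinPerm_surjective n σ
  exact ⟨⟨g, s⟩, rfl, rfl⟩

/-- An element is determined by its permutation and by whether it is the chosen lift of that
permutation. -/
instance spinGroup_finite (n : ℕ) : Finite (SpinGroup n) := by
  classical
  let s := Function.surjInv (spinPerm_surjective n)
  have hs : ∀ σ, spinPerm n (s σ) = σ := Function.surjInv_eq _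
  refine Finite.of_injective (β := Equiv.Perm (Fin n) × Prop)
    (fun x => (spinPerm n x, x = s (spinPerm n x))) fun x y h => ?_
  obtain ⟨h1, h2⟩ := Prod.ext_iff.1 h
  simp only at h1 h2
  by_cases hx : x = s (spinPerm n x)
  · rw [hx, h1, ← (h2 ▸ hx : y = s (spinPerm n y))]
  · have hy : ¬ y = s (spinPerm n y) := h2 ▸ hx
    rw [(spinPerm_eq_iff.1 (hs (spinPerm n x)).symm).resolve_left hx,
      (spinPerm_eq_iff.1 (hs (spinPerm n y)).symm).resolve_left hy, h1]

instance wreath_finite [Finite Γ] (n : ℕ) : Finite (Wreath Γ n) :=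
  Finite.of_equiv _ SemidirectProduct.equivProd.symm

noncomputable instance wreathFintype [Finite Γ] (n : ℕ) : Fintype (Wreath Γ n) :=
  Fintype.ofFinite _

variable {a b m : ℕ}

theorem wreathPerm_place (k : ℕ) (h : k + a ≤ m) (x : Wreath Γ a) (i : Fin a) :
    wreathPerm (place k h x) ⟨k + i, by omega⟩ = ⟨k + wreathPerm x i, by omega⟩ :=
  spinPerm_spinShift k a m h x.right i

theorem wreathPerm_place_of_notMem (k : ℕ) (h : k + a ≤ m) (x : Wreath Γ a) (i : Fin m)
    (hi : (i : ℕ) < k ∨ k + a ≤ i) : wreathPerm (place k h x) i = i :=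
  spinPerm_spinShift_of_notMem k a m h x.right i hi

theorem place_left (k : ℕ) (h : k + a ≤ m) (x : Wreath Γ a) (i : Fin a) :
    (place k h x).left ⟨k + i, by omega⟩ = x.left i := by
  simp only [place]
  rw [dif_pos (by omega)]
  exact congrArg x.left (Fin.ext (by simp))

theorem place_left_of_notMem (k : ℕ) (h : k + a ≤ m) (x : Wreath Γ a) (i : Fin m)
    (hi : (i : ℕ) < k ∨ k + a ≤ i) : (place k h x).left i = 1 := by
  simp only [place]
  rw [dif_neg (by omega)]

theorem wreathParity_place (k : ℕ) (h : k + a ≤ m) (x : Wreath Γ a) :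
    wreathParity (place k h x) = wreathParity x :=
  spinParity_spinShift k a m h x.right

theorem fin_block_cases (k : ℕ) (h : k + a ≤ m) (i : Fin m) :
    (∃ j : Fin a, i = ⟨k + j, by omega⟩) ∨ ((i : ℕ) < k ∨ k + a ≤ i) := by
  by_cases hi : (i : ℕ) < k ∨ k + a ≤ i
  · exact Or.inr hi
  · exact Or.inl ⟨⟨i - k, by omega⟩, Fin.ext (by simp only; omega)⟩

theorem place_mul (k : ℕ) (h : k + a ≤ m) (x y : Wreath Γ a) :
    place k h (x * y) = place k h x * place k h y := by
  refine Wreath.ext (fun i => ?_) (map_mul _ _ _)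
  rw [Wreath.mul_left_apply]
  rcases fin_block_cases k h i with ⟨j, rfl⟩ | hi
  · have : (wreathPerm (place k h x))⁻¹ ⟨k + j, by omega⟩ =
        ⟨k + ((wreathPerm x)⁻¹ j : Fin a), by omega⟩ := by
      rw [Equiv.Perm.inv_eq_iff_eq, wreathPerm_place]
      simp
    rw [this, place_left, place_left, place_left, Wreath.mul_left_apply]
  · have : (wreathPerm (place k h x))⁻¹ i = i := by
      rw [Equiv.Perm.inv_eq_iff_eq, wreathPerm_place_of_notMem _ _ _ _ hi]
    rw [this, place_left_of_notMem _ _ _ _ hi, place_left_of_notMem _ _ _ _ hi,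
      place_left_of_notMem _ _ _ _ hi, one_mul]

/-- `place` as a group homomorphism. -/
def placeHom (k : ℕ) (h : k + a ≤ m) : Wreath Γ a →* Wreath Γ m :=
  MonoidHom.mk' (place k h) (place_mul k h)

theorem place_wreathZ (k : ℕ) (h : k + a ≤ m) : place k h (wreathZ Γ a) = wreathZ Γ m := by
  refine Wreath.ext (fun i => ?_) (spinShift_spinZ ..)
  rcases fin_block_cases k h i with ⟨j, rfl⟩ | hi
  · rw [place_left]; rfl
  · rw [place_left_of_notMem _ _ _ _ hi]; rfl

theorem inv_eq_self_of_eq {σ : Equiv.Perm (Fin m)} {i : Fin m} (h : σ i = i) : σ⁻¹ i = i := by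
  rw [Equiv.Perm.inv_eq_iff_eq, h]

theorem place_comm (h : 0 + a ≤ m) (h' : a + b ≤ m) (x : Wreath Γ a) (y : Wreath Γ b) :
    place 0 h x * place a h' y =
      (if wreathParity x = -1 ∧ wreathParity y = -1 then wreathZ Γ m else 1) *
        (place a h' y * place 0 h x) := by
  have hr := spinShift_comm a b m h h' x.right y.right
  have hl : ∀ i, (place 0 h x * place a h' y).left i = (place a h' y * place 0 h x).left i := by
    intro i
    rw [Wreath.mul_left_apply, Wreath.mul_left_apply]
    rcases fin_block_cases 0 h i with ⟨j, rfl⟩ | hi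
    · rw [inv_eq_self_of_eq (wreathPerm_place_of_notMem a h' y ⟨0 + j, by omega⟩ (by simp only; omega)),
        place_left_of_notMem a h' y ⟨0 + j, by omega⟩ (by simp only; omega), one_mul]
      have : (wreathPerm (place 0 h x))⁻¹ ⟨0 + j, by omega⟩ =
          ⟨0 + ((wreathPerm x)⁻¹ j : Fin a), by omega⟩ := by
        rw [Equiv.Perm.inv_eq_iff_eq, wreathPerm_place]
        simp
      rw [this, place_left_of_notMem a h' y ⟨0 + ((wreathPerm x)⁻¹ j : Fin a), by omega⟩
        (by simp only; omega), mul_one]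
    · rw [inv_eq_self_of_eq (wreathPerm_place_of_notMem 0 h x i hi),
        place_left_of_notMem 0 h x i hi, one_mul]
      have : (place 0 h x).left ((wreathPerm (place a h' y))⁻¹ i) = 1 := by
        apply place_left_of_notMem
        right
        by_contra hc
        have := wreathPerm_place_of_notMem a h' y ((wreathPerm (place a h' y))⁻¹ i) (by omega)
        rw [← Equiv.Perm.mul_apply, mul_inv_cancel, Equiv.Perm.one_apply] at this
        rw [← this] at hc
        omega
      rw [this, mul_one]
  refine Wreath.ext (fun i => ?_) ?_
  · rw [hl]
    split_ifs
    · rw [wreathZ_mul_left]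
    · rw [one_mul]
  · refine hr.trans ?_
    by_cases hc : wreathParity x = -1 ∧ wreathParity y = -1
    · rw [if_pos hc, spinSign]
      exact congrArg (· * _) (if_pos hc)
    · rw [if_neg hc, spinSign]
      exact congrArg (· * _) (if_neg hc)

theorem spinMul_left₁ (h : a + b = m) (x : Wreath Γ a) (y : Wreath Γ b) (i : Fin a) :
    (spinMul h (x, y)).left ⟨i, by omega⟩ = x.left i := by
  have e : (⟨i, by omega⟩ : Fin m) = ⟨0 + i, by omega⟩ := Fin.ext (by simp)
  have : (wreathPerm (place 0 (by omega : 0 + a ≤ m) x))⁻¹ ⟨0 + i, by omega⟩ =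
      ⟨0 + ((wreathPerm x)⁻¹ i : Fin a), by omega⟩ := by
    rw [Equiv.Perm.inv_eq_iff_eq, wreathPerm_place]
    simp
  rw [spinMul, e, Wreath.mul_left_apply, place_left, this]
  rw [place_left_of_notMem a _ y ⟨0 + ((wreathPerm x)⁻¹ i : Fin a), by omega⟩
    (by simp only; omega), mul_one]

theorem spinMul_left₂ (h : a + b = m) (x : Wreath Γ a) (y : Wreath Γ b) (i : Fin b) :
    (spinMul h (x, y)).left ⟨a + i, by omega⟩ = y.left i := by
  rw [spinMul, Wreath.mul_left_apply, inv_eq_self_of_eq (wreathPerm_place_of_notMem 0 _ x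
    ⟨a + i, by omega⟩ (by simp only; omega)), place_left_of_notMem 0 _ x ⟨a + i, by omega⟩
    (by simp only; omega), one_mul, place_left]

theorem wreathPerm_spinMul₁ (h : a + b = m) (x : Wreath Γ a) (y : Wreath Γ b) (i : Fin a) :
    wreathPerm (spinMul h (x, y)) ⟨i, by omega⟩ = ⟨wreathPerm x i, by omega⟩ := by
  have e : ∀ i : Fin a, (⟨i, by omega⟩ : Fin m) = ⟨0 + i, by omega⟩ := fun i => Fin.ext (by simp)
  rw [spinMul, map_mul, Equiv.Perm.mul_apply, wreathPerm_place_of_notMem a _ y ⟨i, by omega⟩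
    (by simp only; omega), e, wreathPerm_place, e]

theorem wreathPerm_spinMul₂ (h : a + b = m) (x : Wreath Γ a) (y : Wreath Γ b) (i : Fin b) :
    wreathPerm (spinMul h (x, y)) ⟨a + i, by omega⟩ = ⟨a + wreathPerm y i, by omega⟩ := by
  rw [spinMul, map_mul, Equiv.Perm.mul_apply, wreathPerm_place,
    wreathPerm_place_of_notMem 0 _ x ⟨a + wreathPerm y i, by omega⟩ (by simp only; omega)]

theorem wreathParity_spinMul (h : a + b = m) (x : Wreath Γ a) (y : Wreath Γ b) :
    wreathParity (spinMul h (x, y)) = wreathParity x * wreathParity y := by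
  rw [spinMul, map_mul, wreathParity_place, wreathParity_place]

theorem spinMul_wreathZ_left (h : a + b = m) (x : Wreath Γ a) (y : Wreath Γ b) :
    spinMul h (wreathZ Γ a * x, y) = wreathZ Γ m * spinMul h (x, y) := by
  rw [spinMul, place_mul, place_wreathZ, mul_assoc]; rfl

theorem spinMul_wreathZ_right (h : a + b = m) (x : Wreath Γ a) (y : Wreath Γ b) :
    spinMul h (x, wreathZ Γ b * y) = wreathZ Γ m * spinMul h (x, y) := by
  rw [spinMul, place_mul, place_wreathZ, ← mul_assoc, ← wreathZ_comm, mul_assoc]; rfl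

/-- The product of two products of blocks, up to the central involution. -/
theorem spinMul_mul (h : a + b = m) (x x' : Wreath Γ a) (y y' : Wreath Γ b) :
    spinMul h (x, y) * spinMul h (x', y') =
      (if wreathParity x' = -1 ∧ wreathParity y = -1 then wreathZ Γ m else 1) *
        spinMul h (x * x', y * y') := by
  have := place_comm (by omega : 0 + a ≤ m) (by omega : a + b ≤ m) x' y
  have h2 : place a (by omega : a + b ≤ m) y * place 0 (by omega : 0 + a ≤ m) x' =
      (if wreathParity x' = -1 ∧ wreathParity y = -1 then wreathZ Γ m else 1) *
        (place 0 (by omega : 0 + a ≤ m) x' * place a (by omega : a + b ≤ m) y) := by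
    rw [this]
    split_ifs
    · rw [wreathZ_mul_wreathZ_mul]
    · simp
  simp only [spinMul, place_mul]
  generalize place a (by omega : a + b ≤ m) y = Y at *
  generalize place 0 (by omega : 0 + a ≤ m) x' = X' at *
  calc _ = place 0 (by omega : 0 + a ≤ m) x * (Y * X') * place a (by omega : a + b ≤ m) y' := by
        simp only [mul_assoc]
    _ = _ := by
        rw [h2]
        split_ifs
        · rw [← mul_assoc, ← wreathZ_comm]; simp only [mul_assoc]
        · simp only [one_mul, mul_assoc]

theorem spinMul_inv (h : a + b = m) (x : Wreath Γ a) (y : Wreath Γ b) :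
    (spinMul h (x, y))⁻¹ =
      (if wreathParity x = -1 ∧ wreathParity y = -1 then wreathZ Γ m else 1) *
        spinMul h (x⁻¹, y⁻¹) := by
  symm
  apply eq_inv_of_mul_eq_one_left
  rw [mul_assoc, spinMul_mul]
  have h1 : spinMul h ((1 : Wreath Γ a), (1 : Wreath Γ b)) = 1 := by
    rw [spinMul]
    exact (congrArg₂ _ (map_one (placeHom _ _)) (map_one (placeHom _ _))).trans (one_mul 1)
  rw [map_inv, inv_mul_cancel, inv_mul_cancel, h1, mul_one]
  have : ∀ u : ℤˣ, u⁻¹ = u := Int.units_inv_eq_self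
  rw [this]
  split_ifs
  · rw [wreathZ_mul_self]
  · rw [one_mul]

/-- The product shows the base entries and the permutation of each factor, which determines each
factor up to `z`. A change in only one factor would multiply the product by `z`, which fixes no
element. -/
theorem spinMul_eq_spinMul (h : a + b = m) {x x' : Wreath Γ a} {y y' : Wreath Γ b} :
    spinMul h (x, y) = spinMul h (x', y') ↔
      (x = x' ∧ y = y') ∨ (x = wreathZ Γ a * x' ∧ y = wreathZ Γ b * y') := by
  constructor
  · intro H
    have hx : x = x' ∨ x = wreathZ Γ a * x' := by
      refine eq_or_eq_wreathZ_mul (fun i => ?_) (Equiv.ext fun i => ?_)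
      · rw [← spinMul_left₁ h x y, H, spinMul_left₁]
      · have := congrArg (fun w => wreathPerm w ⟨i, by omega⟩) H
        simpa only [wreathPerm_spinMul₁, Fin.mk.injEq, Fin.val_inj] using this
    have hy : y = y' ∨ y = wreathZ Γ b * y' := by
      refine eq_or_eq_wreathZ_mul (fun i => ?_) (Equiv.ext fun i => ?_)
      · rw [← spinMul_left₂ h x y, H, spinMul_left₂]
      · have := congrArg (fun w => wreathPerm w ⟨a + i, by omega⟩) H
        simpa only [wreathPerm_spinMul₂, Fin.mk.injEq, Nat.add_left_cancel_iff, Fin.val_inj]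
          using this
    rcases hx with rfl | rfl <;> rcases hy with rfl | rfl
    · exact Or.inl ⟨rfl, rfl⟩
    · rw [spinMul_wreathZ_right] at H
      exact absurd H (wreathZ_mul_ne _)
    · rw [spinMul_wreathZ_left] at H
      exact absurd H (wreathZ_mul_ne _)
    · exact Or.inr ⟨rfl, rfl⟩
  · rintro (⟨rfl, rfl⟩ | ⟨rfl, rfl⟩)
    · rfl
    · rw [spinMul_wreathZ_left, spinMul_wreathZ_right, wreathZ_mul_wreathZ_mul]

/-- A permutation that maps the first `a` letters into themselves also preserves the remaining ones,
by finiteness. Lifting the two restrictions gives a product of blocks which agrees with `w` up to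
`z`, and `z` can be moved into the first factor. -/
theorem mem_range_spinMul (h : a + b = m) (w : Wreath Γ m) :
    w ∈ Set.range (spinMul (Γ := Γ) h) ↔
      ∀ i : Fin m, (i : ℕ) < a → (wreathPerm w i : ℕ) < a := by
  constructor
  · rintro ⟨⟨x, y⟩, rfl⟩ i hi
    have := wreathPerm_spinMul₁ h x y ⟨i, hi⟩
    simp only [Fin.eta] at this
    rw [this]
    exact (wreathPerm x _).2
  · intro H
    have inj1 : Function.Injective
        (fun i : Fin a => (⟨wreathPerm w ⟨i, by omega⟩, H _ i.2⟩ : Fin a)) := by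
      intro i j hij
      have h3 := (wreathPerm w).injective (Fin.ext (Fin.mk.inj hij))
      exact Fin.ext (Fin.mk.inj h3)
    have bij1 := Finite.injective_iff_bijective.1 inj1
    have H2 : ∀ i : Fin m, a ≤ (i : ℕ) → a ≤ (wreathPerm w i : ℕ) := by
      intro i hi
      by_contra hc
      obtain ⟨j, hj⟩ := bij1.2 ⟨wreathPerm w i, by omega⟩
      simp only [Fin.mk.injEq, Fin.val_inj, EmbeddingLike.apply_eq_iff_eq] at hj
      rw [← hj] at hi
      simp only at hi
      omega
    have inj2 : Function.Injective (fun i : Fin b =>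
        (⟨wreathPerm w ⟨a + i, by omega⟩ - a, by
          have := H2 ⟨a + i, by omega⟩ (by simp)
          omega⟩ : Fin b)) := by
      intro i j hij
      have h1 := H2 ⟨a + i, by omega⟩ (by simp)
      have h2 := H2 ⟨a + j, by omega⟩ (by simp)
      simp only [Fin.mk.injEq] at hij
      have h3 : wreathPerm w ⟨a + i, by omega⟩ = wreathPerm w ⟨a + j, by omega⟩ :=
        Fin.ext (by omega)
      simpa [Fin.ext_iff] using h3
    have bij2 := Finite.injective_iff_bijective.1 inj2
    obtain ⟨x, hx1, hx2⟩ := exists_wreath (fun i : Fin a => w.left ⟨i, by omega⟩)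
      (Equiv.ofBijective _ bij1)
    obtain ⟨y, hy1, hy2⟩ := exists_wreath (fun i : Fin b => w.left ⟨a + i, by omega⟩)
      (Equiv.ofBijective _ bij2)
    have hcase : ∀ i : Fin m, (∃ j : Fin a, i = ⟨j, by omega⟩) ∨
        ∃ j : Fin b, i = ⟨a + j, by omega⟩ := by
      intro i
      by_cases hi : (i : ℕ) < a
      · exact Or.inl ⟨⟨i, hi⟩, rfl⟩
      · exact Or.inr ⟨⟨i - a, by omega⟩, Fin.ext (by simp only; omega)⟩
    have key := eq_or_eq_wreathZ_mul (x := w) (y := spinMul h (x, y)) (fun i => by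
      rcases hcase i with ⟨j, rfl⟩ | ⟨j, rfl⟩
      · rw [spinMul_left₁, hx1]
      · rw [spinMul_left₂, hy1]) (Equiv.ext fun i => by
      rcases hcase i with ⟨j, rfl⟩ | ⟨j, rfl⟩
      · rw [wreathPerm_spinMul₁]
        exact Fin.ext (by simp only [hx2]; rfl)
      · rw [wreathPerm_spinMul₂]
        have := H2 ⟨a + j, by omega⟩ (by simp)
        exact Fin.ext (by simp only [hy2, Equiv.ofBijective_apply]; omega))
    rcases key with key | key
    · exact ⟨(x, y), key.symm⟩
    · exact ⟨(wreathZ Γ a * x, y), by rw [spinMul_wreathZ_left, key]⟩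

/-- An element whose permutation stabilizes a set of `a` letters is conjugate to a product of
blocks. -/
theorem exists_conj_mem_range_spinMul (h : a + b = m) (A : Finset (Fin m)) (hA : A.card = a) :
    ∃ y : Wreath Γ m, ∀ i, i ∈ A ↔ (wreathPerm y i : ℕ) < a := by
  classical
  have hcard : Fintype.card {i // i ∈ A} = Fintype.card {i : Fin m // (i : ℕ) < a} := by
    rw [Fintype.card_coe, hA, Fintype.card_subtype]
    have : (Finset.univ.filter fun i : Fin m => (i : ℕ) < a) =
        Finset.univ.map (Fin.castLEEmb (by omega : a ≤ m)) := by
      ext i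
      simp only [Finset.mem_filter, Finset.mem_univ, true_and, Finset.mem_map]
      constructor
      · intro hi; exact ⟨⟨i, hi⟩, rfl⟩
      · rintro ⟨j, rfl⟩; exact j.2
    rw [this, Finset.card_map, Finset.card_univ, Fintype.card_fin]
  let e := Fintype.equivOfCardEq hcard
  obtain ⟨y, -, hy⟩ := exists_wreath (fun _ => (1 : Γ)) e.extendSubtype
  refine ⟨y, fun i => ?_⟩
  rw [hy]
  constructor
  · intro hi
    exact e.extendSubtype_mem i hi
  · intro hi
    by_contra hc
    exact e.extendSubtype_not_mem i hc hi

end Blocks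

/-! ### The character of the basic spin supermodule -/

section Wick

/-- The anticommutators `t_i t_j + t_j t_i` in the basic spin supermodule. -/
def gram (i j : ℕ) : ℝ := if i = j then -2 else if i + 1 = j ∨ j + 1 = i then 1 else 0

theorem gram_add (s i j : ℕ) : gram (s + i) (s + j) = gram i j := by
  unfold gram
  congr 1
  · simp
  · congr 1
    simp only [eq_iff_iff]
    omega

/-- The normalized trace of a product of generators `t_i` in the basic spin supermodule. -/
noncomputable def wick : List ℕ → ℝ
  | [] => 1
  | i :: L => 1 / 2 * ∑ k : Fin L.length, (-1) ^ (k : ℕ) * gram i (L.getD k 0) *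
      wick (L.eraseIdx k)
termination_by L => L.length
decreasing_by
  have := k.2
  grind

theorem length_eraseIdx_succ {α : Type*} (L : List α) {k : ℕ} (hk : k < L.length) :
    (L.eraseIdx k).length + 1 = L.length := by
  rw [List.length_eraseIdx, if_pos hk]
  omega

theorem wick_nil : wick [] = 1 := by rw [wick]

theorem wick_cons (i : ℕ) (L : List ℕ) : wick (i :: L) =
    1 / 2 * ∑ k ∈ Finset.range L.length,
      (-1) ^ k * gram i (L.getD k 0) * wick (L.eraseIdx k) := by
  rw [wick, Finset.sum_range]

theorem wick_odd : ∀ (n : ℕ) (L : List ℕ), L.length = 2 * n + 1 → wick L = 0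
  | n, [], h => by simp at h
  | 0, [i], _ => by rw [wick_cons]; simp
  | 0, i :: j :: L, h => by simp at h
  | n + 1, i :: L, h => by
    rw [wick_cons, Finset.sum_eq_zero, mul_zero]
    intro k hk
    have := length_eraseIdx_succ L (Finset.mem_range.1 hk)
    rw [wick_odd n (L.eraseIdx k) (by simp only [List.length_cons] at h; omega), mul_zero]

theorem wick_map_add (s : ℕ) : ∀ (n : ℕ) (L : List ℕ), L.length ≤ n →
    wick (L.map (s + ·)) = wick L
  | _, [], _ => rfl
  | 0, i :: L, h => by simp at h
  | n + 1, i :: L, h => by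
    rw [List.map_cons, wick_cons, wick_cons, List.length_map]
    congr 1
    refine Finset.sum_congr rfl fun k hk => ?_
    rw [Finset.mem_range] at hk
    have h2 := length_eraseIdx_succ L hk
    rw [List.length_cons] at h
    rw [← wick_map_add s n (L.eraseIdx k) (by omega), List.eraseIdx_map]
    have : (L.map (s + ·)).getD k 0 = s + L.getD k 0 := by
      simp [hk]
    rw [this, gram_add]

/-- Contractions between the two words vanish, so every letter of `L` is contracted inside `L`. -/
theorem wick_append : ∀ (n : ℕ) (L M : List ℕ), L.length ≤ n →
    (∀ i ∈ L, ∀ j ∈ M, gram i j = 0) → wick (L ++ M) = wick L * wick M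
  | _, [], M, _, _ => by rw [List.nil_append, wick_nil, one_mul]
  | 0, i :: L, _, h, _ => by simp at h
  | n + 1, i :: L, M, h, hg => by
    rw [List.length_cons] at h
    rw [List.cons_append, wick_cons, wick_cons, List.length_append, Finset.sum_range_add,
      Finset.sum_eq_zero (s := Finset.range M.length), add_zero, mul_assoc, Finset.sum_mul]
    · congr 1
      refine Finset.sum_congr rfl fun k hk => ?_
      rw [Finset.mem_range] at hk
      have h2 := length_eraseIdx_succ L hk
      rw [List.eraseIdx_append_of_lt_length hk, List.getD_append _ _ _ _ hk,
        wick_append n (L.eraseIdx k) M (by omega) (fun i hi j hj =>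
          hg i (List.mem_cons_of_mem _ (List.mem_of_mem_eraseIdx hi)) j hj)]
      ring
    · intro k hk
      rw [Finset.mem_range] at hk
      rw [List.getD_append_right _ _ _ _ (by omega), Nat.add_sub_cancel_left,
        hg i List.mem_cons_self, mul_zero, zero_mul]
      rw [List.getD_eq_getElem _ _ hk]
      exact List.getElem_mem _

/-- The first letter contracts only with its right neighbour. This gives a factor `1 / 2` and leaves
a run of the same kind. -/
theorem wick_range' : ∀ (p s : ℕ), wick (List.range' s (2 * p)) = (1 / 2) ^ p
  | 0, s => by simp [wick_nil]
  | p + 1, s => by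
    rw [show 2 * (p + 1) = 2 * p + 1 + 1 by ring, List.range'_succ, List.range'_succ, wick_cons]
    rw [List.length_cons, Finset.sum_range_succ', Finset.sum_eq_zero]
    · simp [gram, wick_range' p, pow_succ']
    · intro k hk
      rw [Finset.mem_range] at hk
      rw [List.getD_cons_succ, List.getD_eq_getElem _ _ hk]
      have : (List.range' (s + 1 + 1) (2 * p))[k] ∈ List.range' (s + 1 + 1) (2 * p) :=
        List.getElem_mem _
      rw [List.mem_range'_1] at this
      have h0 : gram s (List.range' (s + 1 + 1) (2 * p))[k] = 0 := by
        unfold gram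
        rw [if_neg (by omega), if_neg (by omega)]
      rw [h0, mul_zero, zero_mul]

/-- `T i` is moved to the right end one factor at a time; each interchange yields a sign and an
anticommutator. This is the algebraic source of the recursion defining `wick`. -/
theorem mul_prod_of_anticomm {R : Type*} [Ring R] [Algebra ℝ R] (T : ℕ → R) (i : ℕ) :
    ∀ (L : List ℕ) (_ : ∀ l ∈ L, T i * T l + T l * T i = algebraMap ℝ R (gram i l)),
      T i * (L.map T).prod =
        ∑ k ∈ Finset.range L.length, algebraMap ℝ R ((-1) ^ k * gram i (L.getD k 0)) *
          ((L.eraseIdx k).map T).prod + (-1) ^ L.length * ((L.map T).prod * T i)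
  | [], _ => by simp
  | l :: L, h => by
    have ih := mul_prod_of_anticomm T i L (fun l hl => h l (List.mem_cons_of_mem _ hl))
    have h0 := h l List.mem_cons_self
    rw [List.map_cons, List.prod_cons, ← mul_assoc, eq_sub_of_add_eq h0, sub_mul, mul_assoc, ih]
    rw [List.length_cons, Finset.sum_range_succ', mul_add, Finset.mul_sum]
    simp only [pow_zero, one_mul, List.getD_cons_zero, List.eraseIdx_cons_zero,
      List.getD_cons_succ, List.eraseIdx_cons_succ, List.map_cons, List.prod_cons, pow_succ,
      mul_neg, mul_one, neg_mul, map_neg, Finset.sum_neg_distrib]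
    have e1 : ∀ k ∈ Finset.range L.length,
        T l * (algebraMap ℝ R ((-1) ^ k * gram i (L.getD k 0)) * ((L.eraseIdx k).map T).prod) =
          algebraMap ℝ R ((-1) ^ k * gram i (L.getD k 0)) *
            (T l * ((L.eraseIdx k).map T).prod) := by
      intro k _
      rw [← mul_assoc, ← Algebra.commutes, mul_assoc]
    have e2 : T l * ((-1) ^ L.length * ((L.map T).prod * T i)) =
        (-1) ^ L.length * (T l * (L.map T).prod * T i) := by
      rw [← mul_assoc, ← ((Commute.neg_one_left (T l)).pow_left L.length).eq]
      simp only [mul_assoc]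
    rw [Finset.sum_congr rfl e1, e2]
    abel

theorem spinMatT_adjacent (K j : ℕ) (hj : (j + 1) / 2 < K) :
    spinMatT K j * spinMatT K (j + 1) + spinMatT K (j + 1) * spinMatT K j = 1 := by
  have hc : (Real.sqrt (((j : ℝ) + 2) / (2 * ((j : ℝ) + 1))) : ℂ) *
      (Real.sqrt ((((j + 1 : ℕ) : ℝ)) / (2 * (((j + 1 : ℕ) : ℝ) + 1))) : ℂ) = 1 / 2 := by
    rw [← Complex.ofReal_mul, ← Real.sqrt_mul (by positivity)]
    have : ((j : ℝ) + 2) / (2 * ((j : ℝ) + 1)) *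
        ((((j + 1 : ℕ) : ℝ)) / (2 * (((j + 1 : ℕ) : ℝ) + 1))) = (1 / 2) ^ 2 := by
      push_cast
      field_simp
      ring
    rw [this, Real.sqrt_sq (by norm_num)]
    norm_num
  have h1 := clifford_sq K j
  have h2 := clifford_anticomm K j (j + 1) (by omega) (by omega)
  rcases Nat.eq_zero_or_pos j with rfl | h0
  · unfold spinMatT
    simp only [Nat.add_sub_cancel] at *
    generalize (Real.sqrt ((((0 : ℕ) : ℝ) + 2) / (2 * (((0 : ℕ) : ℝ) + 1))) : ℂ) = a at *
    generalize (Real.sqrt ((((0 + 1 : ℕ) : ℝ)) / (2 * (((0 + 1 : ℕ) : ℝ) + 1))) : ℂ) = b at *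
    simp only [Nat.cast_zero, zero_div, Real.sqrt_zero, Complex.ofReal_zero, zero_smul, sub_zero]
    simp only [mul_sub, sub_mul, smul_mul_smul_comm, h1, h2, mul_comm b a, hc,
      mul_comm _ a]
    module
  · have h3 := clifford_anticomm K (j - 1) j (by omega) (by omega)
    have h4 := clifford_anticomm K (j - 1) (j + 1) (by omega) (by omega)
    unfold spinMatT
    simp only [Nat.add_sub_cancel] at *
    generalize (Real.sqrt (((j : ℝ) + 2) / (2 * ((j : ℝ) + 1))) : ℂ) = a at *
    generalize (Real.sqrt ((((j + 1 : ℕ) : ℝ)) / (2 * (((j + 1 : ℕ) : ℝ) + 1))) : ℂ) = b at *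
    generalize (Real.sqrt ((j : ℝ) / (2 * ((j : ℝ) + 1))) : ℂ) = c at *
    generalize (Real.sqrt ((((j + 1 : ℕ) : ℝ) + 2) / (2 * (((j + 1 : ℕ) : ℝ) + 1))) : ℂ) = d
      at *
    simp only [mul_sub, sub_mul, smul_mul_smul_comm, h1, h2, h3, h4, mul_comm b a, hc,
      mul_comm b c, mul_comm d a, mul_comm d c]
    module

theorem spinMatT_anticomm (K i j : ℕ) (hi : i / 2 < K) (hj : j / 2 < K) :
    spinMatT K i * spinMatT K j + spinMatT K j * spinMatT K i =
      algebraMap ℝ (Matrix (Fin K → Fin 2) (Fin K → Fin 2) ℂ) (gram i j) := by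
  unfold gram
  split_ifs with h1 h2
  · subst h1
    rw [spinMatT_sq K i hi, map_neg]
    rw [show (2 : ℝ) = 1 + 1 by norm_num, map_add, map_one]
    abel
  · rcases h2 with rfl | rfl
    · rw [spinMatT_adjacent K i hj, map_one]
    · rw [add_comm, spinMatT_adjacent K j hi, map_one]
  · rw [map_zero]
    rcases lt_or_ge (j + 1) i with h | h
    · rw [spinMatT_far K i j h hi, neg_add_cancel]
    · rw [spinMatT_far K j i (by omega) hj, add_neg_cancel]

/-- For the index `2 * K` all `K` tensor factors are `σ₃`, so `clifford K (2 * K)` is `√-1` times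
the grading operator, with which odd operators anticommute. -/
theorem clifford_spinMatT_anticomm (K j : ℕ) (hj : j / 2 < K) :
    spinMatT K j * clifford K (2 * K) = -(clifford K (2 * K) * spinMatT K j) := by
  have h1 := clifford_anticomm K j (2 * K) (by omega) hj
  have h2 := clifford_anticomm K (j - 1) (2 * K) (by omega) (by omega)
  unfold spinMatT
  simp only [sub_mul, mul_sub, smul_mul_assoc, mul_smul_comm, h1, h2, smul_neg]
  abel

/-- Conjugation by the grading operator preserves the trace and changes the sign of an odd product.
The recursion for the trace gives no information in this case. -/
theorem trace_prod_spinMatT_odd (K : ℕ) (L : List ℕ) (hL : ∀ i ∈ L, i / 2 < K)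
    (hodd : Odd L.length) : ((L.map (spinMatT K)).prod).trace = 0 := by
  have key : ∀ L : List ℕ, (∀ i ∈ L, i / 2 < K) → (L.map (spinMatT K)).prod * clifford K (2 * K) =
      (-1) ^ L.length * (clifford K (2 * K) * (L.map (spinMatT K)).prod) := by
    intro L
    induction L with
    | nil => simp
    | cons i L ih =>
      intro hL
      rw [List.map_cons, List.prod_cons, mul_assoc,
        ih (fun j hj => hL j (List.mem_cons_of_mem _ hj)), List.length_cons, pow_succ]
      rw [← mul_assoc, ← ((Commute.neg_one_left (spinMatT K i)).pow_left L.length).eq]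
      simp only [mul_assoc]
      rw [← mul_assoc (spinMatT K i) (clifford _ _),
        clifford_spinMatT_anticomm K i (hL i List.mem_cons_self)]
      simp [mul_assoc]
  have h := key L hL
  rw [hodd.neg_one_pow] at h
  generalize (L.map (spinMatT K)).prod = P at *
  have hs := clifford_sq K (2 * K)
  have h1 : (clifford K (2 * K) * (P * clifford K (2 * K))).trace = P.trace := by
    rw [h, neg_one_mul, mul_neg, ← mul_assoc, hs, neg_one_mul, neg_neg]
  have h2 : (clifford K (2 * K) * (P * clifford K (2 * K))).trace = -P.trace := by
    rw [Matrix.trace_mul_comm, mul_assoc, hs, mul_neg_one, Matrix.trace_neg]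
  have h3 : P.trace = -P.trace := h1.symm.trans h2
  linear_combination (1 / 2 : ℂ) * h3

/-- If the tail has odd length, cyclicity of the trace makes the last term of `mul_prod_of_anticomm`
equal to minus the left side; this is where the factor `1 / 2` in `wick` comes from. If the tail has
even length, both sides vanish. -/
theorem trace_prod_spinMatT (K : ℕ) : ∀ (n : ℕ) (L : List ℕ), L.length ≤ n →
    (∀ i ∈ L, i / 2 < K) → ((L.map (spinMatT K)).prod).trace = 2 ^ K * (wick L : ℂ)
  | _, [], _, _ => by simp [wick_nil, Matrix.trace_one]
  | 0, i :: L, h, _ => by simp at h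
  | n + 1, i :: L, h, hL => by
    rcases Nat.even_or_odd L.length with he | ho
    · have hodd : Odd (i :: L).length := by rw [List.length_cons]; exact he.add_one
      rw [trace_prod_spinMatT_odd K _ hL hodd]
      obtain ⟨p, hp⟩ := hodd
      rw [wick_odd p _ hp]
      simp
    · have h1 := mul_prod_of_anticomm (spinMatT K) i L (fun l hl => spinMatT_anticomm K i l
        (hL i List.mem_cons_self) (hL l (List.mem_cons_of_mem _ hl)))
      have h2 := congrArg Matrix.trace h1
      rw [ho.neg_one_pow, neg_one_mul, Matrix.trace_add, Matrix.trace_neg,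
        Matrix.trace_mul_comm (List.prod _), Matrix.trace_sum] at h2
      rw [List.map_cons, List.prod_cons, wick_cons]
      have h3 : ∀ k ∈ Finset.range L.length,
          (algebraMap ℝ (Matrix (Fin K → Fin 2) (Fin K → Fin 2) ℂ)
            ((-1) ^ k * gram i (L.getD k 0)) * ((L.eraseIdx k).map (spinMatT K)).prod).trace =
          2 ^ K * (((-1) ^ k * gram i (L.getD k 0) * wick (L.eraseIdx k) : ℝ) : ℂ) := by
        intro k hk
        rw [Finset.mem_range] at hk
        have hlen := length_eraseIdx_succ L hk
        rw [List.length_cons] at h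
        rw [Algebra.algebraMap_eq_smul_one, smul_one_mul, Matrix.trace_smul,
          trace_prod_spinMatT K n (L.eraseIdx k) (by omega)
            (fun j hj => hL j (List.mem_cons_of_mem _ (List.mem_of_mem_eraseIdx hj)))]
        rw [Complex.real_smul]
        push_cast
        ring
      rw [Finset.sum_congr rfl h3, ← Finset.mul_sum] at h2
      push_cast at h2 ⊢
      linear_combination (1 / 2 : ℂ) * h2

end Wick

/-! ### Multiplicativity, reality and special values of the normalized basic spin character. -/

section SpinChar

variable {n : ℕ}

/-- `2^{n̄/2}` times the character of the basic spin supermodule of `S̃_n`. -/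
noncomputable def spinChar (n : ℕ) (x : SpinGroup n) : ℂ :=
  (Real.sqrt 2 : ℂ) ^ (n % 2) * (basicSpin n x).val.trace

/-- The product of the generators `t_i` along a word. -/
def spinWord (L : List (Fin (n - 1))) : SpinGroup n := (L.map spinT).prod

theorem exists_spinWord (x : SpinGroup n) : ∃ (e : ℕ) (L : List (Fin (n - 1))),
    x = spinZ n ^ e * spinWord L := by
  induction x using SpinGroup.induction with
  | one => exact ⟨0, [], by simp [spinWord]⟩
  | z x ih =>
    obtain ⟨e, L, rfl⟩ := ih
    exact ⟨e + 1, L, by rw [pow_succ', mul_assoc]⟩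
  | t i x ih =>
    obtain ⟨e, L, rfl⟩ := ih
    refine ⟨e, i :: L, ?_⟩
    rw [← mul_assoc, ← ((show Commute (spinZ n) (spinT i) from spinZ_comm _).pow_left e).eq,
      mul_assoc]
    simp [spinWord]

theorem basicSpin_spinWord (L : List (Fin (n - 1))) :
    (basicSpin n (spinWord L)).val = ((L.map Fin.val).map (spinMatT (n / 2))).prod := by
  induction L with
  | nil => simp [spinWord]
  | cons i L ih =>
    have : spinWord (i :: L) = spinT i * spinWord L := by simp [spinWord]
    rw [this, map_mul, Units.val_mul, ih, basicSpin_spinT]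
    simp [spinUnitT]

/-- The dimension `2^⌊n/2⌋` and the normalizing factor combine to `√2 ^ n`, which is multiplicative
in `n`. The unnormalized dimension is not. -/
theorem spinChar_word (e : ℕ) (L : List (Fin (n - 1))) :
    spinChar n (spinZ n ^ e * spinWord L) =
      (-1) ^ e * ((Real.sqrt 2 : ℂ) ^ n * (wick (L.map Fin.val) : ℂ)) := by
  have hs : (Real.sqrt 2 : ℂ) ^ 2 = 2 := by
    rw [← Complex.ofReal_pow, Real.sq_sqrt (by norm_num)]; norm_num
  have hpow : (Real.sqrt 2 : ℂ) ^ n = (Real.sqrt 2 : ℂ) ^ (n % 2) * 2 ^ (n / 2) := by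
    conv_lhs => rw [← Nat.mod_add_div n 2, pow_add, pow_mul, hs]
  rw [spinChar, map_mul, map_pow, basicSpin_spinZ, Units.val_mul, Units.val_pow_eq_pow_val,
    Units.val_neg, Units.val_one, basicSpin_spinWord, hpow]
  have : ((-1 : Matrix (Fin (n / 2) → Fin 2) (Fin (n / 2) → Fin 2) ℂ) ^ e) =
      ((-1 : ℂ) ^ e) • 1 := by
    rcases Nat.even_or_odd e with h | h
    · simp [h.neg_one_pow]
    · simp [h.neg_one_pow]
  rw [this, smul_one_mul, Matrix.trace_smul, trace_prod_spinMatT _ _ _ le_rfl]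
  · rw [smul_eq_mul]; ring
  · intro i hi
    obtain ⟨j, _, rfl⟩ := List.mem_map.1 hi
    omega

theorem spinChar_conj (x y : SpinGroup n) : spinChar n (y * x * y⁻¹) = spinChar n x := by
  rw [spinChar, spinChar, map_mul, Units.val_mul, Matrix.trace_mul_comm, ← Units.val_mul,
    ← map_mul, ← mul_assoc, inv_mul_cancel, one_mul]

theorem spinChar_spinZ_mul (x : SpinGroup n) : spinChar n (spinZ n * x) = -spinChar n x := by
  rw [spinChar, spinChar, map_mul, basicSpin_spinZ]
  simp

theorem spinChar_of_odd {x : SpinGroup n} (hx : spinParity n x = -1) : spinChar n x = 0 := by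
  obtain ⟨e, L, rfl⟩ := exists_spinWord x
  have hp : ∀ L : List (Fin (n - 1)), spinParity n (spinWord L) = (-1) ^ L.length := by
    intro L
    induction L with
    | nil => simp [spinWord]
    | cons i L ih =>
      have : spinWord (i :: L) = spinT i * spinWord L := by simp [spinWord]
      rw [this, map_mul, ih, spinParity_spinT, List.length_cons, pow_succ']
  rw [map_mul, map_pow, spinParity_spinZ, one_pow, one_mul, hp] at hx
  rcases Nat.even_or_odd L.length with h | ⟨p, h⟩
  · rw [h.neg_one_pow] at hx
    exact absurd hx (by decide)
  · rw [spinChar_word, wick_odd p _ (by simpa using h)]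
    simp

/-- Pauli matrices are Hermitian, so the generators act by skew-Hermitian matrices. This makes the
basic spin supermodule unitary. -/
theorem clifford_conjTranspose (K m : ℕ) : (clifford K m).conjTranspose = -clifford K m := by
  have h : ∀ k : Fin K, (cliffordFactor K m k).conjTranspose = cliffordFactor K m k := by
    intro k
    unfold cliffordFactor
    split_ifs
    · ext i j; fin_cases i <;> fin_cases j <;> simp [pauli3]
    · ext i j; fin_cases i <;> fin_cases j <;> simp [pauli1]
    · ext i j; fin_cases i <;> fin_cases j <;> simp [pauli2]
    · simp
  ext v w
  simp only [clifford, Matrix.conjTranspose_apply, Matrix.smul_apply, tensorMat, smul_eq_mul,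
    Matrix.neg_apply, star_mul', star_prod]
  have h' : ∀ k, star (cliffordFactor K m k (w k) (v k)) = cliffordFactor K m k (v k) (w k) := by
    intro k
    conv_rhs => rw [← h k]
    rfl
  simp [h']

theorem spinMatT_conjTranspose (K j : ℕ) : (spinMatT K j).conjTranspose = -spinMatT K j := by
  simp [spinMatT, clifford_conjTranspose]
  abel

theorem basicSpin_inv (x : SpinGroup n) :
    (basicSpin n x⁻¹).val = (basicSpin n x).val.conjTranspose := by
  induction x using SpinGroup.induction with
  | one => simp
  | z x ih =>
    rw [mul_inv_rev, map_mul, Units.val_mul, ih, map_mul, basicSpin_spinZ, spinZ_inv,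
      basicSpin_spinZ]
    simp
  | t i x ih =>
    rw [mul_inv_rev, map_mul, Units.val_mul, ih, map_mul, basicSpin_spinT, map_inv,
      basicSpin_spinT, Units.val_mul, Matrix.conjTranspose_mul]
    congr 1
    exact (spinMatT_conjTranspose _ _).symm

/-- Unitarity gives the complex conjugate of the value at `x`, and `spinChar_word` shows that the
values are real. -/
theorem spinChar_inv (x : SpinGroup n) : spinChar n x⁻¹ = spinChar n x := by
  have h1 : spinChar n x⁻¹ = star (spinChar n x) := by
    rw [spinChar, spinChar, basicSpin_inv, Matrix.trace_conjTranspose]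
    simp
  rw [h1]
  obtain ⟨e, L, rfl⟩ := exists_spinWord x
  rw [spinChar_word]
  simp

/-- The trace factors because no contraction joins the two blocks, and the constants match because
`√2 ^ m = √2 ^ a * √2 ^ b`. All multiplicativity of the characters rests on this. -/
theorem spinChar_spinShift {a b m : ℕ} (h : a + b = m) (x : SpinGroup a) (y : SpinGroup b) :
    spinChar m (spinShift 0 a m (by omega) x * spinShift a b m (by omega) y) =
      spinChar a x * spinChar b y := by
  obtain ⟨e, L, rfl⟩ := exists_spinWord x
  obtain ⟨f, M, rfl⟩ := exists_spinWord y
  have hw : ∀ (k c : ℕ) (hk : k + c ≤ m) (L : List (Fin (c - 1))),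
      ∃ L' : List (Fin (m - 1)), spinShift k c m hk (spinWord L) = spinWord L' ∧
        L'.map Fin.val = (L.map Fin.val).map (k + ·) := by
    intro k c hk L
    refine ⟨L.map fun i : Fin (c - 1) => (⟨k + i, by omega⟩ : Fin (m - 1)), ?_, ?_⟩
    · rw [spinWord, spinWord, map_list_prod, List.map_map, List.map_map]
      congr 2
    · simp [List.map_map, Function.comp_def]
  obtain ⟨L', hL, hL'⟩ := hw 0 a (by omega) L
  obtain ⟨M', hM, hM'⟩ := hw a b (by omega) M
  have : spinShift 0 a m (by omega) (spinZ a ^ e * spinWord L) *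
      spinShift a b m (by omega) (spinZ b ^ f * spinWord M) =
      spinZ m ^ (e + f) * spinWord (L' ++ M') := by
    rw [map_mul, map_mul, map_pow, map_pow, spinShift_spinZ, spinShift_spinZ, hL, hM, pow_add]
    have hc : spinZ m ^ f * spinWord L' = spinWord L' * spinZ m ^ f :=
      ((show Commute (spinZ m) _ from spinZ_comm _).pow_left f).eq
    rw [mul_assoc, ← mul_assoc (spinWord L'), ← hc]
    simp [spinWord, mul_assoc]
  rw [this, spinChar_word, spinChar_word, spinChar_word, List.map_append, hL', hM',
    wick_append _ _ _ le_rfl, wick_map_add _ _ _ le_rfl, wick_map_add _ _ _ le_rfl, ← h]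
  · push_cast; ring
  · intro i hi j hj
    simp only [List.map_map, List.mem_map, Function.comp_apply, zero_add] at hi hj
    obtain ⟨i, _, rfl⟩ := hi
    obtain ⟨j, _, rfl⟩ := hj
    -- Indices from the first block are at most `a - 2` and those from the second at least `a`, so
    -- they are neither equal nor adjacent.
    unfold gram
    rw [if_neg (by omega), if_neg (by omega)]

/-- The product `t_1 t_2 ⋯ t_{n-1}`. -/
def spinCycle (n : ℕ) : SpinGroup n := spinWord (List.finRange (n - 1))

/-- For `n = 2p + 1` the value is `√2 ^ (2p + 1)` times the Wick value `2 ^ (-p)` of a run of length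
`2p`. -/
theorem spinChar_spinCycle (hn : Odd n) : spinChar n (spinCycle n) = (Real.sqrt 2 : ℂ) := by
  obtain ⟨p, rfl⟩ := hn
  have := spinChar_word 0 (List.finRange (2 * p + 1 - 1))
  rw [pow_zero, one_mul, pow_zero, one_mul] at this
  rw [spinCycle, this, show (List.finRange (2 * p + 1 - 1)).map Fin.val = List.range' 0 (2 * p) by
    simp [List.range_eq_range'], wick_range']
  have hs : (Real.sqrt 2 : ℂ) ^ 2 = 2 := by
    rw [← Complex.ofReal_pow, Real.sq_sqrt (by norm_num)]; norm_num
  rw [pow_succ, pow_mul, hs]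
  push_cast
  rw [mul_assoc, mul_comm _ (_ ^ p), ← mul_assoc, ← mul_pow]
  norm_num

theorem spinPerm_spinCycle (n : ℕ) :
    spinPerm n (spinCycle n) = (List.finRange n).formPerm := by
  rcases n with _ | n
  · exact Subsingleton.elim _ _
  -- The starting index `s` is kept free because the induction removes the first letter of the run.
  have key : ∀ (k s : ℕ) (hk : s + k ≤ n), spinPerm (n + 1)
      (spinWord ((List.finRange k).map fun i : Fin k => (⟨s + i, by omega⟩ : Fin (n + 1 - 1)))) =
      ((List.finRange (k + 1)).map fun i : Fin (k + 1) =>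
        (⟨s + i, by omega⟩ : Fin (n + 1))).formPerm := by
    intro k
    induction k with
    | zero => intro s hs; simp [spinWord, List.finRange_succ]
    | succ k ih =>
      intro s hs
      have := ih (s + 1) (by omega)
      rw [List.finRange_succ, List.map_cons, List.map_map, List.finRange_succ, List.map_cons,
        List.map_map]
      rw [show spinWord ((⟨s + ((0 : Fin (k + 1)) : ℕ), by omega⟩ : Fin (n + 1 - 1)) ::
        (List.finRange k).map ((fun i : Fin (k + 1) => (⟨s + i, by omega⟩ : Fin (n + 1 - 1))) ∘
          Fin.succ)) = spinT ⟨s, by omega⟩ * spinWord ((List.finRange k).map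
            fun i : Fin k => (⟨s + 1 + i, by omega⟩ : Fin (n + 1 - 1))) by
        simp only [spinWord, List.map_cons, List.prod_cons]
        congr 3
        apply List.map_congr_left
        intro i _
        simp only [Function.comp_apply, Fin.mk.injEq, Fin.val_succ]
        omega]
      rw [map_mul, this, spinPerm_spinT]
      rw [show ((List.finRange (k + 1)).map
        ((fun i : Fin (k + 1 + 1) => (⟨s + i, by omega⟩ : Fin (n + 1))) ∘ Fin.succ)) =
        ((List.finRange (k + 1)).map fun i : Fin (k + 1) =>
          (⟨s + 1 + i, by omega⟩ : Fin (n + 1))) by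
        apply List.map_congr_left
        intro i _
        simp only [Function.comp_apply, Fin.mk.injEq, Fin.val_succ]
        omega]
      rw [List.finRange_succ, List.map_cons, List.formPerm_cons_cons]
      rfl
  have := key n 0 (by omega)
  simp only [zero_add, Fin.eta] at this
  rw [show (List.finRange (n + 1)).map (fun i : Fin (n + 1) => i) = List.finRange (n + 1) from
    List.map_id _, show (List.finRange n).map (fun i : Fin n => (i : Fin (n + 1 - 1))) =
      List.finRange n from List.map_id _] at this
  exact this

end SpinChar

/-! ### Products over the orbits of a permutation -/

section Orbits

/-- The set of orbits of a permutation. -/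
abbrev Orbits {α : Type*} (σ : Equiv.Perm α) : Type _ :=
  Quotient (Equiv.Perm.SameCycle.setoid σ)

noncomputable instance orbitsFintype {α : Type*} [Finite α] (σ : Equiv.Perm α) :
    Fintype (Orbits σ) := Fintype.ofFinite _

variable {α β γ M : Type*} [CommMonoid M]

/-- The product over the orbits of `σ` of the values of `φ` at representatives. -/
noncomputable def orbProd [Finite α] (σ : Equiv.Perm α) (φ : α → M) : M :=
  ∏ q : Orbits σ, φ q.out

theorem sameCycle_out (σ : Equiv.Perm α) (i : α) :
    σ.SameCycle (Quotient.out (s := Equiv.Perm.SameCycle.setoid σ) ⟦i⟧) i :=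
  Quotient.exact (s := Equiv.Perm.SameCycle.setoid σ) (Quotient.out_eq _)

theorem apply_zpow_semiconj {σ : Equiv.Perm α} {τ : Equiv.Perm β} {f : α → β}
    (hf : ∀ i, τ (f i) = f (σ i)) (k : ℤ) (i : α) : (τ ^ k) (f i) = f ((σ ^ k) i) := by
  have hn : ∀ (n : ℕ) i, (τ ^ n) (f i) = f ((σ ^ n) i) := by
    intro n
    induction n with
    | zero => intro i; rfl
    | succ n ih =>
      intro i
      rw [pow_succ, pow_succ, Equiv.Perm.mul_apply, Equiv.Perm.mul_apply, hf, ih]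
  cases k with
  | ofNat n => simpa using hn n i
  | negSucc n =>
    rw [zpow_negSucc, zpow_negSucc, Equiv.Perm.inv_eq_iff_eq, hn, ← Equiv.Perm.mul_apply,
      mul_inv_cancel]
    rfl

theorem sameCycle_iff_of_semiconj {σ : Equiv.Perm α} {τ : Equiv.Perm β} {f : α → β}
    (hinj : Function.Injective f) (hf : ∀ i, τ (f i) = f (σ i)) (i j : α) :
    τ.SameCycle (f i) (f j) ↔ σ.SameCycle i j := by
  constructor
  · rintro ⟨k, hk⟩
    rw [apply_zpow_semiconj hf] at hk
    exact ⟨k, hinj hk⟩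
  · rintro ⟨k, hk⟩
    exact ⟨k, by rw [apply_zpow_semiconj hf, hk]⟩

theorem eq_of_sameCycle {σ : Equiv.Perm α} {φ : α → γ} (hφ : ∀ i, φ (σ i) = φ i) {i j : α}
    (h : σ.SameCycle i j) : φ i = φ j := by
  obtain ⟨k, rfl⟩ := h
  have := apply_zpow_semiconj (τ := (1 : Equiv.Perm γ)) (σ := σ) (f := φ)
    (fun i => (hφ i).symm) k i
  simpa using this

theorem orbProd_congr [Finite α] (σ : Equiv.Perm α) {φ ψ : α → M} (h : ∀ i, φ i = ψ i) :
    orbProd σ φ = orbProd σ ψ := by rw [funext h]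

theorem orbProd_equiv [Finite α] [Finite β] {σ : Equiv.Perm α} {τ : Equiv.Perm β} (e : α ≃ β)
    (he : ∀ i, τ (e i) = e (σ i)) {φ : β → M} (hφ : ∀ i, φ (τ i) = φ i) :
    orbProd σ (fun i => φ (e i)) = orbProd τ φ := by
  refine Fintype.prod_equiv (Quotient.congr e fun i j =>
    (sameCycle_iff_of_semiconj e.injective he i j).symm) _ _ fun q => ?_
  refine eq_of_sameCycle hφ ?_
  conv_rhs => rw [← Quotient.out_eq q]
  exact (sameCycle_out τ _).symm

/-- The images of `f` and `g` are complementary invariant sets, so the orbits of `σ` are the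
disjoint union of those of `σ₁` and `σ₂`. Invariance of `φ` makes the choice of representatives
irrelevant. -/
theorem orbProd_block [Finite α] [Finite β] [Finite γ] {σ : Equiv.Perm γ} {σ₁ : Equiv.Perm α}
    {σ₂ : Equiv.Perm β} {f : α → γ} {g : β → γ} (hf : Function.Injective f)
    (hg : Function.Injective g) (hfg : ∀ i j, f i ≠ g j) (hcov : ∀ c, (∃ i, c = f i) ∨ ∃ j, c = g j)
    (hσf : ∀ i, σ (f i) = f (σ₁ i)) (hσg : ∀ i, σ (g i) = g (σ₂ i)) {φ : γ → M}
    (hφ : ∀ i, φ (σ i) = φ i) :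
    orbProd σ φ = orbProd σ₁ (fun i => φ (f i)) * orbProd σ₂ (fun i => φ (g i)) := by
  let F : Orbits σ₁ → Orbits σ := Quotient.map f fun i j h =>
    (sameCycle_iff_of_semiconj hf hσf i j).2 h
  let G : Orbits σ₂ → Orbits σ := Quotient.map g fun i j h =>
    (sameCycle_iff_of_semiconj hg hσg i j).2 h
  have hbij : Function.Bijective (Sum.elim F G) := by
    constructor
    · rintro (p | p) (q | q) h
      · induction p using Quotient.inductionOn with | _ i
        induction q using Quotient.inductionOn with | _ j
        have h1 : σ.SameCycle (f i) (f j) := Quotient.exact h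
        exact congrArg Sum.inl (Quotient.sound ((sameCycle_iff_of_semiconj hf hσf i j).1 h1))
      · induction p using Quotient.inductionOn with | _ i
        induction q using Quotient.inductionOn with | _ j
        have h1 : σ.SameCycle (f i) (g j) := Quotient.exact h
        obtain ⟨k, hk⟩ := h1
        rw [apply_zpow_semiconj hσf] at hk
        exact absurd hk (hfg _ _)
      · induction p using Quotient.inductionOn with | _ i
        induction q using Quotient.inductionOn with | _ j
        have h1 : σ.SameCycle (g i) (f j) := Quotient.exact h
        obtain ⟨k, hk⟩ := h1
        rw [apply_zpow_semiconj hσg] at hk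
        exact absurd hk.symm (hfg _ _)
      · induction p using Quotient.inductionOn with | _ i
        induction q using Quotient.inductionOn with | _ j
        have h1 : σ.SameCycle (g i) (g j) := Quotient.exact h
        exact congrArg Sum.inr (Quotient.sound ((sameCycle_iff_of_semiconj hg hσg i j).1 h1))
    · intro p
      induction p using Quotient.inductionOn with | _ c
      rcases hcov c with ⟨i, rfl⟩ | ⟨j, rfl⟩
      · exact ⟨Sum.inl ⟦i⟧, rfl⟩
      · exact ⟨Sum.inr ⟦j⟧, rfl⟩
  rw [orbProd, ← (Equiv.ofBijective _ hbij).prod_comp, Fintype.prod_sum_type]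
  congr 1
  · refine Finset.prod_congr rfl fun q _ => ?_
    refine eq_of_sameCycle hφ ?_
    have : Sum.elim F G (Sum.inl q) = ⟦f q.out⟧ := by
      conv_lhs => rw [← Quotient.out_eq q]
      rfl
    exact (congrArg (fun p : Orbits σ => σ.SameCycle p.out (f q.out)) this).mpr
      (sameCycle_out σ (f q.out))
  · refine Finset.prod_congr rfl fun q _ => ?_
    refine eq_of_sameCycle hφ ?_
    have : Sum.elim F G (Sum.inr q) = ⟦g q.out⟧ := by
      conv_lhs => rw [← Quotient.out_eq q]
      rfl
    exact (congrArg (fun p : Orbits σ => σ.SameCycle p.out (g q.out)) this).mpr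
      (sameCycle_out σ (g q.out))

theorem orbProd_full [Finite α] {σ : Equiv.Perm α} (hσ : ∀ i j, σ.SameCycle i j) {φ : α → M}
    (hφ : ∀ i, φ (σ i) = φ i) (i : α) : orbProd σ φ = φ i := by
  have : ∀ q : Orbits σ, q = ⟦i⟧ := by
    intro q
    induction q using Quotient.inductionOn with | _ j
    exact Quotient.sound (hσ j i)
  rw [orbProd, Fintype.prod_eq_single (⟦i⟧ : Orbits σ) (fun q hq => absurd (this q) hq)]
  exact eq_of_sameCycle hφ (hσ _ _)

theorem orbProd_empty [IsEmpty α] [Finite α] (σ : Equiv.Perm α) (φ : α → M) : orbProd σ φ = 1 := by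
  have : IsEmpty (Orbits σ) := ⟨fun q => isEmptyElim q.out⟩
  exact Fintype.prod_empty _

theorem map_orbProd [Finite α] {N : Type*} [CommMonoid N] (F : M →* N) (σ : Equiv.Perm α)
    (φ : α → M) : F (orbProd σ φ) = orbProd σ fun i => F (φ i) := map_prod F _ _

theorem minimalPeriod_semiconj {σ : Equiv.Perm α} {τ : Equiv.Perm β} {f : α → β}
    (hinj : Function.Injective f) (hf : ∀ i, τ (f i) = f (σ i)) (i : α) :
    Function.minimalPeriod τ (f i) = Function.minimalPeriod σ i := by
  rw [Function.minimalPeriod_eq_minimalPeriod_iff]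
  intro n
  have : τ^[n] (f i) = f (σ^[n] i) := by
    have := apply_zpow_semiconj hf n i
    simpa only [zpow_natCast, Equiv.Perm.coe_pow] using this
  rw [Function.IsPeriodicPt, Function.IsFixedPt, this, hinj.eq_iff]
  rfl

theorem minimalPeriod_eq_card_sameCycle [Finite α] (σ : Equiv.Perm α) (i : α) :
    Function.minimalPeriod σ i = Nat.card {j // σ.SameCycle i j} := by
  have : Fintype (MulAction.orbit (Subgroup.zpowers σ) i) := Fintype.ofFinite _
  have h := MulAction.minimalPeriod_eq_card (a := σ) (b := i)
  rw [← Nat.card_eq_fintype_card] at h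
  refine h.trans (Nat.card_congr (Equiv.subtypeEquivRight fun j => ?_))
  constructor
  · rintro ⟨⟨_, k, rfl⟩, hk⟩
    exact ⟨k, hk⟩
  · rintro ⟨k, hk⟩
    exact ⟨⟨σ ^ k, k, rfl⟩, hk⟩

end Orbits

/-! ### Cycle types in the wreath product -/

section CycleType

variable {Γ : Type*} [Group Γ] {n : ℕ}

theorem Wreath.conj_left (u x : Wreath Γ n) (i : Fin n) :
    (u * x * u⁻¹).left (wreathPerm u i) =
      u.left (wreathPerm u i) * x.left i * (u.left (wreathPerm u ((wreathPerm x)⁻¹ i)))⁻¹ := by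
  have hinv : ∀ j, (u⁻¹).left j = (u.left (wreathPerm u j))⁻¹ := by
    intro j
    have h := Wreath.mul_left_apply u⁻¹ u j
    rw [inv_mul_cancel, map_inv, inv_inv, Wreath.one_left_apply] at h
    exact eq_inv_of_mul_eq_one_left h.symm
  rw [Wreath.mul_left_apply, Wreath.mul_left_apply, hinv, map_mul, mul_inv_rev]
  simp

theorem Wreath.pow_left_semiconj {m : ℕ} {x : Wreath Γ n} {w : Wreath Γ m} {f : Fin n → Fin m}
    (hf : ∀ i, wreathPerm w (f i) = f (wreathPerm x i)) (hl : ∀ i, w.left (f i) = x.left i)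
    (k : ℕ) (i : Fin n) : (w ^ k).left (f i) = (x ^ k).left i := by
  induction k generalizing i with
  | zero => rfl
  | succ k ih =>
    have : (wreathPerm w)⁻¹ (f i) = f ((wreathPerm x)⁻¹ i) := by
      have := apply_zpow_semiconj hf (-1) i
      simpa using this
    rw [pow_succ', pow_succ', Wreath.mul_left_apply, Wreath.mul_left_apply, hl, this, ih]

/-- The length of the cycle of `x` through `i`, and the conjugacy class of its cycle product. -/
noncomputable def cyc (x : Wreath Γ n) (i : Fin n) : ℕ × ConjClasses Γ :=
  (Function.minimalPeriod (wreathPerm x) i,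
    ConjClasses.mk ((x ^ Function.minimalPeriod (wreathPerm x) i).left i))

theorem cyc_semiconj {m : ℕ} {x : Wreath Γ n} {w : Wreath Γ m} {f : Fin n → Fin m}
    (hinj : Function.Injective f) (hf : ∀ i, wreathPerm w (f i) = f (wreathPerm x i))
    (hl : ∀ i, w.left (f i) = x.left i) (i : Fin n) : cyc w (f i) = cyc x i := by
  rw [cyc, cyc, minimalPeriod_semiconj hinj hf, Wreath.pow_left_semiconj hf hl]

/-- At the full period the permutation of the power fixes `i`, so both outer factors in
`Wreath.conj_left` come from the same entry of `u`, and the cycle product is only conjugated. -/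
theorem cyc_conj (u x : Wreath Γ n) (i : Fin n) :
    cyc (u * x * u⁻¹) (wreathPerm u i) = cyc x i := by
  have hm : Function.minimalPeriod (wreathPerm (u * x * u⁻¹)) (wreathPerm u i) =
      Function.minimalPeriod (wreathPerm x) i :=
    minimalPeriod_semiconj (wreathPerm u).injective (fun i => by simp) i
  rw [cyc, cyc, hm, conj_pow, Wreath.conj_left]
  refine Prod.ext rfl ?_
  rw [ConjClasses.mk_eq_mk_iff_isConj, isConj_iff]
  refine ⟨(u.left (wreathPerm u i))⁻¹, ?_⟩
  have : (wreathPerm (x ^ Function.minimalPeriod (wreathPerm x) i))⁻¹ i = i := by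
    apply inv_eq_self_of_eq
    rw [map_pow, Equiv.Perm.coe_pow]
    exact Function.iterate_minimalPeriod
  rw [this]
  group

theorem cyc_wreathPerm (x : Wreath Γ n) (i : Fin n) : cyc x (wreathPerm x i) = cyc x i := by
  have := cyc_conj x x i
  rwa [mul_inv_cancel_right] at this

theorem cyc_wreathZ_mul (x : Wreath Γ n) (i : Fin n) : cyc (wreathZ Γ n * x) i = cyc x i :=
  cyc_semiconj (f := id) Function.injective_id (fun i => by simp)
    (fun i => wreathZ_mul_left x i) i

theorem cyc_spinMul₁ {a b m : ℕ} (h : a + b = m) (x : Wreath Γ a) (y : Wreath Γ b) (i : Fin a) :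
    cyc (spinMul h (x, y)) ⟨i, by omega⟩ = cyc x i :=
  cyc_semiconj (f := fun i : Fin a => (⟨i, by omega⟩ : Fin m))
    (fun i j hij => Fin.ext (Fin.mk.inj hij))
    (fun i => wreathPerm_spinMul₁ h x y i) (fun i => spinMul_left₁ h x y i) i

theorem cyc_spinMul₂ {a b m : ℕ} (h : a + b = m) (x : Wreath Γ a) (y : Wreath Γ b) (i : Fin b) :
    cyc (spinMul h (x, y)) ⟨a + i, by omega⟩ = cyc y i :=
  cyc_semiconj (f := fun i : Fin b => (⟨a + i, by omega⟩ : Fin m))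
    (fun i j hij => Fin.ext (by have := Fin.mk.inj hij; omega))
    (fun i => wreathPerm_spinMul₂ h x y i) (fun i => spinMul_left₂ h x y i) i

variable {M : Type*} [CommMonoid M]

/-- The product over the cycles of `x` of the values of `X` at their types. -/
noncomputable def cycProd (X : ℕ × ConjClasses Γ → M) (x : Wreath Γ n) : M :=
  orbProd (wreathPerm x) fun i => X (cyc x i)

theorem map_cycProd {N : Type*} [CommMonoid N] (F : M →* N) (X : ℕ × ConjClasses Γ → M)
    (x : Wreath Γ n) : F (cycProd X x) = cycProd (fun d => F (X d)) x := map_orbProd F _ _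

theorem cycProd_mul (X Y : ℕ × ConjClasses Γ → M) (x : Wreath Γ n) :
    cycProd (X * Y) x = cycProd X x * cycProd Y x := Finset.prod_mul_distrib

theorem cycProd_conj (X : ℕ × ConjClasses Γ → M) (u x : Wreath Γ n) :
    cycProd X (u * x * u⁻¹) = cycProd X x := by
  have := orbProd_equiv (σ := wreathPerm x) (τ := wreathPerm (u * x * u⁻¹)) (wreathPerm u)
    (fun i => by simp) (φ := fun i => X (cyc (u * x * u⁻¹) i))
    (fun i => by simp only [cyc_wreathPerm])
  rw [cycProd, ← this]
  simp only [cyc_conj]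
  rfl

theorem cycProd_wreathZ_mul (X : ℕ × ConjClasses Γ → M) (x : Wreath Γ n) :
    cycProd X (wreathZ Γ n * x) = cycProd X x := by
  simp only [cycProd, cyc_wreathZ_mul, map_mul, wreathPerm_wreathZ, one_mul]

theorem cycProd_spinMul {a b m : ℕ} (h : a + b = m) (X : ℕ × ConjClasses Γ → M) (x : Wreath Γ a)
    (y : Wreath Γ b) : cycProd X (spinMul h (x, y)) = cycProd X x * cycProd X y := by
  have := orbProd_block (σ := wreathPerm (spinMul h (x, y))) (σ₁ := wreathPerm x)
    (σ₂ := wreathPerm y) (f := fun i : Fin a => (⟨i, by omega⟩ : Fin m))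
    (g := fun i : Fin b => (⟨a + i, by omega⟩ : Fin m))
    (fun i j hij => Fin.ext (Fin.mk.inj hij))
    (fun i j hij => Fin.ext (by have := Fin.mk.inj hij; omega))
    (fun i j hij => by have := Fin.mk.inj hij; omega)
    (fun c => by
      by_cases hi : (c : ℕ) < a
      · exact Or.inl ⟨⟨c, hi⟩, rfl⟩
      · exact Or.inr ⟨⟨c - a, by omega⟩, Fin.ext (by simp only; omega)⟩)
    (fun i => wreathPerm_spinMul₁ h x y i) (fun i => wreathPerm_spinMul₂ h x y i)
    (φ := fun i => X (cyc (spinMul h (x, y)) i)) (fun i => by simp only [cyc_wreathPerm])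
  rw [cycProd, this]
  simp only [cyc_spinMul₁, cyc_spinMul₂]
  rfl

/-- The permutation underlying `x` has a single orbit. -/
def Wreath.IsFull (x : Wreath Γ n) : Prop := ∀ i j, (wreathPerm x).SameCycle i j

theorem Wreath.IsFull.cycProd {x : Wreath Γ n} (hx : x.IsFull) (X : ℕ × ConjClasses Γ → M)
    (i : Fin n) : cycProd X x = X (cyc x i) :=
  orbProd_full hx (φ := fun i => X (cyc x i)) (fun i => by simp only [cyc_wreathPerm]) i

theorem Wreath.IsFull.cyc_fst {x : Wreath Γ n} (hx : x.IsFull) (i : Fin n) : (cyc x i).1 = n := by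
  rw [cyc, minimalPeriod_eq_card_sameCycle, Nat.card_congr (Equiv.subtypeUnivEquiv (hx i)),
    Nat.card_fin]

/-- Splitting off the cycle through a given letter. -/
theorem exists_conj_spinMul_isFull (x : Wreath Γ n) (i : Fin n) :
    ∃ (a b : ℕ) (h : a + b = n) (u : Wreath Γ n) (x₁ : Wreath Γ a) (x₂ : Wreath Γ b) (j : Fin a),
      x₁.IsFull ∧ u * x * u⁻¹ = spinMul h (x₁, x₂) ∧ cyc x₁ j = cyc x i := by
  classical
  let A : Finset (Fin n) := Finset.univ.filter fun j => (wreathPerm x).SameCycle i j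
  have hA : A.card ≤ n := by simpa using Finset.card_le_univ A
  obtain ⟨u, hu⟩ := exists_conj_mem_range_spinMul (Γ := Γ) (Nat.add_sub_of_le hA) A rfl
  have hmem : ∀ j, j ∈ A ↔ (wreathPerm x).SameCycle i j := fun j => by simp [A]
  have hr : u * x * u⁻¹ ∈ Set.range (spinMul (Γ := Γ) (Nat.add_sub_of_le hA)) := by
    rw [mem_range_spinMul]
    intro j hj
    obtain ⟨j, rfl⟩ := (wreathPerm u).surjective j
    rw [← hu, hmem] at hj
    simp only [map_mul, map_inv, Equiv.Perm.mul_apply, Equiv.Perm.inv_def, Equiv.symm_apply_apply]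
    rw [← hu, hmem]
    simpa using hj
  obtain ⟨⟨x₁, x₂⟩, hx⟩ := hr
  have hi : (wreathPerm u i : ℕ) < A.card := (hu i).1 ((hmem i).2 (Equiv.Perm.SameCycle.refl _ _))
  refine ⟨A.card, n - A.card, Nat.add_sub_of_le hA, u, x₁, x₂, ⟨wreathPerm u i, hi⟩, ?_, hx.symm,
    ?_⟩
  · have key : ∀ j : Fin A.card, (wreathPerm x).SameCycle i
        ((wreathPerm u)⁻¹ (⟨j, by omega⟩ : Fin n)) := by
      intro j
      rw [← hmem, hu]
      simp
    intro j k
    rw [← sameCycle_iff_of_semiconj (τ := wreathPerm (u * x * u⁻¹))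
      (f := fun i : Fin A.card => (⟨i, by omega⟩ : Fin n))
      (fun i j hij => Fin.ext (Fin.mk.inj hij))
      (fun i => by rw [← hx]; exact wreathPerm_spinMul₁ _ x₁ x₂ i)]
    rw [map_mul, map_mul, map_inv, Equiv.Perm.sameCycle_conj]
    exact (key j).symm.trans (key k)
  · rw [← cyc_spinMul₁ (Nat.add_sub_of_le hA) x₁ x₂, hx]
    exact cyc_conj u x i

/-- Conjugation brings the cycle through the letter `0` to the front as a block of its own.
Multiplicative class functions are thereby determined by their values on single cycles. -/
theorem cycle_induction {P : ∀ n, Wreath Γ n → Prop}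
    (conj : ∀ n (u x : Wreath Γ n), P n (u * x * u⁻¹) → P n x) (zero : ∀ x, P 0 x)
    (mul : ∀ (a b m : ℕ) (h : a + 1 + b = m) (x₁ : Wreath Γ (a + 1)) (x₂ : Wreath Γ b), x₁.IsFull →
      P b x₂ → P m (spinMul h (x₁, x₂))) (n : ℕ) (x : Wreath Γ n) : P n x := by
  induction n using Nat.strong_induction_on with
  | _ n ih =>
    rcases n with _ | n
    · exact zero x
    · obtain ⟨a, b, h, u, x₁, x₂, j, h1, h2, -⟩ := exists_conj_spinMul_isFull x 0
      obtain ⟨a, rfl⟩ : ∃ a', a = a' + 1 := ⟨a - 1, by have := j.2; omega⟩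
      apply conj _ u
      rw [h2]
      exact mul a b _ h x₁ x₂ h1 (ih b (by omega) x₂)

/-- Elements with a single cycle are conjugate, up to `z`, to a standard rotation. -/
theorem Wreath.IsFull.exists_conj {m : ℕ} {x : Wreath Γ (m + 1)} (hx : x.IsFull) :
    ∃ u : Wreath Γ (m + 1), ∃ h : Γ, wreathPerm (u * x * u⁻¹) = finRotate (m + 1) ∧
      (u * x * u⁻¹).left = Pi.mulSingle 0 h := by
  have hc : IsConj (wreathPerm x) (finRotate (m + 1)) := by
    rcases m with _ | m
    · rw [show wreathPerm x = finRotate (0 + 1) from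
        Equiv.ext fun i => Subsingleton.elim (α := Fin 1) _ _]
    · have hne : ∀ i, wreathPerm x i ≠ i := by
        intro i hi
        obtain ⟨j, hj⟩ := exists_ne i
        obtain ⟨k, hk⟩ := hx i j
        rw [Equiv.Perm.zpow_apply_eq_self_of_apply_eq_self hi] at hk
        exact hj hk.symm
      have hcyc : (wreathPerm x).IsCycle := ⟨0, hne 0, fun j _ => hx 0 j⟩
      refine hcyc.isConj isCycle_finRotate ?_
      rw [support_finRotate]
      congr 1
      ext i
      simp [hne i]
  obtain ⟨π, hπ⟩ := isConj_iff.1 hc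
  obtain ⟨v, -, rfl⟩ := exists_wreath (fun _ => (1 : Γ)) π
  set y := v * x * v⁻¹ with hy
  have hyp : wreathPerm y = finRotate (m + 1) := by rw [hy, ← hπ]; simp
  -- Conjugation by a base element with entries `w k` turns the entry at `k + 1` into `w (k + 1) * g
  -- (k + 1) * (w k)⁻¹`. The recursion for `w` makes this trivial, and the whole cycle product is
  -- collected at the letter `0`.
  let g : ℕ → Γ := fun k => if h : k < m + 1 then y.left ⟨k, h⟩ else 1
  let w : ℕ → Γ := fun k => Nat.rec 1 (fun k c => c * (g (k + 1))⁻¹) k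
  have hw : ∀ k, w (k + 1) = w k * (g (k + 1))⁻¹ := fun k => rfl
  obtain ⟨t, ht, ht'⟩ := exists_wreath (fun i : Fin (m + 1) => w i) 1
  refine ⟨t * v, w 0 * y.left 0 * (w m)⁻¹, ?_⟩
  have e : t * v * x * (t * v)⁻¹ = t * y * t⁻¹ := by rw [hy]; group
  rw [e]
  constructor
  · simp [ht', hyp]
  · funext i
    have := Wreath.conj_left t y i
    rw [ht', Equiv.Perm.one_apply, Equiv.Perm.one_apply, ht, hyp] at this
    rw [this]
    refine Fin.cases ?_ (fun i => ?_) i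
    · rw [Pi.mulSingle_eq_same]
      have : (finRotate (m + 1))⁻¹ 0 = Fin.last m := by
        rw [Equiv.Perm.inv_eq_iff_eq, finRotate_last]
      rw [this]
      rfl
    · have h1 : (finRotate (m + 1))⁻¹ i.succ = i.castSucc := by
        rw [Equiv.Perm.inv_eq_iff_eq, finRotate_apply, Fin.coeSucc_eq_succ]
      rw [h1, Pi.mulSingle_eq_of_ne (Fin.succ_ne_zero i)]
      simp only [Fin.val_succ, Fin.val_castSucc, hw]
      have : g (i + 1) = y.left i.succ := by
        simp only [g]
        rw [dif_pos (by omega)]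
        rfl
      rw [this]
      group

/-- Going back along the rotation from the letter `j`, the letter `0` is first met after `j` steps,
so `x ^ (j + 1)` has entry `h` at `j`. For the last letter the exponent is the full period. -/
theorem cyc_of_rotate {m : ℕ} {x : Wreath Γ (m + 1)} (hx : x.IsFull) {h : Γ}
    (h1 : wreathPerm x = finRotate (m + 1)) (h2 : x.left = Pi.mulSingle 0 h) :
    cyc x (Fin.last m) = (m + 1, ConjClasses.mk h) := by
  have key : ∀ (j : ℕ) (hj : j < m + 1), (x ^ (j + 1)).left ⟨j, hj⟩ = h := by
    intro j
    induction j with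
    | zero =>
      intro hj
      rw [zero_add, pow_one, h2]
      exact Pi.mulSingle_eq_same (M := fun _ => Γ) 0 h
    | succ j ih =>
      intro hj
      have h3 : (wreathPerm x)⁻¹ ⟨j + 1, hj⟩ = ⟨j, by omega⟩ := by
        rw [h1, Equiv.Perm.inv_eq_iff_eq, finRotate_of_lt (by omega : j < m)]
      rw [pow_succ', Wreath.mul_left_apply, h3, ih, h2, Pi.mulSingle_eq_of_ne, one_mul]
      exact fun h => by simpa using congrArg Fin.val h
  have hf := hx.cyc_fst (Fin.last m)
  rw [cyc] at hf ⊢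
  simp only at hf
  rw [hf]
  exact Prod.ext rfl (congrArg ConjClasses.mk (key m (by omega)))

end CycleType

/-! ### Conjugacy modulo the central involution -/

section ConjModZ

variable {Γ : Type*} [Group Γ] {n : ℕ}

/-- The projection of `Γ̃_n` to the wreath product of `Γ` with `S_n`. -/
def wreathProj (Γ : Type*) [Group Γ] (n : ℕ) : Wreath Γ n →*
    (Fin n → Γ) ⋊[mulAutArrow (G := Equiv.Perm (Fin n)) (A := Fin n) (M := Γ)]
      Equiv.Perm (Fin n) :=
  SemidirectProduct.map (MonoidHom.id _) (spinPerm n) (fun _ => rfl)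

theorem wreathProj_eq_iff' {x y : Wreath Γ n} :
    wreathProj Γ n x = wreathProj Γ n y ↔
      (∀ i, x.left i = y.left i) ∧ wreathPerm x = wreathPerm y := by
  rw [SemidirectProduct.ext_iff, ← funext_iff]
  rfl

theorem wreathProj_eq_iff {x y : Wreath Γ n} :
    wreathProj Γ n x = wreathProj Γ n y ↔ x = y ∨ x = wreathZ Γ n * y := by
  rw [wreathProj_eq_iff']
  constructor
  · rintro ⟨h1, h2⟩
    exact eq_or_eq_wreathZ_mul h1 h2
  · rintro (rfl | rfl)
    · exact ⟨fun _ => rfl, rfl⟩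
    · exact ⟨fun i => wreathZ_mul_left y i, by simp⟩

theorem wreathProj_wreathZ : wreathProj Γ n (wreathZ Γ n) = 1 := by
  rw [← map_one (wreathProj Γ n), wreathProj_eq_iff]
  exact Or.inr (mul_one _).symm

theorem wreathProj_surjective : Function.Surjective (wreathProj Γ n) := by
  rintro ⟨g, σ⟩
  obtain ⟨x, rfl, rfl⟩ := exists_wreath g σ
  exact ⟨x, rfl⟩

/-- Conjugacy up to the central involution. -/
def ConjModZ (x y : Wreath Γ n) : Prop := IsConj (wreathProj Γ n x) (wreathProj Γ n y)

theorem conjModZ_iff {x y : Wreath Γ n} :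
    ConjModZ x y ↔ ∃ u, u * x * u⁻¹ = y ∨ u * x * u⁻¹ = wreathZ Γ n * y := by
  simp only [ConjModZ, isConj_iff, ← wreathProj_eq_iff, map_mul, map_inv]
  constructor
  · rintro ⟨c, hc⟩
    obtain ⟨u, rfl⟩ := wreathProj_surjective c
    exact ⟨u, hc⟩
  · rintro ⟨u, hu⟩
    exact ⟨_, hu⟩

theorem conjModZ_conj (u x : Wreath Γ n) : ConjModZ x (u * x * u⁻¹) :=
  conjModZ_iff.2 ⟨u, Or.inl rfl⟩

theorem ConjModZ.symm {x y : Wreath Γ n} (h : ConjModZ x y) : ConjModZ y x := IsConj.symm h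

theorem ConjModZ.trans {x y w : Wreath Γ n} (h : ConjModZ x y) (h' : ConjModZ y w) :
    ConjModZ x w := IsConj.trans h h'

theorem wreathProj_spinMul_mul {a b m : ℕ} (h : a + b = m) (x x' : Wreath Γ a) (y y' : Wreath Γ b) :
    wreathProj Γ m (spinMul h (x * x', y * y')) =
      wreathProj Γ m (spinMul h (x, y)) * wreathProj Γ m (spinMul h (x', y')) := by
  rw [← map_mul, spinMul_mul, map_mul]
  split_ifs
  · rw [wreathProj_wreathZ, one_mul]
  · rw [map_one, one_mul]

theorem wreathProj_spinMul_congr {a b m : ℕ} (h : a + b = m) {x x' : Wreath Γ a}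
    {y y' : Wreath Γ b} (hx : wreathProj Γ a x = wreathProj Γ a x')
    (hy : wreathProj Γ b y = wreathProj Γ b y') :
    wreathProj Γ m (spinMul h (x, y)) = wreathProj Γ m (spinMul h (x', y')) := by
  rcases wreathProj_eq_iff.1 hx with rfl | rfl <;> rcases wreathProj_eq_iff.1 hy with rfl | rfl <;>
    simp only [spinMul_wreathZ_left, spinMul_wreathZ_right, map_mul, wreathProj_wreathZ, one_mul]

theorem ConjModZ.spinMul {a b m : ℕ} (h : a + b = m) {x x' : Wreath Γ a} {y y' : Wreath Γ b}
    (hx : ConjModZ x x') (hy : ConjModZ y y') :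
    ConjModZ (spinMul h (x, y)) (spinMul h (x', y')) := by
  obtain ⟨c, hc⟩ := isConj_iff.1 hx
  obtain ⟨d, hd⟩ := isConj_iff.1 hy
  obtain ⟨u, rfl⟩ := wreathProj_surjective c
  obtain ⟨v, rfl⟩ := wreathProj_surjective d
  refine isConj_iff.2 ⟨wreathProj Γ m (SpinWreath.spinMul h (u, v)), ?_⟩
  rw [mul_inv_eq_iff_eq_mul, ← wreathProj_spinMul_mul, ← wreathProj_spinMul_mul]
  rw [mul_inv_eq_iff_eq_mul, ← map_mul, ← map_mul] at hc hd
  exact wreathProj_spinMul_congr h hc hd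

/-- Both elements can be brought to a rotation with a single possibly nontrivial entry. Equal cycle
types make these entries conjugate, and the base element with constant entry the conjugating element
carries one normal form to the other up to `z`. -/
theorem Wreath.IsFull.conjModZ {x y : Wreath Γ n} (hx : x.IsFull) (hy : y.IsFull) {i j : Fin n}
    (h : cyc x i = cyc y j) : ConjModZ x y := by
  obtain ⟨n, rfl⟩ : ∃ m, n = m + 1 := ⟨n - 1, by have := i.pos; omega⟩
  have hconj : ∀ {x : Wreath Γ (n + 1)} (u : Wreath Γ (n + 1)), x.IsFull →
      (u * x * u⁻¹).IsFull := by
    intro x u hx i j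
    rw [map_mul, map_mul, map_inv, Equiv.Perm.sameCycle_conj]
    exact hx _ _
  have hall : ∀ {x : Wreath Γ (n + 1)}, x.IsFull → ∀ i j, cyc x i = cyc x j :=
    fun hx i j => eq_of_sameCycle (cyc_wreathPerm _) (hx i j)
  obtain ⟨u, a, hu1, hu2⟩ := hx.exists_conj
  obtain ⟨v, b, hv1, hv2⟩ := hy.exists_conj
  refine (conjModZ_conj u x).trans (ConjModZ.trans ?_ (conjModZ_conj v y).symm)
  have e1 : cyc x i = (n + 1, ConjClasses.mk a) := by
    rw [← cyc_of_rotate (hconj u hx) hu1 hu2, hall hx i ((wreathPerm u)⁻¹ (Fin.last n)),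
      ← cyc_conj u x]
    simp
  have e2 : cyc y j = (n + 1, ConjClasses.mk b) := by
    rw [← cyc_of_rotate (hconj v hy) hv1 hv2, hall hy j ((wreathPerm v)⁻¹ (Fin.last n)),
      ← cyc_conj v y]
    simp
  rw [e1, e2, Prod.mk.injEq, ConjClasses.mk_eq_mk_iff_isConj, isConj_iff] at h
  obtain ⟨-, c, hc⟩ := h
  generalize u * x * u⁻¹ = X at *
  generalize v * y * v⁻¹ = Y at *
  obtain ⟨t, ht, ht'⟩ := exists_wreath (fun _ : Fin (n + 1) => c) 1
  refine conjModZ_iff.2 ⟨t, ?_⟩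
  rw [← wreathProj_eq_iff, wreathProj_eq_iff']
  constructor
  · intro i
    have := Wreath.conj_left t X i
    rw [ht', Equiv.Perm.one_apply, Equiv.Perm.one_apply, ht, hu2] at this
    rw [this, hv2]
    by_cases hi : i = 0
    · subst hi
      rw [Pi.mulSingle_eq_same, Pi.mulSingle_eq_same, hc]
    · rw [Pi.mulSingle_eq_of_ne hi, Pi.mulSingle_eq_of_ne hi, mul_one, mul_inv_cancel]
  · simp [ht', hu1, hv1]

/-- The multiset of cycle types of `x`. -/
noncomputable def cycleCount (x : Wreath Γ n) : (ℕ × ConjClasses Γ) →₀ ℕ :=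
  (cycProd (fun d => Multiplicative.ofAdd (Finsupp.single d 1)) x).toAdd

theorem cycleCount_conj (u x : Wreath Γ n) : cycleCount (u * x * u⁻¹) = cycleCount x := by
  rw [cycleCount, cycProd_conj, cycleCount]

theorem cycleCount_spinMul {a b m : ℕ} (h : a + b = m) (x : Wreath Γ a) (y : Wreath Γ b) :
    cycleCount (spinMul h (x, y)) = cycleCount x + cycleCount y := by
  rw [cycleCount, cycProd_spinMul, toAdd_mul, cycleCount, cycleCount]

theorem Wreath.IsFull.cycleCount {x : Wreath Γ n} (hx : x.IsFull) (i : Fin n) :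
    cycleCount x = Finsupp.single (cyc x i) 1 := by
  rw [SpinWreath.cycleCount, hx.cycProd _ i, toAdd_ofAdd]

theorem cycleCount_eq_sum (x : Wreath Γ n) :
    cycleCount x = ∑ q : Orbits (wreathPerm x), Finsupp.single (cyc x q.out) 1 := by
  rw [cycleCount, cycProd, orbProd, toAdd_prod]
  rfl

/-- With weights as variables, a product over cycles is a monomial whose exponent is the cycle type.
This lets one isolate a single type by comparing coefficients. -/
theorem monomial_cycleCount {R : Type*} [CommSemiring R] (x : Wreath Γ n) :
    MvPolynomial.monomial (cycleCount x) (1 : R) = cycProd MvPolynomial.X x := by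
  rw [cycleCount_eq_sum, MvPolynomial.monomial_sum_one]
  rfl

theorem exists_cyc_eq {x y : Wreath Γ n} (h : cycleCount x = cycleCount y) (i : Fin n) :
    ∃ j, cyc y j = cyc x i := by
  classical
  by_contra hc
  push Not at hc
  have h1 : cycleCount y (cyc x i) = 0 := by
    rw [cycleCount_eq_sum, Finsupp.finsetSum_apply]
    exact Finset.sum_eq_zero fun q _ => Finsupp.single_eq_of_ne' (hc _)
  rw [← h, cycleCount_eq_sum, Finsupp.finsetSum_apply, Finset.sum_eq_zero_iff] at h1
  have h2 := h1 ⟦i⟧ (Finset.mem_univ _)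
  have h3 : cyc x (Quotient.out (s := Equiv.Perm.SameCycle.setoid (wreathPerm x)) ⟦i⟧) = cyc x i :=
    eq_of_sameCycle (cyc_wreathPerm x) (sameCycle_out _ i)
  rw [h3, Finsupp.single_eq_same] at h2
  exact one_ne_zero h2

/-- Elements with the same cycle types are conjugate up to `z`. -/
theorem conjModZ_of_cycleCount (n : ℕ) : ∀ {x y : Wreath Γ n}, cycleCount x = cycleCount y →
    ConjModZ x y := by
  induction n using Nat.strong_induction_on with
  | _ n ih =>
    intro x y h
    rcases n with _ | n
    · refine conjModZ_iff.2 ⟨1, ?_⟩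
      rw [← wreathProj_eq_iff, wreathProj_eq_iff']
      exact ⟨fun i => i.elim0, Subsingleton.elim _ _⟩
    · obtain ⟨j, hj⟩ := exists_cyc_eq h 0
      obtain ⟨a, b, hab, u, x₁, x₂, i₁, hx1, hx2, hx3⟩ := exists_conj_spinMul_isFull x 0
      obtain ⟨a', b', hab', v, y₁, y₂, j₁, hy1, hy2, hy3⟩ := exists_conj_spinMul_isFull y j
      -- Equal cycle types contain the cycle lengths, so the cycles split off from the two elements
      -- occupy blocks of the same size. Cancelling them leaves equal counts for the remaining
      -- blocks.
      have haa : a = a' := by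
        rw [← hx1.cyc_fst i₁, ← hy1.cyc_fst j₁, hx3, hy3, hj]
      subst haa
      obtain rfl : b = b' := by omega
      have hc : cyc x₁ i₁ = cyc y₁ j₁ := by rw [hx3, hy3, hj]
      refine (conjModZ_conj u x).trans (ConjModZ.trans ?_ (conjModZ_conj v y).symm)
      have e1 := cycleCount_conj u x
      have e2 := cycleCount_conj v y
      rw [hx2, cycleCount_spinMul, hx1.cycleCount i₁] at e1
      rw [hy2, cycleCount_spinMul, hy1.cycleCount j₁, ← hc] at e2
      rw [hx2, hy2]
      refine ConjModZ.spinMul hab (hx1.conjModZ hy1 hc) (ih b (by have := i₁.2; omega) ?_)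
      exact add_left_cancel (e1.trans (h.trans e2.symm))

end ConjModZ

/-! ### Values of characters as products over cycles -/

section Values

variable {Γ : Type*} [Group Γ] {n : ℕ}

theorem cycProd_zero {M : Type*} [CommMonoid M] (X : ℕ × ConjClasses Γ → M) (x : Wreath Γ 0) :
    cycProd X x = 1 := orbProd_empty _ _

theorem Wreath.IsFull.wreathParity {m : ℕ} {x : Wreath Γ (m + 1)} (hx : x.IsFull) :
    wreathParity x = (-1) ^ m := by
  obtain ⟨u, h, h1, -⟩ := hx.exists_conj
  have : SpinWreath.wreathParity (u * x * u⁻¹) = SpinWreath.wreathParity x := by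
    rw [map_mul, map_mul, map_inv, mul_comm, inv_mul_cancel_left]
  rw [← this, wreathParity_eq_sign, h1, sign_finRotate]
  rfl

theorem wreathParity_eq_cycProd (x : Wreath Γ n) :
    wreathParity x = cycProd (fun d => (-1) ^ (d.1 - 1)) x := by
  induction n, x using cycle_induction with
  | conj n u x h =>
    rw [cycProd_conj] at h
    rw [← h, map_mul, map_mul, map_inv, mul_comm, inv_mul_cancel_left]
  | zero x => rw [cycProd_zero, wreathParity_eq_sign, Subsingleton.elim (wreathPerm x) 1]; simp
  | mul a b m h x₁ x₂ h1 h2 =>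
    rw [wreathParity_spinMul, cycProd_spinMul, h1.cycProd _ 0, h1.cyc_fst, h1.wreathParity, h2]
    simp

theorem superSpin_conj {f : Wreath Γ n → ℂ} (hf : f ∈ superSpin Γ n) (x y : Wreath Γ n) :
    f (y * x * y⁻¹) = f x := hf.1 x y

theorem superSpin_wreathZ_mul {f : Wreath Γ n → ℂ} (hf : f ∈ superSpin Γ n) (x : Wreath Γ n) :
    f (wreathZ Γ n * x) = -f x := hf.2.1 x

theorem superSpin_of_odd {f : Wreath Γ n → ℂ} (hf : f ∈ superSpin Γ n) {x : Wreath Γ n}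
    (hx : wreathParity x = -1) : f x = 0 := hf.2.2 x hx

/-- Spin class functions that vanish on odd elements vanish on elements with an even cycle. -/
theorem superSpin_of_even_cycle {f : Wreath Γ n → ℂ} (hf : f ∈ superSpin Γ n) {x : Wreath Γ n}
    {i : Fin n} (hi : Even (cyc x i).1) : f x = 0 := by
  rcases Int.units_eq_one_or (wreathParity x) with hp | hp
  swap
  · exact superSpin_of_odd hf hp
  obtain ⟨a, b, h, u, x₁, x₂, j, h1, h2, h3⟩ := exists_conj_spinMul_isFull x i
  obtain ⟨a, rfl⟩ : ∃ a', a = a' + 1 := ⟨a - 1, by have := j.pos; omega⟩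
  rw [← h3, h1.cyc_fst] at hi
  have hx1 : wreathParity x₁ = -1 := by
    rw [h1.wreathParity]
    rw [Nat.even_add_one, Nat.not_even_iff_odd] at hi
    exact hi.neg_one_pow
  have hx2 : wreathParity x₂ = -1 := by
    have := wreathParity_spinMul h x₁ x₂
    rw [← h2, map_mul, map_mul, map_inv, mul_comm, inv_mul_cancel_left, hp, hx1] at this
    rcases Int.units_eq_one_or (wreathParity x₂) with h | h
    · rw [h] at this; exact absurd this (by decide)
    · exact h
  rw [← superSpin_conj hf x u, h2]
  have hc := place_comm (by omega : 0 + (a + 1) ≤ n) (by omega : a + 1 + b ≤ n) x₁ x₂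
  rw [if_pos ⟨hx1, hx2⟩] at hc
  -- The cycle of even length is odd, so for an even element the complementary block is odd too.
  -- Conjugation by the first block then multiplies the element by `z`, which forces `f x = -f x`.
  have key : place 0 (by omega : 0 + (a + 1) ≤ n) x₁ * spinMul h (x₁, x₂) *
      (place 0 (by omega : 0 + (a + 1) ≤ n) x₁)⁻¹ = wreathZ Γ n * spinMul h (x₁, x₂) := by
    rw [mul_inv_eq_iff_eq_mul]
    simp only [spinMul]
    generalize place 0 (by omega : 0 + (a + 1) ≤ n) x₁ = X at *
    generalize place (a + 1) (by omega : a + 1 + b ≤ n) x₂ = Y at *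
    have hc' : Y * X = wreathZ Γ n * (X * Y) := by rw [hc, wreathZ_mul_wreathZ_mul]
    calc X * (X * Y) = X * (wreathZ Γ n * (Y * X)) := by rw [hc]
      _ = wreathZ Γ n * (X * Y) * X := by
        rw [← mul_assoc, ← wreathZ_comm]; simp only [mul_assoc]
  have h4 := superSpin_conj hf (spinMul h (x₁, x₂)) (place 0 (by omega : 0 + (a + 1) ≤ n) x₁)
  rw [key, superSpin_wreathZ_mul hf] at h4
  exact self_eq_neg.1 h4.symm

/-- The character of the basic spin supermodule, as a function on `Γ̃_n`. -/
noncomputable def spinCharW (x : Wreath Γ n) : ℂ := spinChar n x.right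

theorem spinCharW_mem : spinCharW ∈ superSpin Γ n :=
  ⟨fun x y => spinChar_conj x.right y.right, fun x => spinChar_spinZ_mul x.right,
    fun _ hx => spinChar_of_odd hx⟩

theorem spinCharW_inv (x : Wreath Γ n) : spinCharW x⁻¹ = spinCharW x := spinChar_inv x.right

theorem spinCharW_spinMul {a b m : ℕ} (h : a + b = m) (x : Wreath Γ a) (y : Wreath Γ b) :
    spinCharW (spinMul h (x, y)) = spinCharW x * spinCharW y := spinChar_spinShift h x.right y.right

theorem isConj_spinCycle {m : ℕ} {x : Wreath Γ (m + 1)} (hx : x.IsFull) :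
    ∃ v : SpinGroup (m + 1), v * x.right * v⁻¹ = spinCycle (m + 1) ∨
      v * x.right * v⁻¹ = spinZ (m + 1) * spinCycle (m + 1) := by
  obtain ⟨u, h, h1, -⟩ := hx.exists_conj
  have hc : IsConj (finRotate (m + 1)) (spinPerm (m + 1) (spinCycle (m + 1))) := by
    rw [spinPerm_spinCycle]
    rcases m with _ | m
    · rw [show finRotate (0 + 1) = (List.finRange (0 + 1)).formPerm from
        Equiv.ext fun i => Subsingleton.elim (α := Fin 1) _ _]
    · refine isCycle_finRotate.isConj (List.isCycle_formPerm (List.nodup_finRange _) (by simp)) ?_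
      rw [support_finRotate, List.support_formPerm_of_nodup _ (List.nodup_finRange _)]
      · congr 1
        ext; simp
      · intro y hy
        simpa using congrArg List.length hy
  obtain ⟨π, hπ⟩ := isConj_iff.1 hc
  obtain ⟨w, rfl⟩ := spinPerm_surjective _ π
  refine ⟨w * u.right, ?_⟩
  rw [← spinPerm_eq_iff, ← hπ, ← h1, wreathPerm_apply]
  simp [mul_assoc]

/-- The cycle type fixes the basic spin character only up to sign, but it fixes the square: each
cycle of odd length contributes `√2 * √2`, and a cycle of even length gives zero. -/
theorem spinCharW_sq (x : Wreath Γ n) :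
    spinCharW x * spinCharW x = cycProd (fun d => 1 + (-1) ^ (d.1 - 1)) x := by
  induction n, x using cycle_induction with
  | conj n u x h => rwa [cycProd_conj, superSpin_conj spinCharW_mem] at h
  | zero x =>
    rw [cycProd_zero]
    have := spinPerm_eq_iff.1 (Subsingleton.elim (spinPerm 0 x.right) (spinPerm 0 1))
    have h1 : spinChar 0 1 = 1 := by simp [spinChar]
    rcases this with h | h
    · rw [spinCharW, h, h1, one_mul]
    · rw [spinCharW, h, spinChar_spinZ_mul, h1]; norm_num
  | mul a b m h x₁ x₂ h1 h2 =>
    rw [spinCharW_spinMul, cycProd_spinMul, h1.cycProd _ 0, h1.cyc_fst, ← h2, mul_mul_mul_comm]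
    congr 1
    rcases Nat.even_or_odd a with ha | ha
    · rw [Nat.add_sub_cancel, ha.neg_one_pow]
      have hc : spinChar (a + 1) (spinCycle (a + 1)) = (Real.sqrt 2 : ℂ) :=
        spinChar_spinCycle ha.add_one
      have hs : (Real.sqrt 2 : ℂ) * (Real.sqrt 2 : ℂ) = 2 := by
        rw [← Complex.ofReal_mul, Real.mul_self_sqrt (by norm_num)]; norm_num
      obtain ⟨v, hv⟩ := isConj_spinCycle h1
      rw [spinCharW, ← spinChar_conj x₁.right v]
      rcases hv with hv | hv
      · rw [hv, hc, hs]; norm_num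
      · rw [hv, spinChar_spinZ_mul, hc, neg_mul_neg, hs]; norm_num
    · rw [Nat.add_sub_cancel, ha.neg_one_pow, add_neg_cancel,
        superSpin_of_odd spinCharW_mem (h1.wreathParity.trans ha.neg_one_pow), mul_zero]

end Values

/-! ### The characters of tensor powers -/

section TensorPower

variable {Γ : Type*} [Group Γ] {n d : ℕ}

theorem tensorPowMat_mul (ρ : Representation ℂ Γ (Fin d → ℂ)) (x y : Wreath Γ n) :
    tensorPowMat ρ (x * y) = tensorPowMat ρ x * tensorPowMat ρ y := by
  ext i j
  simp only [Matrix.mul_apply, tensorPowMat, Wreath.mul_left_apply, ← wreathPerm_apply]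
  have h1 : ∀ w : Fin n → Fin d,
      ∏ k, LinearMap.toMatrix' (ρ (y.left k)) (w k) (j ((wreathPerm y)⁻¹ k)) =
      ∏ k, LinearMap.toMatrix' (ρ (y.left ((wreathPerm x)⁻¹ k))) (w ((wreathPerm x)⁻¹ k))
        (j ((wreathPerm y)⁻¹ ((wreathPerm x)⁻¹ k))) := fun w =>
    (Equiv.prod_comp (wreathPerm x)⁻¹ fun k =>
      LinearMap.toMatrix' (ρ (y.left k)) (w k) (j ((wreathPerm y)⁻¹ k))).symm
  simp only [h1, ← Finset.prod_mul_distrib]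
  have h2 := Equiv.sum_comp ((wreathPerm x).arrowCongr (Equiv.refl (Fin d))) fun w =>
    ∏ k, LinearMap.toMatrix' (ρ (x.left k)) (i k) (w k) *
      LinearMap.toMatrix' (ρ (y.left ((wreathPerm x)⁻¹ k))) (w k)
        (j ((wreathPerm y)⁻¹ ((wreathPerm x)⁻¹ k)))
  refine Eq.trans ?_ h2.symm
  rw [← Fintype.piFinset_univ, ← Finset.prod_univ_sum (fun _ => Finset.univ) fun k l =>
    LinearMap.toMatrix' (ρ (x.left k)) (i k) l *
      LinearMap.toMatrix' (ρ (y.left ((wreathPerm x)⁻¹ k))) l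
        (j ((wreathPerm y)⁻¹ ((wreathPerm x)⁻¹ k)))]
  refine Finset.prod_congr rfl fun k _ => ?_
  rw [map_mul ρ, Module.End.mul_eq_comp, LinearMap.toMatrix'_comp, Matrix.mul_apply, map_mul,
    mul_inv_rev]
  rfl

theorem trace_tensorPowMat_conj (ρ : Representation ℂ Γ (Fin d → ℂ)) (u x : Wreath Γ n) :
    (tensorPowMat ρ (u * x * u⁻¹)).trace = (tensorPowMat ρ x).trace := by
  rw [tensorPowMat_mul, Matrix.trace_mul_comm, ← tensorPowMat_mul, inv_mul_cancel_left]

theorem trace_tensorPowMat_spinMul (ρ : Representation ℂ Γ (Fin d → ℂ)) {a b m : ℕ}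
    (h : a + b = m) (x : Wreath Γ a) (y : Wreath Γ b) :
    (tensorPowMat ρ (spinMul h (x, y))).trace =
      (tensorPowMat ρ x).trace * (tensorPowMat ρ y).trace := by
  subst h
  simp only [Matrix.trace, Matrix.diag_apply]
  rw [← (Fin.appendEquiv a b).sum_comp, Fintype.sum_prod_type, Finset.sum_mul_sum]
  refine Finset.sum_congr rfl fun i _ => Finset.sum_congr rfl fun j _ => ?_
  simp only [tensorPowMat, Fin.prod_univ_add, ← wreathPerm_apply]
  have e1 : ∀ k : Fin a, (wreathPerm (spinMul rfl (x, y)))⁻¹ (Fin.castAdd b k) =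
      Fin.castAdd b ((wreathPerm x)⁻¹ k) := by
    intro k
    have := apply_zpow_semiconj (τ := wreathPerm (spinMul (rfl : a + b = a + b) (x, y)))
      (σ := wreathPerm x) (f := fun k : Fin a => Fin.castAdd b k)
      (fun i => wreathPerm_spinMul₁ rfl x y i) (-1) k
    simpa using this
  have e2 : ∀ k : Fin b, (wreathPerm (spinMul rfl (x, y)))⁻¹ (Fin.natAdd a k) =
      Fin.natAdd a ((wreathPerm y)⁻¹ k) := by
    intro k
    have := apply_zpow_semiconj (τ := wreathPerm (spinMul (rfl : a + b = a + b) (x, y)))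
      (σ := wreathPerm y) (f := fun k : Fin b => Fin.natAdd a k)
      (fun i => wreathPerm_spinMul₂ rfl x y i) (-1) k
    simpa using this
  congr 1
  · refine Finset.prod_congr rfl fun k _ => ?_
    rw [e1]
    have := spinMul_left₁ (rfl : a + b = a + b) x y k
    simp only [Fin.appendEquiv, Equiv.coe_fn_mk, Fin.append_left]
    rw [← this]
    rfl
  · refine Finset.prod_congr rfl fun k _ => ?_
    rw [e2]
    have := spinMul_left₂ (rfl : a + b = a + b) x y k
    simp only [Fin.appendEquiv, Equiv.coe_fn_mk, Fin.append_right]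
    rw [← this]
    rfl

/-- Apart from the letter `0` all entries are trivial, so a diagonal coefficient vanishes unless
consecutive indices agree. Only constant index tuples remain, and their coefficients are the
diagonal entries of `ρ h`. -/
theorem trace_tensorPowMat_rotate (ρ : Representation ℂ Γ (Fin d → ℂ)) {m : ℕ}
    {x : Wreath Γ (m + 1)} {h : Γ} (h1 : wreathPerm x = finRotate (m + 1))
    (h2 : x.left = Pi.mulSingle 0 h) : (tensorPowMat ρ x).trace = ρ.character h := by
  have e0 : (finRotate (m + 1))⁻¹ 0 = Fin.last m := by
    rw [Equiv.Perm.inv_eq_iff_eq, finRotate_last]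
  have e1 : ∀ i : Fin m, (finRotate (m + 1))⁻¹ i.succ = i.castSucc := by
    intro i
    rw [Equiv.Perm.inv_eq_iff_eq, finRotate_apply, Fin.coeSucc_eq_succ]
  have key : ∀ i : Fin (m + 1) → Fin d, tensorPowMat ρ x i i =
      if i = Function.const _ (i 0) then LinearMap.toMatrix' (ρ h) (i 0) (i 0) else 0 := by
    intro i
    rw [tensorPowMat, ← wreathPerm_apply, h1, h2, Fin.prod_univ_succ, e0, Pi.mulSingle_eq_same]
    have hs : ∀ k : Fin m, LinearMap.toMatrix' (ρ ((Pi.mulSingle 0 h : Fin (m + 1) → Γ) k.succ))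
        (i k.succ) (i ((finRotate (m + 1))⁻¹ k.succ)) =
        if i k.succ = i k.castSucc then (1 : ℂ) else 0 := by
      intro k
      rw [e1, Pi.mulSingle_eq_of_ne (Fin.succ_ne_zero k), map_one, Module.End.one_eq_id,
        LinearMap.toMatrix'_id, Matrix.one_apply]
    simp only [hs]
    split_ifs with hc
    · rw [Finset.prod_eq_one, mul_one]
      · rw [hc]; rfl
      · intro k _
        rw [hc]; simp
    · by_cases hall : ∀ k : Fin m, i k.succ = i k.castSucc
      · exact absurd (funext fun k => by
          induction k using Fin.induction with
          | zero => rfl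
          | succ k ih => rw [hall, ih]; rfl) hc
      · push Not at hall
        obtain ⟨k, hk⟩ := hall
        rw [Finset.prod_eq_zero (Finset.mem_univ k) (if_neg hk), mul_zero]
  rw [Matrix.trace, Representation.character]
  simp only [Matrix.diag_apply, key]
  rw [LinearMap.trace_eq_matrix_trace ℂ (Pi.basisFun ℂ (Fin d)), LinearMap.toMatrix_eq_toMatrix',
    Matrix.trace]
  rw [← Finset.sum_filter]
  refine Finset.sum_nbij' (fun i => i 0) (fun c => Function.const _ c) ?_ ?_ ?_ ?_ ?_
  · intro i _; exact Finset.mem_univ _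
  · intro c _; simp
  · intro i hi; simpa using ((Finset.mem_filter.1 hi).2).symm
  · intro c _; rfl
  · intro i _; rfl

/-- A class function, as a function on the set of conjugacy classes. -/
noncomputable def onClasses (φ : Γ → ℂ) (c : ConjClasses Γ) : ℂ := φ (Quotient.out c)

theorem onClasses_mk {φ : Γ → ℂ} (hφ : ∀ g h, φ (h * g * h⁻¹) = φ g) (g : Γ) :
    onClasses φ (ConjClasses.mk g) = φ g := by
  have h : IsConj (Quotient.out (ConjClasses.mk g)) g := by
    rw [← ConjClasses.mk_eq_mk_iff_isConj]
    exact Quotient.out_eq (s := IsConj.setoid Γ) (ConjClasses.mk g)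
  obtain ⟨c, hc⟩ := isConj_iff.1 h
  rw [onClasses, ← hφ _ c, hc]

theorem character_conj' (ρ : Representation ℂ Γ (Fin d → ℂ)) (g h : Γ) :
    ρ.character (h * g * h⁻¹) = ρ.character g := by
  simp only [Representation.character, map_mul]
  rw [LinearMap.trace_mul_comm, ← mul_assoc, ← map_mul, inv_mul_cancel, map_one, one_mul]

theorem trace_tensorPowMat (ρ : Representation ℂ Γ (Fin d → ℂ)) (x : Wreath Γ n) :
    (tensorPowMat ρ x).trace = cycProd (fun e => onClasses ρ.character e.2) x := by
  induction n, x using cycle_induction with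
  | conj n u x h => rwa [cycProd_conj, trace_tensorPowMat_conj] at h
  | zero x =>
    rw [cycProd_zero]
    simp [Matrix.trace, tensorPowMat]
  | mul a b m h x₁ x₂ h1 h2 =>
    rw [trace_tensorPowMat_spinMul, cycProd_spinMul, h2]
    congr 1
    obtain ⟨u, g, hu1, hu2⟩ := h1.exists_conj
    have hf : (u * x₁ * u⁻¹).IsFull := by
      intro i j
      rw [map_mul, map_mul, map_inv, Equiv.Perm.sameCycle_conj]
      exact h1 _ _
    rw [← trace_tensorPowMat_conj ρ u, ← cycProd_conj _ u, trace_tensorPowMat_rotate ρ hu1 hu2,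
      hf.cycProd _ (Fin.last a), cyc_of_rotate hf hu1 hu2, onClasses_mk (character_conj' ρ)]

/-- The irreducible character `γ`, as a function on cycle types. -/
noncomputable def IrrChar.onCyc (γ : IrrChar Γ) (d : ℕ × ConjClasses Γ) : ℂ := onClasses γ.1 d.2

/-- Multiplicative spin class functions. -/
noncomputable def spinExp (X : ℕ × ConjClasses Γ → ℂ) (n : ℕ) (x : Wreath Γ n) : ℂ :=
  spinCharW x * cycProd X x

theorem IrrChar.rep_character (γ : IrrChar Γ) : γ.rep.character = γ.1 :=
  γ.2.choose_spec.choose_spec.2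

theorem IrrChar.rep_irreducible (γ : IrrChar Γ) : γ.rep.IsIrreducible :=
  γ.2.choose_spec.choose_spec.1

/-- The trace on a Kronecker product is a product of traces, and the character of the tensor power
is a product over cycles. This places the vectors `q_n(γ)` in the multiplicative family on which the
argument rests. -/
theorem normChar_eq_spinExp (γ : IrrChar Γ) (n : ℕ) : normChar γ n = spinExp γ.onCyc n := by
  funext x
  rw [normChar, Pi.smul_apply, basicChar, Matrix.trace_kronecker, trace_tensorPowMat,
    γ.rep_character, smul_eq_mul, spinExp, spinCharW, spinChar]
  unfold IrrChar.onCyc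
  ring

theorem spinExp_mem (X : ℕ × ConjClasses Γ → ℂ) (n : ℕ) : spinExp X n ∈ superSpin Γ n := by
  refine ⟨fun x y => ?_, fun x => ?_, fun x hx => ?_⟩
  · rw [spinExp, cycProd_conj, superSpin_conj spinCharW_mem, spinExp]
  · rw [spinExp, cycProd_wreathZ_mul, superSpin_wreathZ_mul spinCharW_mem, spinExp, neg_mul]
  · rw [spinExp, superSpin_of_odd spinCharW_mem hx, zero_mul]

theorem spinExp_spinMul {a b m : ℕ} (h : a + b = m) (X : ℕ × ConjClasses Γ → ℂ) (x : Wreath Γ a)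
    (y : Wreath Γ b) : spinExp X m (spinMul h (x, y)) = spinExp X a x * spinExp X b y := by
  rw [spinExp, spinCharW_spinMul, cycProd_spinMul, spinExp, spinExp]
  ring

/-- Inversion introduces a factor `z` only when both blocks are odd, and then both sides vanish. -/
theorem spinExp_inv_spinMul {a b m : ℕ} (h : a + b = m) (X : ℕ × ConjClasses Γ → ℂ)
    (x : Wreath Γ a) (y : Wreath Γ b) :
    spinExp X m (spinMul h (x, y))⁻¹ = spinExp X a x⁻¹ * spinExp X b y⁻¹ := by
  rw [spinMul_inv]
  split_ifs with hc
  · have h1 : SpinWreath.wreathParity x⁻¹ = -1 := by rw [map_inv, hc.1]; rfl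
    rw [superSpin_wreathZ_mul (spinExp_mem X m), spinExp_spinMul,
      superSpin_of_odd (spinExp_mem X a) h1]
    simp
  · rw [one_mul, spinExp_spinMul]

end TensorPower

/-! ### Frobenius reciprocity -/

section Frobenius

variable {Γ : Type*} [Group Γ] [Finite Γ] {n a b m : ℕ}

theorem card_wreath_ne_zero : (Nat.card (Wreath Γ n) : ℂ) ≠ 0 :=
  Nat.cast_ne_zero.2 Nat.card_pos.ne'

theorem form_eq_sum (f g : Wreath Γ n → ℂ) :
    form f g = (Nat.card (Wreath Γ n) : ℂ)⁻¹ * ∑ x, f x * g x⁻¹ := by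
  rw [form, finsum_eq_sum_of_fintype]

theorem form_comm (f g : Wreath Γ n → ℂ) : form f g = form g f := by
  rw [form_eq_sum, form_eq_sum, ← Equiv.sum_comp (Equiv.inv (Wreath Γ n))]
  simp [mul_comm]

theorem form_add_left (f f' g : Wreath Γ n → ℂ) : form (f + f') g = form f g + form f' g := by
  simp [form_eq_sum, add_mul, Finset.sum_add_distrib, mul_add]

theorem form_smul_left (c : ℂ) (f g : Wreath Γ n → ℂ) : form (c • f) g = c * form f g := by
  simp only [form_eq_sum, Pi.smul_apply, smul_eq_mul, Finset.mul_sum]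
  exact Finset.sum_congr rfl fun _ _ => by ring

theorem form_zero_left (g : Wreath Γ n → ℂ) : form 0 g = 0 := by
  simp [form_eq_sum]

theorem form_sum_left {ι : Type*} (s : Finset ι) (f : ι → Wreath Γ n → ℂ) (g : Wreath Γ n → ℂ) :
    form (∑ i ∈ s, f i) g = ∑ i ∈ s, form (f i) g := by
  classical
  induction s using Finset.induction_on with
  | empty => simp [form_zero_left]
  | insert i s hi ih => rw [Finset.sum_insert hi, Finset.sum_insert hi, form_add_left, ih]

/-- The standard bilinear form, as a bilinear map. -/
noncomputable def formBilin (Γ : Type*) [Group Γ] [Finite Γ] (n : ℕ) :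
    LinearMap.BilinForm ℂ (Wreath Γ n → ℂ) :=
  LinearMap.mk₂ ℂ form form_add_left form_smul_left
    (fun f g g' => by rw [form_comm, form_add_left, form_comm g, form_comm g'])
    (fun c f g => by rw [form_comm, form_smul_left, form_comm g, smul_eq_mul])

theorem sum_outer (h : a + b = m) (f : Wreath Γ a → ℂ) (g : Wreath Γ b → ℂ)
    (Φ : Wreath Γ m → ℂ) :
    ∑ w, outer h f g w * Φ w = (2 : ℂ)⁻¹ * ∑ p, f p.1 * g p.2 * Φ (spinMul h p) := by
  classical
  simp only [outer, finsum_eq_sum_of_fintype, mul_assoc, ← Finset.mul_sum, Finset.sum_mul]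
  congr 1
  rw [← Fintype.sum_fiberwise (spinMul h) fun p => f p.1 * (g p.2 * Φ (spinMul h p))]
  refine Finset.sum_congr rfl fun w _ => Fintype.sum_equiv (Equiv.refl _) _ _ fun p => ?_
  simp [p.2]

theorem sum_fiber_spinMul (h : a + b = m) (φ : Wreath Γ a × Wreath Γ b → ℂ) (x : Wreath Γ a)
    (y : Wreath Γ b) :
    ∑ᶠ p : {p : Wreath Γ a × Wreath Γ b // spinMul h p = spinMul h (x, y)}, φ p =
      φ (x, y) + φ (wreathZ Γ a * x, wreathZ Γ b * y) := by
  classical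
  rw [finsum_eq_sum_of_fintype]
  have hne : (x, y) ≠ (wreathZ Γ a * x, wreathZ Γ b * y) := fun hc =>
    wreathZ_mul_ne x (Prod.ext_iff.1 hc).1.symm
  rw [← Finset.sum_pair hne]
  refine (Finset.sum_subtype _ (fun p => ?_) φ).symm
  obtain ⟨x', y'⟩ := p
  rw [spinMul_eq_spinMul]
  simp [Prod.ext_iff]

/-- The fibre consists of two pairs with equal contributions, which the factor `1 / 2` compensates.
-/
theorem outer_spinMul (h : a + b = m) {f : Wreath Γ a → ℂ} {g : Wreath Γ b → ℂ}
    (hfg : ∀ x y, f (wreathZ Γ a * x) * g (wreathZ Γ b * y) = f x * g y) (x : Wreath Γ a)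
    (y : Wreath Γ b) : outer h f g (spinMul h (x, y)) = f x * g y := by
  rw [outer, sum_fiber_spinMul h (fun p => f p.1 * g p.2), hfg]
  ring

omit [Finite Γ] in
theorem outer_of_notMem (h : a + b = m) (f : Wreath Γ a → ℂ) (g : Wreath Γ b → ℂ)
    {w : Wreath Γ m} (hw : w ∉ Set.range (spinMul (Γ := Γ) h)) : outer h f g w = 0 := by
  rw [outer]
  have : IsEmpty {p : Wreath Γ a × Wreath Γ b // spinMul h p = w} :=
    ⟨fun p => hw ⟨p.1, p.2⟩⟩
  rw [finsum_of_isEmpty, mul_zero]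

theorem card_range_spinMul (h : a + b = m) :
    2 * (Nat.card (Set.range (spinMul (Γ := Γ) h)) : ℂ) =
      Nat.card (Wreath Γ a) * Nat.card (Wreath Γ b) := by
  classical
  have h1 := sum_outer h (fun _ : Wreath Γ a => 1) (fun _ : Wreath Γ b => 1) fun _ => 1
  have h2 : ∀ w : Wreath Γ m, outer h (fun _ : Wreath Γ a => 1) (fun _ : Wreath Γ b => 1) w =
      if w ∈ Set.range (spinMul (Γ := Γ) h) then 1 else 0 := by
    intro w
    split_ifs with hw
    · obtain ⟨⟨x, y⟩, rfl⟩ := hw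
      rw [outer_spinMul h fun _ _ => rfl, one_mul]
    · exact outer_of_notMem h _ _ hw
  simp only [h2, mul_one, Finset.sum_const, Finset.card_univ, nsmul_eq_mul] at h1
  rw [Fintype.card_prod, Finset.sum_boole, ← Fintype.card_subtype, ← Nat.card_eq_fintype_card,
    ← Nat.card_eq_fintype_card, ← Nat.card_eq_fintype_card] at h1
  push_cast at h1
  change (Nat.card (Set.range (spinMul (Γ := Γ) h)) : ℂ) = _ at h1
  rw [h1]
  ring

theorem card_range_spinMul_ne_zero (h : a + b = m) :
    (Nat.card (Set.range (spinMul (Γ := Γ) h)) : ℂ) ≠ 0 := by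
  intro h0
  have := card_range_spinMul (Γ := Γ) h
  rw [h0, mul_zero] at this
  exact mul_ne_zero card_wreath_ne_zero card_wreath_ne_zero this.symm

theorem indProd_eq_sum (h : a + b = m) (f : Wreath Γ a → ℂ) (g : Wreath Γ b → ℂ)
    (w : Wreath Γ m) : indProd h f g w =
      (Nat.card (Set.range (spinMul (Γ := Γ) h)) : ℂ)⁻¹ * ∑ y, outer h f g (y⁻¹ * w * y) := by
  rw [indProd, finsum_eq_sum_of_fintype]

/-- This is Frobenius reciprocity. Since `Φ` is a class function, all conjugates of the extended
function contribute equally, and the two-to-one parametrization of the spin product cancels against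
its order. -/
theorem sum_indProd (h : a + b = m) (f : Wreath Γ a → ℂ) (g : Wreath Γ b → ℂ)
    {Φ : Wreath Γ m → ℂ} (hΦ : ∀ x y, Φ (y * x * y⁻¹) = Φ x) :
    (Nat.card (Wreath Γ m) : ℂ)⁻¹ * ∑ w, indProd h f g w * Φ w =
      (Nat.card (Wreath Γ a) * Nat.card (Wreath Γ b) : ℂ)⁻¹ *
        ∑ p, f p.1 * g p.2 * Φ (spinMul h p) := by
  simp only [indProd_eq_sum, mul_assoc, ← Finset.mul_sum, Finset.sum_mul]
  rw [Finset.sum_comm]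
  have h1 : ∀ y : Wreath Γ m, ∑ w, outer h f g (y⁻¹ * (w * y)) * Φ w =
      ∑ w, outer h f g w * Φ w := by
    intro y
    rw [← Equiv.sum_comp (MulAut.conj y⁻¹).toEquiv fun w => outer h f g w * Φ w]
    refine Finset.sum_congr rfl fun w _ => ?_
    have := hΦ w y⁻¹
    simp only [MulEquiv.toEquiv_eq_coe, EquivLike.coe_coe, MulAut.conj_apply, this]
    rw [inv_inv, mul_assoc]
  simp only [h1, Finset.sum_const, Finset.card_univ, ← Nat.card_eq_fintype_card, nsmul_eq_mul]
  rw [sum_outer, ← card_range_spinMul h]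
  have h2 := card_wreath_ne_zero (Γ := Γ) (n := m)
  have h3 := card_range_spinMul_ne_zero (Γ := Γ) h
  field_simp

theorem form_indProd (h : a + b = m) (f : Wreath Γ a → ℂ) (g : Wreath Γ b → ℂ)
    {Φ : Wreath Γ m → ℂ} (hΦ : ∀ x y, Φ (y * x * y⁻¹) = Φ x) :
    form (indProd h f g) Φ = (Nat.card (Wreath Γ a) * Nat.card (Wreath Γ b) : ℂ)⁻¹ *
        ∑ x, ∑ y, f x * g y * Φ (spinMul h (x, y))⁻¹ := by
  rw [form_eq_sum, sum_indProd h f g (Φ := fun w => Φ w⁻¹) (fun x y => by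
    rw [← hΦ x⁻¹ y]; group), Fintype.sum_prod_type]

/-- By reciprocity the pairing is a double sum over the two blocks, on which `spinExp X` factors.
Hence each weight `X` defines a multiplicative functional. -/
theorem form_indProd_spinExp (h : a + b = m) (f : Wreath Γ a → ℂ) (g : Wreath Γ b → ℂ)
    (X : ℕ × ConjClasses Γ → ℂ) :
    form (indProd h f g) (spinExp X m) = form f (spinExp X a) * form g (spinExp X b) := by
  rw [form_indProd h f g (spinExp_mem X m).1, form_eq_sum, form_eq_sum, mul_mul_mul_comm,
    ← mul_inv, Finset.sum_mul_sum]
  congr 1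
  refine Finset.sum_congr rfl fun x _ => Finset.sum_congr rfl fun y _ => ?_
  rw [spinExp_inv_spinMul]
  ring

/-- The inverse of a product of blocks differs from the product of the inverses only when `x` is
odd, and there `f` vanishes. -/
theorem form_indProd_skew (h : a + b = m) {f : Wreath Γ a → ℂ} {g : Wreath Γ b → ℂ}
    {Φ : Wreath Γ m → ℂ} (hf : f ∈ superSpin Γ a) (hΦ : Φ ∈ superSpin Γ m) :
    form (indProd h f g) Φ = form g (skew h f Φ) := by
  rw [form_indProd h f g hΦ.1, form_eq_sum, Finset.sum_comm]
  simp only [skew, form_eq_sum, Finset.mul_sum]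
  refine Finset.sum_congr rfl fun y _ => Finset.sum_congr rfl fun x _ => ?_
  rw [spinMul_inv]
  split_ifs with hc
  · rw [superSpin_of_odd hf hc.1]; simp
  · rw [one_mul, mul_inv]; ring

theorem outer_wreathZ_mul (h : a + b = m) {f : Wreath Γ a → ℂ} {g : Wreath Γ b → ℂ}
    (hf : f ∈ superSpin Γ a) (hg : g ∈ superSpin Γ b) (w : Wreath Γ m) :
    outer h f g (wreathZ Γ m * w) = -outer h f g w := by
  have hfg : ∀ x y, f (wreathZ Γ a * x) * g (wreathZ Γ b * y) = f x * g y := fun x y => by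
    rw [superSpin_wreathZ_mul hf, superSpin_wreathZ_mul hg, neg_mul_neg]
  by_cases hw : w ∈ Set.range (spinMul (Γ := Γ) h)
  · obtain ⟨⟨x, y⟩, rfl⟩ := hw
    rw [← spinMul_wreathZ_left, outer_spinMul h hfg, outer_spinMul h hfg,
      superSpin_wreathZ_mul hf, neg_mul]
  · rw [outer_of_notMem h f g hw, outer_of_notMem, neg_zero]
    rintro ⟨⟨x, y⟩, hxy⟩
    exact hw ⟨(wreathZ Γ a * x, y), by rw [spinMul_wreathZ_left, hxy, wreathZ_mul_wreathZ_mul]⟩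

theorem outer_of_odd (h : a + b = m) {f : Wreath Γ a → ℂ} {g : Wreath Γ b → ℂ}
    (hf : f ∈ superSpin Γ a) (hg : g ∈ superSpin Γ b) {w : Wreath Γ m}
    (hw : wreathParity w = -1) : outer h f g w = 0 := by
  have hfg : ∀ x y, f (wreathZ Γ a * x) * g (wreathZ Γ b * y) = f x * g y := fun x y => by
    rw [superSpin_wreathZ_mul hf, superSpin_wreathZ_mul hg, neg_mul_neg]
  by_cases hr : w ∈ Set.range (spinMul (Γ := Γ) h)
  · obtain ⟨⟨x, y⟩, rfl⟩ := hr
    rw [outer_spinMul h hfg]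
    rw [wreathParity_spinMul] at hw
    rcases Int.units_eq_one_or (wreathParity x) with hx | hx
    · rw [hx, one_mul] at hw
      rw [superSpin_of_odd hg hw, mul_zero]
    · rw [superSpin_of_odd hf hx, zero_mul]
  · exact outer_of_notMem h f g hr

theorem indProd_mem (h : a + b = m) {f : Wreath Γ a → ℂ} {g : Wreath Γ b → ℂ}
    (hf : f ∈ superSpin Γ a) (hg : g ∈ superSpin Γ b) : indProd h f g ∈ superSpin Γ m := by
  refine ⟨fun x v => ?_, fun x => ?_, fun x hx => ?_⟩
  · rw [indProd_eq_sum, indProd_eq_sum, ← Equiv.sum_comp (Equiv.mulLeft v)]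
    congr 1
    refine Finset.sum_congr rfl fun y _ => ?_
    rw [Equiv.coe_mulLeft]
    congr 1
    group
  · rw [indProd_eq_sum, indProd_eq_sum, ← mul_neg, ← Finset.sum_neg_distrib]
    congr 1
    refine Finset.sum_congr rfl fun y _ => ?_
    rw [← outer_wreathZ_mul h hf hg, ← mul_assoc, ← wreathZ_comm]
    simp only [mul_assoc]
  · rw [indProd_eq_sum, Finset.sum_eq_zero, mul_zero]
    intro y _
    refine outer_of_odd h hf hg ?_
    rw [map_mul, map_mul, map_inv, mul_right_comm, inv_mul_cancel, one_mul]
    exact hx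

theorem skew_mem (h : a + b = m) {f : Wreath Γ a → ℂ} {g : Wreath Γ m → ℂ}
    (hf : f ∈ superSpin Γ a) (hg : g ∈ superSpin Γ m) : skew h f g ∈ superSpin Γ b := by
  have hodd : ∀ y : Wreath Γ b, wreathParity y = -1 → skew h f g y = 0 := by
    intro y hy
    rw [skew, form_comm, form_eq_sum, Finset.sum_eq_zero, mul_zero]
    intro x _
    rcases Int.units_eq_one_or (wreathParity x) with hx | hx
    · rw [superSpin_of_odd hg (by rw [wreathParity_spinMul, hx, hy, one_mul]), zero_mul]
    · rw [superSpin_of_odd hf (by rw [map_inv, hx]; rfl), mul_zero]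
  refine ⟨fun y v => ?_, fun y => ?_, hodd⟩
  · rcases Int.units_eq_one_or (wreathParity y) with hy | hy
    · rw [skew, skew, form_comm, form_comm f, form_eq_sum, form_eq_sum]
      congr 1
      refine Finset.sum_congr rfl fun x _ => ?_
      rcases Int.units_eq_one_or (wreathParity x) with hx | hx
      · congr 1
        -- Only even `x` contribute, and an even `x` commutes with the second block even if `v` is
        -- odd, so no factor `z` appears.
        rw [← superSpin_conj hg (spinMul h (x, y)) (spinMul h (1, v)), spinMul_inv, map_one,
          if_neg (fun hc => absurd hc.1 (by decide)), one_mul, spinMul_mul, hx, if_neg (fun hc => absurd hc.1 (by decide)),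
          one_mul, spinMul_mul, inv_one, map_one, if_neg (fun hc => absurd hc.1 (by decide))]
        simp only [one_mul, mul_one]
      · rw [superSpin_of_odd hf (by rw [map_inv, hx]; rfl), mul_zero, mul_zero]
    · rw [hodd _ hy, hodd]
      rw [map_mul, map_mul, map_inv, mul_right_comm, mul_inv_cancel, one_mul, hy]
  · rw [skew, skew, form_comm, form_comm f, ← neg_one_mul, ← form_smul_left]
    congr 1
    funext x
    simp only [spinMul_wreathZ_right, superSpin_wreathZ_mul hg, Pi.smul_apply, smul_eq_mul,
      neg_one_mul]

end Frobenius

/-! ### Products of multiplicative class functions -/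

section Mackey

variable {Γ : Type*} [Group Γ] [Finite Γ] {n a b m : ℕ}

open Classical in
/-- The product over the cycles of `w`, with the weight `X` for those in `A` and `Y` otherwise. -/
noncomputable def twoProd (X Y : ℕ × ConjClasses Γ → ℂ) (w : Wreath Γ n) (A : Finset (Fin n)) : ℂ :=
  orbProd (wreathPerm w) fun i => (if i ∈ A then X else Y) (cyc w i)

omit [Finite Γ] in
open Classical in
theorem twoProd_spinMul (X Y : ℕ × ConjClasses Γ → ℂ) (h : a + b = m) (x : Wreath Γ a)
    (y : Wreath Γ b) :
    twoProd X Y (spinMul h (x, y)) {i | (i : ℕ) < a} = cycProd X x * cycProd Y y := by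
  have hinv : ∀ i : Fin m, ((wreathPerm (spinMul h (x, y)) i : ℕ) < a) ↔ (i : ℕ) < a := by
    intro i
    by_cases hi : (i : ℕ) < a
    · have := wreathPerm_spinMul₁ h x y ⟨i, hi⟩
      simp only [Fin.eta] at this
      rw [this]
      simp [hi]
    · have := wreathPerm_spinMul₂ h x y ⟨i - a, by omega⟩
      have e : (⟨a + (i - a), by omega⟩ : Fin m) = i := Fin.ext (by simp only; omega)
      simp only [e] at this
      rw [this]
      simp [hi]
  have := orbProd_block (σ := wreathPerm (spinMul h (x, y))) (σ₁ := wreathPerm x)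
    (σ₂ := wreathPerm y) (f := fun i : Fin a => (⟨i, by omega⟩ : Fin m))
    (g := fun i : Fin b => (⟨a + i, by omega⟩ : Fin m))
    (fun i j hij => Fin.ext (Fin.mk.inj hij))
    (fun i j hij => Fin.ext (by have := Fin.mk.inj hij; omega))
    (fun i j hij => by have := Fin.mk.inj hij; omega)
    (fun c => by
      by_cases hi : (c : ℕ) < a
      · exact Or.inl ⟨⟨c, hi⟩, rfl⟩
      · exact Or.inr ⟨⟨c - a, by omega⟩, Fin.ext (by simp only; omega)⟩)
    (fun i => wreathPerm_spinMul₁ h x y i) (fun i => wreathPerm_spinMul₂ h x y i)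
    (φ := fun i => (if i ∈ Finset.univ.filter (fun i : Fin m => (i : ℕ) < a) then X else Y)
      (cyc (spinMul h (x, y)) i)) (fun i => by
        simp only [cyc_wreathPerm, Finset.mem_filter, Finset.mem_univ, true_and, hinv])
  rw [twoProd, this]
  simp only [cyc_spinMul₁, cyc_spinMul₂, Finset.mem_filter, Finset.mem_univ, true_and, Fin.is_lt,
    if_true, add_lt_iff_neg_left, Nat.not_lt_zero, if_false]
  rfl

omit [Finite Γ] in
theorem twoProd_conj (X Y : ℕ × ConjClasses Γ → ℂ) (u w : Wreath Γ n) {A B : Finset (Fin n)}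
    (hAB : ∀ i, wreathPerm u i ∈ B ↔ i ∈ A) (hA : ∀ i, wreathPerm w i ∈ A ↔ i ∈ A) :
    twoProd X Y (u * w * u⁻¹) B = twoProd X Y w A := by
  have hB : ∀ i, wreathPerm (u * w * u⁻¹) i ∈ B ↔ i ∈ B := by
    intro i
    obtain ⟨j, rfl⟩ := (wreathPerm u).surjective i
    have : wreathPerm (u * w * u⁻¹) (wreathPerm u j) = wreathPerm u (wreathPerm w j) := by simp
    rw [this, hAB, hAB, hA]
  have := orbProd_equiv (σ := wreathPerm w) (τ := wreathPerm (u * w * u⁻¹)) (wreathPerm u)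
    (fun i => by simp) (φ := fun i => (if i ∈ B then X else Y) (cyc (u * w * u⁻¹) i))
    (fun i => by simp only [cyc_wreathPerm, hB])
  rw [twoProd, ← this]
  simp only [cyc_conj, hAB]
  rfl

-- The invariant subsets are the unions of orbits, so this is the expansion of a product of
-- binomials over the orbits.
omit [Finite Γ] in
open Classical in
theorem sum_twoProd (X Y : ℕ × ConjClasses Γ → ℂ) (w : Wreath Γ n) :
    ∑ A : Finset (Fin n), (if ∀ i, wreathPerm w i ∈ A ↔ i ∈ A then twoProd X Y w A else 0) =
      cycProd (X + Y) w := by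
  have h1 : cycProd (X + Y) w = ∑ S : Finset (Orbits (wreathPerm w)),
      ∏ q, (if q ∈ S then X else Y) (cyc w q.out) := by
    rw [cycProd, orbProd]
    simp only [Pi.add_apply]
    rw [Finset.prod_add, Finset.powerset_univ]
    refine Finset.sum_congr rfl fun S _ => ?_
    rw [← Finset.prod_sdiff (Finset.subset_univ S), mul_comm]
    congr 1
    · exact Finset.prod_congr rfl fun q hq => by rw [if_neg (Finset.mem_sdiff.1 hq).2]
    · exact Finset.prod_congr rfl fun q hq => by rw [if_pos hq]
  have key : ∀ A : Finset (Fin n), (∀ i, wreathPerm w i ∈ A ↔ i ∈ A) → ∀ i : Fin n,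
      Quotient.out (s := Equiv.Perm.SameCycle.setoid (wreathPerm w)) ⟦i⟧ ∈ A ↔ i ∈ A := by
    intro A hA i
    exact iff_of_eq (eq_of_sameCycle (φ := fun i => i ∈ A) (fun i => propext (hA i))
      (sameCycle_out (wreathPerm w) i))
  rw [h1, ← Finset.sum_filter]
  refine Finset.sum_bij' (fun A _ => Finset.univ.filter fun q => q.out ∈ A)
    (fun S _ => Finset.univ.filter fun i =>
      (Quotient.mk (Equiv.Perm.SameCycle.setoid (wreathPerm w)) i) ∈ S) ?_ ?_ ?_ ?_ ?_
  · intro A _; exact Finset.mem_univ _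
  · intro S _
    simp only [Finset.mem_filter, Finset.mem_univ, true_and]
    intro i
    have : Quotient.mk (Equiv.Perm.SameCycle.setoid (wreathPerm w)) (wreathPerm w i) =
        Quotient.mk (Equiv.Perm.SameCycle.setoid (wreathPerm w)) i :=
      Quotient.sound (Equiv.Perm.sameCycle_apply_left.2 (Equiv.Perm.SameCycle.refl _ _))
    rw [this]
  · intro A hA
    ext i
    simp only [Finset.mem_filter, Finset.mem_univ, true_and] at hA ⊢
    exact key A hA i
  · intro S _
    ext q
    simp only [Finset.mem_filter, Finset.mem_univ, true_and]
    rw [Quotient.out_eq]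
  · intro A hA
    simp only [Finset.mem_filter, Finset.mem_univ, true_and] at hA ⊢
    rfl

omit [Finite Γ] in
theorem lt_iff_of_mem_range_spinMul (h : a + b = m) {w : Wreath Γ m}
    (hw : w ∈ Set.range (spinMul (Γ := Γ) h)) (i : Fin m) :
    (wreathPerm w i : ℕ) < a ↔ (i : ℕ) < a := by
  have hw' := (mem_range_spinMul h w).1 hw
  refine ⟨fun hi => ?_, hw' i⟩
  obtain ⟨⟨x, y⟩, rfl⟩ := hw
  by_contra hc
  have := wreathPerm_spinMul₂ h x y ⟨i - a, by omega⟩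
  have e : (⟨a + (i - a), by omega⟩ : Fin m) = i := Fin.ext (by simp only; omega)
  simp only [e] at this
  rw [this] at hi
  simp at hi

-- These elements form one coset of the spin product, up to inversion.
open Classical in
theorem card_wreathPerm_eq (h : a + b = m) (A : Finset (Fin m)) (hA : A.card = a) :
    (Finset.univ.filter fun y : Wreath Γ m =>
      ∀ i : Fin m, i ∈ A ↔ ((wreathPerm y)⁻¹ i : ℕ) < a).card =
      Nat.card (Set.range (spinMul (Γ := Γ) h)) := by
  obtain ⟨y₀, hy₀⟩ := exists_conj_mem_range_spinMul (Γ := Γ) h A hA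
  rw [Nat.card_eq_fintype_card, ← Fintype.card_coe]
  refine Fintype.card_congr ?_
  refine ((Equiv.inv (Wreath Γ m)).trans (Equiv.mulRight y₀⁻¹)).subtypeEquiv fun y => ?_
  simp only [Finset.mem_filter, Finset.mem_univ, true_and]
  constructor
  · intro hy
    rw [mem_range_spinMul]
    intro i hi
    simp only [Equiv.trans_apply, Equiv.inv_apply, Equiv.coe_mulRight, map_mul, map_inv,
      Equiv.Perm.mul_apply]
    rw [← hy, hy₀]
    simpa using hi
  · intro hy i
    have := lt_iff_of_mem_range_spinMul h hy (wreathPerm y₀ i)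
    rw [hy₀, ← this]
    simp

variable (ε : ∀ n, Wreath Γ n → ℂ)

-- The factor `ε` is left general because two cases are needed: the constant `1`, for computing
-- norms, and the basic spin character, for the ring structure.
open Classical in
theorem outer_mul_cycProd (h : a + b = m)
    (hz : ∀ x y, ε a (wreathZ Γ a * x) * ε b (wreathZ Γ b * y) = ε a x * ε b y)
    (hm : ∀ x y, ε m (spinMul h (x, y)) = ε a x * ε b y) (X Y : ℕ × ConjClasses Γ → ℂ)
    (w : Wreath Γ m) :
    outer h (fun x => ε a x * cycProd X x) (fun y => ε b y * cycProd Y y) w =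
      if ∀ i, (wreathPerm w i : ℕ) < a ↔ (i : ℕ) < a then
        ε m w * twoProd X Y w {i | (i : ℕ) < a} else 0 := by
  by_cases hw : w ∈ Set.range (spinMul (Γ := Γ) h)
  · rw [if_pos (lt_iff_of_mem_range_spinMul h hw)]
    obtain ⟨⟨x, y⟩, rfl⟩ := hw
    rw [outer_spinMul, twoProd_spinMul, hm]
    · ring
    · intro x y
      rw [cycProd_wreathZ_mul, cycProd_wreathZ_mul, mul_mul_mul_comm, hz]
      ring
  · rw [outer_of_notMem h _ _ hw, if_neg]
    intro hc
    exact hw ((mem_range_spinMul h w).2 fun i => (hc i).2)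

-- The conjugate of `w` by `y⁻¹` lies in the spin product exactly when the image under `y` of the
-- first `a` letters is invariant under `w`. Each set of size `a` is such an image for as many `y`
-- as the spin product has elements, which cancels the denominator.
open Classical in
theorem indProd_mul_cycProd (h : a + b = m) (hc : ∀ x y, ε m (y * x * y⁻¹) = ε m x)
    (hz : ∀ x y, ε a (wreathZ Γ a * x) * ε b (wreathZ Γ b * y) = ε a x * ε b y)
    (hm : ∀ x y, ε m (spinMul h (x, y)) = ε a x * ε b y) (X Y : ℕ × ConjClasses Γ → ℂ)
    (w : Wreath Γ m) :
    indProd h (fun x => ε a x * cycProd X x) (fun y => ε b y * cycProd Y y) w =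
      ε m w * ∑ A : Finset (Fin m), if A.card = a then
        (if ∀ i, wreathPerm w i ∈ A ↔ i ∈ A then twoProd X Y w A else 0) else 0 := by
  let S : Wreath Γ m → Finset (Fin m) := fun y => {i | ((wreathPerm y)⁻¹ i : ℕ) < a}
  have hS : ∀ y i, i ∈ S y ↔ ((wreathPerm y)⁻¹ i : ℕ) < a := fun y i => by simp [S]
  have hcard : ∀ y, (S y).card = a := by
    intro y
    have : S y = (Finset.univ.filter fun i : Fin m => (i : ℕ) < a).map
        (wreathPerm y).toEmbedding := by
      ext i
      rw [hS, Finset.mem_map_equiv, Finset.mem_filter]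
      simp
    rw [this, Finset.card_map, Fin.card_filter_val_lt]
    omega
  have h1 : ∀ y : Wreath Γ m,
      outer h (fun x => ε a x * cycProd X x) (fun y => ε b y * cycProd Y y) (y⁻¹ * w * y) =
      ε m w * if ∀ i, wreathPerm w i ∈ S y ↔ i ∈ S y then twoProd X Y w (S y) else 0 := by
    intro y
    rw [outer_mul_cycProd ε h hz hm]
    have e1 : (∀ i, (wreathPerm (y⁻¹ * w * y) i : ℕ) < a ↔ (i : ℕ) < a) ↔
        ∀ i, wreathPerm w i ∈ S y ↔ i ∈ S y := by
      rw [← (wreathPerm y).forall_congr_right (q := fun i => wreathPerm w i ∈ S y ↔ i ∈ S y)]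
      refine forall_congr' fun i => ?_
      rw [hS, hS]
      simp
    have e2 : ε m (y⁻¹ * w * y) = ε m w := by
      have := hc w y⁻¹
      rwa [inv_inv] at this
    simp only [e1, e2]
    split_ifs with hi
    · congr 1
      rw [← twoProd_conj X Y y (y⁻¹ * w * y) (A := {i | (i : ℕ) < a}) (B := S y)]
      · congr 1; group
      · intro i; rw [hS]; simp
      · intro i
        simpa using e1.2 hi i
    · rw [mul_zero]
  rw [indProd_eq_sum]
  simp only [h1, ← Finset.mul_sum]
  rw [mul_left_comm]
  congr 1
  rw [← Finset.sum_fiberwise Finset.univ S, Finset.mul_sum]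
  refine Finset.sum_congr rfl fun A _ => ?_
  have h2 : ∀ y ∈ Finset.univ.filter (fun y => S y = A),
      (if ∀ i, wreathPerm w i ∈ S y ↔ i ∈ S y then twoProd X Y w (S y) else 0) =
      if ∀ i, wreathPerm w i ∈ A ↔ i ∈ A then twoProd X Y w A else 0 := by
    intro y hy
    rw [(Finset.mem_filter.1 hy).2]
  rw [Finset.sum_congr rfl h2, Finset.sum_const]
  by_cases hA : A.card = a
  · rw [if_pos hA]
    have h3 : Finset.univ.filter (fun y => S y = A) = Finset.univ.filter fun y : Wreath Γ m =>
        ∀ i : Fin m, i ∈ A ↔ ((wreathPerm y)⁻¹ i : ℕ) < a := by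
      ext y
      simp only [Finset.mem_filter, Finset.mem_univ, true_and, Finset.ext_iff, hS]
      exact forall_congr' fun i => Iff.comm
    rw [h3, card_wreathPerm_eq h A hA, nsmul_eq_mul, ← mul_assoc,
      inv_mul_cancel₀ (card_range_spinMul_ne_zero h), one_mul]
  · have h3 : Finset.univ.filter (fun y => S y = A) = ∅ :=
      Finset.filter_eq_empty_iff.2 fun y _ hy => hA (hy ▸ hcard y)
    rw [h3, if_neg hA]; simp

/-- Summing over all splittings removes the condition on the size of the invariant set, and
`sum_twoProd` applies. In generating-series form, sums of weights become products. -/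
theorem sum_indProd_mul_cycProd (hc : ∀ n x y, ε n (y * x * y⁻¹) = ε n x)
    (hz : ∀ a b x y, ε a (wreathZ Γ a * x) * ε b (wreathZ Γ b * y) = ε a x * ε b y)
    (hm : ∀ a b m (h : a + b = m) x y, ε m (spinMul h (x, y)) = ε a x * ε b y)
    (X Y : ℕ × ConjClasses Γ → ℂ) (w : Wreath Γ m) :
    ∑ p : {p // p ∈ Finset.HasAntidiagonal.antidiagonal m},
      indProd (Finset.HasAntidiagonal.mem_antidiagonal.1 p.2) (fun x => ε p.1.1 x * cycProd X x)
        (fun y => ε p.1.2 y * cycProd Y y) w = ε m w * cycProd (X + Y) w := by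
  classical
  simp only [indProd_mul_cycProd ε (Finset.HasAntidiagonal.mem_antidiagonal.1 (Subtype.prop _))
    (hc m) (hz _ _) (hm _ _ _ _)]
  rw [← Finset.mul_sum, ← sum_twoProd, Finset.sum_comm]
  congr 1
  refine Finset.sum_congr rfl fun A _ => ?_
  have hA : A.card ≤ m := by simpa using A.card_le_univ
  rw [Finset.sum_eq_single
    (⟨(A.card, m - A.card), Finset.HasAntidiagonal.mem_antidiagonal.2 (by simp only; omega)⟩ :
      {p // p ∈ Finset.HasAntidiagonal.antidiagonal m})]
  · rw [if_pos rfl]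
  · rintro ⟨⟨c, d⟩, hcd⟩ _ hne
    rw [if_neg]
    rintro h
    apply hne
    have := Finset.HasAntidiagonal.mem_antidiagonal.1 hcd
    simp only at h this
    subst h
    simp only [Subtype.mk.injEq, Prod.mk.injEq, true_and]
    omega
  · intro h; exact absurd (Finset.mem_univ _) h

end Mackey

/-! ### Averages over the base group -/

section Average

variable {Γ : Type*} [Group Γ] {n : ℕ}

theorem orbProd_eq_of_sameCycle {α M : Type*} [CommMonoid M] [Finite α] {σ τ : Equiv.Perm α}
    (h : ∀ i j, σ.SameCycle i j ↔ τ.SameCycle i j) (φ : α → M) : orbProd σ φ = orbProd τ φ := by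
  have hs : Equiv.Perm.SameCycle.setoid σ = Equiv.Perm.SameCycle.setoid τ := Setoid.ext h
  let G : Setoid α → M := fun s => (Fintype.ofFinite (Quotient s)).elems.prod fun q => φ q.out
  change G _ = G _
  rw [hs]

theorem mk_left_inv_cyc (x : Wreath Γ n) (i : Fin n) :
    cyc x⁻¹ i = (Function.minimalPeriod (wreathPerm x) i,
      ConjClasses.mk ((x ^ Function.minimalPeriod (wreathPerm x) i).left i)⁻¹) := by
  have hp : Function.minimalPeriod (wreathPerm x⁻¹) i =
      Function.minimalPeriod (wreathPerm x) i := by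
    rw [minimalPeriod_eq_card_sameCycle, minimalPeriod_eq_card_sameCycle, map_inv]
    simp only [Equiv.Perm.sameCycle_inv]
  rw [cyc, hp]
  set k := Function.minimalPeriod (wreathPerm x) i with hk
  have h1 : (x ^ k * x⁻¹ ^ k).left i = 1 := by rw [inv_pow, mul_inv_cancel]; rfl
  have h2 : (wreathPerm (x ^ k))⁻¹ i = i := by
    apply inv_eq_self_of_eq
    rw [map_pow, Equiv.Perm.coe_pow]
    exact Function.iterate_minimalPeriod
  rw [Wreath.mul_left_apply, h2] at h1
  rw [eq_inv_of_mul_eq_one_right h1]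

theorem cycProd_onClasses_inv {φ : Γ → ℂ} (hφ : ∀ g h, φ (h * g * h⁻¹) = φ g) (x : Wreath Γ n) :
    cycProd (fun d => onClasses φ d.2) x⁻¹ = cycProd (fun d => onClasses (fun g => φ g⁻¹) d.2) x := by
  rw [cycProd, cycProd, orbProd_eq_of_sameCycle (τ := wreathPerm x)
    (fun i j => by rw [map_inv, Equiv.Perm.sameCycle_inv])]
  refine orbProd_congr _ fun i => ?_
  rw [mk_left_inv_cyc, cyc, onClasses_mk hφ, onClasses_mk]
  intro g h
  rw [← hφ g⁻¹ h]
  congr 1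
  group

/-- The element of the base group with entries `u q` at the chosen representative of each orbit of
`σ`, and `1` elsewhere. -/
noncomputable def repElt {σ : Equiv.Perm (Fin n)} (u : Orbits σ → Γ) : Wreath Γ n := by
  classical
  exact ⟨fun i => if Quotient.out (s := Equiv.Perm.SameCycle.setoid σ) ⟦i⟧ = i then u ⟦i⟧ else 1, 1⟩

theorem wreathPerm_repElt {σ : Equiv.Perm (Fin n)} (u : Orbits σ → Γ) :
    wreathPerm (repElt u) = 1 := by
  rw [wreathPerm_apply, repElt, map_one]

/-- Within one turn around the cycle the representative is met only at the start, so the extra entry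
enters once, as the leftmost factor. -/
theorem repElt_pow_left (x : Wreath Γ n) (u : Orbits (wreathPerm x) → Γ)
    (q : Orbits (wreathPerm x)) :
    ∀ j < Function.minimalPeriod (wreathPerm x) q.out,
      ((repElt u * x) ^ (j + 1)).left q.out = u q * (x ^ (j + 1)).left q.out
  | 0, _ => by
    rw [zero_add, pow_one, pow_one, Wreath.mul_left_apply, wreathPerm_repElt]
    have : (Quotient.mk (Equiv.Perm.SameCycle.setoid (wreathPerm x)) q.out) = q := q.out_eq
    simp [repElt, this]
  | j + 1, hj => by
    rw [pow_succ, Wreath.mul_left_apply, repElt_pow_left x u q j (by omega), pow_succ x (j + 1),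
      Wreath.mul_left_apply, Wreath.mul_left_apply, wreathPerm_repElt, map_pow, map_mul,
      wreathPerm_repElt, one_mul, inv_one, map_pow, mul_assoc]
    congr 2
    set i := ((wreathPerm x) ^ (j + 1))⁻¹ q.out with hi
    have h1 : (Quotient.mk (Equiv.Perm.SameCycle.setoid (wreathPerm x)) i) = q := by
      conv_rhs => rw [← q.out_eq]
      refine Quotient.sound (s := Equiv.Perm.SameCycle.setoid (wreathPerm x)) ?_
      exact ⟨((j + 1 : ℕ) : ℤ), by rw [hi, zpow_natCast]; simp⟩
    have h2 : q.out ≠ i := by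
      intro hc
      have : ((wreathPerm x) ^ (j + 1)) q.out = q.out := by
        conv_lhs => rw [hc, hi]
        simp
      rw [Equiv.Perm.coe_pow] at this
      have := Function.IsPeriodicPt.minimalPeriod_le (Nat.succ_pos j) this
      omega
    simp [repElt, h1, h2]

theorem cyc_repElt_mul (x : Wreath Γ n) (u : Orbits (wreathPerm x) → Γ)
    (q : Orbits (wreathPerm x)) :
    cyc (repElt u * x) q.out = (Function.minimalPeriod (wreathPerm x) q.out, ConjClasses.mk
      (u q * (x ^ Function.minimalPeriod (wreathPerm x) q.out).left q.out)) := by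
  have hp : wreathPerm (repElt u * x) = wreathPerm x := by
    rw [map_mul, wreathPerm_repElt, one_mul]
  rw [cyc, hp]
  obtain ⟨j, hj⟩ : ∃ j, Function.minimalPeriod (wreathPerm x) q.out = j + 1 := by
    refine Nat.exists_eq_succ_of_ne_zero ?_
    rw [minimalPeriod_eq_card_sameCycle]
    have : Nonempty {j // (wreathPerm x).SameCycle q.out j} := ⟨⟨_, Equiv.Perm.SameCycle.refl _ _⟩⟩
    exact Nat.card_pos.ne'
  rw [hj, repElt_pow_left x u q j (by omega)]

variable [Finite Γ]

/-- The average over `Γ` of a function on `Γ`. -/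
noncomputable def avg (φ : Γ → ℂ) : ℂ := (Nat.card Γ : ℂ)⁻¹ * ∑ᶠ h, φ h

omit [Finite Γ] in
theorem cycProd_repElt_mul (X : ℕ × ConjClasses Γ → ℂ) (x : Wreath Γ n)
    (u : Orbits (wreathPerm x) → Γ) :
    cycProd X (repElt u * x) = ∏ q : Orbits (wreathPerm x), X (cyc (repElt u * x) q.out) := by
  rw [cycProd, orbProd_eq_of_sameCycle (τ := wreathPerm x)
    (fun i j => by rw [map_mul, wreathPerm_repElt, one_mul]), orbProd]

/-- For a fixed spin component, translating the base by `repElt u` does not change the sum. Summing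
also over all `u` makes the cycle products run independently over `Γ`, so each weight may be
replaced by its average. -/
theorem sum_cycProd_eq_avg (X : ℕ × ConjClasses Γ → ℂ) :
    ∑ x : Wreath Γ n, cycProd X x =
      ∑ x : Wreath Γ n, cycProd (fun d => avg fun h => X (d.1, ConjClasses.mk h)) x := by
  classical
  have := Fintype.ofFinite Γ
  have := Fintype.ofFinite (SpinGroup n)
  rw [← Equiv.sum_comp SemidirectProduct.equivProd.symm,
    ← Equiv.sum_comp SemidirectProduct.equivProd.symm, Fintype.sum_prod_type_right,
    Fintype.sum_prod_type_right]
  refine Finset.sum_congr rfl fun τ _ => ?_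
  set O := Orbits (spinPerm n τ) with hO
  have hcard : (Fintype.card Γ : ℂ) ≠ 0 := Nat.cast_ne_zero.2 Fintype.card_ne_zero
  have h1 : ∀ u : O → Γ, ∑ g : Fin n → Γ, cycProd X (⟨g, τ⟩ : Wreath Γ n) =
      ∑ g : Fin n → Γ, ∏ q : O, X (Function.minimalPeriod (spinPerm n τ) q.out, ConjClasses.mk
        (u q * ((⟨g, τ⟩ : Wreath Γ n) ^
          Function.minimalPeriod (spinPerm n τ) q.out).left q.out)) := by
    intro u
    rw [← Equiv.sum_comp (Equiv.mulLeft (repElt u).left)]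
    refine Finset.sum_congr rfl fun g _ => ?_
    have : (⟨Equiv.mulLeft (repElt u).left g, τ⟩ : Wreath Γ n) = repElt u * ⟨g, τ⟩ := by
      refine Wreath.ext (fun i => ?_) ?_
      · rw [Wreath.mul_left_apply, wreathPerm_repElt]; rfl
      · change τ = 1 * τ
        rw [one_mul]
    change cycProd X (⟨Equiv.mulLeft (repElt u).left g, τ⟩ : Wreath Γ n) = _
    rw [this]
    refine (cycProd_repElt_mul X (⟨g, τ⟩ : Wreath Γ n) u).trans ?_
    exact Finset.prod_congr rfl fun q _ => by rw [cyc_repElt_mul (⟨g, τ⟩ : Wreath Γ n) u q]; rfl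
  have h2 : (Fintype.card (O → Γ) : ℂ) * ∑ g : Fin n → Γ, cycProd X (⟨g, τ⟩ : Wreath Γ n) =
      ∑ g : Fin n → Γ, ∏ q : O, ∑ h : Γ,
        X (Function.minimalPeriod (spinPerm n τ) q.out, ConjClasses.mk h) := by
    rw [← nsmul_eq_mul, ← Finset.card_univ, ← Finset.sum_const, Finset.sum_congr rfl fun u _ => h1 u,
      Finset.sum_comm]
    refine Finset.sum_congr rfl fun g _ => ?_
    rw [← Fintype.piFinset_univ, ← Finset.prod_univ_sum (fun _ : O => Finset.univ) fun q h =>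
      X (Function.minimalPeriod (spinPerm n τ) q.out, ConjClasses.mk
        (h * ((⟨g, τ⟩ : Wreath Γ n) ^
          Function.minimalPeriod (spinPerm n τ) q.out).left q.out))]
    refine Finset.prod_congr rfl fun q _ => ?_
    exact Equiv.sum_comp (Equiv.mulRight (((⟨g, τ⟩ : Wreath Γ n) ^
          Function.minimalPeriod (spinPerm n τ) q.out).left q.out)) fun h =>
        X (Function.minimalPeriod (spinPerm n τ) q.out, ConjClasses.mk h)
  have h3 : (Fintype.card (O → Γ) : ℂ) ≠ 0 := Nat.cast_ne_zero.2 Fintype.card_ne_zero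
  refine mul_left_cancel₀ h3 (h2.trans ?_)
  rw [Finset.mul_sum]
  refine Finset.sum_congr rfl fun g _ => ?_
  have h4 : ∀ q : O, avg (fun h => X ((cyc (⟨g, τ⟩ : Wreath Γ n) q.out).1, ConjClasses.mk h)) =
      (Fintype.card Γ : ℂ)⁻¹ * ∑ h : Γ,
        X (Function.minimalPeriod (spinPerm n τ) q.out, ConjClasses.mk h) := by
    intro q
    rw [avg, finsum_eq_sum_of_fintype, Nat.card_eq_fintype_card]
    rfl
  have h5 : cycProd (fun d => avg fun h => X (d.1, ConjClasses.mk h)) (⟨g, τ⟩ : Wreath Γ n) =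
      ∏ q : O, avg (fun h => X ((cyc (⟨g, τ⟩ : Wreath Γ n) q.out).1, ConjClasses.mk h)) := rfl
  change _ = _ * cycProd (fun d => avg fun h => X (d.1, ConjClasses.mk h)) (⟨g, τ⟩ : Wreath Γ n)
  rw [h5, Finset.prod_congr rfl fun q _ => h4 q, Finset.prod_mul_distrib, Finset.prod_const,
    Finset.card_univ, Fintype.card_fun, Nat.cast_pow, ← mul_assoc, ← mul_pow,
    mul_inv_cancel₀ hcard, one_pow, one_mul]

end Average

/-! ### Norms of the basic characters -/

section Norms

variable {Γ : Type*} [Group Γ] [Finite Γ] {n : ℕ}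

omit [Finite Γ] in
theorem IrrChar.conj (γ : IrrChar Γ) (g h : Γ) : γ.1 (h * g * h⁻¹) = γ.1 g := by
  rw [← γ.rep_character, character_conj']

theorem avg_irrChar_mul (γ γ' : IrrChar Γ) [Decidable (γ = γ')] :
    avg (fun g => γ.1 g * γ'.1 g⁻¹) = if γ = γ' then 1 else 0 := by
  have := Fintype.ofFinite Γ
  have : Invertible (Nat.card Γ : ℂ) := invertibleOfNonzero (Nat.cast_ne_zero.2 Nat.card_pos.ne')
  have := γ.rep_irreducible
  have := γ'.rep_irreducible
  have h := Representation.char_orthonormal γ.rep γ'.rep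
  rw [γ.rep_character, γ'.rep_character] at h
  rw [avg, finsum_eq_sum_of_fintype, h]
  by_cases hγ : γ = γ'
  · subst hγ
    rw [if_pos rfl, if_pos ⟨Representation.Equiv.refl _⟩]
  · rw [if_neg hγ, if_neg]
    rintro ⟨φ⟩
    apply hγ
    apply Subtype.ext
    rw [← γ.rep_character, ← γ'.rep_character, Representation.char_iso φ]

/-- For `n ≥ 2`, translation by a lift of a transposition changes the sign of the sum; for `n ≤ 1`
every element is even. -/
theorem avg_wreathParity (n : ℕ) :
    (Nat.card (Wreath Γ n) : ℂ)⁻¹ * ∑ x : Wreath Γ n, (((wreathParity x : ℤˣ) : ℤ) : ℂ) =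
      if n ≤ 1 then 1 else 0 := by
  split_ifs with hn
  · have : Subsingleton (Fin n) := Fin.subsingleton_iff_le_one.2 hn
    have h1 : ∀ x : Wreath Γ n, wreathParity x = 1 := fun x => by
      rw [wreathParity_eq_sign, Subsingleton.elim (wreathPerm x) 1, map_one]
    simp only [h1, Units.val_one, Int.cast_one, Finset.sum_const, Finset.card_univ,
      ← Nat.card_eq_fintype_card, nsmul_eq_mul, mul_one]
    exact inv_mul_cancel₀ card_wreath_ne_zero
  · obtain ⟨v, _, hv⟩ := exists_wreath (1 : Fin n → Γ)
      (Equiv.swap ⟨0, by omega⟩ ⟨1, by omega⟩)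
    have hv' : wreathParity v = -1 := by
      rw [wreathParity_eq_sign, hv, Equiv.Perm.sign_swap (by simp)]
    have h1 : ∑ x : Wreath Γ n, (((wreathParity x : ℤˣ) : ℤ) : ℂ) =
        -∑ x : Wreath Γ n, (((wreathParity x : ℤˣ) : ℤ) : ℂ) := by
      conv_lhs => rw [← Equiv.sum_comp (Equiv.mulLeft v)]
      simp [hv']
    rw [self_eq_neg.1 h1, mul_zero]

omit [Finite Γ] in
theorem cycProd_neg_one_pow (x : Wreath Γ n) :
    cycProd (fun d => (-1 : ℂ) ^ (d.1 - 1)) x = (((wreathParity x : ℤˣ) : ℤ) : ℂ) := by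
  have := map_cycProd ((Int.castRingHom ℂ).toMonoidHom.comp (Units.coeHom ℤ))
    (fun d => (-1) ^ (d.1 - 1)) x
  rw [← wreathParity_eq_cycProd] at this
  simpa using this.symm

/-- The weight is the sum of the trivial and the sign weight, so the function is a sum of inductions
of trivial times sign. Averages multiply under induction and the sign averages to zero on two or
more letters, so only the splittings with `0` or `1` letters in the second block remain. -/
theorem avg_cycProd_one_add (n : ℕ) :
    (Nat.card (Wreath Γ n) : ℂ)⁻¹ *
      ∑ x : Wreath Γ n, cycProd (fun d => 1 + (-1 : ℂ) ^ (d.1 - 1)) x = if n = 0 then 1 else 2 := by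
  have h1 : ∀ x : Wreath Γ n, cycProd (fun d => 1 + (-1 : ℂ) ^ (d.1 - 1)) x =
      ∑ p : {p // p ∈ Finset.HasAntidiagonal.antidiagonal n},
        indProd (Finset.HasAntidiagonal.mem_antidiagonal.1 p.2)
          (fun _ => 1) (fun y : Wreath Γ p.1.2 => (((wreathParity y : ℤˣ) : ℤ) : ℂ)) x := by
    intro x
    have := sum_indProd_mul_cycProd (Γ := Γ) (fun _ _ => 1) (fun _ _ _ => rfl)
      (fun _ _ _ _ => rfl) (fun _ _ _ _ _ _ => (one_mul 1).symm) (fun _ => 1)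
      (fun d => (-1 : ℂ) ^ (d.1 - 1)) x
    rw [one_mul] at this
    refine (this.symm.trans ?_)
    refine Finset.sum_congr rfl fun p _ => ?_
    simp only [cycProd_neg_one_pow, one_mul]
    congr 1
    funext y
    exact Finset.prod_const_one
  simp only [h1]
  rw [Finset.sum_comm, Finset.mul_sum]
  have h2 : ∀ p : {p // p ∈ Finset.HasAntidiagonal.antidiagonal n},
      (Nat.card (Wreath Γ n) : ℂ)⁻¹ * ∑ x : Wreath Γ n,
        indProd (Finset.HasAntidiagonal.mem_antidiagonal.1 p.2)
          (fun _ => 1) (fun y : Wreath Γ p.1.2 => (((wreathParity y : ℤˣ) : ℤ) : ℂ)) x =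
      if p.1.2 ≤ 1 then 1 else 0 := by
    intro p
    have := sum_indProd (Finset.HasAntidiagonal.mem_antidiagonal.1 p.2)
      (fun _ => 1) (fun y : Wreath Γ p.1.2 => (((wreathParity y : ℤˣ) : ℤ) : ℂ)) (Φ := fun _ => 1)
      (fun _ _ => rfl)
    simp only [mul_one, one_mul] at this
    rw [this, Fintype.sum_prod_type]
    simp only
    rw [Finset.sum_const, Finset.card_univ,
      ← Nat.card_eq_fintype_card, nsmul_eq_mul, mul_inv, mul_mul_mul_comm,
      inv_mul_cancel₀ card_wreath_ne_zero, one_mul, avg_wreathParity]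
  rw [Finset.sum_congr rfl fun p _ => h2 p,
    Finset.sum_coe_sort (Finset.HasAntidiagonal.antidiagonal n)
      (fun p => if p.2 ≤ 1 then (1 : ℂ) else 0),
    ← Finset.Nat.sum_antidiagonal_swap,
    Finset.Nat.sum_antidiagonal_eq_sum_range_succ_mk]
  rcases n with _ | n
  · simp [Finset.filter_singleton]
  · rw [if_neg (Nat.succ_ne_zero n), Finset.sum_range_succ', Finset.sum_range_succ']
    simp
    norm_num

/-- The integrand is `spinCharW ^ 2` times a product over cycles of values of `γ(g) γ'(g⁻¹)`.
Averaging over the base replaces these values by `0` or `1`, by orthogonality of irreducible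
characters, and what remains is `avg_cycProd_one_add`. -/
theorem form_normChar (γ γ' : IrrChar Γ) [Decidable (γ = γ')] (n : ℕ) :
    form (normChar γ n) (normChar γ' n) = if n = 0 then 1 else if γ = γ' then 2 else 0 := by
  have h1 : ∀ x : Wreath Γ n, normChar γ n x * normChar γ' n x⁻¹ =
      cycProd (fun d => (1 + (-1) ^ (d.1 - 1)) *
        onClasses (fun g => γ.1 g * γ'.1 g⁻¹) d.2) x := by
    intro x
    have e : (cycProd (fun d => onClasses (fun g => γ.1 g * γ'.1 g⁻¹) d.2) x : ℂ) =
        cycProd (fun d => onClasses γ.1 d.2) x * cycProd (fun d => onClasses γ'.1 d.2) x⁻¹ := by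
      rw [cycProd_onClasses_inv γ'.conj]
      exact cycProd_mul (fun d => onClasses γ.1 d.2) (fun d => onClasses (fun g => γ'.1 g⁻¹) d.2) x
    have e' := cycProd_mul (fun d => (1 + (-1 : ℂ) ^ (d.1 - 1)))
      (fun d => onClasses (fun g => γ.1 g * γ'.1 g⁻¹) d.2) x
    rw [normChar_eq_spinExp, normChar_eq_spinExp, spinExp, spinExp, spinCharW_inv]
    refine Eq.trans ?_ e'.symm
    rw [e, ← spinCharW_sq]
    unfold IrrChar.onCyc
    ring
  have hcl : ∀ g h, γ.1 (h * g * h⁻¹) * γ'.1 (h * g * h⁻¹)⁻¹ = γ.1 g * γ'.1 g⁻¹ := by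
    intro g h
    rw [γ.conj, ← γ'.conj g⁻¹ h]
    congr 2
    group
  rw [form_eq_sum, Finset.sum_congr rfl fun x _ => h1 x, sum_cycProd_eq_avg]
  have h2 : ∀ d : ℕ × ConjClasses Γ, avg (fun h => (1 + (-1 : ℂ) ^ (d.1 - 1)) *
      onClasses (fun g => γ.1 g * γ'.1 g⁻¹) (ConjClasses.mk h)) =
      (1 + (-1) ^ (d.1 - 1)) * if γ = γ' then 1 else 0 := by
    intro d
    have := Fintype.ofFinite Γ
    rw [← avg_irrChar_mul, avg, avg, finsum_eq_sum_of_fintype, finsum_eq_sum_of_fintype,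
      ← Finset.mul_sum, mul_left_comm]
    congr 2
    exact Finset.sum_congr rfl fun g _ => onClasses_mk hcl g
  simp only [h2]
  by_cases hγ : γ = γ'
  · simp only [if_pos hγ, mul_one]
    exact avg_cycProd_one_add n
  · simp only [if_neg hγ, mul_zero]
    rcases n with _ | n
    · simp only [cycProd_zero, Finset.sum_const, Finset.card_univ, ← Nat.card_eq_fintype_card,
        nsmul_eq_mul, mul_one, if_true]
      exact inv_mul_cancel₀ card_wreath_ne_zero
    · rw [if_neg (Nat.succ_ne_zero n), Finset.sum_eq_zero, mul_zero]
      intro x _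
      exact Finset.prod_eq_zero (Finset.mem_univ ⟦0⟧) rfl

end Norms

/-! ### Separation of spin class functions -/

section Separation

variable {Γ : Type*} [Group Γ] [Finite Γ] {n : ℕ}

/-- As a function of the weights the pairing is a polynomial, so all its coefficients vanish. The
coefficient at a cycle type is a positive multiple of the basic spin character times `g` at any
element of that type, and the character is nonzero there when all cycles are odd. Elements with an
even cycle are covered by `superSpin_of_even_cycle`. -/
theorem eq_zero_of_form_spinExp {f : Wreath Γ n → ℂ} (hf : f ∈ superSpin Γ n)
    (h : ∀ X, form f (spinExp X n) = 0) : f = 0 := by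
  classical
  have hg : (fun x => f x⁻¹) ∈ superSpin Γ n := by
    refine ⟨fun x y => ?_, fun x => ?_, fun x hx => ?_⟩
    · simp only
      rw [← hf.1 x⁻¹ y]; congr 1; group
    · simp only
      rw [← hf.2.1, mul_inv_rev, wreathZ_inv, wreathZ_comm]
    · exact superSpin_of_odd hf (by rw [map_inv, wreathParity_apply, hx]; rfl)
  suffices hs : ∀ x, f x⁻¹ = 0 from funext fun x => by simpa using hs x⁻¹
  set g : Wreath Γ n → ℂ := fun x => f x⁻¹ with hgdef
  let P : MvPolynomial (ℕ × ConjClasses Γ) ℂ :=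
    ∑ x : Wreath Γ n, MvPolynomial.C (spinCharW x * g x) * MvPolynomial.monomial (cycleCount x) 1
  have hP : P = 0 := by
    refine MvPolynomial.funext fun X => ?_
    have hX := h X
    rw [form_comm, form_eq_sum, mul_eq_zero, or_iff_right (inv_ne_zero card_wreath_ne_zero)] at hX
    rw [map_zero, ← hX, map_sum]
    refine Finset.sum_congr rfl fun x _ => ?_
    rw [map_mul, MvPolynomial.eval_C, monomial_cycleCount]
    have : MvPolynomial.eval X (cycProd MvPolynomial.X x) = cycProd X x := by
      refine (map_cycProd (MvPolynomial.eval X : MvPolynomial _ ℂ →* ℂ) MvPolynomial.X x).trans ?_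
      simp
    rw [this, spinExp]
    ring
  intro x₀
  by_cases hev : ∃ i, Even (cyc x₀ i).1
  · obtain ⟨i, hi⟩ := hev
    exact superSpin_of_even_cycle hg hi
  push Not at hev
  have h1 := congrArg (MvPolynomial.coeff (cycleCount x₀)) hP
  simp only [P, MvPolynomial.coeff_sum, MvPolynomial.coeff_C_mul, MvPolynomial.coeff_monomial,
    MvPolynomial.coeff_zero, mul_ite, mul_one, mul_zero] at h1
  rw [← Finset.sum_filter] at h1
  -- Elements of the same type are conjugate only up to `z`, but `z` changes the sign of both
  -- factors.
  have h2 : ∀ x ∈ Finset.univ.filter fun x : Wreath Γ n => cycleCount x = cycleCount x₀,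
      spinCharW x * g x = spinCharW x₀ * g x₀ := by
    intro x hx
    obtain ⟨u, hu⟩ := conjModZ_iff.1 (conjModZ_of_cycleCount n (Finset.mem_filter.1 hx).2)
    rw [← superSpin_conj hg x u, ← superSpin_conj spinCharW_mem x u]
    rcases hu with hu | hu
    · rw [hu]
    · rw [hu, superSpin_wreathZ_mul hg, superSpin_wreathZ_mul spinCharW_mem, neg_mul_neg]
  rw [Finset.sum_congr rfl h2, Finset.sum_const, nsmul_eq_mul, mul_eq_zero] at h1
  rcases h1 with h1 | h1
  · rw [Nat.cast_eq_zero, Finset.card_eq_zero] at h1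
    have hx : x₀ ∈ Finset.univ.filter fun x : Wreath Γ n => cycleCount x = cycleCount x₀ := by simp
    rw [h1] at hx
    exact absurd hx (Finset.notMem_empty _)
  rcases mul_eq_zero.1 h1 with h1 | h1
  · exfalso
    have h3 := spinCharW_sq x₀
    rw [h1, zero_mul] at h3
    obtain ⟨q, _, hq⟩ := Finset.prod_eq_zero_iff.1 h3.symm
    have hodd := Nat.not_even_iff_odd.1 (hev q.out)
    simp only [(Nat.Odd.sub_odd hodd odd_one).neg_one_pow] at hq
    norm_num at hq
  · exact h1

end Separation

/-! ### The ring `R^-_Γ` -/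

section Ring

variable {Γ : Type*} [Group Γ] [Finite Γ]

omit [Finite Γ] in
theorem RMinus.exists_bound (F : RMinus Γ) : ∃ N, ∀ n, N ≤ n → F.1 n = 0 := by
  obtain ⟨N, hN⟩ := F.2.2.bddAbove
  refine ⟨N + 1, fun n hn => ?_⟩
  by_contra hc
  have := hN (show n ∈ {n | F.1 n ≠ 0} from hc)
  omega

omit [Finite Γ] in
theorem mem_RMinus_of_bound {F : GradedFun Γ} (h : ∀ n, F n ∈ superSpin Γ n) {N : ℕ}
    (hN : ∀ n, N ≤ n → F n = 0) : F ∈ RMinus Γ :=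
  ⟨h, (Set.finite_lt_nat N).subset fun n hn => by
    by_contra hc
    exact hn (hN n (not_lt.1 hc))⟩

omit [Finite Γ] in
theorem outer_zero_left {a b m : ℕ} (h : a + b = m) (g : Wreath Γ b → ℂ) : outer h 0 g = 0 := by
  funext w; simp [outer]

omit [Finite Γ] in
theorem outer_zero_right {a b m : ℕ} (h : a + b = m) (f : Wreath Γ a → ℂ) : outer h f 0 = 0 := by
  funext w; simp [outer]

omit [Finite Γ] in
theorem indProd_zero_left {a b m : ℕ} (h : a + b = m) (g : Wreath Γ b → ℂ) :
    indProd h 0 g = 0 := by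
  funext w; simp [indProd, outer_zero_left]

omit [Finite Γ] in
theorem indProd_zero_right {a b m : ℕ} (h : a + b = m) (f : Wreath Γ a → ℂ) :
    indProd h f 0 = 0 := by
  funext w; simp [indProd, outer_zero_right]

theorem gradedMul_mem {F G : GradedFun Γ} (hF : F ∈ RMinus Γ) (hG : G ∈ RMinus Γ) :
    gradedMul F G ∈ RMinus Γ := by
  obtain ⟨N, hN⟩ := RMinus.exists_bound ⟨F, hF⟩
  obtain ⟨M, hM⟩ := RMinus.exists_bound ⟨G, hG⟩
  refine mem_RMinus_of_bound (N := N + M)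
    (fun n => Submodule.sum_mem _ fun p _ => indProd_mem _ (hF.1 _) (hG.1 _)) fun n hn => ?_
  refine Finset.sum_eq_zero fun p _ => ?_
  have hp := Finset.HasAntidiagonal.mem_antidiagonal.1 p.2
  by_cases h : N ≤ p.1.1
  · have : F p.1.1 = 0 := hN _ h
    rw [this, indProd_zero_left]
  · have : G p.1.2 = 0 := hM _ (by omega)
    rw [this, indProd_zero_right]

omit [Finite Γ] in
theorem gradedOne_apply_zero : gradedOne Γ 0 = spinCharW := by
  funext x
  have hx : x = 1 ∨ x = wreathZ Γ 0 := by
    have := eq_or_eq_wreathZ_mul (x := x) (y := 1) (fun i => i.elim0) (Subsingleton.elim _ _)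
    rwa [mul_one] at this
  have h1 : spinCharW (1 : Wreath Γ 0) = 1 := by
    simp [spinCharW, spinChar, Matrix.trace]
  have hz : wreathZ Γ 0 ≠ 1 := by simpa using wreathZ_mul_ne (1 : Wreath Γ 0)
  rcases hx with rfl | rfl
  · simp [gradedOne, h1]
  · have := superSpin_wreathZ_mul (spinCharW_mem (Γ := Γ)) (1 : Wreath Γ 0)
    rw [mul_one, h1] at this
    simp [gradedOne, hz, this]

omit [Finite Γ] in
theorem gradedOne_apply_succ (n : ℕ) : gradedOne Γ (n + 1) = 0 := by
  funext x; simp [gradedOne]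

omit [Finite Γ] in
theorem gradedOne_mem : gradedOne Γ ∈ RMinus Γ := by
  refine mem_RMinus_of_bound (N := 1) (fun n => ?_) fun n hn => ?_
  · rcases n with _ | n
    · rw [gradedOne_apply_zero]; exact spinCharW_mem
    · rw [gradedOne_apply_succ]; exact Submodule.zero_mem _
  · obtain ⟨n, rfl⟩ := Nat.exists_eq_succ_of_ne_zero (by omega : n ≠ 0)
    exact gradedOne_apply_succ n

/-- The pairings of `F` with the multiplicative spin class function of `X`, as a polynomial in a
variable which records the degree. -/
noncomputable def charPoly (X : ℕ × ConjClasses Γ → ℂ) : RMinus Γ →ₗ[ℂ] Polynomial ℂ where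
  toFun F := Polynomial.ofFinsupp (AddMonoidAlgebra.ofCoeff (Finsupp.ofSupportFinite
    (fun n => form (F.1 n) (spinExp X n))
    (F.2.2.subset fun n hn h0 => hn (by simp only [h0, form_zero_left]))))
  map_add' F G := by
    ext n
    rw [Polynomial.coeff_add]
    exact form_add_left _ _ _
  map_smul' c F := by
    ext n
    rw [Polynomial.coeff_smul]
    exact form_smul_left _ _ _

theorem coeff_charPoly (X : ℕ × ConjClasses Γ → ℂ) (F : RMinus Γ) (n : ℕ) :
    (charPoly X F).coeff n = form (F.1 n) (spinExp X n) := rfl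

/-- The maps `charPoly X` are jointly injective by separation in each degree. As they are
multiplicative, identities in `R^-_Γ` can be checked in a polynomial ring. -/
theorem eq_of_charPoly {F G : RMinus Γ} (h : ∀ X, charPoly X F = charPoly X G) : F = G := by
  rw [← sub_eq_zero]
  apply Subtype.ext
  funext n
  refine eq_zero_of_form_spinExp ((F - G).2.1 n) fun X => ?_
  rw [← coeff_charPoly, map_sub, h, sub_self, Polynomial.coeff_zero]

noncomputable instance : Mul (RMinus Γ) := ⟨fun F G => ⟨gradedMul F.1 G.1, gradedMul_mem F.2 G.2⟩⟩

noncomputable instance : One (RMinus Γ) := ⟨⟨gradedOne Γ, gradedOne_mem⟩⟩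

theorem RMinus.coe_mul (F G : RMinus Γ) : (F * G : RMinus Γ).1 = gradedMul F.1 G.1 := rfl

omit [Finite Γ] in
theorem RMinus.coe_one : (1 : RMinus Γ).1 = gradedOne Γ := rfl

theorem charPoly_mul (X : ℕ × ConjClasses Γ → ℂ) (F G : RMinus Γ) :
    charPoly X (F * G) = charPoly X F * charPoly X G := by
  ext n
  rw [Polynomial.coeff_mul, coeff_charPoly, RMinus.coe_mul, gradedMul, form_sum_left]
  simp only [form_indProd_spinExp, coeff_charPoly]
  exact Finset.sum_coe_sort (Finset.HasAntidiagonal.antidiagonal n) fun p =>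
    form (F.1 p.1) (spinExp X p.1) * form (G.1 p.2) (spinExp X p.2)

theorem form_spinCharW_zero (X : ℕ × ConjClasses Γ → ℂ) :
    form (spinCharW : Wreath Γ 0 → ℂ) (spinExp X 0) = 1 := by
  have h : ∀ x : Wreath Γ 0, spinCharW x * spinExp X 0 x⁻¹ = 1 := by
    intro x
    rw [spinExp, spinCharW_inv, cycProd_zero, mul_one, spinCharW_sq, cycProd_zero]
  rw [form_eq_sum, Finset.sum_congr rfl fun x _ => h x, Finset.sum_const, Finset.card_univ,
    ← Nat.card_eq_fintype_card, nsmul_eq_mul, mul_one, inv_mul_cancel₀ card_wreath_ne_zero]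

theorem charPoly_one (X : ℕ × ConjClasses Γ → ℂ) : charPoly X (1 : RMinus Γ) = 1 := by
  ext n
  rw [coeff_charPoly, RMinus.coe_one, Polynomial.coeff_one]
  rcases n with _ | n
  · rw [gradedOne_apply_zero, form_spinCharW_zero, if_pos rfl]
  · rw [gradedOne_apply_succ, form_zero_left, if_neg (Nat.succ_ne_zero n)]

/-- The axioms are pulled back along the family `charPoly X`; in particular associativity and
commutativity need no direct analysis of iterated induction. -/
noncomputable instance : CommRing (RMinus Γ) where
  left_distrib F G H := eq_of_charPoly fun X => by
    simp only [charPoly_mul, map_add, mul_add]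
  right_distrib F G H := eq_of_charPoly fun X => by
    simp only [charPoly_mul, map_add, add_mul]
  zero_mul F := eq_of_charPoly fun X => by rw [charPoly_mul, map_zero, zero_mul]
  mul_zero F := eq_of_charPoly fun X => by rw [charPoly_mul, map_zero, mul_zero]
  mul_assoc F G H := eq_of_charPoly fun X => by simp only [charPoly_mul, mul_assoc]
  one_mul F := eq_of_charPoly fun X => by rw [charPoly_mul, charPoly_one, one_mul]
  mul_one F := eq_of_charPoly fun X => by rw [charPoly_mul, charPoly_one, mul_one]
  mul_comm F G := eq_of_charPoly fun X => by rw [charPoly_mul, charPoly_mul, mul_comm]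
  neg_add_cancel F := neg_add_cancel F
  zsmul := fun n F => n • F
  zsmul_zero' F := zero_zsmul F
  zsmul_succ' n F := SubNegMonoid.zsmul_succ' n F
  zsmul_neg' n F := SubNegMonoid.zsmul_neg' n F
  sub_eq_add_neg := sub_eq_add_neg
  nsmul := fun n F => n • F
  nsmul_zero F := zero_nsmul F
  nsmul_succ n F := succ_nsmul F n

noncomputable instance : Algebra ℂ (RMinus Γ) :=
  Algebra.ofModule
    (fun c F G => eq_of_charPoly fun X => by
      rw [charPoly_mul, map_smul, map_smul, charPoly_mul, smul_mul_assoc])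
    (fun c F G => eq_of_charPoly fun X => by
      rw [charPoly_mul, map_smul, map_smul, charPoly_mul, mul_smul_comm])

/-- The spin class function `f n` in degree `n`. -/
noncomputable def degElt (f : GradedFun Γ) (hf : ∀ k, f k ∈ superSpin Γ k) (n : ℕ) : RMinus Γ :=
  ⟨fun k => if k = n then f k else 0, mem_RMinus_of_bound (N := n + 1)
    (fun k => by split_ifs; exacts [hf k, Submodule.zero_mem _])
    (fun k hk => if_neg (by omega))⟩

/-- The multiplicative spin class function of `X` in degree `n`. -/
noncomputable def expElt (X : ℕ × ConjClasses Γ → ℂ) (n : ℕ) : RMinus Γ :=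
  degElt (spinExp X) (spinExp_mem X) n

omit [Finite Γ] in
theorem expElt_apply (X : ℕ × ConjClasses Γ → ℂ) (n k : ℕ) :
    (expElt X n).1 k = if k = n then spinExp X k else 0 := rfl

omit [Finite Γ] in
theorem expElt_apply_self (X : ℕ × ConjClasses Γ → ℂ) (n : ℕ) :
    (expElt X n).1 n = spinExp X n := if_pos rfl

theorem expElt_mul_apply (X : ℕ × ConjClasses Γ → ℂ) {a c m : ℕ} (h : a + c = m) (F : RMinus Γ) :
    (expElt X a * F).1 m = indProd h (spinExp X a) (F.1 c) := by
  subst h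
  rw [RMinus.coe_mul, gradedMul, Finset.sum_eq_single
    (⟨(a, c), Finset.HasAntidiagonal.mem_antidiagonal.2 rfl⟩ :
      {p // p ∈ Finset.HasAntidiagonal.antidiagonal (a + c)})]
  · simp only [expElt_apply_self]
  · rintro ⟨⟨i, j⟩, hij⟩ _ hne
    have h := Finset.HasAntidiagonal.mem_antidiagonal.1 hij
    rw [expElt_apply, if_neg, indProd_zero_left]
    intro hi
    apply hne
    simp only at h hi
    simp only [Subtype.mk.injEq, Prod.mk.injEq]
    omega
  · intro h; exact absurd (Finset.mem_univ _) h

theorem expElt_mul_apply_of_lt (X : ℕ × ConjClasses Γ → ℂ) {a p : ℕ} (h : p < a) (F : RMinus Γ) :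
    (expElt X a * F).1 p = 0 := by
  rw [RMinus.coe_mul, gradedMul]
  refine Finset.sum_eq_zero fun q _ => ?_
  have := Finset.HasAntidiagonal.mem_antidiagonal.1 q.2
  rw [expElt_apply, if_neg (by omega), indProd_zero_left]

omit [Finite Γ] in
theorem expElt_zero (X : ℕ × ConjClasses Γ → ℂ) : expElt X 0 = 1 := by
  apply Subtype.ext
  funext k
  rw [RMinus.coe_one, expElt_apply]
  rcases k with _ | k
  · rw [if_pos rfl, gradedOne_apply_zero]
    funext x
    rw [spinExp, cycProd_zero, mul_one]
  · rw [if_neg (Nat.succ_ne_zero k), gradedOne_apply_succ]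

/-- This is `sum_indProd_mul_cycProd` with the basic spin character as common factor; it plays the
role of the exponential law. -/
theorem expElt_add (X Y : ℕ × ConjClasses Γ → ℂ) (n : ℕ) :
    expElt (X + Y) n = ∑ p ∈ Finset.HasAntidiagonal.antidiagonal n, expElt X p.1 * expElt Y p.2 := by
  apply Subtype.ext
  funext k
  rw [AddSubmonoidClass.coe_finsetSum, Finset.sum_apply, expElt_apply]
  split_ifs with hk
  · subst hk
    funext w
    have := sum_indProd_mul_cycProd (Γ := Γ) (fun _ => spinCharW)
      (fun n x y => superSpin_conj spinCharW_mem x y)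
      (fun a b x y => by
        rw [superSpin_wreathZ_mul spinCharW_mem, superSpin_wreathZ_mul spinCharW_mem, neg_mul_neg])
      (fun a b m h x y => spinCharW_spinMul h x y) X Y w
    rw [spinExp, ← this, Finset.sum_apply,
      ← Finset.sum_coe_sort (Finset.HasAntidiagonal.antidiagonal k)
        (fun p => (expElt X p.1 * expElt Y p.2).1 k w)]
    refine Finset.sum_congr rfl fun p _ => ?_
    have h := Finset.HasAntidiagonal.mem_antidiagonal.1 p.2
    rw [expElt_mul_apply X h, expElt_apply_self]
    rfl
  · symm
    refine Finset.sum_eq_zero fun p hp => ?_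
    have h := Finset.HasAntidiagonal.mem_antidiagonal.1 hp
    by_cases hlt : k < p.1
    · exact expElt_mul_apply_of_lt X hlt _
    · obtain ⟨c, rfl⟩ := Nat.exists_eq_add_of_le (not_lt.1 hlt)
      rw [expElt_mul_apply X rfl, expElt_apply, if_neg (by omega), indProd_zero_right]

omit [Finite Γ] in
theorem cycProd_pow_fst {n : ℕ} (t : ℂ) (x : Wreath Γ n) : cycProd (fun d => t ^ d.1) x = t ^ n := by
  induction n, x using cycle_induction with
  | conj n u x h => rwa [cycProd_conj] at h
  | zero x => rw [cycProd_zero, pow_zero]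
  | mul a b m h x₁ x₂ h1 h2 =>
    rw [cycProd_spinMul, h2, h1.cycProd _ (Fin.last a), h1.cyc_fst, ← h, pow_add _ (a + 1)]

-- The cycle lengths add up to `n`, so the extra weights multiply to `t ^ n`.
omit [Finite Γ] in
theorem expElt_pow_mul (t : ℂ) (X : ℕ × ConjClasses Γ → ℂ) (n : ℕ) :
    expElt (fun d => t ^ d.1 * X d) n = t ^ n • expElt X n := by
  apply Subtype.ext
  funext k
  change _ = t ^ n • (expElt X n).1 k
  rw [expElt_apply, expElt_apply]
  split_ifs with hk
  · subst hk
    funext x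
    have := cycProd_mul (fun d => t ^ d.1) X x
    rw [spinExp, Pi.smul_apply, spinExp, smul_eq_mul]
    change spinCharW x * cycProd ((fun d => t ^ d.1) * X) x = _
    rw [this, cycProd_pow_fst]
    ring
  · rw [smul_zero]

-- An element with an even cycle is killed by the basic spin character. In positive degree any other
-- element has a cycle of odd length, whose weight is zero.
omit [Finite Γ] in
theorem expElt_of_odd_eq_zero {X : ℕ × ConjClasses Γ → ℂ} (hX : ∀ d, Odd d.1 → X d = 0) {n : ℕ}
    (hn : n ≠ 0) : expElt X n = 0 := by
  apply Subtype.ext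
  funext k
  rw [expElt_apply]
  split_ifs with hk
  · subst hk
    funext x
    change spinCharW x * cycProd X x = 0
    obtain ⟨k, rfl⟩ := Nat.exists_eq_succ_of_ne_zero hn
    by_cases hev : ∃ i, Even (cyc x i).1
    · obtain ⟨i, hi⟩ := hev
      rw [superSpin_of_even_cycle spinCharW_mem hi, zero_mul]
    · push Not at hev
      have : cycProd X x = 0 := Finset.prod_eq_zero (Finset.mem_univ ⟦0⟧)
        (hX _ (Nat.not_even_iff_odd.1 (hev _)))
      rw [this, mul_zero]
  · rfl

end Ring

/-! ### The bilinear form and the adjoint operators -/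

section Adjoint

variable {Γ : Type*} [Group Γ] [Finite Γ]

theorem gradedForm_eq_sum {F G : GradedFun Γ} {N : ℕ} (hN : ∀ n, N ≤ n → F n = 0) :
    gradedForm F G = ∑ n ∈ Finset.range N, form (F n) (G n) := by
  refine finsum_eq_sum_of_support_subset _ fun n hn => ?_
  rw [Finset.coe_range, Set.mem_Iio]
  by_contra hc
  exact hn (by simp only [hN n (not_lt.1 hc), form_zero_left])

theorem gradedForm_comm (F G : GradedFun Γ) : gradedForm F G = gradedForm G F := by
  simp only [gradedForm, form_comm]

theorem gradedForm_add_left (F F' G : RMinus Γ) :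
    gradedForm (F + F').1 G.1 = gradedForm F.1 G.1 + gradedForm F'.1 G.1 := by
  obtain ⟨N, hN⟩ := RMinus.exists_bound F
  obtain ⟨M, hM⟩ := RMinus.exists_bound F'
  rw [gradedForm_eq_sum (F := F.1) (N := N + M) fun n hn => hN n (by omega),
    gradedForm_eq_sum (F := F'.1) (N := N + M) fun n hn => hM n (by omega),
    gradedForm_eq_sum (F := (F + F').1) (N := N + M), ← Finset.sum_add_distrib]
  · exact Finset.sum_congr rfl fun n _ => form_add_left _ _ _
  · intro n hn
    change F.1 n + F'.1 n = 0
    rw [hN n (by omega), hM n (by omega), add_zero]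

theorem gradedForm_smul_left (c : ℂ) (F G : RMinus Γ) :
    gradedForm (c • F).1 G.1 = c * gradedForm F.1 G.1 := by
  obtain ⟨N, hN⟩ := RMinus.exists_bound F
  rw [gradedForm_eq_sum hN, gradedForm_eq_sum (F := (c • F).1) (N := N), Finset.mul_sum]
  · exact Finset.sum_congr rfl fun n _ => form_smul_left _ _ _
  · intro n hn
    change c • F.1 n = 0
    rw [hN n hn, smul_zero]

/-- The bilinear form of `R^-_Γ`. -/
noncomputable def rForm (Γ : Type*) [Group Γ] [Finite Γ] : LinearMap.BilinForm ℂ (RMinus Γ) :=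
  LinearMap.mk₂ ℂ (fun F G => gradedForm F.1 G.1) gradedForm_add_left gradedForm_smul_left
    (fun F G G' => by
      rw [gradedForm_comm, gradedForm_add_left, gradedForm_comm G.1, gradedForm_comm G'.1])
    (fun c F G => by rw [gradedForm_comm, gradedForm_smul_left, gradedForm_comm G.1, smul_eq_mul])

theorem rForm_apply (F G : RMinus Γ) : rForm Γ F G = gradedForm F.1 G.1 := rfl

theorem rForm_comm (F G : RMinus Γ) : rForm Γ F G = rForm Γ G F := gradedForm_comm _ _

theorem rForm_degElt (F : RMinus Γ) (f : GradedFun Γ) (hf : ∀ k, f k ∈ superSpin Γ k) (n : ℕ) :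
    rForm Γ F (degElt f hf n) = form (F.1 n) (f n) := by
  rw [rForm_apply, gradedForm, finsum_eq_single _ n]
  · simp [degElt]
  · intro k hk
    rw [form_comm]
    simp [degElt, hk, form_zero_left]

theorem rForm_expElt (F : RMinus Γ) (X : ℕ × ConjClasses Γ → ℂ) (n : ℕ) :
    rForm Γ F (expElt X n) = form (F.1 n) (spinExp X n) := rForm_degElt F _ _ n

theorem eq_of_rForm_expElt {F G : RMinus Γ}
    (h : ∀ X n, rForm Γ F (expElt X n) = rForm Γ G (expElt X n)) : F = G :=
  eq_of_charPoly fun X => by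
    ext n
    rw [coeff_charPoly, coeff_charPoly, ← rForm_expElt, ← rForm_expElt, h]

theorem eq_of_rForm {F G : RMinus Γ} (h : ∀ K, rForm Γ F K = rForm Γ G K) : F = G :=
  eq_of_rForm_expElt fun _ _ => h _

theorem rForm_mul_expElt (F G : RMinus Γ) (X : ℕ × ConjClasses Γ → ℂ) (n : ℕ) :
    rForm Γ (F * G) (expElt X n) = ∑ p ∈ Finset.HasAntidiagonal.antidiagonal n,
      rForm Γ F (expElt X p.1) * rForm Γ G (expElt X p.2) := by
  simp only [rForm_expElt, ← coeff_charPoly]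
  rw [charPoly_mul, Polynomial.coeff_mul]

theorem rForm_expElt_of_ne (X Y : ℕ × ConjClasses Γ → ℂ) {a b : ℕ} (h : a ≠ b) :
    rForm Γ (expElt X a) (expElt Y b) = 0 := by
  rw [rForm_expElt, expElt_apply, if_neg h.symm, form_zero_left]

theorem rForm_one_one : rForm Γ 1 1 = 1 := by
  conv_lhs => rw [← expElt_zero (fun _ => 0), rForm_expElt, expElt_apply_self]
  convert form_spinCharW_zero (Γ := Γ) (fun _ => 0) using 2
  funext x
  rw [spinExp, cycProd_zero, mul_one]

theorem skew_add {a b m : ℕ} (h : a + b = m) (u : Wreath Γ a → ℂ) (f g : Wreath Γ m → ℂ) :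
    skew h u (f + g) = skew h u f + skew h u g :=
  funext fun y => map_add (formBilin Γ a u) (fun x => f (spinMul h (x, y)))
    fun x => g (spinMul h (x, y))

theorem skew_smul {a b m : ℕ} (h : a + b = m) (u : Wreath Γ a → ℂ) (c : ℂ) (f : Wreath Γ m → ℂ) :
    skew h u (c • f) = c • skew h u f :=
  funext fun y => map_smul (formBilin Γ a u) c fun x => f (spinMul h (x, y))

/-- The adjoint of multiplication by `expElt X a`: restriction, followed by the pairing of the
first factor with the multiplicative spin class function of `X`. -/
noncomputable def lower (X : ℕ × ConjClasses Γ → ℂ) (a : ℕ) : RMinus Γ →ₗ[ℂ] RMinus Γ where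
  toFun F := ⟨fun c => skew rfl (spinExp X a) (F.1 (a + c)), by
    obtain ⟨N, hN⟩ := RMinus.exists_bound F
    refine mem_RMinus_of_bound (N := N) (fun c => skew_mem _ (spinExp_mem X a) (F.2.1 _)) ?_
    intro c hc
    funext y
    rw [skew, hN (a + c) (by omega), form_comm]
    exact form_zero_left _⟩
  map_add' F G := Subtype.ext (funext fun c => skew_add rfl _ (F.1 (a + c)) (G.1 (a + c)))
  map_smul' r F := Subtype.ext (funext fun c => skew_smul rfl _ r (F.1 (a + c)))

theorem lower_apply (X : ℕ × ConjClasses Γ → ℂ) (a : ℕ) (F : RMinus Γ) (c : ℕ) :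
    (lower X a F).1 c = skew rfl (spinExp X a) (F.1 (a + c)) := rfl

theorem lower_of_bound (X : ℕ × ConjClasses Γ → ℂ) {F : RMinus Γ} {N : ℕ}
    (hN : ∀ n, N ≤ n → F.1 n = 0) (a c : ℕ) (hc : N ≤ a + c) : (lower X a F).1 c = 0 := by
  funext y
  rw [lower_apply, skew, hN _ hc, form_comm]
  exact form_zero_left _

theorem lower_eq_zero (X : ℕ × ConjClasses Γ → ℂ) {F : RMinus Γ} {N : ℕ}
    (hN : ∀ n, N ≤ n → F.1 n = 0) {a : ℕ} (ha : N ≤ a) : lower X a F = 0 :=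
  Subtype.ext (funext fun c => lower_of_bound X hN a c (by omega))

theorem rForm_expElt_mul (X : ℕ × ConjClasses Γ → ℂ) (a : ℕ) (F G : RMinus Γ) :
    rForm Γ (expElt X a * F) G = rForm Γ F (lower X a G) := by
  obtain ⟨N, hN⟩ := RMinus.exists_bound F
  have h1 : ∀ n, a + N ≤ n → (expElt X a * F).1 n = 0 := by
    intro n hn
    obtain ⟨c, rfl⟩ := Nat.exists_eq_add_of_le (show a ≤ n by omega)
    rw [expElt_mul_apply X rfl, hN c (by omega), indProd_zero_right]
  rw [rForm_apply, rForm_apply, gradedForm_eq_sum h1, gradedForm_eq_sum hN,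
    Finset.sum_range_add, Finset.sum_eq_zero, zero_add]
  · refine Finset.sum_congr rfl fun c _ => ?_
    rw [expElt_mul_apply X rfl, form_indProd_skew rfl (spinExp_mem X a) (G.2.1 _), lower_apply]
  · intro n hn
    rw [expElt_mul_apply_of_lt X (Finset.mem_range.1 hn), form_zero_left]

theorem rForm_lower (X : ℕ × ConjClasses Γ → ℂ) (a : ℕ) (F G : RMinus Γ) :
    rForm Γ (lower X a F) G = rForm Γ F (expElt X a * G) := by
  rw [rForm_comm, ← rForm_expElt_mul, rForm_comm]

theorem lower_zero (X : ℕ × ConjClasses Γ → ℂ) (F : RMinus Γ) : lower X 0 F = F :=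
  eq_of_rForm fun K => by rw [rForm_lower, expElt_zero, one_mul]

/-- By `rForm_mul_expElt` the family `expElt Y` behaves like a group-like element for the coproduct
dual to multiplication. For degree reasons only the component in degrees `(b, n - b)` contributes.
-/
theorem lower_expElt (X Y : ℕ × ConjClasses Γ → ℂ) (b n : ℕ) :
    lower X b (expElt Y n) =
      if b ≤ n then rForm Γ (expElt X b) (expElt Y b) • expElt Y (n - b) else 0 :=
  eq_of_rForm fun K => by
    rw [rForm_lower, rForm_comm, rForm_mul_expElt]
    split_ifs with h
    · rw [Finset.sum_eq_single (b, n - b)]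
      · rw [map_smul, LinearMap.smul_apply, smul_eq_mul, rForm_comm K]
      · rintro ⟨i, j⟩ hij hne
        have := Finset.HasAntidiagonal.mem_antidiagonal.1 hij
        rw [rForm_expElt_of_ne, zero_mul]
        rintro rfl
        apply hne
        simp only at this
        simp only [Prod.mk.injEq, true_and]
        omega
      · intro hc
        exact absurd (Finset.HasAntidiagonal.mem_antidiagonal.2 (by simp only; omega)) hc
    · rw [map_zero, LinearMap.zero_apply]
      refine Finset.sum_eq_zero fun p hp => ?_
      have := Finset.HasAntidiagonal.mem_antidiagonal.1 hp
      rw [rForm_expElt_of_ne X Y (by omega), zero_mul]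

/-- The sum over all degrees of the pairings with a multiplicative spin class function. -/
noncomputable def charEval (X : ℕ × ConjClasses Γ → ℂ) : RMinus Γ →ₗ[ℂ] ℂ :=
  (Polynomial.leval 1).comp (charPoly X)

theorem charEval_mul (X : ℕ × ConjClasses Γ → ℂ) (F G : RMinus Γ) :
    charEval X (F * G) = charEval X F * charEval X G := by
  simp only [charEval, LinearMap.comp_apply, charPoly_mul, Polynomial.leval_apply,
    Polynomial.eval_mul]

theorem charEval_eq_sum (X : ℕ × ConjClasses Γ → ℂ) {F : RMinus Γ} {N : ℕ}
    (hN : ∀ n, N ≤ n → F.1 n = 0) :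
    charEval X F = ∑ n ∈ Finset.range N, rForm Γ F (expElt X n) := by
  have hc : ∀ n, N ≤ n → (charPoly X F).coeff n = 0 := fun n hn => by
    rw [coeff_charPoly, hN n hn, form_zero_left]
  rw [charEval, LinearMap.comp_apply, Polynomial.leval_apply, Polynomial.eval_eq_sum,
    Polynomial.sum_over_range' _ (by simp) (N + 1) (Nat.lt_succ_of_le
      (Polynomial.natDegree_le_iff_coeff_eq_zero.2 fun n hn => hc n hn.le)),
    Finset.sum_range_succ, hc N le_rfl, zero_mul, add_zero]
  simp [coeff_charPoly, rForm_expElt]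

theorem charEval_pow_mul (t : ℂ) (X : ℕ × ConjClasses Γ → ℂ) (F : RMinus Γ) :
    charEval (fun d => t ^ d.1 * X d) F = (charPoly X F).eval t := by
  rw [charEval, LinearMap.comp_apply, Polynomial.leval_apply]
  have : charPoly (fun d => t ^ d.1 * X d) F = (charPoly X F).comp (Polynomial.C t * Polynomial.X) := by
    ext n
    rw [Polynomial.comp_C_mul_X_coeff, coeff_charPoly, coeff_charPoly, ← rForm_expElt,
      ← rForm_expElt, expElt_pow_mul, map_smul, smul_eq_mul, mul_comm]
  rw [this, Polynomial.eval_comp]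
  simp

theorem eq_of_charEval {F G : RMinus Γ} (h : ∀ X, charEval X F = charEval X G) : F = G :=
  eq_of_charPoly fun X => Polynomial.funext fun t => by
    rw [← charEval_pow_mul, ← charEval_pow_mul, h]

/-- The exponential law splits `expElt` of the sum into products, the factor belonging to `X` scales
by `t ^ b`, and moving that factor across the form gives `lower X b`. -/
theorem charEval_pow_mul_add (X Y : ℕ × ConjClasses Γ → ℂ) (t : ℂ) {F : RMinus Γ} {N : ℕ}
    (hN : ∀ n, N ≤ n → F.1 n = 0) :
    charEval ((fun d => t ^ d.1 * X d) + Y) F =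
      ∑ b ∈ Finset.range N, t ^ b * charEval Y (lower X b F) := by
  have h1 : ∀ b ∈ Finset.range N, t ^ b * charEval Y (lower X b F) =
      ∑ c ∈ Finset.range (N - b), t ^ b * rForm Γ (lower X b F) (expElt Y c) := by
    intro b _
    rw [← Finset.mul_sum, charEval_eq_sum Y (F := lower X b F) (N := N - b)]
    intro n hn
    exact lower_of_bound X hN b n (by omega)
  rw [Finset.sum_congr rfl h1, ← Finset.sum_range_diag_flip, charEval_eq_sum _ hN]
  refine Finset.sum_congr rfl fun n _ => ?_
  rw [expElt_add, map_sum, Finset.Nat.sum_antidiagonal_eq_sum_range_succ_mk]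
  refine Finset.sum_congr rfl fun b _ => ?_
  rw [expElt_pow_mul, smul_mul_assoc, map_smul, rForm_lower, smul_eq_mul]

/-- Evaluation at the weight `t^d X + Y` is multiplicative for every `t`. By `charEval_pow_mul_add`
it is a polynomial in `t` with the adjoint operators in its coefficients, and the coefficient of `t
^ b` in the product is the Leibniz rule. -/
theorem lower_mul (X : ℕ × ConjClasses Γ → ℂ) (b : ℕ) (F G : RMinus Γ) :
    lower X b (F * G) = ∑ p ∈ Finset.HasAntidiagonal.antidiagonal b, lower X p.1 F * lower X p.2 G := by
  obtain ⟨N₁, h₁⟩ := RMinus.exists_bound F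
  obtain ⟨N₂, h₂⟩ := RMinus.exists_bound G
  obtain ⟨N₃, h₃⟩ := RMinus.exists_bound (F * G)
  set N := N₁ + N₂ + N₃ with hN
  refine eq_of_charEval fun Y => ?_
  let Q : RMinus Γ → Polynomial ℂ := fun K =>
    ∑ b ∈ Finset.range N, Polynomial.monomial b (charEval Y (lower X b K))
  have hQ : ∀ K : RMinus Γ, (∀ n, N ≤ n → K.1 n = 0) → ∀ b,
      (Q K).coeff b = charEval Y (lower X b K) := by
    intro K hK b
    simp only [Q, Polynomial.finsetSum_coeff, Polynomial.coeff_monomial]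
    rw [Finset.sum_ite_eq' (Finset.range N) b]
    split_ifs with hb
    · rfl
    · rw [lower_eq_zero X hK (by simpa using hb), map_zero]
  have hQe : ∀ K : RMinus Γ, (∀ n, N ≤ n → K.1 n = 0) → ∀ t,
      (Q K).eval t = charEval ((fun d => t ^ d.1 * X d) + Y) K := by
    intro K hK t
    rw [charEval_pow_mul_add X Y t hK]
    simp only [Q, Polynomial.eval_finsetSum, Polynomial.eval_monomial, mul_comm]
  have hmul : Q (F * G) = Q F * Q G := Polynomial.funext fun t => by
    rw [Polynomial.eval_mul, hQe F fun n hn => h₁ n (by omega),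
      hQe G fun n hn => h₂ n (by omega), hQe (F * G) fun n hn => h₃ n (by omega), charEval_mul]
  rw [← hQ (F * G) fun n hn => h₃ n (by omega), hmul, Polynomial.coeff_mul, map_sum]
  refine Finset.sum_congr rfl fun p _ => ?_
  rw [hQ F fun n hn => h₁ n (by omega), hQ G fun n hn => h₂ n (by omega), charEval_mul]

end Adjoint

/-! ### Twisted Fock spaces -/

section Fock

open Finset.HasAntidiagonal in
/-- A commutative algebra with generators `q γ n`, and adjoints `H γ n` of the multiplications
by them, which satisfy the relations of the twisted Heisenberg algebra. -/
structure TwistedFock (ι A : Type*) [CommRing A] [Algebra ℂ A] where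
  /-- The generators. -/
  q : ι → ℤ → A
  /-- The adjoints of the multiplications by generators. -/
  H : ι → ℤ → A →ₗ[ℂ] A
  /-- The bilinear form. -/
  form : LinearMap.BilinForm ℂ A
  q_zero : ∀ γ, q γ 0 = 1
  q_neg : ∀ γ n, n < 0 → q γ n = 0
  q_rel : ∀ γ (n : ℕ), n ≠ 0 → ∑ p ∈ antidiagonal n, (-1) ^ p.2 * (q γ p.1 * q γ p.2) = 0
  H_zero : ∀ γ F, H γ 0 F = F
  H_neg : ∀ γ n, n < 0 → H γ n = 0
  H_mul : ∀ γ (b : ℕ) F G, H γ b (F * G) = ∑ p ∈ antidiagonal b, H γ p.1 F * H γ p.2 G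
  H_q_self : ∀ γ (b : ℕ) n, H γ b (q γ n) = (if b = 0 then 1 else 2) * q γ (n - b)
  H_q_of_ne : ∀ γ γ', γ ≠ γ' → ∀ b : ℕ, b ≠ 0 → ∀ n, H γ b (q γ' n) = 0
  exists_bound : ∀ F, ∃ N : ℕ, ∀ γ (b : ℕ), N ≤ b → H γ b F = 0
  form_comm : ∀ F G, form F G = form G F
  form_H : ∀ γ n F G, form (H γ n F) G = form F (q γ n * G)
  form_one : form 1 1 = 1
  eq_of_form : ∀ F G, (∀ K, form F K = form G K) → F = G

variable {ι A : Type*} [CommRing A] [Algebra ℂ A]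

omit [Algebra ℂ A] in
theorem sum_range_antidiagonal {N M K : ℕ} (hK : N + M ≤ K) (f : ℕ → ℕ → A)
    (h1 : ∀ i j, N ≤ i → f i j = 0) (h2 : ∀ i j, M ≤ j → f i j = 0) :
    ∑ b ∈ Finset.range K, ∑ p ∈ Finset.HasAntidiagonal.antidiagonal b, f p.1 p.2 =
      ∑ i ∈ Finset.range N, ∑ j ∈ Finset.range M, f i j := by
  simp only [Finset.Nat.sum_antidiagonal_eq_sum_range_succ f]
  rw [Finset.sum_range_diag_flip]
  symm
  refine (Finset.sum_subset (Finset.range_mono (show N ≤ K by omega)) fun i _ hi =>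
    Finset.sum_eq_zero fun j _ => h1 i j (by simpa using hi)).trans ?_
  refine Finset.sum_congr rfl fun i hi => ?_
  by_cases hiN : N ≤ i
  · rw [Finset.sum_eq_zero fun j _ => h1 i j hiN, Finset.sum_eq_zero fun j _ => h1 i j hiN]
  · exact Finset.sum_subset (Finset.range_mono (by omega)) fun j _ hj => h2 i j (by simpa using hj)

/-- The coefficients `1, -2, 2, -2, …` of `(1 - X) / (1 + X)`. -/
def twistCoeff (i : ℕ) : ℤ := (-1) ^ i * if i = 0 then 1 else 2

theorem negOnePow_natCast (n : ℕ) : ((Int.negOnePow n : ℤˣ) : ℤ) = (-1) ^ n := by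
  simp [Int.negOnePow_def]

/-- The sign `(-1) ^ n`, for an integer `n`. -/
def intSign (n : ℤ) : ℤ := (n.negOnePow : ℤˣ)

theorem intSign_natCast (n : ℕ) : intSign n = (-1) ^ n := negOnePow_natCast n

theorem intSign_add (m n : ℤ) : intSign (m + n) = intSign m * intSign n := by
  simp [intSign, Int.negOnePow_add]

theorem intSign_neg (n : ℤ) : intSign (-n) = intSign n := by simp [intSign]

theorem intSign_mul_self (n : ℤ) : intSign n * intSign n = 1 := by
  rw [intSign, ← Units.val_mul, Int.units_mul_self, Units.val_one]

namespace TwistedFock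

variable (T : TwistedFock ι A) (γ : ι)

theorem form_q (n : ℤ) (F G : A) : T.form (T.q γ n * F) G = T.form F (T.H γ n G) := by
  rw [T.form_comm, ← T.form_H, T.form_comm]

theorem H_comm (γ' : ι) (m n : ℤ) (F : A) :
    T.H γ m (T.H γ' n F) = T.H γ' n (T.H γ m F) :=
  T.eq_of_form _ _ fun K => by simp only [T.form_H, mul_left_comm]

theorem H_one {b : ℕ} (hb : b ≠ 0) : T.H γ b 1 = 0 := by
  rw [← T.q_zero γ, T.H_q_self, T.q_neg γ (0 - b) (by omega), mul_zero]

/-- This is the adjoint of the quadratic relation among the generators. -/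
theorem H_rel {n : ℕ} (hn : n ≠ 0) (F : A) :
    ∑ p ∈ Finset.HasAntidiagonal.antidiagonal n,
      (-1) ^ p.2 * T.H γ p.1 (T.H γ p.2 F) = 0 := by
  refine T.eq_of_form _ _ fun K => ?_
  have h : ∀ p : ℕ × ℕ, T.form ((-1) ^ p.2 * T.H γ p.1 (T.H γ p.2 F)) K =
      T.form F ((-1) ^ p.2 * (T.q γ p.1 * T.q γ p.2) * K) := by
    intro p
    have e1 : ∀ y : A, (-1) ^ p.2 * y = ((-1 : ℂ) ^ p.2) • y := fun y => by
      rw [Algebra.smul_def, map_pow, map_neg, map_one]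
    rw [e1, e1, map_smul, LinearMap.smul_apply, T.form_H, T.form_H, smul_mul_assoc, map_smul]
    congr 2
    ring
  rw [map_sum, LinearMap.sum_apply, Finset.sum_congr rfl fun p _ => h p, ← map_sum,
    ← Finset.sum_mul, T.q_rel γ n hn, zero_mul]
  simp

theorem support_vertex_finite (k : ℤ) (F : A) :
    (Function.support fun b : ℤ => (intSign b : A) * (T.q γ (k + b) * T.H γ b F)).Finite := by
  obtain ⟨N, hN⟩ := T.exists_bound F
  refine (Set.finite_Icc (0 : ℤ) N).subset fun b hb => ?_
  by_contra hc
  apply hb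
  simp only
  by_cases h0 : b < 0
  · rw [T.H_neg γ b h0, LinearMap.zero_apply, mul_zero, mul_zero]
  · obtain ⟨b, rfl⟩ := Int.eq_ofNat_of_zero_le (not_lt.1 h0)
    rw [hN γ b (by simp only [Set.mem_Icc, not_and_or] at hc; omega), mul_zero, mul_zero]

/-- The vertex operator `X_{-k} = ∑_b (-1)^b q_{k+b} H_b`. -/
noncomputable def vertex (k : ℤ) : A →ₗ[ℂ] A where
  toFun F := ∑ᶠ b : ℤ, (intSign b : A) * (T.q γ (k + b) * T.H γ b F)
  map_add' F G := by
    rw [← finsum_add_distrib (T.support_vertex_finite γ k F) (T.support_vertex_finite γ k G)]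
    exact finsum_congr fun b => by rw [map_add]; ring
  map_smul' c F := by
    rw [RingHom.id_apply, smul_finsum]
    exact finsum_congr fun b => by rw [map_smul, mul_smul_comm, mul_smul_comm]

theorem vertex_eq_finsum (k : ℤ) (F : A) :
    T.vertex γ k F = ∑ᶠ b : ℤ, (intSign b : A) * (T.q γ (k + b) * T.H γ b F) := rfl

theorem vertex_eq_sum (k : ℤ) {F : A} {N : ℕ} (hN : ∀ b : ℕ, N ≤ b → T.H γ b F = 0) :
    T.vertex γ k F = ∑ b ∈ Finset.range N, (-1) ^ b * (T.q γ (k + b) * T.H γ b F) := by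
  rw [vertex_eq_finsum, finsum_eq_sum_of_support_subset (s := (Finset.range N).map Nat.castEmbedding),
    Finset.sum_map]
  · refine Finset.sum_congr rfl fun b _ => ?_
    simp [intSign_natCast]
  · intro b hb
    by_contra hc
    apply hb
    simp only
    by_cases h0 : b < 0
    · rw [T.H_neg γ b h0, LinearMap.zero_apply, mul_zero, mul_zero]
    · obtain ⟨b, rfl⟩ := Int.eq_ofNat_of_zero_le (not_lt.1 h0)
      rw [hN b (by simpa using hc), mul_zero, mul_zero]

theorem vertex_one (k : ℤ) : T.vertex γ k 1 = T.q γ k := by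
  rw [T.vertex_eq_sum γ k (N := 1) fun b hb => T.H_one γ (by omega)]
  simp [T.H_zero]

/-- Taking adjoints exchanges the generator and the operator in each term. The shift of the
summation index by `k` restores the form of a vertex operator and costs the sign `(-1)^k`. -/
theorem form_vertex (k : ℤ) (F G : A) :
    T.form (T.vertex γ k F) G = intSign k * T.form F (T.vertex γ (-k) G) := by
  have hs : ∀ (n : ℤ) (x y : A), T.form ((n : A) * x) y = n * T.form x y := by
    intro n x y
    have : (n : A) * x = (n : ℂ) • x := by rw [Algebra.smul_def, map_intCast]
    rw [this, map_smul, LinearMap.smul_apply, smul_eq_mul]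
  rw [vertex_eq_finsum, vertex_eq_finsum, T.form_comm F,
    ← LinearMap.flip_apply, ← LinearMap.flip_apply T.form _ F,
    map_finsum _ (T.support_vertex_finite γ k F), map_finsum _ (T.support_vertex_finite γ (-k) G),
    ← smul_eq_mul, smul_finsum,
    ← finsum_comp_equiv (Equiv.addRight k) (f := fun b : ℤ => (intSign k : ℂ) •
      LinearMap.flip T.form F ((intSign b : A) * (T.q γ (-k + b) * T.H γ b G)))]
  refine finsum_congr fun b => ?_
  rw [LinearMap.flip_apply, LinearMap.flip_apply, hs, hs, T.form_q, T.form_q, Equiv.coe_addRight,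
    T.form_comm, smul_eq_mul, intSign_add, neg_add_cancel_comm_assoc, add_comm k b]
  have hk : (intSign k : ℂ) * intSign k = 1 := by
    rw [← Int.cast_mul, intSign_mul_self, Int.cast_one]
  push_cast
  linear_combination (-(intSign b : ℂ) * (T.form (T.H γ (b + k) G)) (T.H γ b F)) * hk

/-- The Leibniz rule and `H_q_self` let each operator act on `q γ a` with coefficients `1, 2, 2, …`;
with the signs of the vertex operator these become the coefficients of `(1 - x) / (1 + x)`. The
bound `L` discards only terms in which `q γ (a - i)` has negative index. -/
theorem vertex_q_mul (k a : ℤ) (F : A) {L : ℕ} (hL : a < L) :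
    T.vertex γ k (T.q γ a * F) = ∑ i ∈ Finset.range L,
      (twistCoeff i : A) * (T.q γ (a - i) * T.vertex γ (k + i) F) := by
  obtain ⟨N, hN⟩ := T.exists_bound F
  have hH : ∀ b : ℕ, T.H γ b (T.q γ a * F) = ∑ p ∈ Finset.HasAntidiagonal.antidiagonal b,
      ((if p.1 = 0 then 1 else 2) * T.q γ (a - p.1)) * T.H γ p.2 F := by
    intro b
    rw [T.H_mul]
    exact Finset.sum_congr rfl fun p _ => by rw [T.H_q_self]
  have hq : ∀ i : ℕ, L ≤ i → T.q γ (a - i) = 0 := fun i hi => T.q_neg γ _ (by omega)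
  rw [T.vertex_eq_sum γ k (N := L + N)]
  · simp only [hH, Finset.mul_sum]
    have := sum_range_antidiagonal (A := A) (N := L) (M := N) le_rfl (fun i j => (-1) ^ (i + j) *
      (T.q γ (k + (i + j : ℕ)) * ((if i = 0 then 1 else 2) * T.q γ (a - i) * T.H γ j F)))
      (fun i j hi => by rw [hq i hi]; ring) (fun i j hj => by rw [hN γ j hj]; ring)
    refine Eq.trans (Finset.sum_congr rfl fun b _ => Finset.sum_congr rfl fun p hp => ?_)
      (this.trans ?_)
    · rw [Finset.HasAntidiagonal.mem_antidiagonal.1 hp]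
    · refine Finset.sum_congr rfl fun i _ => ?_
      rw [T.vertex_eq_sum γ (k + i) (hN γ), Finset.mul_sum, Finset.mul_sum]
      refine Finset.sum_congr rfl fun j _ => ?_
      rw [twistCoeff, Nat.cast_add, ← add_assoc]
      push_cast
      split_ifs <;> ring
  · intro b hb
    rw [hH]
    refine Finset.sum_eq_zero fun p hp => ?_
    have := Finset.HasAntidiagonal.mem_antidiagonal.1 hp
    by_cases h : L ≤ p.1
    · rw [hq _ h]; ring
    · rw [hN γ p.2 (by omega)]; ring

end TwistedFock

end Fock

/-! ### Anticommutation relations and orthogonality -/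

section Anticommutation

variable {ι A : Type*} [CommRing A] [Algebra ℂ A]

namespace TwistedFock

variable (T : TwistedFock ι A) (γ : ι)

/-- This is a coefficient of `q(w) q(-w) = 1`. A term is nonzero only for `-u ≤ i ≤ v`, so by the
bounds on `u` and `v` the interval contains every such term. -/
theorem sum_Icc_intSign_mul {u v : ℤ} {L : ℕ} (hu : u < L) (hv : v < L) :
    ∑ i ∈ Finset.Ioo (-(L : ℤ)) L, (intSign i : A) * (T.q γ (u + i) * T.q γ (v - i)) =
      if u + v = 0 then (intSign u : A) else 0 := by
  by_cases hn : u + v < 0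
  · rw [if_neg (by omega), Finset.sum_eq_zero]
    intro i _
    by_cases h : u + i < 0
    · rw [T.q_neg γ _ h]; ring
    · rw [T.q_neg γ (v - i) (by omega)]; ring
  obtain ⟨n, hn⟩ := Int.eq_ofNat_of_zero_le (not_lt.1 hn)
  have h1 : ∑ i ∈ Finset.Ioo (-(L : ℤ)) L, (intSign i : A) * (T.q γ (u + i) * T.q γ (v - i)) =
      ∑ p ∈ Finset.HasAntidiagonal.antidiagonal n,
        (intSign v : A) * ((-1) ^ p.2 * (T.q γ p.1 * T.q γ p.2)) := by
    symm
    refine Finset.sum_of_injOn (fun p => (p.1 : ℤ) - u) ?_ ?_ ?_ ?_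
    · intro p hp p' hp' h
      have e1 := Finset.HasAntidiagonal.mem_antidiagonal.1 (Finset.mem_coe.1 hp)
      have e2 := Finset.HasAntidiagonal.mem_antidiagonal.1 (Finset.mem_coe.1 hp')
      simp only at h
      exact Prod.ext (by omega) (by omega)
    · intro p hp
      have e1 := Finset.HasAntidiagonal.mem_antidiagonal.1 (Finset.mem_coe.1 hp)
      rw [Finset.mem_coe, Finset.mem_Ioo]
      simp only
      omega
    · intro i _ hi
      by_cases h : u + i < 0
      · rw [T.q_neg γ _ h]; ring
      by_cases h' : v - i < 0
      · rw [T.q_neg γ _ h']; ring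
      exfalso
      apply hi
      refine ⟨((u + i).toNat, (v - i).toNat), ?_, ?_⟩
      · rw [Finset.mem_coe, Finset.HasAntidiagonal.mem_antidiagonal]
        simp only
        omega
      · simp only
        omega
    · intro p hp
      have e1 := Finset.HasAntidiagonal.mem_antidiagonal.1 hp
      have e2 : u + ((p.1 : ℤ) - u) = p.1 := by ring
      have e3 : v - ((p.1 : ℤ) - u) = p.2 := by omega
      have e4 : (intSign ((p.1 : ℤ) - u) : A) = intSign v * (-1) ^ p.2 := by
        have : (p.1 : ℤ) - u = v + -(p.2 : ℤ) := by omega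
        rw [this, intSign_add, intSign_neg, intSign_natCast]
        push_cast
        ring
      rw [e2, e3, e4]
      ring
  rw [h1, ← Finset.mul_sum]
  by_cases h0 : n = 0
  · subst h0
    rw [if_pos (by simpa using hn)]
    have : v = -u := by simp only [Nat.cast_zero] at hn; omega
    rw [this, intSign_neg]
    simp [T.q_zero]
  · rw [T.q_rel γ n h0, mul_zero, if_neg (by omega)]

/-- Symmetrization folds the one-sided sum with coefficients `±1, ±2, ±2, …` into twice the
two-sided alternating sum, because the term at zero occurs twice. -/
theorem sum_twistCoeff_mul {u v : ℤ} {L : ℕ} (hu : u < L) (hv : v < L) :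
    ∑ i ∈ Finset.range L, (twistCoeff i : A) *
      (T.q γ (u + i) * T.q γ (v - i) + T.q γ (u - i) * T.q γ (v + i)) =
      if u + v = 0 then 2 * (intSign u : A) else 0 := by
  have hsplit : ∀ (g : ℤ → A) (L : ℕ), ∑ i ∈ Finset.range L,
      (if i = 0 then 1 else 2) * (g i + g (-i)) = 2 * ∑ i ∈ Finset.Ioo (-(L : ℤ)) L, g i := by
    intro g L
    induction L with
    | zero => simp
    | succ L ih =>
      rw [Finset.sum_range_succ, ih]
      rcases L with _ | L
      · have : Finset.Ioo (-((0 + 1 : ℕ) : ℤ)) ((0 + 1 : ℕ) : ℤ) = {0} := by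
          ext i; simp only [Finset.mem_Ioo, Finset.mem_singleton]; omega
        rw [this]
        simp
        ring
      · have : Finset.Ioo (-((L + 1 + 1 : ℕ) : ℤ)) ((L + 1 + 1 : ℕ) : ℤ) =
            insert ((L + 1 : ℕ) : ℤ) (insert (-((L + 1 : ℕ) : ℤ))
              (Finset.Ioo (-((L + 1 : ℕ) : ℤ)) ((L + 1 : ℕ) : ℤ))) := by
          ext i; simp only [Finset.mem_Ioo, Finset.mem_insert]; omega
        rw [this, Finset.sum_insert, Finset.sum_insert, if_neg (Nat.succ_ne_zero L)]
        · ring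
        · simp
        · simp only [Finset.mem_insert, Finset.mem_Ioo]; omega
  have := hsplit (fun i => (intSign i : A) * (T.q γ (u + i) * T.q γ (v - i))) L
  rw [T.sum_Icc_intSign_mul γ hu hv, mul_ite, mul_zero] at this
  rw [← this]
  refine Finset.sum_congr rfl fun i _ => ?_
  simp only [intSign_neg, intSign_natCast, twistCoeff]
  rw [← sub_eq_add_neg, sub_neg_eq_add]
  push_cast
  ring

/-- This is normal ordering: the generators stand to the left of all adjoint operators. The
operators `H` commute, so one bound `N` serves for both. -/
theorem vertex_vertex (k l : ℤ) {F : A} {N : ℕ} (hN : ∀ b : ℕ, N ≤ b → T.H γ b F = 0) {L : ℕ}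
    (hL : l + N < L) :
    T.vertex γ k (T.vertex γ l F) = ∑ b ∈ Finset.range N, ∑ d ∈ Finset.range N,
      ((-1) ^ (b + d) * ∑ i ∈ Finset.range L, (twistCoeff i : A) *
        (T.q γ (k + b + i) * T.q γ (l + d - i))) * T.H γ b (T.H γ d F) := by
  have hN' : ∀ d b : ℕ, N ≤ b → T.H γ b (T.H γ d F) = 0 := fun d b hb => by
    rw [T.H_comm, hN b hb, map_zero]
  rw [T.vertex_eq_sum γ l hN, map_sum, Finset.sum_comm]
  refine Finset.sum_congr rfl fun d hd => ?_
  have e1 : ∀ y : A, T.vertex γ k ((-1) ^ d * y) = (-1) ^ d * T.vertex γ k y := fun y => by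
    have : ∀ y : A, (-1) ^ d * y = ((-1 : ℂ) ^ d) • y := fun y => by
      rw [Algebra.smul_def, map_pow, map_neg, map_one]
    rw [this, this, map_smul]
  have hd' := Finset.mem_range.1 hd
  rw [e1, T.vertex_q_mul γ k (l + d) _ (L := L) (by omega)]
  simp only [T.vertex_eq_sum γ _ (hN' d), Finset.mul_sum, Finset.sum_mul]
  rw [Finset.sum_comm]
  refine Finset.sum_congr rfl fun b _ => Finset.sum_congr rfl fun i _ => ?_
  rw [add_right_comm k, pow_add]
  ring

/-- After normal ordering, the coefficient of each pair `H_b H_d` in the anticommutator is evaluated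
by `sum_twistCoeff_mul`, and only pairs with `b + d = -(k + l)` survive. Their alternating sum
vanishes by `H_rel` unless the total degree is zero. -/
theorem vertex_anticomm (k l : ℤ) (F : A) :
    T.vertex γ k (T.vertex γ l F) + T.vertex γ l (T.vertex γ k F) =
      if k + l = 0 then (2 * intSign k : A) * F else 0 := by
  obtain ⟨N, hN⟩ := T.exists_bound F
  have hN := hN γ
  obtain ⟨L, hL⟩ : ∃ L : ℕ, k + N < L ∧ l + N < L := ⟨(max (k + N) (l + N)).toNat + 1, by omega⟩
  rw [T.vertex_vertex γ k l hN hL.2, T.vertex_vertex γ l k hN hL.1,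
    Finset.sum_comm (s := Finset.range N) (t := Finset.range N) (f := fun b d =>
      ((-1) ^ (b + d) * ∑ i ∈ Finset.range L, (twistCoeff i : A) *
        (T.q γ (l + b + i) * T.q γ (k + d - i))) * T.H γ b (T.H γ d F)),
    ← Finset.sum_add_distrib]
  have h1 : ∀ b ∈ Finset.range N, (∑ d ∈ Finset.range N,
      ((-1) ^ (b + d) * ∑ i ∈ Finset.range L, (twistCoeff i : A) *
        (T.q γ (k + b + i) * T.q γ (l + d - i))) * T.H γ b (T.H γ d F)) +
      (∑ d ∈ Finset.range N,
      ((-1) ^ (d + b) * ∑ i ∈ Finset.range L, (twistCoeff i : A) *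
        (T.q γ (l + d + i) * T.q γ (k + b - i))) * T.H γ d (T.H γ b F)) =
      ∑ d ∈ Finset.range N, if k + l + (b + d : ℕ) = 0 then
        (2 * intSign k : A) * ((-1) ^ d * T.H γ b (T.H γ d F)) else 0 := by
    intro b hb
    rw [← Finset.sum_add_distrib]
    refine Finset.sum_congr rfl fun d hd => ?_
    have hb' := Finset.mem_range.1 hb
    have hd' := Finset.mem_range.1 hd
    have key := T.sum_twistCoeff_mul γ (u := k + b) (v := l + d) (L := L) (by omega) (by omega)
    rw [T.H_comm γ γ d b, add_comm d b, ← add_mul, ← mul_add, ← Finset.sum_add_distrib]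
    have e : ∀ i : ℕ, (twistCoeff i : A) * (T.q γ (k + b + i) * T.q γ (l + d - i)) +
        (twistCoeff i : A) * (T.q γ (l + d + i) * T.q γ (k + b - i)) = (twistCoeff i : A) *
        (T.q γ (k + b + i) * T.q γ (l + d - i) + T.q γ (k + b - i) * T.q γ (l + d + i)) :=
      fun i => by ring
    rw [Finset.sum_congr rfl fun i _ => e i, key]
    have hiff : k + b + (l + d) = 0 ↔ k + l + (b + d : ℕ) = 0 := by push_cast; omega
    simp only [hiff]
    split_ifs
    · rw [intSign_add, intSign_natCast]
      push_cast
      rw [pow_add]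
      have : ((-1 : A) ^ b) * (-1) ^ b = 1 := by rw [← mul_pow]; simp
      linear_combination (2 * intSign k * (-1) ^ d * T.H γ b (T.H γ d F)) * this
    · ring
  rw [Finset.sum_congr rfl h1]
  by_cases hn : 0 < k + l
  · rw [if_neg (by omega)]
    exact Finset.sum_eq_zero fun b _ => Finset.sum_eq_zero fun d _ => if_neg (by omega)
  obtain ⟨n, hn⟩ := Int.eq_ofNat_of_zero_le (show 0 ≤ -(k + l) by omega)
  have h2 := sum_range_antidiagonal (A := A) (N := N) (M := N) (K := N + N + n + 1) (by omega)
    (fun b d => if k + l + (b + d : ℕ) = 0 then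
        (2 * intSign k : A) * ((-1) ^ d * T.H γ b (T.H γ d F)) else 0)
    (fun b d hb => by rw [T.H_comm, hN b hb, map_zero]; simp)
    (fun b d hd => by rw [hN d hd, map_zero]; simp)
  rw [← h2, Finset.sum_eq_single n]
  · have h3 : ∀ p ∈ Finset.HasAntidiagonal.antidiagonal n, (if k + l + (p.1 + p.2 : ℕ) = 0 then
        (2 * intSign k : A) * ((-1) ^ p.2 * T.H γ p.1 (T.H γ p.2 F)) else 0) =
        (2 * intSign k : A) * ((-1) ^ p.2 * T.H γ p.1 (T.H γ p.2 F)) := by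
      intro p hp
      have := Finset.HasAntidiagonal.mem_antidiagonal.1 hp
      rw [if_pos (by omega)]
    rw [Finset.sum_congr rfl h3, ← Finset.mul_sum]
    by_cases h0 : n = 0
    · subst h0
      rw [if_pos (by simp only [Nat.cast_zero] at hn; omega)]
      simp [T.H_zero]
    · rw [T.H_rel γ h0, mul_zero, if_neg (by omega)]
  · intro m _ hm
    refine Finset.sum_eq_zero fun p hp => ?_
    have := Finset.HasAntidiagonal.mem_antidiagonal.1 hp
    rw [if_neg (by omega)]
  · intro h
    exact absurd (Finset.mem_range.2 (by omega)) h

/-! ### Vectors of vertex operators -/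

/-- `X_φ = X_{-φ_1} ⋯ X_{-φ_m} 1`. -/
noncomputable def word (φ : List ℤ) : A := φ.foldr (fun k F => T.vertex γ k F) 1

theorem word_nil : T.word γ [] = 1 := rfl

theorem word_cons (k : ℤ) (φ : List ℤ) : T.word γ (k :: φ) = T.vertex γ k (T.word γ φ) := rfl

/-- The elements killed by the operators `H γ n`, `n > 0`. -/
def inert : Subalgebra ℂ A where
  carrier := {F | ∀ b : ℕ, b ≠ 0 → T.H γ b F = 0}
  mul_mem' := by
    intro F G hF hG b hb
    rw [T.H_mul]
    refine Finset.sum_eq_zero fun p hp => ?_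
    have := Finset.HasAntidiagonal.mem_antidiagonal.1 hp
    by_cases h : p.1 = 0
    · rw [hG p.2 (by omega), mul_zero]
    · rw [hF p.1 h, zero_mul]
  add_mem' := by
    intro F G hF hG b hb
    rw [map_add, hF b hb, hG b hb, add_zero]
  algebraMap_mem' := by
    intro c b hb
    rw [Algebra.algebraMap_eq_smul_one, map_smul, T.H_one γ hb, smul_zero]

theorem q_mem_inert {γ γ' : ι} (h : γ ≠ γ') (n : ℤ) : T.q γ' n ∈ T.inert γ :=
  fun b hb => T.H_q_of_ne γ γ' h b hb n

theorem H_mem_inert (γ' : ι) (n : ℤ) {F : A} (hF : F ∈ T.inert γ) : T.H γ' n F ∈ T.inert γ :=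
  fun b hb => by rw [T.H_comm, hF b hb, map_zero]

theorem vertex_mem_inert {γ γ' : ι} (h : γ ≠ γ') (k : ℤ) {F : A} (hF : F ∈ T.inert γ) :
    T.vertex γ' k F ∈ T.inert γ := by
  obtain ⟨N, hN⟩ := T.exists_bound F
  rw [T.vertex_eq_sum γ' k (hN γ')]
  refine Subalgebra.sum_mem _ fun b _ => Subalgebra.mul_mem _ ?_
    (Subalgebra.mul_mem _ (T.q_mem_inert h _) (T.H_mem_inert γ γ' _ hF))
  exact Subalgebra.pow_mem _ (Subalgebra.neg_mem _ (Subalgebra.one_mem _)) _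

theorem word_mem_inert {γ γ' : ι} (h : γ ≠ γ') (φ : List ℤ) : T.word γ' φ ∈ T.inert γ := by
  induction φ with
  | nil => exact Subalgebra.one_mem _
  | cons k φ ih => exact T.vertex_mem_inert h k ih

theorem H_mul_inert (b : ℕ) (F : A) {R : A} (hR : R ∈ T.inert γ) :
    T.H γ b (F * R) = T.H γ b F * R := by
  rw [T.H_mul, Finset.sum_eq_single (b, 0)]
  · rw [Nat.cast_zero, T.H_zero]
  · intro p hp hne
    have := Finset.HasAntidiagonal.mem_antidiagonal.1 hp
    rw [hR p.2, mul_zero]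
    intro h
    apply hne
    exact Prod.ext (by simp only; omega) h
  · intro h
    exact absurd (Finset.HasAntidiagonal.mem_antidiagonal.2 (by simp)) h

theorem vertex_mul_inert (k : ℤ) (F : A) {R : A} (hR : R ∈ T.inert γ) :
    T.vertex γ k (F * R) = T.vertex γ k F * R := by
  obtain ⟨N, hN⟩ := T.exists_bound F
  rw [T.vertex_eq_sum γ k (hN γ), T.vertex_eq_sum γ k (F := F * R) (N := N), Finset.sum_mul]
  · refine Finset.sum_congr rfl fun b _ => ?_
    rw [T.H_mul_inert γ b F hR]
    ring
  · intro b hb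
    rw [T.H_mul_inert γ b F hR, hN γ b hb, zero_mul]

/-- The annihilating operator anticommutes past every letter different from `k` and kills the
vacuum, where it gives a generator of negative index. -/
theorem vertex_neg_word {k : ℤ} (hk : 0 < k) {φ : List ℤ} (hφ : ∀ l ∈ φ, l ≠ k) :
    T.vertex γ (-k) (T.word γ φ) = 0 := by
  induction φ with
  | nil => rw [word_nil, T.vertex_one, T.q_neg γ _ (by omega)]
  | cons l φ ih =>
    have := T.vertex_anticomm γ (-k) l (T.word γ φ)
    rw [ih fun l hl => hφ l (List.mem_cons_of_mem _ hl), map_zero, add_zero,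
      if_neg (by have := hφ l List.mem_cons_self; omega)] at this
    rw [word_cons, this]

/-- Inert factors carry the contributions of the other indices; the vertex operators for `γ` treat
them as scalars. -/
theorem form_vertex_mul (k : ℤ) (F G : A) {R R' : A} (hR : R ∈ T.inert γ) (hR' : R' ∈ T.inert γ) :
    T.form (T.vertex γ k F * R) (G * R') =
      intSign k * T.form (F * R) (T.vertex γ (-k) G * R') := by
  rw [← T.vertex_mul_inert γ k F hR, T.form_vertex, T.vertex_mul_inert γ (-k) G hR']

/-- The adjoint of the larger leading letter is moved to the other word. If the leading letters
differ, it occurs nowhere there and annihilates the word; if they agree, one contraction remains and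
both words become shorter. -/
theorem form_word_mul : ∀ (φ ψ : List ℤ), φ.Pairwise (· > ·) → (∀ k ∈ φ, 0 < k) →
    ψ.Pairwise (· > ·) → (∀ k ∈ ψ, 0 < k) → ∀ {R R' : A}, R ∈ T.inert γ → R' ∈ T.inert γ →
    T.form (T.word γ φ * R) (T.word γ ψ * R') =
      if φ = ψ then 2 ^ φ.length * T.form R R' else 0
  | [], [], _, _, _, _, R, R', _, _ => by simp [word_nil]
  | k :: φ, [], _, h2, _, _, R, R', hR, hR' => by
    have := T.form_vertex_mul γ k (T.word γ φ) (T.word γ []) hR hR'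
    rw [word_cons, this, T.vertex_neg_word γ (h2 k List.mem_cons_self) (by simp), zero_mul,
      map_zero, mul_zero, if_neg (List.cons_ne_nil _ _)]
  | [], l :: ψ, _, _, _, h4, R, R', hR, hR' => by
    have := T.form_vertex_mul γ l (T.word γ ψ) (T.word γ []) hR' hR
    rw [word_cons, T.form_comm, this, T.vertex_neg_word γ (h4 l List.mem_cons_self) (by simp),
      zero_mul, map_zero, mul_zero, if_neg (List.cons_ne_nil _ _).symm]
  | k :: φ, l :: ψ, h1, h2, h3, h4, R, R', hR, hR' => by
    have hk := h2 k List.mem_cons_self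
    have hl := h4 l List.mem_cons_self
    rw [List.pairwise_cons] at h1 h3
    rcases lt_trichotomy k l with hkl | rfl | hkl
    · have := T.form_vertex_mul γ l (T.word γ ψ) (T.word γ (k :: φ)) hR' hR
      rw [T.form_comm, T.word_cons γ l, this, T.vertex_neg_word γ hl, zero_mul,
        map_zero, mul_zero, if_neg]
      · intro h; have := (List.cons.inj h).1; omega
      · intro m hm
        rcases List.mem_cons.1 hm with rfl | hm
        · omega
        · have := h1.1 m hm; omega
    -- The contraction gives `2 (-1)^k`, and its sign cancels the one from taking the adjoint; each
    -- common letter contributes a factor `2`.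
    · have := T.form_vertex_mul γ k (T.word γ φ) (T.word γ (k :: ψ)) hR hR'
      have h5 := T.vertex_anticomm γ (-k) k (T.word γ ψ)
      rw [T.vertex_neg_word γ hk fun m hm => by have := h3.1 m hm; omega, map_zero, add_zero,
        if_pos (by omega), ← word_cons, intSign_neg] at h5
      rw [T.word_cons γ k φ, this, h5]
      have h6 : T.form (T.word γ φ * R) (2 * (intSign k : A) * T.word γ ψ * R') =
          (2 * intSign k : ℂ) * T.form (T.word γ φ * R) (T.word γ ψ * R') := by
        have : 2 * (intSign k : A) * T.word γ ψ * R' =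
            (2 * intSign k : ℂ) • (T.word γ ψ * R') := by
          rw [Algebra.smul_def, map_mul, map_intCast, map_ofNat]; ring
        rw [this, map_smul, smul_eq_mul]
      rw [h6, form_word_mul φ ψ h1.2 (fun m hm => h2 m (List.mem_cons_of_mem _ hm)) h3.2
        (fun m hm => h4 m (List.mem_cons_of_mem _ hm)) hR hR']
      have h7 : (intSign k : ℂ) * intSign k = 1 := by
        rw [← Int.cast_mul, intSign_mul_self, Int.cast_one]
      simp only [List.cons.injEq, true_and]
      split_ifs
      · rw [List.length_cons, pow_succ]
        linear_combination (2 * 2 ^ φ.length * T.form R R') * h7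
      · ring
    · have := T.form_vertex_mul γ k (T.word γ φ) (T.word γ (l :: ψ)) hR hR'
      rw [T.word_cons γ k, this, T.vertex_neg_word γ hk, zero_mul, map_zero, mul_zero, if_neg]
      · intro h; have := (List.cons.inj h).1; omega
      · intro m hm
        rcases List.mem_cons.1 hm with rfl | hm
        · omega
        · have := h3.1 m hm; omega

/-- One index is removed at a time; the words of the others are inert for it. -/
theorem form_prod_word [DecidableEq ι] (s : Finset ι) (φ ψ : ι → List ℤ)
    (hφ : ∀ γ, (φ γ).Pairwise (· > ·)) (hφ' : ∀ γ, ∀ k ∈ φ γ, 0 < k)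
    (hψ : ∀ γ, (ψ γ).Pairwise (· > ·)) (hψ' : ∀ γ, ∀ k ∈ ψ γ, 0 < k) :
    T.form (∏ γ ∈ s, T.word γ (φ γ)) (∏ γ ∈ s, T.word γ (ψ γ)) =
      ∏ γ ∈ s, if φ γ = ψ γ then 2 ^ (φ γ).length else 0 := by
  induction s using Finset.induction_on with
  | empty => simp [T.form_one]
  | insert γ s hγ ih =>
    have hin : ∀ φ : ι → List ℤ, ∏ γ' ∈ s, T.word γ' (φ γ') ∈ T.inert γ := fun φ =>
      Subalgebra.prod_mem _ fun γ' h => T.word_mem_inert (γ := γ) (γ' := γ') (by rintro rfl; exact hγ h) _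
    rw [Finset.prod_insert hγ, Finset.prod_insert hγ, Finset.prod_insert hγ,
      T.form_word_mul γ _ _ (hφ γ) (hφ' γ) (hψ γ) (hψ' γ) (hin φ) (hin ψ), ih, ite_mul, zero_mul]

end TwistedFock

end Anticommutation

/-! ### Raising operators -/

section Raising

theorem coeff_one_sub_mul_inv (n : ℕ) :
    PowerSeries.coeff n ((1 - PowerSeries.X) * (1 + PowerSeries.X)⁻¹ : PowerSeries ℂ) =
      twistCoeff n := by
  have h : (PowerSeries.mk fun n => (twistCoeff n : ℂ)) =
      (1 - PowerSeries.X) * (1 + PowerSeries.X)⁻¹ := by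
    rw [PowerSeries.eq_mul_inv_iff_mul_eq (by simp)]
    ext n
    rcases n with _ | _ | n
    · simp [mul_add, twistCoeff]
    · rw [mul_add, mul_one, map_add, PowerSeries.coeff_succ_mul_X]
      simp [twistCoeff, PowerSeries.coeff_one]
      norm_num
    · rw [mul_add, mul_one, map_add, PowerSeries.coeff_succ_mul_X]
      simp [twistCoeff, PowerSeries.coeff_one, PowerSeries.coeff_X, pow_succ]
  rw [← h, PowerSeries.coeff_mk]

/-- The pairs of indices `i < j` in `Fin (m + 1)`, according to whether `i = 0`. -/
noncomputable def pairEquiv (m : ℕ) : Fin m ⊕ {ij : Fin m × Fin m // ij.1 < ij.2} ≃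
    {ij : Fin (m + 1) × Fin (m + 1) // ij.1 < ij.2} :=
  Equiv.ofBijective (Sum.elim (fun j => ⟨(0, j.succ), Fin.succ_pos j⟩)
    fun ij => ⟨(ij.1.1.succ, ij.1.2.succ), Fin.succ_lt_succ_iff.2 ij.2⟩) (by
    constructor
    · rintro (i | ⟨⟨i, i'⟩, hi⟩) (j | ⟨⟨j, j'⟩, hj⟩) h
      · simpa using h
      · simp [Fin.ext_iff] at h
      · simp [Fin.ext_iff] at h
      · simpa using h
    · rintro ⟨⟨i, j⟩, hij⟩
      simp only at hij
      obtain ⟨j, rfl⟩ := Fin.exists_succ_eq.2 (Fin.ne_zero_of_lt hij)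
      rcases Fin.eq_zero_or_eq_succ i with rfl | ⟨i, rfl⟩
      · exact ⟨Sum.inl j, rfl⟩
      · exact ⟨Sum.inr ⟨(i, j), Fin.succ_lt_succ_iff.1 hij⟩, rfl⟩)

theorem pairEquiv_inl {m : ℕ} (j : Fin m) : (pairEquiv m (Sum.inl j)).1 = (0, j.succ) := rfl

theorem pairEquiv_inr {m : ℕ} (ij : {ij : Fin m × Fin m // ij.1 < ij.2}) :
    (pairEquiv m (Sum.inr ij)).1 = (ij.1.1.succ, ij.1.2.succ) := rfl

/-- The exponents of the raising operators `R_{0j}`, and those of the others. -/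
noncomputable def raisingEquiv (m : ℕ) : RaisingExp (m + 1) ≃ RaisingExp m × (Fin m → ℕ) :=
  ((Equiv.arrowCongr (pairEquiv m).symm (Equiv.refl ℕ)).trans
    (Equiv.sumArrowEquivProdArrow _ _ _)).trans (Equiv.prodComm _ _)

theorem raisingEquiv_fst {m : ℕ} (k : RaisingExp (m + 1))
    (ij : {ij : Fin m × Fin m // ij.1 < ij.2}) :
    (raisingEquiv m k).1 ij = k (pairEquiv m (Sum.inr ij)) := rfl

theorem raisingEquiv_snd {m : ℕ} (k : RaisingExp (m + 1)) (j : Fin m) :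
    (raisingEquiv m k).2 j = k (pairEquiv m (Sum.inl j)) := rfl

theorem prod_pairs_succ {M : Type*} [CommMonoid M] {m : ℕ}
    (f : {ij : Fin (m + 1) × Fin (m + 1) // ij.1 < ij.2} → M) :
    ∏ ij, f ij = (∏ j : Fin m, f (pairEquiv m (Sum.inl j))) * ∏ ij, f (pairEquiv m (Sum.inr ij)) := by
  rw [← (pairEquiv m).prod_comp, Fintype.prod_sum_type]

theorem sum_pairs_succ {M : Type*} [AddCommMonoid M] {m : ℕ}
    (f : {ij : Fin (m + 1) × Fin (m + 1) // ij.1 < ij.2} → M) :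
    ∑ ij, f ij = (∑ j : Fin m, f (pairEquiv m (Sum.inl j))) + ∑ ij, f (pairEquiv m (Sum.inr ij)) := by
  rw [← (pairEquiv m).sum_comp, Fintype.sum_sum_type]

theorem raiseMonomial_apply {m : ℕ} (k : RaisingExp m) (φ : Fin m → ℤ) (l : Fin m) :
    raiseMonomial k φ l = φ l + ∑ ij, (k ij : ℤ) *
      ((if l = ij.1.1 then 1 else 0) - if l = ij.1.2 then 1 else 0) := by
  simp [raiseMonomial, Finset.sum_apply, Pi.single_apply]

theorem raiseMonomial_zero {m : ℕ} (k : RaisingExp (m + 1)) (φ : Fin (m + 1) → ℤ) :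
    raiseMonomial k φ 0 = φ 0 + ∑ j, ((raisingEquiv m k).2 j : ℤ) := by
  rw [raiseMonomial_apply, sum_pairs_succ]
  simp only [raisingEquiv_snd]
  have h1 : ∀ j : Fin m, (0 : Fin (m + 1)) ≠ j.succ := fun j => (Fin.succ_ne_zero j).symm
  simp [pairEquiv_inl, pairEquiv_inr, h1]

theorem raiseMonomial_succ {m : ℕ} (k : RaisingExp (m + 1)) (φ : Fin (m + 1) → ℤ) (l : Fin m) :
    raiseMonomial k φ l.succ =
      raiseMonomial (raisingEquiv m k).1 (fun j => φ j.succ) l - (raisingEquiv m k).2 l := by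
  rw [raiseMonomial_apply, raiseMonomial_apply, sum_pairs_succ]
  simp only [raisingEquiv_snd, raisingEquiv_fst]
  simp [pairEquiv_inl, pairEquiv_inr, Fin.succ_ne_zero]
  ring

/-- The operators `R_{0j}` only lower the entries of the tail. So the remaining operators must
already leave the tail nonnegative, which allows finitely many exponents by induction, and the
entries they produce bound the exponents of the `R_{0j}`. -/
theorem finite_raiseMonomial_nonneg : ∀ {m : ℕ} (φ : Fin m → ℤ),
    {k : RaisingExp m | ∀ l, 0 ≤ raiseMonomial k φ l}.Finite
  | 0, φ => Set.toFinite _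
  | m + 1, φ => by
    have h := (finite_raiseMonomial_nonneg fun j => φ j.succ).biUnion (t := fun k' =>
      (fun i => (k', i)) '' Set.Iic fun j => (raiseMonomial k' (fun j => φ j.succ) j).toNat)
      fun k' _ => (Set.finite_Iic _).image _
    refine (h.preimage (f := raisingEquiv m) (raisingEquiv m).injective.injOn).subset ?_
    intro k hk
    have hk' : ∀ j : Fin m, ((raisingEquiv m k).2 j : ℤ) ≤
        raiseMonomial (raisingEquiv m k).1 (fun j => φ j.succ) j := fun j => by
      have := hk j.succ
      rw [raiseMonomial_succ] at this
      omega
    refine Set.mem_biUnion (x := (raisingEquiv m k).1) (fun j => ?_) ⟨(raisingEquiv m k).2, ?_, rfl⟩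
    · have := hk' j; omega
    · intro j
      have := hk' j
      simp only
      omega

variable {ι A : Type*} [CommRing A] [Algebra ℂ A]

namespace TwistedFock

variable (T : TwistedFock ι A) (γ : ι)

theorem prod_q_eq_zero {m : ℕ} {ψ : Fin m → ℤ} (j : Fin m) (h : ψ j < 0) :
    ∏ j, T.q γ (ψ j) = 0 := Finset.prod_eq_zero (Finset.mem_univ j) (T.q_neg γ _ h)

/-- Iteration of `vertex_q_mul`. The exponent `i j` is that of the raising operator which moves
units from the entry `j` to the new leading entry. -/
theorem vertex_prod_q : ∀ {m : ℕ} (n : ℤ) (ψ : Fin m → ℤ),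
    T.vertex γ n (∏ j, T.q γ (ψ j)) = ∑ᶠ i : Fin m → ℕ, ((∏ j, twistCoeff (i j) : ℤ) : A) *
      (T.q γ (n + ∑ j, (i j : ℤ)) * ∏ j, T.q γ (ψ j - i j))
  | 0, n, ψ => by
    rw [finsum_unique]
    simp [T.vertex_one]
  | m + 1, n, ψ => by
    have hfin : ∀ {m : ℕ} (n : ℤ) (ψ : Fin m → ℤ),
        (Function.support fun i : Fin m → ℕ => ((∏ j, twistCoeff (i j) : ℤ) : A) *
          (T.q γ (n + ∑ j, (i j : ℤ)) * ∏ j, T.q γ (ψ j - i j))).Finite := by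
      intro m n ψ
      refine (Set.finite_Iic fun j => (ψ j).toNat).subset fun i hi j => ?_
      by_contra hc
      have hc' : (ψ j).toNat < i j := not_le.1 hc
      apply hi
      simp only
      rw [T.prod_q_eq_zero γ j (by omega), mul_zero, mul_zero]
    rw [Fin.prod_univ_succ, T.vertex_q_mul γ n (ψ 0) _ (L := (ψ 0).toNat + 1) (by omega),
      ← finsum_comp_equiv (Fin.consEquiv fun _ => ℕ), finsum_curry]
    · rw [finsum_eq_sum_of_support_subset (s := Finset.range ((ψ 0).toNat + 1))]
      · refine Finset.sum_congr rfl fun a _ => ?_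
        rw [vertex_prod_q (n + a), mul_finsum' _ _ (hfin _ _), mul_finsum' _ _]
        · refine finsum_congr fun i => ?_
          simp only [Fin.consEquiv_apply, Fin.prod_univ_succ, Fin.sum_univ_succ, Fin.cons_zero,
            Fin.cons_succ, add_assoc]
          push_cast
          ring
        · refine (hfin (n + a) fun j => ψ j.succ).subset fun i hi h0 => hi ?_
          simp only at h0 ⊢
          rw [h0, mul_zero]
      · intro a ha
        rw [Finset.coe_range, Set.mem_Iio]
        by_contra hc
        apply ha
        simp only
        refine (finsum_congr fun i => ?_).trans finsum_zero
        rw [T.prod_q_eq_zero γ (0 : Fin (m + 1)), mul_zero, mul_zero]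
        simp only [Fin.consEquiv_apply, Fin.cons_zero]
        omega
    · refine ((hfin n ψ).preimage (f := Fin.consEquiv fun _ => ℕ)
        (Fin.consEquiv fun _ => ℕ).injective.injOn).subset fun i hi => hi

/-- The coefficient of a monomial in the raising operators, as an integer. -/
def _root_.SpinWreath.raisingInt {m : ℕ} (k : RaisingExp m) : ℤ := ∏ ij, twistCoeff (k ij)

theorem support_raising_finite {m : ℕ} (φ : Fin m → ℤ) :
    (Function.support fun k : RaisingExp m =>
      (raisingInt k : A) * ∏ j, T.q γ (raiseMonomial k φ j)).Finite := by
  refine (finite_raiseMonomial_nonneg φ).subset fun k hk l => ?_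
  by_contra hc
  apply hk
  simp only
  rw [T.prod_q_eq_zero γ l (by omega), mul_zero]

/-- Adjoining a leading vertex operator introduces exactly the operators `R_{0j}`, with the
coefficients of `vertex_prod_q`; `raisingEquiv` separates their exponents from those of the tail. -/
theorem word_eq_raising : ∀ {m : ℕ} (φ : Fin m → ℤ), T.word γ (List.ofFn φ) =
    ∑ᶠ k : RaisingExp m, (raisingInt k : A) * ∏ j, T.q γ (raiseMonomial k φ j)
  | 0, φ => by
    rw [finsum_unique]
    simp [raisingInt, word_nil]
  | m + 1, φ => by
    rw [List.ofFn_succ, word_cons, word_eq_raising fun j => φ j.succ,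
      map_finsum _ (T.support_raising_finite γ _)]
    let g : RaisingExp m × (Fin m → ℕ) → A := fun p => (raisingInt p.1 : A) *
      (((∏ j, twistCoeff (p.2 j) : ℤ) : A) * (T.q γ (φ 0 + ∑ j, (p.2 j : ℤ)) *
        ∏ j, T.q γ (raiseMonomial p.1 (fun j => φ j.succ) j - p.2 j)))
    have h1 : ∀ k : RaisingExp (m + 1), (raisingInt k : A) * ∏ j, T.q γ (raiseMonomial k φ j) =
        g (raisingEquiv m k) := by
      intro k
      simp only [g]
      rw [Fin.prod_univ_succ, raiseMonomial_zero]
      simp only [raiseMonomial_succ]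
      have : raisingInt k = raisingInt (raisingEquiv m k).1 *
          ∏ j, twistCoeff ((raisingEquiv m k).2 j) := by
        rw [raisingInt, prod_pairs_succ, mul_comm]
        rfl
      rw [this]
      push_cast
      ring
    have hfin := T.support_raising_finite γ φ
    rw [funext h1] at hfin
    rw [finsum_congr h1, finsum_comp_equiv (raisingEquiv m) (f := g), finsum_curry]
    · refine finsum_congr fun k => ?_
      have e : ∀ y : A, T.vertex γ (φ 0) ((raisingInt k : A) * y) =
          (raisingInt k : A) * T.vertex γ (φ 0) y := fun y => by
        have : ∀ y : A, (raisingInt k : A) * y = (raisingInt k : ℂ) • y := fun y => by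
          rw [Algebra.smul_def, map_intCast]
        rw [this, this, map_smul]
      rw [e, T.vertex_prod_q, mul_finsum' _ _]
      refine (Set.finite_Iic fun j => (raiseMonomial k (fun j => φ j.succ) j).toNat).subset
        fun i hi j => ?_
      by_contra hc
      have hc' := not_le.1 hc
      simp only at hc'
      apply hi
      simp only
      rw [T.prod_q_eq_zero γ j (by omega), mul_zero, mul_zero]
    · have := hfin.image (raisingEquiv m)
      refine this.subset fun p hp => ⟨(raisingEquiv m).symm p, ?_, by simp⟩
      rw [Function.mem_support]
      simpa using hp

end TwistedFock

end Raising

/-! ### Straightening -/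

section Straightening

/-- The sum of the excesses of the elements of a multiset over `c`. -/
def excess (c : ℕ) (s : Multiset ℕ) : ℕ := (s.map fun x => x - c).sum

/-- The sum of the squares of the elements of a multiset. -/
def sumSq (s : Multiset ℕ) : ℕ := (s.map fun x => x ^ 2).sum

/-- Majorization of multisets. -/
def Majorizes (t s : Multiset ℕ) : Prop := t.sum = s.sum ∧ ∀ c, excess c s ≤ excess c t

theorem Majorizes.trans {s t u : Multiset ℕ} (h : Majorizes u t) (h' : Majorizes t s) :
    Majorizes u s := ⟨h.1.trans h'.1, fun c => (h'.2 c).trans (h.2 c)⟩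

theorem excess_cons (c a : ℕ) (s : Multiset ℕ) : excess c (a ::ₘ s) = (a - c) + excess c s := by
  simp [excess]

theorem sumSq_cons (a : ℕ) (s : Multiset ℕ) : sumSq (a ::ₘ s) = a ^ 2 + sumSq s := by
  simp [sumSq]

theorem sumSq_le (s : Multiset ℕ) : sumSq s ≤ s.sum ^ 2 := by
  induction s using Multiset.induction_on with
  | empty => simp [sumSq]
  | cons a s ih =>
    rw [sumSq_cons, Multiset.sum_cons]
    nlinarith [Nat.zero_le (a * s.sum)]

theorem majorizes_spread (m r : ℕ) (hr : r ≤ m) (u : Multiset ℕ) :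
    Majorizes ((m + r) ::ₘ (m - r) ::ₘ u) (m ::ₘ m ::ₘ u) := by
  refine ⟨by simp only [Multiset.sum_cons]; omega, fun c => ?_⟩
  simp only [excess_cons]
  omega

theorem sumSq_spread (m r : ℕ) (hr : r ≤ m) (u : Multiset ℕ) :
    sumSq ((m + r) ::ₘ (m - r) ::ₘ u) = sumSq (m ::ₘ m ::ₘ u) + 2 * r ^ 2 := by
  obtain ⟨d, rfl⟩ := Nat.exists_eq_add_of_le hr
  simp only [sumSq_cons, Nat.add_sub_cancel_left]
  ring

theorem filter_pos_facts (s : Multiset ℕ) : (s.filter (0 < ·)).sum = s.sum ∧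
    (∀ c, excess c (s.filter (0 < ·)) = excess c s) ∧ sumSq (s.filter (0 < ·)) = sumSq s := by
  induction s using Multiset.induction_on with
  | empty => simp
  | cons a s ih =>
    rcases Nat.eq_zero_or_pos a with rfl | ha
    · rw [Multiset.filter_cons_of_neg _ (lt_irrefl 0)]
      simpa [excess_cons, sumSq_cons] using ih
    · rw [Multiset.filter_cons_of_pos (p := (0 < ·)) _ ha]
      simp only [Multiset.sum_cons, excess_cons, sumSq_cons]
      exact ⟨by rw [ih.1], fun c => by rw [ih.2.1], by rw [ih.2.2]⟩

variable {A : Type*} [CommRing A]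

/-- A repeated part `m` is replaced by pairs `m + r`, `m - r` with `r ≥ 1`. This moves up in
majorization order and increases the sum of squares, which is bounded by the square of the total, so
the process ends. Zero parts are dropped since `q 0 = 1`. -/
theorem straighten (q : ℕ → A) (h0 : q 0 = 1) (hq : ∀ m, 0 < m → q m * q m =
      ∑ i ∈ Finset.range m, ((-1) ^ i * 2 : ℤ) • (q (m + (i + 1)) * q (m - (i + 1))))
    (s : Multiset ℕ) : (s.map q).prod ∈ Submodule.span ℤ ((fun t : Multiset ℕ => (t.map q).prod) ''
      {t | t.Nodup ∧ (∀ x ∈ t, 0 < x) ∧ Majorizes t s ∧ sumSq s ≤ sumSq t}) := by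
  induction h : s.sum ^ 2 - sumSq s using Nat.strong_induction_on generalizing s with
  | _ N ih =>
    subst h
    obtain ⟨f1, f2, f3⟩ := filter_pos_facts s
    have hs : (s.map q).prod = ((s.filter (0 < ·)).map q).prod := by
      clear ih f1 f2 f3
      induction s using Multiset.induction_on with
      | empty => rfl
      | cons a s ih =>
        rcases Nat.eq_zero_or_pos a with rfl | ha
        · rw [Multiset.filter_cons_of_neg _ (lt_irrefl 0), Multiset.map_cons, Multiset.prod_cons,
            h0, one_mul, ih]
        · rw [Multiset.filter_cons_of_pos (p := (0 < ·)) _ ha, Multiset.map_cons, Multiset.prod_cons, ih,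
            Multiset.map_cons, Multiset.prod_cons]
    have hpos : ∀ x ∈ s.filter (0 < ·), 0 < x := fun x hx => (Multiset.mem_filter.1 hx).2
    generalize s.filter (0 < ·) = s' at *
    rw [hs]
    by_cases hd : s'.Nodup
    · exact Submodule.subset_span ⟨s', ⟨hd, hpos, ⟨f1, fun c => (f2 c).ge⟩, f3.ge⟩, rfl⟩
    · rw [Multiset.nodup_iff_le] at hd
      push Not at hd
      obtain ⟨m, hm⟩ := hd
      obtain ⟨u, rfl⟩ := Multiset.le_iff_exists_add.1 hm
      simp only [Multiset.cons_add, zero_add] at *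
      have hm0 : 0 < m := hpos m (Multiset.mem_cons_self _ _)
      rw [Multiset.map_cons, Multiset.map_cons, Multiset.prod_cons, Multiset.prod_cons,
        ← mul_assoc, hq m hm0, Finset.sum_mul]
      refine Submodule.sum_mem _ fun i hi => ?_
      have hi' : i + 1 ≤ m := by simpa using hi
      rw [smul_mul_assoc]
      refine Submodule.smul_mem _ _ ?_
      have hmaj := majorizes_spread m (i + 1) hi' u
      have hsq := sumSq_spread m (i + 1) hi' u
      have hsp : 0 < 2 * (i + 1) ^ 2 := by positivity
      have hle := sumSq_le ((m + (i + 1)) ::ₘ (m - (i + 1)) ::ₘ u)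
      have hsum := hmaj.1.trans f1
      have := ih (((m + (i + 1)) ::ₘ (m - (i + 1)) ::ₘ u).sum ^ 2 -
        sumSq ((m + (i + 1)) ::ₘ (m - (i + 1)) ::ₘ u)) (by rw [hsum] at hle ⊢; omega) _ rfl
      simp only [Multiset.map_cons, Multiset.prod_cons, ← mul_assoc] at this
      refine Submodule.span_mono (Set.image_mono ?_) this
      rintro t ⟨t1, t2, t3, t4⟩
      exact ⟨t1, t2, t3.trans (hmaj.trans ⟨f1, fun c => (f2 c).ge⟩), by omega⟩

/-- Raising operators move a decreasing tuple up: an inequality for sums of convex functions. -/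
theorem sum_raiseMonomial_ge {m : ℕ} (k : RaisingExp m) (φ : Fin m → ℤ) (f g : ℤ → ℤ)
    (h : ∀ x y, f x + g x * (y - x) ≤ f y) :
    ∑ l, f (φ l) + ∑ ij, (k ij : ℤ) * (g (φ ij.1.1) - g (φ ij.1.2)) ≤
      ∑ l, f (raiseMonomial k φ l) := by
  have h1 : ∑ ij, (k ij : ℤ) * (g (φ ij.1.1) - g (φ ij.1.2)) =
      ∑ l, g (φ l) * (raiseMonomial k φ l - φ l) := by
    simp only [raiseMonomial_apply, add_sub_cancel_left, Finset.mul_sum]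
    rw [Finset.sum_comm]
    refine Finset.sum_congr rfl fun ij _ => ?_
    simp only [mul_sub, Finset.sum_sub_distrib]
    simp [mul_comm]
  rw [h1, ← Finset.sum_add_distrib]
  exact Finset.sum_le_sum fun l _ => h _ _

/-- Both the identity and its negative are convex, so the convexity inequality holds in both
directions. -/
theorem sum_raiseMonomial {m : ℕ} (k : RaisingExp m) (φ : Fin m → ℤ) :
    ∑ l, raiseMonomial k φ l = ∑ l, φ l := by
  have h1 := sum_raiseMonomial_ge k φ id (fun _ => 1) fun x y => by simp
  have h2 := sum_raiseMonomial_ge k φ (fun x => -x) (fun _ => -1) fun x y => by simp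
  simp only [Finset.sum_neg_distrib] at h2
  simp at h1 h2
  omega

/-- The convexity inequality is applied to `max (x - c) 0`, which gives the excesses, and to `x ^
2`. For the latter the slopes differ strictly at distinct entries, so a nonzero exponent gives a
strict increase. -/
theorem majorizes_raiseMonomial {m : ℕ} (k : RaisingExp m) (φ ψ : Fin m → ℕ)
    (hφ : StrictAnti φ) (hψ : ∀ l, raiseMonomial k (fun l => (φ l : ℤ)) l = ψ l) :
    Majorizes (Finset.univ.val.map ψ) (Finset.univ.val.map φ) ∧
      (k ≠ 0 → sumSq (Finset.univ.val.map φ) < sumSq (Finset.univ.val.map ψ)) := by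
  refine ⟨⟨?_, fun c => ?_⟩, fun hk => ?_⟩
  · have := sum_raiseMonomial k (fun l => (φ l : ℤ))
    simp only [hψ] at this
    exact_mod_cast this
  · have h := sum_raiseMonomial_ge k (fun l => (φ l : ℤ)) (fun x => max (x - c) 0)
      (fun x => if (c : ℤ) < x then 1 else 0) fun x y => by
        split_ifs <;> simp only [one_mul, zero_mul] <;> omega
    simp only [hψ] at h
    have h2 : (0 : ℤ) ≤ ∑ ij : {ij : Fin m × Fin m // ij.1 < ij.2}, (k ij : ℤ) *
        ((if (c : ℤ) < φ ij.1.1 then 1 else 0) - if (c : ℤ) < φ ij.1.2 then 1 else 0) := by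
      refine Finset.sum_nonneg fun ij _ => mul_nonneg (by positivity) ?_
      have := hφ ij.2
      split_ifs <;> omega
    have e : ∀ χ : Fin m → ℕ, (excess c (Finset.univ.val.map χ) : ℤ) =
        ∑ l, max ((χ l : ℤ) - c) 0 := by
      intro χ
      rw [excess, Multiset.map_map]
      change ((∑ l, (χ l - c) : ℕ) : ℤ) = _
      push_cast
      refine Finset.sum_congr rfl fun l _ => ?_
      omega
    have := e φ
    have := e ψ
    omega
  · have h := sum_raiseMonomial_ge k (fun l => (φ l : ℤ)) (fun x => x ^ 2)
      (fun x => 2 * x) fun x y => by nlinarith [sq_nonneg (x - y)]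
    simp only [hψ] at h
    have h2 : (0 : ℤ) < ∑ ij : {ij : Fin m × Fin m // ij.1 < ij.2}, (k ij : ℤ) *
        (2 * (φ ij.1.1 : ℤ) - 2 * (φ ij.1.2 : ℤ)) := by
      obtain ⟨ij, hij⟩ := Function.ne_iff.1 hk
      have hpos : ∀ ij : {ij : Fin m × Fin m // ij.1 < ij.2},
          (0 : ℤ) < 2 * (φ ij.1.1 : ℤ) - 2 * (φ ij.1.2 : ℤ) := fun ij => by
        have := hφ ij.2
        omega
      refine Finset.sum_pos' (fun ij _ => mul_nonneg (by positivity) (hpos ij).le)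
        ⟨ij, Finset.mem_univ _, mul_pos ?_ (hpos ij)⟩
      have : k ij ≠ 0 := hij
      omega
    have e : ∀ χ : Fin m → ℕ, (sumSq (Finset.univ.val.map χ) : ℤ) = ∑ l, (χ l : ℤ) ^ 2 := by
      intro χ
      rw [sumSq, Multiset.map_map]
      change ((∑ l, (χ l) ^ 2 : ℕ) : ℤ) = _
      push_cast
      rfl
    have := e φ
    have := e ψ
    omega

/-- The threshold `c` is the part of `l` at position `k`. The first `k` parts of `l` are at least
`c` and the others at most `c`, so their sum is exactly the excess plus `c * k`; for `m` the
corresponding expression is an upper bound. -/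
theorem dominates_of_majorizes {l m : List ℕ} (hl : l.Pairwise (· > ·))
    (h : Majorizes (l : Multiset ℕ) (m : Multiset ℕ)) : Dominates l m := by
  obtain ⟨h1, h2⟩ := h
  simp only [Multiset.sum_coe] at h1
  refine ⟨h1, fun k => ?_⟩
  rcases le_or_gt l.length k with hk | hk
  · rw [List.take_of_length_le hk, h1]
    exact (List.take_sublist k m).sum_le_sum fun _ _ => Nat.zero_le _
  · set c := l[k] with hc
    have h3 := h2 c
    simp only [excess, Multiset.map_coe, Multiset.sum_coe] at h3
    have e1 : ∀ (t : List ℕ), t.sum ≤ (t.map fun x => x - c).sum + c * t.length := by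
      intro t
      induction t with
      | nil => simp
      | cons a t ih =>
        simp only [List.sum_cons, List.map_cons, List.length_cons, mul_add, mul_one]
        omega
    have e2 : ∀ (t : List ℕ), (∀ x ∈ t, c ≤ x) →
        t.sum = (t.map fun x => x - c).sum + c * t.length := by
      intro t ht
      induction t with
      | nil => simp
      | cons a t ih =>
        have := ih fun x hx => ht x (List.mem_cons_of_mem _ hx)
        have := ht a List.mem_cons_self
        simp only [List.sum_cons, List.map_cons, List.length_cons, mul_add, mul_one]
        omega
    have e3 : ((l.drop k).map fun x => x - c).sum = 0 := by
      rw [List.sum_eq_zero_iff]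
      intro x hx
      obtain ⟨y, hy, rfl⟩ := List.mem_map.1 hx
      obtain ⟨i, hi, rfl⟩ := List.getElem_of_mem hy
      rw [List.getElem_drop]
      rcases Nat.eq_zero_or_pos i with rfl | hi0
      · simp [hc]
      · have := List.pairwise_iff_getElem.1 hl k (k + i) hk (by simp at hi; omega) (by omega)
        omega
    have e4 := e2 (l.take k) (fun x hx => by
      obtain ⟨i, hi, rfl⟩ := List.getElem_of_mem hx
      rw [List.getElem_take]
      rw [List.length_take] at hi
      have := List.pairwise_iff_getElem.1 hl i k (by omega) hk (by omega)
      omega)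
    have e5 := e1 (m.take k)
    have e6 : (l.map fun x => x - c).sum = ((l.take k).map fun x => x - c).sum +
        ((l.drop k).map fun x => x - c).sum := by
      rw [← List.sum_append, ← List.map_append, List.take_append_drop]
    have e7 : (m.map fun x => x - c).sum = ((m.take k).map fun x => x - c).sum +
        ((m.drop k).map fun x => x - c).sum := by
      rw [← List.sum_append, ← List.map_append, List.take_append_drop]
    have e8 : c * (m.take k).length ≤ c * (l.take k).length :=
      Nat.mul_le_mul_left _ (by rw [List.length_take, List.length_take]; omega)
    omega

end Straightening

/-! ### Unitriangularity between words and products of generators. -/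

section FockStraightening

variable {ι A : Type*} [CommRing A] [Algebra ℂ A]

namespace TwistedFock

variable (T : TwistedFock ι A) (γ : ι)

/-- In the quadratic relation of degree `2 * m` the square is the middle term, and the terms on its
two sides agree by symmetry. This explains the factor `2`. -/
theorem q_mul_self {m : ℕ} (hm : 0 < m) : T.q γ m * T.q γ m = ∑ i ∈ Finset.range m,
    ((-1) ^ i * 2 : ℤ) • (T.q γ (m + (i + 1) : ℕ) * T.q γ (m - (i + 1) : ℕ)) := by
  have h := T.q_rel γ (m + m) (by omega)
  rw [Finset.Nat.sum_antidiagonal_eq_sum_range_succ_mk, ← Nat.add_one,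
    show m + m + 1 = m + (m + 1) by ring, Finset.sum_range_add, Finset.sum_range_succ'] at h
  rw [← Finset.sum_range_reflect] at h
  have e1 : ∀ i ∈ Finset.range m, (-1 : A) ^ (m + m - (m - 1 - i)) *
      (T.q γ ((m - 1 - i : ℕ) : ℤ) * T.q γ ((m + m - (m - 1 - i) : ℕ) : ℤ)) =
      -((-1) ^ m * ((-1) ^ i * (T.q γ (m + (i + 1) : ℕ) * T.q γ (m - (i + 1) : ℕ)))) := by
    intro i hi
    have hi' := Finset.mem_range.1 hi
    rw [show m + m - (m - 1 - i) = m + (i + 1) by omega, show m - 1 - i = m - (i + 1) by omega]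
    ring
  have e2 : ∀ i ∈ Finset.range m, (-1 : A) ^ (m + m - (m + (i + 1))) *
      (T.q γ ((m + (i + 1) : ℕ) : ℤ) * T.q γ ((m + m - (m + (i + 1)) : ℕ) : ℤ)) =
      -((-1) ^ m * ((-1) ^ i * (T.q γ (m + (i + 1) : ℕ) * T.q γ (m - (i + 1) : ℕ)))) := by
    intro i hi
    have hi' := Finset.mem_range.1 hi
    rw [show m + m - (m + (i + 1)) = m - (i + 1) by omega]
    have : (-1 : A) ^ m = (-1) ^ (m - (i + 1)) * (-1) ^ (i + 1) := by
      rw [← pow_add, Nat.sub_add_cancel (by omega)]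
    rw [this]
    have h1 : (-1 : A) ^ i * (-1) ^ i = 1 := by rw [← mul_pow]; simp
    linear_combination (-1 : A) ^ (m - (i + 1)) * (T.q γ (m + (i + 1) : ℕ) *
      T.q γ (m - (i + 1) : ℕ)) * (-h1)
  rw [Finset.sum_congr rfl e1, Finset.sum_congr rfl e2, Finset.sum_neg_distrib,
    ← Finset.mul_sum, add_zero, Nat.add_sub_cancel] at h
  have h2 : (-1 : A) ^ m * (-1) ^ m = 1 := by rw [← mul_pow]; simp
  have e3 : ∑ i ∈ Finset.range m,
      ((-1) ^ i * 2 : ℤ) • (T.q γ (m + (i + 1) : ℕ) * T.q γ (m - (i + 1) : ℕ)) =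
      2 * ∑ i ∈ Finset.range m, (-1 : A) ^ i *
        (T.q γ (m + (i + 1) : ℕ) * T.q γ (m - (i + 1) : ℕ)) := by
    rw [Finset.mul_sum]
    refine Finset.sum_congr rfl fun i _ => ?_
    rw [zsmul_eq_mul]
    push_cast
    ring
  rw [e3]
  generalize ∑ i ∈ Finset.range m, (-1 : A) ^ i *
        (T.q γ (m + (i + 1) : ℕ) * T.q γ (m - (i + 1) : ℕ)) = S at *
  linear_combination (-1 : A) ^ m * h - (T.q γ m * T.q γ m - 2 * S) * h2

/-- The product of the generators with indices in a strict partition. -/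
noncomputable def prodParts (l : StrictPartition) : A := (l.1.map fun k : ℕ => T.q γ k).prod

/-- The word of a strict partition. -/
noncomputable def wordParts (l : StrictPartition) : A := T.word γ l.parts

/-- Strict partitions of the same integer that strictly dominate `l` and have larger sum of
squares. -/
def _root_.SpinWreath.StrictPartition.above (l : StrictPartition) : Set StrictPartition :=
  {m | Dominates m.1 l.1 ∧ sumSq l.1 < sumSq m.1}

theorem exists_strictPartition {t : Multiset ℕ} (h1 : t.Nodup) (h2 : ∀ x ∈ t, 0 < x) :
    ∃ l : StrictPartition, (l.1 : Multiset ℕ) = t := by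
  refine ⟨⟨t.sort (· ≥ ·), ?_, fun x hx => h2 x (by simpa using hx)⟩, by simp⟩
  have h3 := Multiset.pairwise_sort t (· ≥ ·)
  have h4 : (t.sort (· ≥ ·)).Nodup := by
    rw [← Multiset.coe_nodup, Multiset.sort_eq]
    exact h1
  exact (h3.and h4).imp fun ⟨a, b⟩ => lt_of_le_of_ne a (Ne.symm b)

/-- In the raising operator expansion the trivial monomial gives the product itself. Every other
term either vanishes, having a negative index, or straightens to strict partitions that dominate `l`
and have larger sum of squares. -/
theorem wordParts_sub_mem (l : StrictPartition) : T.wordParts γ l - T.prodParts γ l ∈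
    Submodule.span ℤ (T.prodParts γ '' l.above) := by
  obtain ⟨φ, hφ, hlen⟩ : ∃ φ : Fin l.1.length → ℕ, StrictAnti φ ∧ l.1 = List.ofFn φ :=
    ⟨l.1.get, fun i j hij => List.pairwise_iff_getElem.1 l.2.1 i j i.2 j.2 hij,
      (List.ofFn_get l.1).symm⟩
  generalize l.1.length = m at φ
  have hw : T.wordParts γ l = T.word γ (List.ofFn fun i => (φ i : ℤ)) := by
    rw [wordParts, StrictPartition.parts, hlen, List.map_ofFn]
    rfl
  have hp : T.prodParts γ l = ∏ j, T.q γ (φ j) := by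
    rw [prodParts, hlen, List.map_ofFn, List.prod_ofFn]
    rfl
  have hl : (l.1 : Multiset ℕ) = Finset.univ.val.map φ := by
    rw [hlen, Fin.univ_val_map]
  have hterm : ∀ k : RaisingExp m, k ≠ 0 → (raisingInt k : A) *
      ∏ j, T.q γ (raiseMonomial k (fun i => (φ i : ℤ)) j) ∈
      Submodule.span ℤ (T.prodParts γ '' l.above) := by
    intro k hk
    by_cases hneg : ∀ j, 0 ≤ raiseMonomial k (fun i => (φ i : ℤ)) j
    · rw [← zsmul_eq_mul]
      refine Submodule.smul_mem _ _ ?_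
      obtain ⟨ψ, hψ⟩ : ∃ ψ : Fin m → ℕ, ∀ j, raiseMonomial k (fun i => (φ i : ℤ)) j = ψ j :=
        ⟨fun j => (raiseMonomial k (fun i => (φ i : ℤ)) j).toNat, fun j => by
          rw [Int.toNat_of_nonneg (hneg j)]⟩
      obtain ⟨hm, hs⟩ := majorizes_raiseMonomial k φ ψ hφ hψ
      have := straighten (fun n : ℕ => T.q γ n) (T.q_zero γ) (fun m hm => T.q_mul_self γ hm)
        (Finset.univ.val.map ψ)
      simp only [hψ]
      have e : ((Finset.univ.val.map ψ).map fun n : ℕ => T.q γ n).prod = ∏ j, T.q γ (ψ j) := by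
        rw [Multiset.map_map]
        rfl
      rw [e] at this
      refine Submodule.span_mono ?_ this
      rintro _ ⟨t, ⟨t1, t2, t3, t4⟩, rfl⟩
      obtain ⟨μ, rfl⟩ := exists_strictPartition t1 t2
      refine ⟨μ, ⟨dominates_of_majorizes μ.2.1 (hl ▸ t3.trans hm), ?_⟩, ?_⟩
      · rw [hl]
        exact (hs hk).trans_le t4
      · simp [prodParts]
    · push Not at hneg
      obtain ⟨j, hj⟩ := hneg
      rw [T.prod_q_eq_zero γ j hj, mul_zero]
      exact Submodule.zero_mem _
  rw [hw, word_eq_raising, hp]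
  have hfin := T.support_raising_finite γ fun i => (φ i : ℤ)
  -- The zero exponent is inserted by hand so that its term can be split off without first showing
  -- that it lies in the support.
  rw [finsum_eq_sum_of_support_subset (s := insert 0 hfin.toFinset)
    _ (fun k hk => by simpa using Or.inr hk), ← Finset.add_sum_erase _ _ (Finset.mem_insert_self _ _)]
  have h0 : (raisingInt (0 : RaisingExp m) : A) *
      ∏ j, T.q γ (raiseMonomial 0 (fun i => (φ i : ℤ)) j) = ∏ j, T.q γ (φ j) := by
    have : ∀ j, raiseMonomial 0 (fun i => (φ i : ℤ)) j = φ j := fun j => by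
      rw [raiseMonomial_apply]; simp
    simp [this, raisingInt, twistCoeff]
  rw [h0, add_sub_cancel_left]
  exact Submodule.sum_mem _ fun k hk => hterm k (Finset.ne_of_mem_erase hk)

theorem sumSq_le_of_dominates {l m : StrictPartition} (h : Dominates m.1 l.1) :
    sumSq m.1 ≤ l.1.sum ^ 2 := by
  have := sumSq_le (m.1 : Multiset ℕ)
  rw [Multiset.sum_coe, h.1] at this
  exact this

/-- The triangular relation is inverted by induction on the gap between the sum of squares and its
upper bound, the square of the total. -/
theorem prodParts_mem_span (l : StrictPartition) :
    T.prodParts γ l ∈ Submodule.span ℤ (Set.range (T.wordParts γ)) := by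
  induction h : l.1.sum ^ 2 - sumSq l.1 using Nat.strong_induction_on generalizing l with
  | _ N ih =>
    subst h
    have h1 := T.wordParts_sub_mem γ l
    have h2 : Submodule.span ℤ (T.prodParts γ '' l.above) ≤
        Submodule.span ℤ (Set.range (T.wordParts γ)) := by
      rw [Submodule.span_le]
      rintro _ ⟨m, ⟨hm, hs⟩, rfl⟩
      refine ih (m.1.sum ^ 2 - sumSq m.1) ?_ m rfl
      have := sumSq_le_of_dominates hm
      rw [hm.1]
      omega
    have h3 : T.wordParts γ l ∈ Submodule.span ℤ (Set.range (T.wordParts γ)) :=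
      Submodule.subset_span ⟨l, rfl⟩
    rw [show T.prodParts γ l = T.wordParts γ l - (T.wordParts γ l - T.prodParts γ l) by abel]
    exact Submodule.sub_mem _ h3 (h2 h1)

end TwistedFock

end FockStraightening

/-! ### Bases of a twisted Fock space -/

section FockBasis

variable {ι A : Type*} [CommRing A] [Algebra ℂ A]

namespace TwistedFock

variable (T : TwistedFock ι A)

/-- Requiring `mu` to agree with `lam` outside `s` makes `mu ≠ lam` a statement about the indices in
`s`, so strictness survives when an index is added. -/
theorem prod_wordParts_sub_mem [DecidableEq ι] (s : Finset ι) (lam : ι → StrictPartition) :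
    ∏ γ ∈ s, T.wordParts γ (lam γ) - ∏ γ ∈ s, T.prodParts γ (lam γ) ∈
    Submodule.span ℤ ((fun mu : ι → StrictPartition => ∏ γ ∈ s, T.prodParts γ (mu γ)) ''
      {mu | (∀ γ ∈ s, Dominates (mu γ).1 (lam γ).1) ∧ (∀ γ, γ ∉ s → mu γ = lam γ) ∧ mu ≠ lam}) := by
  induction s using Finset.induction_on with
  | empty => simp
  | insert a s ha ih =>
    have key : ∀ (U : Set StrictPartition) (V : Set (ι → StrictPartition)) (x y : A),
        x ∈ Submodule.span ℤ (T.prodParts a '' U) →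
        y ∈ Submodule.span ℤ
          ((fun mu : ι → StrictPartition => ∏ γ ∈ s, T.prodParts γ (mu γ)) '' V) →
        (∀ m ∈ U, ∀ mu ∈ V, Dominates m.1 (lam a).1 ∧ (∀ γ ∈ s, Dominates (mu γ).1 (lam γ).1) ∧
          (∀ γ, γ ∉ s → mu γ = lam γ) ∧ (m ≠ lam a ∨ mu ≠ lam)) →
        x * y ∈ Submodule.span ℤ
          ((fun mu : ι → StrictPartition => ∏ γ ∈ insert a s, T.prodParts γ (mu γ)) ''
          {mu | (∀ γ ∈ insert a s, Dominates (mu γ).1 (lam γ).1) ∧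
            (∀ γ, γ ∉ insert a s → mu γ = lam γ) ∧ mu ≠ lam}) := by
      intro U V x y hx hy hUV
      have h := Submodule.mul_mem_mul hx hy
      rw [Submodule.span_mul_span] at h
      refine Submodule.span_mono ?_ h
      rintro _ ⟨_, ⟨m, hm, rfl⟩, _, ⟨mu, hmu, rfl⟩, rfl⟩
      obtain ⟨h1, h2, h3, h4⟩ := hUV m hm mu hmu
      have hne : ∀ γ ∈ s, γ ≠ a := fun γ hγ h => ha (h ▸ hγ)
      refine ⟨Function.update mu a m, ⟨fun γ hγ => ?_, fun γ hγ => ?_, fun h => ?_⟩, ?_⟩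
      · rcases Finset.mem_insert.1 hγ with rfl | hγ
        · simpa using h1
        · rw [Function.update_of_ne (hne γ hγ)]
          exact h2 γ hγ
      · rw [Finset.mem_insert, not_or] at hγ
        rw [Function.update_of_ne hγ.1]
        exact h3 γ hγ.2
      · have e : m = lam a := by simpa using congrFun h a
        refine h4.elim (fun h5 => h5 e) fun h5 => h5 ?_
        rw [← h, e, eq_comm, Function.update_eq_self_iff, h3 a ha]
      · simp only
        rw [Finset.prod_insert ha, Function.update_self]
        congr 1
        exact Finset.prod_congr rfl fun γ hγ => by rw [Function.update_of_ne (hne γ hγ)]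
    have hself : ∀ l : StrictPartition, Dominates l.1 l.1 := fun l => ⟨rfl, fun _ => le_rfl⟩
    have ha1 := T.wordParts_sub_mem a (lam a)
    have hx : T.prodParts a (lam a) ∈ Submodule.span ℤ (T.prodParts a '' {lam a}) :=
      Submodule.subset_span ⟨_, rfl, rfl⟩
    have hy : ∏ γ ∈ s, T.prodParts γ (lam γ) ∈ Submodule.span ℤ
        ((fun mu : ι → StrictPartition => ∏ γ ∈ s, T.prodParts γ (mu γ)) '' {lam}) :=
      Submodule.subset_span ⟨_, rfl, rfl⟩
    have habove : ∀ l : StrictPartition, ∀ m ∈ l.above, Dominates m.1 l.1 ∧ m ≠ l := by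
      rintro l m ⟨h1, h2⟩
      exact ⟨h1, fun h => by rw [h] at h2; exact lt_irrefl _ h2⟩
    rw [Finset.prod_insert ha, Finset.prod_insert ha]
    -- Each of the three terms contains at least one difference, hence a strict change at the new
    -- index or at an old one.
    rw [show ∀ w x W X : A, w * W - x * X = (w - x) * (W - X) + (w - x) * X + x * (W - X) from
      fun w x W X => by ring]
    refine Submodule.add_mem _ (Submodule.add_mem _ (key _ _ _ _ ha1 ih ?_)
      (key _ _ _ _ ha1 hy ?_)) (key _ _ _ _ hx ih ?_)
    · rintro m hm mu ⟨h1, h2, h3⟩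
      exact ⟨(habove _ m hm).1, h1, h2, Or.inr h3⟩
    · rintro m hm mu rfl
      exact ⟨(habove _ m hm).1, fun γ _ => hself _, fun _ _ => rfl, Or.inl (habove _ m hm).2⟩
    · rintro m rfl mu ⟨h1, h2, h3⟩
      exact ⟨hself _, h1, h2, Or.inr h3⟩

variable [Fintype ι]

omit [Algebra ℂ A] in
theorem prod_mem_span {κ : ι → Type*} (f : (γ : ι) → A) (g : (γ : ι) → κ γ → A)
    (h : ∀ γ, f γ ∈ Submodule.span ℤ (Set.range (g γ))) :
    ∏ γ, f γ ∈ Submodule.span ℤ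
      (Set.range fun mu : (γ : ι) → κ γ => ∏ γ, g γ (mu γ)) := by
  have h1 : ∏ γ, f γ ∈ ∏ γ, Submodule.span ℤ (Set.range (g γ)) := by
    induction (Finset.univ : Finset ι) using Finset.cons_induction with
    | empty => exact Submodule.one_le.1 le_rfl
    | cons a s ha ih =>
      rw [Finset.prod_cons, Finset.prod_cons]
      exact Submodule.mul_mem_mul (h a) ih
  rw [Submodule.prod_span] at h1
  refine Submodule.span_mono ?_ h1
  intro x hx
  obtain ⟨y, hy, rfl⟩ := (Set.mem_fintype_prod _ _).1 hx
  choose mu hmu using hy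
  exact ⟨mu, by simp only [hmu]⟩

omit [Fintype ι] in
theorem multiset_prod_mem_span (γ : ι) (s : Multiset ℕ) : (s.map fun n : ℕ => T.q γ n).prod ∈
    Submodule.span ℤ (Set.range (T.wordParts γ)) := by
  refine (Submodule.span_le.2 ?_) (straighten (fun n : ℕ => T.q γ n) (T.q_zero γ)
    (fun m hm => T.q_mul_self γ hm) s)
  rintro _ ⟨t, ⟨h1, h2, -⟩, rfl⟩
  obtain ⟨l, rfl⟩ := exists_strictPartition h1 h2
  have := T.prodParts_mem_span γ l
  simpa [prodParts] using this

/-- If the generators generate `A`, then the words of strict partitions span `A`. -/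
theorem span_prod_wordParts
    (h : Algebra.adjoin ℂ (Set.range fun p : ι × ℕ => T.q p.1 (p.2 : ℤ)) = ⊤) :
    Submodule.span ℂ (Set.range fun lam : ι → StrictPartition =>
      ∏ γ, T.wordParts γ (lam γ)) = ⊤ := by
  classical
  rw [eq_top_iff, ← Algebra.top_toSubmodule, ← h, Algebra.adjoin_eq_span, Submodule.span_le]
  intro x hx
  obtain ⟨s, rfl⟩ : ∃ s : ι → Multiset ℕ, ∏ γ, ((s γ).map fun n : ℕ => T.q γ n).prod = x := by
    induction hx using Submonoid.closure_induction with
    | mem x hx =>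
      obtain ⟨⟨γ, n⟩, rfl⟩ := hx
      refine ⟨Pi.single γ {n}, ?_⟩
      rw [Finset.prod_eq_single γ]
      · simp
      · intro γ' _ hne
        simp [Pi.single_eq_of_ne hne]
      · simp
    | one => exact ⟨0, by simp⟩
    | mul x y _ _ hx hy =>
      obtain ⟨s, rfl⟩ := hx
      obtain ⟨t, rfl⟩ := hy
      exact ⟨s + t, by simp [Finset.prod_mul_distrib]⟩
  have := prod_mem_span _ _ fun γ => T.multiset_prod_mem_span γ (s γ)
  exact Submodule.span_le_restrictScalars ℤ ℂ _ this

end TwistedFock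

end FockBasis

/-! ### Completeness of the irreducible characters -/

section Completeness

open Representation

/-- The subrepresentations of equivalent representations correspond. -/
def subrepresentationIso {k G V W : Type*} [Field k] [Group G] [AddCommGroup V] [Module k V]
    [AddCommGroup W] [Module k W] {ρ : Representation k G V} {σ : Representation k G W}
    (φ : ρ.Equiv σ) : Subrepresentation ρ ≃o Subrepresentation σ where
  toFun U := ⟨U.toSubmodule.comap φ.symm.toLinearMap, fun g v hv => by
    have h := φ.symm.toIntertwiningMap.isIntertwining _ _ g v
    exact (congrArg (· ∈ U.toSubmodule) h).mpr (U.apply_mem_toSubmodule g hv)⟩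
  invFun U := ⟨U.toSubmodule.comap φ.toLinearMap, fun g v hv => by
    have h := φ.toIntertwiningMap.isIntertwining _ _ g v
    exact (congrArg (· ∈ U.toSubmodule) h).mpr (U.apply_mem_toSubmodule g hv)⟩
  left_inv U := by
    ext v
    change φ.symm (φ v) ∈ U.toSubmodule ↔ _
    rw [Representation.Equiv.symm_apply_apply]
  right_inv U := by
    ext v
    change φ (φ.symm v) ∈ U.toSubmodule ↔ _
    rw [Representation.Equiv.apply_symm_apply]
  map_rel_iff' {U U'} := by
    constructor
    · intro h v hv
      have := @h (φ v) (show φ.symm (φ v) ∈ U.toSubmodule by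
        rw [Representation.Equiv.symm_apply_apply]; exact hv)
      change φ.symm (φ v) ∈ U'.toSubmodule at this
      rw [Representation.Equiv.symm_apply_apply] at this
      exact this
    · intro h v hv
      exact h hv

variable {Γ : Type*} [Group Γ]

/-- The character of an irreducible representation, as an element of `Γ^*`. -/
theorem exists_irrChar {V : Type*} [AddCommGroup V] [Module ℂ V] [FiniteDimensional ℂ V]
    (ρ : Representation ℂ Γ V) [IsIrreducible ρ] : ∃ γ : IrrChar Γ, γ.1 = ρ.character := by
  let e := (Module.finBasis ℂ V).equivFun
  let σ : Representation ℂ Γ (Fin (Module.finrank ℂ V) → ℂ) :=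
    { toFun := fun g => e.conj (ρ g)
      map_one' := by rw [map_one]; exact LinearEquiv.conj_id e
      map_mul' := fun g h => by rw [map_mul]; exact LinearEquiv.conj_comp e _ _ }
  let φ : ρ.Equiv σ := Representation.Equiv.mk e fun g => by
    ext v
    simp [σ, LinearEquiv.conj_apply_apply]
  exact ⟨⟨σ.character, _, σ, (subrepresentationIso φ).isSimpleOrder_iff.1 inferInstance, rfl⟩,
    (char_iso φ).symm⟩

variable [Fintype Γ]

/-- A class function orthogonal to the irreducible characters acts by zero. -/
theorem sum_smul_rep_eq_zero {φ : Γ → ℂ} (hφ : ∀ g h, φ (h * g * h⁻¹) = φ g)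
    (horth : ∀ γ : IrrChar Γ, ∑ g, φ g * γ.1 g = 0) (n : ℕ) {V : Type*} [AddCommGroup V]
    [Module ℂ V] [FiniteDimensional ℂ V] (ρ : Representation ℂ Γ V)
    (hn : Module.finrank ℂ V = n) : ∑ g, φ g • ρ g = 0 := by
  induction n using Nat.strong_induction_on generalizing V with
  | _ n ih =>
    subst hn
    by_cases hirr : IsIrreducible ρ
    -- On an irreducible representation the operator is a scalar by Schur's lemma, and orthogonality
    -- to the character makes its trace zero.
    · let f : IntertwiningMap ρ ρ := ⟨∑ g, φ g • ρ g, fun h => by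
        change (∑ g, φ g • ρ g) * ρ h = ρ h * ∑ g, φ g • ρ g
        rw [Finset.sum_mul, Finset.mul_sum, ← (MulAut.conj h).toEquiv.sum_comp]
        refine Finset.sum_congr rfl fun g _ => ?_
        change (φ (h * g * h⁻¹) • ρ (h * g * h⁻¹)) * ρ h = ρ h * (φ g • ρ g)
        rw [hφ, smul_mul_assoc, mul_smul_comm, ← map_mul, ← map_mul]
        simp⟩
      obtain ⟨c, hc⟩ :=
        (IsIrreducible.algebraMap_intertwiningMap_bijective_of_isAlgClosed (ρ := ρ)).2 f
      have hf : ∑ g, φ g • ρ g = c • LinearMap.id := by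
        change f.toLinearMap = _
        rw [← hc]
        rfl
      obtain ⟨γ, hγ⟩ := exists_irrChar ρ
      have htr := congrArg (LinearMap.trace ℂ V) hf
      rw [map_sum, map_smul, LinearMap.trace_id] at htr
      have h0 : ∑ g, LinearMap.trace ℂ V (φ g • ρ g) = 0 := by
        rw [← horth γ, hγ]
        exact Finset.sum_congr rfl fun g _ => by rw [map_smul]; rfl
      rw [h0, smul_eq_mul, eq_comm, mul_eq_zero] at htr
      rcases htr with h1 | h1
      · rw [hf, h1, zero_smul]
      · have : Subsingleton V := Module.finrank_zero_iff.1 (by exact_mod_cast h1)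
        ext v
        exact Subsingleton.elim _ _
    · by_cases hV : Subsingleton V
      · ext v
        exact Subsingleton.elim _ _
      rw [not_subsingleton_iff_nontrivial] at hV
      -- The order of the group is invertible, so a proper nonzero subrepresentation has a
      -- complement by Maschke's theorem. Both summands have smaller dimension.
      have : NeZero (Nat.card Γ : ℂ) := ⟨Nat.cast_ne_zero.2 Nat.card_pos.ne'⟩
      have hnt : Nontrivial (Subrepresentation ρ) := by
        refine ⟨⟨⊥, ⊤, fun h => ?_⟩⟩
        have : (⊥ : Submodule ℂ V) = ⊤ := congrArg Subrepresentation.toSubmodule h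
        exact bot_ne_top this
      obtain ⟨U, hU⟩ : ∃ U : Subrepresentation ρ, ¬(U = ⊥ ∨ U = ⊤) := by
        by_contra hc
        exact hirr ⟨fun U => by_contra fun h => hc ⟨U, h⟩⟩
      rw [not_or] at hU
      obtain ⟨U', hUU'⟩ := exists_isCompl U
      have key : ∀ W : Subrepresentation ρ, W ≠ ⊤ → ∀ w ∈ W.toSubmodule,
          (∑ g, φ g • ρ g) w = 0 := by
        intro W hW w hw
        have hlt : Module.finrank ℂ W.toSubmodule < Module.finrank ℂ V :=
          Submodule.finrank_lt fun h => hW (Subrepresentation.toSubmodule_injective h)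
        have h := congrArg (fun f => ((f ⟨w, hw⟩ : W.toSubmodule) : V))
          (ih _ hlt W.toRepresentation rfl)
        simp only [LinearMap.sum_apply, LinearMap.smul_apply, AddSubmonoidClass.coe_finsetSum,
          LinearMap.zero_apply, ZeroMemClass.coe_zero] at h ⊢
        exact h
      have hU' : U' ≠ ⊤ := fun h => hU.1 (by
        have := hUU'.inf_eq_bot
        rwa [h, inf_top_eq] at this)
      ext v
      have hv : v ∈ U.toSubmodule ⊔ U'.toSubmodule := by
        rw [← Subrepresentation.toSubmodule_sup, hUU'.sup_eq_top]
        exact Submodule.mem_top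
      obtain ⟨u, hu, u', hu', rfl⟩ := Submodule.mem_sup.1 hv
      rw [map_add, key U hU.2 u hu, key U' hU' u' hu', add_zero]
      rfl

/-- On the regular representation the operator attached to `φ` sends the basis vector of the
identity to the vector with coefficients `φ`. -/
theorem eq_zero_of_orthogonal {φ : Γ → ℂ} (hφ : ∀ g h, φ (h * g * h⁻¹) = φ g)
    (horth : ∀ γ : IrrChar Γ, ∑ g, φ g * γ.1 g = 0) : φ = 0 := by
  classical
  have h := sum_smul_rep_eq_zero hφ horth _ (Representation.leftRegular ℂ Γ) rfl
  have h1 := congrArg (fun f => f (MonoidAlgebra.single 1 1)) h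
  funext g
  have h2 := congrArg (fun f : MonoidAlgebra ℂ Γ => f.coeff g) h1
  simpa [LinearMap.sum_apply, Finsupp.single_apply] using h2

omit [Fintype Γ] in
/-- The irreducible characters span the space of functions on the set of conjugacy classes. -/
theorem span_onClasses [Finite Γ] :
    Submodule.span ℂ (Set.range fun γ : IrrChar Γ => onClasses γ.1) = ⊤ := by
  classical
  have := Fintype.ofFinite Γ
  have := Fintype.ofFinite (ConjClasses Γ)
  by_contra hne
  obtain ⟨f, hf0, hf⟩ := Submodule.exists_le_ker_of_lt_top _ (lt_top_iff_ne_top.2 hne)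
  -- If the span were proper, a nonzero functional would vanish on it. Dividing its values by the
  -- class sizes gives a class function whose sum against `γ` is the value of the functional at `γ`.
  let N : ConjClasses Γ → ℂ := fun c => ((Finset.univ.filter fun g : Γ => ConjClasses.mk g = c).card : ℂ)
  have hN : ∀ c, N c ≠ 0 := fun c => by
    obtain ⟨g, rfl⟩ := ConjClasses.mk_surjective c
    exact Nat.cast_ne_zero.2 (Finset.card_ne_zero.2 ⟨g, by simp⟩)
  let φ : Γ → ℂ := fun g => f (Pi.single (ConjClasses.mk g) 1) * (N (ConjClasses.mk g))⁻¹
  have hφ : φ = 0 := by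
    refine eq_zero_of_orthogonal (fun g h => ?_) fun γ => ?_
    · have : ConjClasses.mk (h * g * h⁻¹) = ConjClasses.mk g :=
        ConjClasses.mk_eq_mk_iff_isConj.2 (isConj_iff.2 ⟨h, rfl⟩).symm
      simp only [φ, this]
    · have h1 : f (onClasses γ.1) = 0 := hf (Submodule.subset_span ⟨γ, rfl⟩)
      have h2 : f (onClasses γ.1) =
          ∑ c, onClasses γ.1 c * f (Pi.single c 1) := by
        conv_lhs => rw [pi_eq_sum_univ' (onClasses γ.1), map_sum]
        refine Finset.sum_congr rfl fun c _ => ?_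
        rw [map_smul, smul_eq_mul]
      rw [← h1, h2, ← Finset.sum_fiberwise Finset.univ ConjClasses.mk]
      refine Finset.sum_congr rfl fun c _ => ?_
      have h3 : ∀ g ∈ Finset.univ.filter fun g : Γ => ConjClasses.mk g = c, φ g * γ.1 g =
          f (Pi.single c 1) * (N c)⁻¹ * onClasses γ.1 c := by
        intro g hg
        rw [← (Finset.mem_filter.1 hg).2, onClasses_mk γ.conj]
      rw [Finset.sum_congr rfl h3, Finset.sum_const, nsmul_eq_mul]
      change N c * _ = _
      field_simp [hN c]
  apply hf0
  refine LinearMap.pi_ext' fun c => LinearMap.ext_ring ?_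
  obtain ⟨g, rfl⟩ := ConjClasses.mk_surjective c
  have := congrFun hφ g
  simp only [φ, Pi.zero_apply, mul_eq_zero, inv_eq_zero, hN, or_false] at this
  simpa using this

end Completeness

/-! ### `R^-_Γ` as a twisted Fock space -/

section RMinusFock

variable {Γ : Type*} [Group Γ] [Finite Γ]

/-- The elements `q_n(γ)` of `R^-_Γ`. -/
noncomputable def qElt (γ : IrrChar Γ) (n : ℤ) : RMinus Γ :=
  if n < 0 then 0 else expElt γ.onCyc n.toNat

/-- The adjoint of the multiplication by `q_n(γ)`. -/
noncomputable def hOp (γ : IrrChar Γ) (n : ℤ) : RMinus Γ →ₗ[ℂ] RMinus Γ :=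
  if n < 0 then 0 else lower γ.onCyc n.toNat

omit [Finite Γ] in
theorem qElt_natCast (γ : IrrChar Γ) (n : ℕ) : qElt γ (n : ℤ) = expElt γ.onCyc n := by
  rw [qElt, if_neg (by omega), Int.toNat_natCast]

omit [Finite Γ] in
theorem qElt_of_neg (γ : IrrChar Γ) {n : ℤ} (h : n < 0) : qElt γ n = 0 := if_pos h

theorem hOp_natCast (γ : IrrChar Γ) (n : ℕ) : hOp γ (n : ℤ) = lower γ.onCyc n := by
  rw [hOp, if_neg (by omega), Int.toNat_natCast]

theorem hOp_of_neg (γ : IrrChar Γ) {n : ℤ} (h : n < 0) : hOp γ n = 0 := if_pos h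

theorem rForm_onCyc (γ γ' : IrrChar Γ) [Decidable (γ = γ')] (n : ℕ) :
    rForm Γ (expElt γ.onCyc n) (expElt γ'.onCyc n) =
      if n = 0 then 1 else if γ = γ' then 2 else 0 := by
  rw [rForm_expElt, expElt_apply_self, ← normChar_eq_spinExp, ← normChar_eq_spinExp,
    form_normChar]

/-- The weight `X d + (-1) ^ d X d` vanishes on cycles of odd length, so `expElt` of it is zero in
positive degree; the exponential law expands it into this sum. -/
theorem sum_expElt_neg_mul (X : ℕ × ConjClasses Γ → ℂ) {n : ℕ} (hn : n ≠ 0) :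
    ∑ p ∈ Finset.HasAntidiagonal.antidiagonal n,
      (-1) ^ p.2 * (expElt X p.1 * expElt X p.2) = 0 := by
  have h := expElt_add X (fun d => (-1) ^ d.1 * X d) n
  rw [expElt_of_odd_eq_zero (fun d hd => by simp [hd.neg_one_pow]) hn] at h
  rw [h]
  refine Finset.sum_congr rfl fun p _ => ?_
  rw [expElt_pow_mul, mul_smul_comm, Algebra.smul_def, map_pow, map_neg, map_one]

open Classical in
/-- The twisted Fock space `R^-_Γ`. -/
noncomputable def fock (Γ : Type*) [Group Γ] [Finite Γ] : TwistedFock (IrrChar Γ) (RMinus Γ) where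
  q := qElt
  H := hOp
  form := rForm Γ
  q_zero γ := by
    change qElt γ ((0 : ℕ) : ℤ) = 1
    rw [qElt_natCast, expElt_zero]
  q_neg γ n h := qElt_of_neg γ h
  q_rel γ n hn := by
    simp only [qElt_natCast]
    exact sum_expElt_neg_mul _ hn
  H_zero γ F := by
    change hOp γ ((0 : ℕ) : ℤ) F = F
    rw [hOp_natCast, lower_zero]
  H_neg γ n h := hOp_of_neg γ h
  H_mul γ b F G := by
    simp only [hOp_natCast]
    exact lower_mul _ _ _ _
  H_q_self γ b n := by
    rw [hOp_natCast]
    rcases lt_or_ge n 0 with hn | hn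
    · rw [qElt_of_neg γ hn, qElt_of_neg γ (by omega), map_zero, mul_zero]
    · obtain ⟨n, rfl⟩ := Int.eq_ofNat_of_zero_le hn
      rw [qElt_natCast, lower_expElt, rForm_onCyc, if_pos rfl]
      split_ifs with h1 h2 h2
      · rw [one_smul, one_mul, ← qElt_natCast, Nat.cast_sub h1]
      · rw [← Nat.cast_sub h1, qElt_natCast, Algebra.smul_def, map_ofNat]
      · omega
      · rw [qElt_of_neg γ (by omega), mul_zero]
  H_q_of_ne γ γ' hne b hb n := by
    rw [hOp_natCast]
    rcases lt_or_ge n 0 with hn | hn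
    · rw [qElt_of_neg γ' hn, map_zero]
    · obtain ⟨n, rfl⟩ := Int.eq_ofNat_of_zero_le hn
      rw [qElt_natCast, lower_expElt, rForm_onCyc, if_neg hb, if_neg hne, zero_smul, ite_self]
  exists_bound F := by
    obtain ⟨N, hN⟩ := RMinus.exists_bound F
    refine ⟨N, fun γ b hb => ?_⟩
    rw [hOp_natCast, lower_eq_zero _ hN hb]
  form_comm := rForm_comm
  form_H γ n F G := by
    rcases lt_or_ge n 0 with hn | hn
    · rw [hOp_of_neg γ hn, qElt_of_neg γ hn, zero_mul, map_zero]
      simp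
    · obtain ⟨n, rfl⟩ := Int.eq_ofNat_of_zero_le hn
      rw [hOp_natCast, qElt_natCast, rForm_lower]
  form_one := rForm_one_one
  eq_of_form F G h := eq_of_rForm h

/-! ### The generators -/

-- The exponent is the number of cycles of `x`, which is at most `n`. It does not depend on the
-- weight or on the scalar.
omit [Finite Γ] in
theorem exists_spinExp_smul {n : ℕ} (x : Wreath Γ n) : ∃ k : Fin (n + 1),
    ∀ (c : ℂ) (X : ℕ × ConjClasses Γ → ℂ), spinExp (c • X) n x = c ^ (k : ℕ) * spinExp X n x := by
  have hk : Fintype.card (Orbits (wreathPerm x)) ≤ n := by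
    have := Nat.card_le_card_of_surjective _
      (Quotient.mk_surjective (s := Equiv.Perm.SameCycle.setoid (wreathPerm x)))
    rwa [Nat.card_eq_fintype_card, Nat.card_eq_fintype_card, Fintype.card_fin] at this
  refine ⟨⟨_, Nat.lt_succ_of_le hk⟩, fun c X => ?_⟩
  have : cycProd (c • X) x = c ^ Fintype.card (Orbits (wreathPerm x)) * cycProd X x := by
    simp only [cycProd, orbProd, Pi.smul_apply, smul_eq_mul]
    rw [Finset.prod_mul_distrib, Finset.prod_const, Finset.card_univ]
  rw [spinExp, spinExp, this]
  ring

omit [Finite Γ] in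
theorem spinExp_congr {n : ℕ} {X Y : ℕ × ConjClasses Γ → ℂ} (h : ∀ d, d.1 ≤ n → X d = Y d) :
    spinExp X n = spinExp Y n := by
  funext x
  rw [spinExp, spinExp]
  congr 1
  refine orbProd_congr _ fun i => h _ ?_
  simpa [cyc] using Function.minimalPeriod_le_card (f := wreathPerm x) (x := i)

theorem exists_vandermonde (n : ℕ) (v : Fin (n + 1) → ℂ) :
    ∃ s : Fin (n + 1) → ℂ, ∀ d : Fin (n + 1), ∑ t, s t * ((t : ℕ) : ℂ) ^ (d : ℕ) = v d := by
  have hdet : IsUnit (Matrix.vandermonde fun t : Fin (n + 1) => ((t : ℕ) : ℂ)).det := by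
    rw [isUnit_iff_ne_zero, Matrix.det_vandermonde_ne_zero_iff]
    intro i j h
    exact Fin.ext (Nat.cast_injective (R := ℂ) h)
  refine ⟨Matrix.vecMul v (Matrix.vandermonde fun t : Fin (n + 1) => ((t : ℕ) : ℂ))⁻¹, fun d => ?_⟩
  have : Matrix.vecMul (Matrix.vecMul v (Matrix.vandermonde fun t : Fin (n + 1) => ((t : ℕ) : ℂ))⁻¹)
      (Matrix.vandermonde fun t : Fin (n + 1) => ((t : ℕ) : ℂ)) = v := by
    rw [Matrix.vecMul_vecMul, Matrix.nonsing_inv_mul _ hdet, Matrix.vecMul_one]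
  exact congrFun this d

variable (Γ) in
/-- The subalgebra generated by the elements `q_n(γ)`. -/
noncomputable def qAlgebra : Subalgebra ℂ (RMinus Γ) :=
  Algebra.adjoin ℂ (Set.range fun p : IrrChar Γ × ℕ => (fock Γ).q p.1 (p.2 : ℤ))

variable (Γ) in
/-- The functions whose multiplicative spin class functions lie in `qAlgebra Γ`. -/
noncomputable def qFunctions : Submodule ℂ (ℕ × ConjClasses Γ → ℂ) where
  carrier := {X | ∀ n, expElt X n ∈ qAlgebra Γ}
  zero_mem' n := by
    rcases eq_or_ne n 0 with rfl | hn
    · rw [expElt_zero]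
      exact one_mem _
    · rw [expElt_of_odd_eq_zero (X := 0) (fun _ _ => rfl) hn]
      exact zero_mem _
  add_mem' {X Y} hX hY n := by
    rw [expElt_add]
    exact sum_mem fun p _ => mul_mem (hX _) (hY _)
  smul_mem' c X hX n := by
    have hnat : ∀ t m : ℕ, expElt ((t : ℂ) • X) m ∈ qAlgebra Γ := by
      intro t
      induction t with
      | zero =>
        intro m
        rw [Nat.cast_zero, zero_smul]
        rcases eq_or_ne m 0 with rfl | hm
        · rw [expElt_zero]
          exact one_mem _
        · rw [expElt_of_odd_eq_zero (X := 0) (fun _ _ => rfl) hm]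
          exact zero_mem _
      | succ t ih =>
        intro m
        rw [Nat.cast_succ, add_smul, one_smul, expElt_add]
        exact sum_mem fun p _ => mul_mem (ih _) (hX _)
    -- Each value of `expElt (c • X) n` carries a power `c ^ k` with `k ≤ n`. One set of
    -- coefficients expresses all these powers through the scalars `0, …, n`, and for natural
    -- scalars the exponential law suffices.
    obtain ⟨s, hs⟩ := exists_vandermonde n fun d => c ^ (d : ℕ)
    have : expElt (c • X) n = ∑ t : Fin (n + 1), s t • expElt (((t : ℕ) : ℂ) • X) n := by
      apply Subtype.ext
      funext k
      rw [AddSubmonoidClass.coe_finsetSum, Finset.sum_apply, expElt_apply]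
      simp only [SetLike.val_smul, Pi.smul_apply, expElt_apply]
      split_ifs with hk
      · subst hk
        funext x
        obtain ⟨i, hi⟩ := exists_spinExp_smul x
        simp only [Finset.sum_apply, Pi.smul_apply, smul_eq_mul, hi]
        rw [← hs i, Finset.sum_mul]
        exact Finset.sum_congr rfl fun t _ => by ring
      · simp
    rw [this]
    exact sum_mem fun t _ => Subalgebra.smul_mem _ (hnat _ _) _

theorem pow_mul_onCyc_mem (t : ℂ) (γ : IrrChar Γ) :
    (fun d => t ^ d.1 * γ.onCyc d) ∈ qFunctions Γ := fun n => by
  rw [expElt_pow_mul, ← qElt_natCast]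
  exact Subalgebra.smul_mem _ (Algebra.subset_adjoin (Set.mem_range_self (γ, n))) _

/-- Admissible weights form a subspace which contains every `t ^ d` times an irreducible character.
Vandermonde combinations in `t` isolate one cycle length, completeness of the characters gives an
arbitrary class function there, and only lengths up to `n` matter. -/
theorem expElt_mem_qAlgebra (X : ℕ × ConjClasses Γ → ℂ) (n : ℕ) : expElt X n ∈ qAlgebra Γ := by
  have key : ∀ (d₀ : Fin (n + 1)) (ψ : ConjClasses Γ → ℂ), ∃ Y ∈ qFunctions Γ,
      ∀ d, d.1 ≤ n → Y d = if d.1 = d₀ then ψ d.2 else 0 := by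
    intro d₀ ψ
    obtain ⟨s, hs⟩ := exists_vandermonde n (Pi.single d₀ 1)
    let L : (ConjClasses Γ → ℂ) →ₗ[ℂ] (ℕ × ConjClasses Γ → ℂ) :=
      { toFun := fun ψ d => (∑ t, s t * ((t : ℕ) : ℂ) ^ d.1) * ψ d.2
        map_add' := fun ψ ψ' => by funext d; simp [mul_add]
        map_smul' := fun c ψ => by funext d; simp; ring }
    refine ⟨L ψ, ?_, fun d hd => ?_⟩
    · have h : ψ ∈ Submodule.span ℂ (Set.range fun γ : IrrChar Γ => onClasses γ.1) := by
        rw [span_onClasses]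
        exact Submodule.mem_top
      have h2 := Submodule.mem_map_of_mem (f := L) h
      rw [Submodule.map_span] at h2
      refine Submodule.span_le.2 ?_ h2
      rintro _ ⟨_, ⟨γ, rfl⟩, rfl⟩
      have : L (onClasses γ.1) = ∑ t, s t • fun d => ((t : ℕ) : ℂ) ^ d.1 * γ.onCyc d := by
        funext d
        simp only [L, LinearMap.coe_mk, AddHom.coe_mk, Finset.sum_apply, Pi.smul_apply, smul_eq_mul,
          Finset.sum_mul, IrrChar.onCyc, mul_assoc]
      rw [this]
      exact sum_mem fun t _ => Submodule.smul_mem _ _ (pow_mul_onCyc_mem _ γ)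
    · have := hs ⟨d.1, Nat.lt_succ_of_le hd⟩
      simp only at this
      simp only [L, LinearMap.coe_mk, AddHom.coe_mk, this, Pi.single_apply, Fin.ext_iff]
      split_ifs <;> simp
  choose Y hY1 hY2 using key
  have hmem : ∑ d₀, Y d₀ (fun c => X (d₀, c)) ∈ qFunctions Γ := sum_mem fun d₀ _ => hY1 _ _
  have : expElt X n = expElt (∑ d₀, Y d₀ (fun c => X (d₀, c))) n := by
    apply Subtype.ext
    funext k
    rw [expElt_apply, expElt_apply]
    split_ifs with hk
    · subst hk
      refine spinExp_congr fun d hd => ?_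
      rw [Finset.sum_apply, Finset.sum_eq_single ⟨d.1, Nat.lt_succ_of_le hd⟩, hY2 _ _ d hd,
        if_pos rfl]
      · intro d₀ _ hne
        rw [hY2 _ _ d hd, if_neg]
        rintro h
        exact hne (Fin.ext h.symm)
      · simp
    · rfl
  rw [this]
  exact hmem n

/-- Separation embeds `superSpin Γ n` into the dual of the span, so the span cannot have smaller
dimension. -/
theorem span_spinExp (n : ℕ) :
    Submodule.span ℂ (Set.range fun X : ℕ × ConjClasses Γ → ℂ => spinExp X n) = superSpin Γ n := by
  set U := Submodule.span ℂ (Set.range fun X : ℕ × ConjClasses Γ → ℂ => spinExp X n) with hU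
  refine Submodule.eq_of_le_of_finrank_le ?_ ?_
  · rw [hU, Submodule.span_le]
    rintro _ ⟨X, rfl⟩
    exact spinExp_mem X n
  · let B : superSpin Γ n →ₗ[ℂ] Module.Dual ℂ U := (formBilin Γ n).domRestrict₁₂ (superSpin Γ n) U
    have hB : Function.Injective B := by
      rw [← LinearMap.ker_eq_bot, LinearMap.ker_eq_bot']
      intro f hf
      refine Subtype.ext (eq_zero_of_form_spinExp f.2 fun X => ?_)
      exact congrArg (fun φ : Module.Dual ℂ U => φ ⟨spinExp X n, Submodule.subset_span ⟨X, rfl⟩⟩) hf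
    exact (LinearMap.finrank_le_finrank_of_injective hB).trans_eq Subspace.dual_finrank_eq

variable (Γ) in
theorem qAlgebra_eq_top : qAlgebra Γ = ⊤ := by
  rw [eq_top_iff]
  intro F _
  obtain ⟨N, hN⟩ := RMinus.exists_bound F
  have h : ∀ n, ∃ c : (ℕ × ConjClasses Γ → ℂ) →₀ ℂ,
      (c.sum fun X a => a • spinExp X n) = F.1 n := by
    intro n
    have : F.1 n ∈ superSpin Γ n := F.2.1 n
    rw [← span_spinExp] at this
    exact Finsupp.mem_span_range_iff_exists_finsupp.1 this
  choose c hc using h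
  have : F = ∑ n ∈ Finset.range N, (c n).sum fun X a => a • expElt X n := by
    apply Subtype.ext
    funext k
    let D : RMinus Γ →ₗ[ℂ] (Wreath Γ k → ℂ) := (LinearMap.proj k).comp (RMinus Γ).subtype
    have hD : ∀ n, D ((c n).sum fun X a => a • expElt X n) = if k = n then F.1 k else 0 := by
      intro n
      rw [Finsupp.sum, map_sum]
      simp only [map_smul]
      have hDe : ∀ X : ℕ × ConjClasses Γ → ℂ, D (expElt X n) = _ := fun X => expElt_apply X n k
      simp only [hDe]
      split_ifs with hk
      · subst hk
        exact hc k
      · simp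
    change F.1 k = D (∑ n ∈ Finset.range N, (c n).sum fun X a => a • expElt X n)
    rw [map_sum, Finset.sum_congr rfl fun n _ => hD n, Finset.sum_ite_eq]
    split_ifs with hk
    · rfl
    · exact hN k (by simpa using hk)
  rw [this]
  exact sum_mem fun n _ => sum_mem fun X _ => Subalgebra.smul_mem _ (expElt_mem_qAlgebra X n) _

end RMinusFock

/-! ### The operations on graded class functions -/

section Bridge

variable {Γ : Type*} [Group Γ] [Finite Γ]

theorem coe_list_prod (L : List (RMinus Γ)) :
    (L.prod : RMinus Γ).1 = gradedProd (L.map Subtype.val) := by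
  induction L with
  | nil => rfl
  | cons F L ih =>
    rw [List.prod_cons, RMinus.coe_mul, ih]
    rfl

theorem coe_prod_fin {n : ℕ} (f : Fin n → RMinus Γ) :
    (∏ p, f p : RMinus Γ).1 = gradedProd (List.ofFn fun p => (f p).1) := by
  rw [← List.prod_ofFn, coe_list_prod, List.map_ofFn]
  rfl

theorem creation_coe (γ : IrrChar Γ) (a : ℕ) (F : RMinus Γ) :
    creation γ a F.1 = (expElt γ.onCyc a * F).1 := by
  funext p
  rw [creation, normChar_eq_spinExp]
  split_ifs with h
  · rw [expElt_mul_apply _ (Nat.add_sub_of_le h)]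
  · rw [expElt_mul_apply_of_lt _ (not_le.1 h)]

theorem annihilation_coe (γ : IrrChar Γ) (b : ℕ) (F : RMinus Γ) :
    annihilation γ b F.1 = (lower γ.onCyc b F).1 := by
  funext c
  rw [annihilation, normChar_eq_spinExp, lower_apply]

/-- The two sums are matched by indexing the terms by the creation degree `a`, with annihilation
degree `a + n`. In degree `p` the terms with `a > p` vanish, so the truncation in `vertexOp` loses
nothing. -/
theorem vertexOp_coe (γ : IrrChar Γ) (n : ℤ) (F : RMinus Γ) :
    vertexOp γ n F.1 = ((fock Γ).vertex γ (-n) F).1 := by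
  funext p
  let D : RMinus Γ →+ (Wreath Γ p → ℂ) :=
    ((LinearMap.proj p).comp (RMinus Γ).subtype : RMinus Γ →ₗ[ℂ] (Wreath Γ p → ℂ)).toAddMonoidHom
  change _ = D ((fock Γ).vertex γ (-n) F)
  rw [TwistedFock.vertex_eq_finsum, D.map_finsum ((fock Γ).support_vertex_finite γ (-n) F),
    ← finsum_comp_equiv (Equiv.addRight n),
    finsum_eq_sum_of_support_subset (s := (Finset.range (p + 1)).map Nat.castEmbedding),
    Finset.sum_map]
  · refine Finset.sum_congr rfl fun a _ => ?_
    simp only [Nat.castEmbedding_apply, Equiv.coe_addRight]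
    rw [show -n + ((a : ℤ) + n) = a by ring]
    change _ = D (_ * (qElt γ (a : ℤ) * hOp γ ((a : ℤ) + n) F))
    split_ifs with h
    · obtain ⟨b, hb⟩ := Int.eq_ofNat_of_zero_le h
      rw [hb, Int.toNat_natCast, qElt_natCast, hOp_natCast, intSign_natCast, annihilation_coe,
        creation_coe]
      have : (((-1 : ℤ) ^ b : ℤ) : RMinus Γ) * (expElt γ.onCyc a * lower γ.onCyc b F) =
          ((-1 : ℂ) ^ b) • (expElt γ.onCyc a * lower γ.onCyc b F) := by
        rw [Algebra.smul_def, map_pow, map_neg, map_one]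
        push_cast
        rfl
      rw [this]
      rfl
    · rw [hOp_of_neg γ (not_le.1 h), LinearMap.zero_apply, mul_zero, mul_zero, map_zero]
  · intro a ha
    by_contra hc
    apply ha
    simp only [Equiv.coe_addRight]
    rw [show -n + (a + n) = a by ring]
    change D (_ * (qElt γ a * hOp γ (a + n) F)) = 0
    rcases lt_or_ge a 0 with h | h
    · rw [qElt_of_neg γ h, zero_mul, mul_zero, map_zero]
    · obtain ⟨a, rfl⟩ := Int.eq_ofNat_of_zero_le h
      have hlt : p < a := by simpa using hc
      have : ∀ (m : ℤ) (y : RMinus Γ), D ((m : RMinus Γ) * y) = (m : ℂ) • D y := by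
        intro m y
        have : (m : RMinus Γ) * y = (m : ℂ) • y := by rw [Algebra.smul_def, map_intCast]
        rw [this]
        rfl
      rw [this, qElt_natCast]
      have h0 : D (expElt γ.onCyc a * hOp γ (a + n) F) = 0 := expElt_mul_apply_of_lt _ hlt _
      rw [h0, smul_zero]

theorem XVec_eq (γ : IrrChar Γ) (φ : List ℤ) : XVec γ φ = ((fock Γ).word γ φ).1 := by
  induction φ with
  | nil => rw [TwistedFock.word_nil]; rfl
  | cons k φ ih =>
    rw [TwistedFock.word_cons]
    change vertexOp γ (-k) (XVec γ φ) = _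
    rw [ih, vertexOp_coe, neg_neg]

theorem xVec_eq (γ : IrrChar Γ) (φ : List ℤ) :
    xVec γ φ = ((φ.map fun k => (fock Γ).q γ k).prod : RMinus Γ).1 := by
  rw [coe_list_prod, xVec, List.map_map]
  congr 1
  refine List.map_congr_left fun k _ => ?_
  change vertexOp γ (-k) (1 : RMinus Γ).1 = _
  rw [vertexOp_coe, neg_neg, TwistedFock.vertex_one]
  rfl

variable {r : ℕ} (e : Fin (r + 1) ≃ IrrChar Γ)

theorem XLam_eq (lam : SP Γ) :
    XLam e lam = (∏ p, (fock Γ).wordParts (e p) (lam (e p)) : RMinus Γ).1 := by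
  rw [coe_prod_fin, XLam]
  simp only [XVec_eq]
  rfl

theorem xLam_eq (lam : SP Γ) :
    xLam e lam = (∏ p, (fock Γ).prodParts (e p) (lam (e p)) : RMinus Γ).1 := by
  rw [coe_prod_fin, xLam]
  simp only [xVec_eq]
  congr 2
  funext p
  rw [TwistedFock.prodParts, StrictPartition.parts, List.map_map]
  rfl

omit [Finite Γ] in
theorem raisingCoeff_eq {m : ℕ} (k : RaisingExp m) : raisingCoeff k = raisingInt k := by
  rw [raisingCoeff, raisingInt, Int.cast_prod]
  exact Finset.prod_congr rfl fun ij _ => coeff_one_sub_mul_inv _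

theorem raisingTerm_eq (lam : SP Γ) (k : MultiRaisingExp e lam) : raisingTerm e lam k =
    (∏ p, ((raisingInt (k p) : RMinus Γ) *
      ∏ j, (fock Γ).q (e p) (raiseMonomial (k p) (lam (e p)).parts.get j)) : RMinus Γ).1 := by
  rw [Finset.prod_mul_distrib]
  have h : (∏ p, (raisingInt (k p) : RMinus Γ)) =
      algebraMap ℂ (RMinus Γ) (∏ p, raisingCoeff (k p)) := by
    rw [map_prod]
    exact Finset.prod_congr rfl fun p _ => by rw [raisingCoeff_eq, map_intCast]
  rw [h, ← Algebra.smul_def, Submodule.coe_smul, coe_prod_fin, raisingTerm]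
  simp only [xVec_eq, List.map_ofFn, List.prod_ofFn]
  rfl

end Bridge

/-! ### Finite products of finitely supported sums. -/

section Products

/-- Distributivity of finite products over sums with finite support. -/
theorem prod_finsum {ι A : Type*} [Fintype ι] [CommRing A] {κ : ι → Type*} (f : (i : ι) → κ i → A)
    (h : ∀ i, (Function.support (f i)).Finite) :
    (Function.support fun k : (i : ι) → κ i => ∏ i, f i (k i)).Finite ∧
      ∏ i, ∑ᶠ j, f i j = ∑ᶠ k : (i : ι) → κ i, ∏ i, f i (k i) := by
  classical
  have hs : (Function.support fun k : (i : ι) → κ i => ∏ i, f i (k i)) ⊆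
      (Fintype.piFinset fun i => (h i).toFinset : Finset ((i : ι) → κ i)) := by
    intro k hk
    simp only [Finset.mem_coe, Fintype.mem_piFinset, Set.Finite.mem_toFinset, Function.mem_support]
    exact fun i hi => hk (Finset.prod_eq_zero (Finset.mem_univ i) hi)
  refine ⟨(Finset.finite_toSet _).subset hs, ?_⟩
  rw [finsum_eq_sum_of_support_subset _ hs, ← Finset.prod_univ_sum]
  exact Finset.prod_congr rfl fun i _ => finsum_eq_sum_of_support_subset _ (by simp)

end Products

/-! ### The assertions of the theorem, transferred from the Fock space. -/

section Main

variable {Γ : Type*} [Group Γ] [Finite Γ] {r : ℕ} (e : Fin (r + 1) ≃ IrrChar Γ)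

theorem form_XLam [DecidableEq (SP Γ)] (lam mu : SP Γ) : gradedForm (XLam e lam) (XLam e mu) =
    if lam = mu then 2 ^ SP.length e lam else 0 := by
  classical
  rw [XLam_eq, XLam_eq, ← rForm_apply]
  let _ : Fintype (IrrChar Γ) := Fintype.ofEquiv _ e
  rw [e.prod_comp fun γ => (fock Γ).wordParts γ (lam γ),
    e.prod_comp fun γ => (fock Γ).wordParts γ (mu γ)]
  have hsort : ∀ l : StrictPartition, l.parts.Pairwise (· > ·) ∧ ∀ k ∈ l.parts, 0 < k := by
    intro l
    constructor
    · rw [StrictPartition.parts, List.pairwise_map]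
      exact l.2.1.imp fun h => by exact_mod_cast h
    · intro k hk
      obtain ⟨x, hx, rfl⟩ := List.mem_map.1 hk
      exact_mod_cast l.2.2 x hx
  have hinj : ∀ l m : StrictPartition, l.parts = m.parts ↔ l = m := fun l m =>
    ⟨fun h => Subtype.ext (List.map_injective_iff.2 Nat.cast_injective h), fun h => h ▸ rfl⟩
  refine ((fock Γ).form_prod_word Finset.univ (fun γ => (lam γ).parts) (fun γ => (mu γ).parts)
    (fun γ => (hsort _).1) (fun γ => (hsort _).2) (fun γ => (hsort _).1)
    fun γ => (hsort _).2).trans ?_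
  simp only [hinj]
  split_ifs with h
  · subst h
    simp only [if_true]
    rw [Finset.prod_pow_eq_pow_sum, SP.length, ← e.sum_comp]
    simp [StrictPartition.parts, StrictPartition.length]
  · obtain ⟨γ, hγ⟩ := Function.ne_iff.1 h
    exact Finset.prod_eq_zero (Finset.mem_univ γ) (if_neg hγ)

theorem XLam_eq_raising (lam : SP Γ) : (Function.support (raisingTerm e lam)).Finite ∧
    XLam e lam = ∑ᶠ k, raisingTerm e lam k := by
  obtain ⟨h1, h2⟩ := prod_finsum (A := RMinus Γ)
    (fun p (k : RaisingExp (lam (e p)).parts.length) => (raisingInt k : RMinus Γ) *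
      ∏ j, (fock Γ).q (e p) (raiseMonomial k (lam (e p)).parts.get j))
    fun p => (fock Γ).support_raising_finite (e p) _
  have h3 : ∀ k, raisingTerm e lam k = (RMinus Γ).subtype.toAddMonoidHom _ := raisingTerm_eq e lam
  refine ⟨h1.subset fun k hk h0 => hk ?_, ?_⟩
  · rw [h3, ← map_zero (RMinus Γ).subtype.toAddMonoidHom]
    exact congrArg _ h0
  · rw [finsum_congr h3, ← AddMonoidHom.map_finsum _ h1, ← h2, XLam_eq]
    refine congrArg Subtype.val (Finset.prod_congr rfl fun p _ => ?_)
    rw [← TwistedFock.word_eq_raising, List.ofFn_get]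
    rfl

theorem exists_triangular (lam : SP Γ) : ∃ c : SP Γ →₀ ℤ,
    (∀ mu ∈ c.support, SP.StrictlyDominates mu lam) ∧
    XLam e lam = xLam e lam + c.sum fun mu n => (n : ℂ) • xLam e mu := by
  classical
  let _ : Fintype (IrrChar Γ) := Fintype.ofEquiv _ e
  have h := (fock Γ).prod_wordParts_sub_mem Finset.univ lam
  obtain ⟨c, hc, hsum⟩ := (Finsupp.mem_span_image_iff_linearCombination ℤ).1 h
  refine ⟨c, fun mu hmu => ?_, ?_⟩
  · obtain ⟨h1, -, h2⟩ := hc hmu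
    exact ⟨fun γ => h1 γ (Finset.mem_univ γ), h2⟩
  · rw [XLam_eq, e.prod_comp fun γ => (fock Γ).wordParts γ (lam γ), ← sub_add_cancel
      (∏ γ, (fock Γ).wordParts γ (lam γ)) (∏ γ, (fock Γ).prodParts γ (lam γ)), ← hsum, add_comm,
      xLam_eq, e.prod_comp fun γ => (fock Γ).prodParts γ (lam γ)]
    simp only [xLam_eq, fun mu : SP Γ => e.prod_comp fun γ => (fock Γ).prodParts γ (mu γ)]
    rw [Submodule.coe_add]
    congr 1
    rw [Finsupp.linearCombination_apply, Finsupp.sum, Finsupp.sum, AddSubmonoidClass.coe_finsetSum]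
    refine Finset.sum_congr rfl fun mu _ => ?_
    rw [Int.cast_smul_eq_zsmul]
    rfl

/-- The vectors are pairwise orthogonal and the values `⟨X_λ, X_λ⟩` are powers of `2`, hence
nonzero. -/
theorem linearIndependent_XLam : LinearIndependent ℂ (XLam e) := by
  classical
  let v : SP Γ → RMinus Γ := fun lam => ∏ p, (fock Γ).wordParts (e p) (lam (e p))
  have hv : ∀ lam mu, rForm Γ (v lam) (v mu) = if lam = mu then 2 ^ SP.length e lam else 0 := by
    intro lam mu
    rw [rForm_apply, ← XLam_eq, ← XLam_eq, form_XLam]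
  have h : LinearIndependent ℂ v := by
    refine LinearMap.BilinForm.linearIndependent_of_iIsOrtho (B := rForm Γ)
      (fun lam mu hne => ?_) fun lam hlam => ?_
    · exact (hv lam mu).trans (if_neg hne)
    · have h0 := (hv lam lam).symm.trans hlam
      rw [if_pos rfl] at h0
      exact pow_ne_zero _ two_ne_zero h0
  have h2 := h.map' (RMinus Γ).subtype (Submodule.ker_subtype _)
  have h3 : XLam e = (RMinus Γ).subtype ∘ v := funext fun lam => XLam_eq e lam
  rw [h3]
  exact h2

theorem span_XLam : Submodule.span ℂ (Set.range (XLam e)) = RMinus Γ := by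
  let _ : Fintype (IrrChar Γ) := Fintype.ofEquiv _ e
  have h := (fock Γ).span_prod_wordParts (qAlgebra_eq_top Γ)
  have h2 := congrArg (Submodule.map (RMinus Γ).subtype) h
  rw [Submodule.map_span, Submodule.map_top, Submodule.range_subtype, ← Set.range_comp] at h2
  rw [← h2]
  congr 2
  funext lam
  rw [XLam_eq, e.prod_comp fun γ => (fock Γ).wordParts γ (lam γ)]
  rfl

end Main

end SpinWreath

theorem theoremT {Γ : Type*} [Group Γ] [Finite Γ] {r : ℕ}
    (e : Fin (r + 1) ≃ SpinWreath.IrrChar Γ) :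
    LinearIndependent ℂ (SpinWreath.XLam e) ∧
    Submodule.span ℂ (Set.range (SpinWreath.XLam e)) = SpinWreath.RMinus Γ ∧
    (∀ lam mu : SpinWreath.SP Γ, lam ≠ mu →
      SpinWreath.gradedForm (SpinWreath.XLam e lam) (SpinWreath.XLam e mu) = 0) ∧
    (∀ lam : SpinWreath.SP Γ,
      SpinWreath.gradedForm (SpinWreath.XLam e lam) (SpinWreath.XLam e lam) =
        2 ^ SpinWreath.SP.length e lam) ∧
    (∀ lam : SpinWreath.SP Γ,
      (Function.support (SpinWreath.raisingTerm e lam)).Finite ∧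
      SpinWreath.XLam e lam = ∑ᶠ k, SpinWreath.raisingTerm e lam k) ∧
    ∃ c : SpinWreath.SP Γ → (SpinWreath.SP Γ →₀ ℤ), ∀ lam : SpinWreath.SP Γ,
      (∀ mu ∈ (c lam).support, SpinWreath.SP.StrictlyDominates mu lam) ∧
      SpinWreath.XLam e lam = SpinWreath.xLam e lam +
        (c lam).sum fun mu n => (n : ℂ) • SpinWreath.xLam e mu := by
  classical
  refine ⟨SpinWreath.linearIndependent_XLam e, SpinWreath.span_XLam e, fun lam mu h => ?_,
    fun lam => ?_, SpinWreath.XLam_eq_raising e, ?_⟩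
  · rw [SpinWreath.form_XLam, if_neg h]
  · rw [SpinWreath.form_XLam, if_pos rfl]
  · choose c hc using SpinWreath.exists_triangular e
    exact ⟨c, hc⟩
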